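/- **Setting.** $\mathrm{PILL}_Y$ is the polymorphic dual intuitionistic/linear $\lambda$-calculus with types $\sigma ::= \alpha \mid C(\sigma_1,\dots,\sigma_k)\mid I\mid\sigma\otimes\sigma\mid\sigma\multimap\sigma\mid\,!\sigma\mid\prod\alpha.\,\sigma$ (where $C$ ranges over the type constants of an arbitrary polymorphic signature, which may also contain term constants of closed types), terms typed in contexts $\Xi\mid\Gamma;\Delta$ of type variables, intuitionistic variables and linear variables, a fixed point combinator $Y:\prod\alpha.(\alpha\to\alpha)\to\alpha$, where $\sigma\to\tau$ means $!\sigma\multimap\tau$, and the usual external ($\beta$, $\eta$, commuting) equality of terms. Linear Abadi–Plotkin logic (LAPL) is the predicate logic over $\mathrm{PILL}_Y$ with internal equality, quantification over types, terms, relations and admissible relations between types, and a relational interpretation $\sigma[\vec\rho]$ of each type $\sigma(\vec\alpha)$ at admissible relations $\vec\rho$. Let $T$ be LAPL, possibly extended by further axioms, such that $T$ proves * *extensionality*: $(\forall x{:}\sigma.\ t\,x=_\tau u\,x)\supset t=_{\sigma\multimap\tau}u$ and $(\forall\alpha.\ t\,\alpha=_\tau u\,\alpha)\supset t=_{\prod\alpha.\tau}u$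 for all terms $t,u$ of the respective types; * *identity extension*: $\forall\vec\alpha.\ \sigma[\mathrm{eq}_{\vec\alpha}]\equiv \mathrm{eq}_{\sigma(\vec\alpha)}$ for every type $\sigma(\vec\alpha)$. Let $\sigma(\alpha,\beta)$ be a type with no free type variables other than $\alpha,\beta$, in which $\alpha$ occurs only negatively and $\beta$ only positively (in particular, neither occurs inside an argument of a type constant). For $f:\alpha'\multimap\alpha$ and $g:\beta\multimap\beta'$ let $\sigma(f,g):\sigma(\alpha,\beta)\multimap\sigma(\alpha',\beta')$ be the functorial action of $\sigma$, given by a polymorphic term defined by recursion on $\sigma$. In a kind context $\Xi$, a *dialgebra* for $\sigma$ is a quadruple $(\tau_0,\tau_0',f_0,f_0')$ of types $\tau_0,\tau_0'$ over $\Xi$ and terms $f_0:\sigma(\tau_0',\tau_0)\multimap\tau_0$, $f_0':\tau_0'\multimap\sigma(\tau_0,\tau_0')$ without free term variables. A *morphism* from it to $(\tau_1,\tau_1',f_1,f_1')$ is a pair $h:\tau_0\multimap\tau_1$, $h':\tau_1'\multimap\tau_0'$ of terms without free term variables such that $T$ proves the internal equalities $h\circ f_0= f_1\circ\sigma(h',h)$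 and $\sigma(h,h')\circ f_1'=f_0'\circ h'$. For a type $\rho(\alpha)$ in which $\alpha$ occurs only positively let $\mu\alpha.\rho=\prod\alpha.(\rho\multimap\alpha)\to\alpha$ and $\nu\alpha.\rho=\prod\beta.\bigl(\prod\alpha.\,!(\alpha\multimap\rho)\otimes\alpha\multimap\beta\bigr)\multimap\beta$, with the canonical terms $\mathit{fold}=\Lambda\alpha.\lambda f.\lambda^\circ u.\,u\,\alpha\,!f$, $\ \mathit{in}=\lambda^\circ z.\Lambda\alpha.\lambda f.\,f\bigl(\rho(\mathit{fold}\,\alpha\,!f)\,z\bigr):\rho(\mu\alpha.\rho)\multimap\mu\alpha.\rho$, $\ \mathit{unfold}=\Lambda\alpha.\lambda^\circ f.\lambda^\circ x.\Lambda\beta.\lambda^\circ g.\,g\,\alpha\,(f\otimes x)$, and $\ \mathit{out}=\lambda^\circ x.\,x\,\rho(\nu\alpha.\rho)\,\bigl(\Lambda\alpha.\lambda^\circ y.\,\mathrm{let}\ w\otimes z\ \mathrm{be}\ y\ \mathrm{in\ let}\ !f\ \mathrm{be}\ w\ \mathrm{in}\ \rho(\mathit{unfold}\,\alpha\,!f)(f\,z)\bigr):\nu\alpha.\rho\multimap\rho(\nu\alpha.\rho)$.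 **Theorem.** Put $\omega(\alpha)=\mu\beta.\,\sigma(\alpha,\beta)$, $\tau'=\nu\alpha.\,\sigma(\omega(\alpha),\alpha)$ and $\tau=\omega(\tau')$, with $\mathit{in}:\sigma(\tau',\tau)\multimap\tau$ and $\mathit{out}:\tau'\multimap\sigma(\tau,\tau')$ the canonical terms (for $\mathit{in}$, those of $\omega(\alpha)$ at $\alpha=\tau'$). Then in every kind context $\Xi$, $(\tau,\tau',\mathit{in},\mathit{out})$ is an initial dialgebra for $\sigma$ up to internal equality: it is a dialgebra, and for every dialgebra $(\tau_0,\tau_0',g,g')$ over $\Xi$ there is a morphism $(h,h')$ from $(\tau,\tau',\mathit{in},\mathit{out})$ to it such that for every morphism $(k,k')$ between the same dialgebras $T$ proves $k=_{\tau\multimap\tau_0}h$ and $k'=_{\tau_0'\multimap\tau'}h'$. -/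

import Mathlib

universe u

namespace LAPL

/-! ## Types and terms of the polymorphic dual intuitionistic/linear calculus with fixed points

Binders are represented by de Bruijn indices; index `0` is the innermost variable.  A type
`σ : Ty S n` is a type in a kind context of `n` type variables. -/

/-- Type constants with their arities. -/
structure TySig where
  Con : Type u
  arity : Con → ℕ

/-- Types `α | C(σ₁,…,σₖ) | I | σ ⊗ τ | σ ⊸ τ | !σ | Π α. σ` in `n` type variables. -/
inductive Ty (S : TySig.{u}) : ℕ → Type u
  | var {n : ℕ} (i : Fin n) : Ty S n
  | con {n : ℕ} (c : S.Con) (args : Fin (S.arity c) → Ty S n) : Ty S n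
  | one {n : ℕ} : Ty S n
  | tensor {n : ℕ} (σ τ : Ty S n) : Ty S n
  | lolli {n : ℕ} (σ τ : Ty S n) : Ty S n
  | bang {n : ℕ} (σ : Ty S n) : Ty S n
  | pi {n : ℕ} (σ : Ty S (n + 1)) : Ty S n

/-- Lift a renaming of type variables under a type binder. -/
def upRen {n m : ℕ} (r : Fin n → Fin m) : Fin (n + 1) → Fin (m + 1) :=
  Fin.cases 0 (fun i => (r i).succ)

namespace Ty

variable {S : TySig.{u}}

def ren : {n m : ℕ} → (Fin n → Fin m) → Ty S n → Ty S m
  | _, _, r, var i => var (r i)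
  | _, _, r, con c args => con c (fun k => (args k).ren r)
  | _, _, _, one => one
  | _, _, r, tensor σ τ => tensor (σ.ren r) (τ.ren r)
  | _, _, r, lolli σ τ => lolli (σ.ren r) (τ.ren r)
  | _, _, r, bang σ => bang (σ.ren r)
  | _, _, r, pi σ => pi (σ.ren (upRen r))

/-- Weakening by one (innermost) type variable. -/
def wk {n : ℕ} (σ : Ty S n) : Ty S (n + 1) := σ.ren Fin.succ

/-- Extend a type substitution by a value for the innermost variable. -/
def cons {n m : ℕ} (τ : Ty S m) (s : Fin n → Ty S m) : Fin (n + 1) → Ty S m :=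
  Fin.cases τ s

/-- Lift a type substitution under a type binder. -/
def up {n m : ℕ} (s : Fin n → Ty S m) : Fin (n + 1) → Ty S (m + 1) :=
  cons (var 0) (fun i => (s i).wk)

def subst : {n m : ℕ} → (Fin n → Ty S m) → Ty S n → Ty S m
  | _, _, s, var i => s i
  | _, _, s, con c args => con c (fun k => (args k).subst s)
  | _, _, _, one => one
  | _, _, s, tensor σ τ => tensor (σ.subst s) (τ.subst s)
  | _, _, s, lolli σ τ => lolli (σ.subst s) (τ.subst s)
  | _, _, s, bang σ => bang (σ.subst s)
  | _, _, s, pi σ => pi (σ.subst (up s))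

/-- `σ[τ/α]` for the innermost variable `α`. -/
def inst {n : ℕ} (σ : Ty S (n + 1)) (τ : Ty S n) : Ty S n := σ.subst (cons τ var)

/-- The intuitionistic function type `σ → τ = !σ ⊸ τ`. -/
def arr {n : ℕ} (σ τ : Ty S n) : Ty S n := lolli (bang σ) τ

/-- `σ.Occ p i`: the variable `i` has a positive (`p = true`) or a negative (`p = false`)
occurrence in `σ`.  An occurrence in an argument of a type constant counts as both, since a type
constant need not be functorial; so a variable that occurs only positively, or only negatively,
does not occur in arguments of type constants. -/
def Occ : {n : ℕ} → Bool → Fin n → Ty S n → Prop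
  | _, p, i, var j => p = true ∧ i = j
  | _, _, i, con _ args => ∃ k q, (args k).Occ q i
  | _, _, _, one => False
  | _, p, i, tensor σ τ => σ.Occ p i ∨ τ.Occ p i
  | _, p, i, lolli σ τ => σ.Occ (!p) i ∨ τ.Occ p i
  | _, p, i, bang σ => σ.Occ p i
  | _, p, i, pi σ => σ.Occ p i.succ

def OnlyPos {n : ℕ} (i : Fin n) (σ : Ty S n) : Prop := ¬ σ.Occ false i

def OnlyNeg {n : ℕ} (i : Fin n) (σ : Ty S n) : Prop := ¬ σ.Occ true i

end Ty

/-- A polymorphic signature: type constants with arities, and term constants of closed types. -/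
structure Signature extends TySig.{u} where
  TmCon : Type u
  tmTy : TmCon → LAPL.Ty toTySig 0

/-- Types over a signature. -/
abbrev Signature.Ty (S : Signature.{u}) (n : ℕ) : Type u := LAPL.Ty S.toTySig n

/-- Raw terms in `n` type variables.  Term variables, intuitionistic and linear, share one
index space.  `lam` is linear abstraction and binds one variable; `letTensor s t` is
`let x ⊗ y be s in t`, with `x` at index `1` and `y` at index `0` in `t`; `letBang s t` is
`let !x be s in t`; `letStar s t` is `let ⋆ be s in t`.  The types of the variables bound by a
`let` are those determined by `s` and are not recorded. -/
inductive Tm (S : Signature.{u}) : ℕ → Type u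
  | var {n : ℕ} (i : ℕ) : Tm S n
  | con {n : ℕ} (c : S.TmCon) : Tm S n
  | star {n : ℕ} : Tm S n
  | fixY {n : ℕ} : Tm S n
  | lam {n : ℕ} (σ : S.Ty n) (t : Tm S n) : Tm S n
  | app {n : ℕ} (t u : Tm S n) : Tm S n
  | tensor {n : ℕ} (t u : Tm S n) : Tm S n
  | bang {n : ℕ} (t : Tm S n) : Tm S n
  | tlam {n : ℕ} (t : Tm S (n + 1)) : Tm S n
  | tapp {n : ℕ} (t : Tm S n) (σ : S.Ty n) : Tm S n
  | letTensor {n : ℕ} (s t : Tm S n) : Tm S n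
  | letBang {n : ℕ} (s t : Tm S n) : Tm S n
  | letStar {n : ℕ} (s t : Tm S n) : Tm S n

/-- Extend a sequence by a value for the innermost variable. -/
def scons {A : Type u} (a : A) (f : ℕ → A) : ℕ → A
  | 0 => a
  | i + 1 => f i

/-- Lift a renaming of term (or relation) variables under a binder. -/
def upN (e : ℕ → ℕ) : ℕ → ℕ
  | 0 => 0
  | i + 1 => e i + 1

namespace Tm

variable {S : Signature.{u}}

def ren : {n m : ℕ} → (Fin n → Fin m) → (ℕ → ℕ) → Tm S n → Tm S m
  | _, _, _, e, var i => var (e i)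
  | _, _, _, _, con c => con c
  | _, _, _, _, star => star
  | _, _, _, _, fixY => fixY
  | _, _, r, e, lam σ t => lam (σ.ren r) (t.ren r (upN e))
  | _, _, r, e, app t u => app (t.ren r e) (u.ren r e)
  | _, _, r, e, tensor t u => tensor (t.ren r e) (u.ren r e)
  | _, _, r, e, bang t => bang (t.ren r e)
  | _, _, r, e, tlam t => tlam (t.ren (upRen r) e)
  | _, _, r, e, tapp t σ => tapp (t.ren r e) (σ.ren r)
  | _, _, r, e, letTensor s t => letTensor (s.ren r e) (t.ren r (upN (upN e)))
  | _, _, r, e, letBang s t => letBang (s.ren r e) (t.ren r (upN e))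
  | _, _, r, e, letStar s t => letStar (s.ren r e) (t.ren r e)

/-- Weakening by `k` innermost term variables. -/
def wk {n : ℕ} (k : ℕ) (t : Tm S n) : Tm S n := t.ren id (· + k)

/-- Weakening by an innermost type variable. -/
def wkTy {n : ℕ} (t : Tm S n) : Tm S (n + 1) := t.ren Fin.succ id

/-- Lift a term substitution under a term binder. -/
def up {n : ℕ} (e : ℕ → Tm S n) : ℕ → Tm S n := scons (var 0) (fun i => (e i).wk 1)

/-- Simultaneous capture-avoiding substitution of types and terms. -/
def subst : {n m : ℕ} → (Fin n → S.Ty m) → (ℕ → Tm S m) → Tm S n → Tm S m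
  | _, _, _, e, var i => e i
  | _, _, _, _, con c => con c
  | _, _, _, _, star => star
  | _, _, _, _, fixY => fixY
  | _, _, s, e, lam σ t => lam (σ.subst s) (t.subst s (up e))
  | _, _, s, e, app t u => app (t.subst s e) (u.subst s e)
  | _, _, s, e, tensor t u => tensor (t.subst s e) (u.subst s e)
  | _, _, s, e, bang t => bang (t.subst s e)
  | _, _, s, e, tlam t => tlam (t.subst (Ty.up s) (fun i => (e i).wkTy))
  | _, _, s, e, tapp t σ => tapp (t.subst s e) (σ.subst s)
  | _, _, s, e, letTensor t u => letTensor (t.subst s e) (u.subst s (up (up e)))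
  | _, _, s, e, letBang t u => letBang (t.subst s e) (u.subst s (up e))
  | _, _, s, e, letStar t u => letStar (t.subst s e) (u.subst s e)

/-- `t[u/x]` for the innermost variable `x`. -/
def inst {n : ℕ} (t u : Tm S n) : Tm S n := t.subst Ty.var (scons u var)

/-- `t[s,u/x,y]`, where `x` has index `1` and `y` has index `0`. -/
def inst2 {n : ℕ} (t s u : Tm S n) : Tm S n := t.subst Ty.var (scons u (scons s var))

/-- `t[σ/α]` for the innermost type variable `α`. -/
def instTy {n : ℕ} (t : Tm S (n + 1)) (σ : S.Ty n) : Tm S n := t.subst (Ty.cons σ Ty.var) var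

/-- Intuitionistic abstraction `λ x:σ. t = λ° y:!σ. let !x be y in t`. -/
def ilam {n : ℕ} (σ : S.Ty n) (t : Tm S n) : Tm S n :=
  lam (Ty.bang σ) (letBang (var 0) (t.ren id (upN Nat.succ)))

/-- The linear identity on `σ`. -/
def idm {n : ℕ} (σ : S.Ty n) : Tm S n := lam σ (var 0)

/-- The composite `f ∘ g = λ° x:σ. f (g x)`, where `σ` is the domain of `g`. -/
def comp {n : ℕ} (σ : S.Ty n) (f g : Tm S n) : Tm S n :=
  lam σ (app (f.wk 1) (app (g.wk 1) (var 0)))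

end Tm

/-- How a variable of a context may be used: intuitionistically, linearly (exactly once), or
not at all (`off`: a place in the index space whose variable belongs to another part of a split
linear context). -/
inductive Use
  | int
  | lin
  | off

/-- A term context `Γ; Δ`, innermost variable first: `Γ` consists of the entries marked `int`
and `Δ` of those marked `lin`. -/
abbrev TCtx (S : Signature.{u}) (n : ℕ) : Type u := List (Use × S.Ty n)

/-- The linear part of the context is empty. -/
def TCtx.NoLin {S : Signature.{u}} {n : ℕ} (Γ : TCtx S n) : Prop := ∀ p ∈ Γ, p.1 ≠ Use.lin

/-- Weakening of a term context by an innermost type variable. -/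
def TCtx.wkTy {S : Signature.{u}} {n : ℕ} (Γ : TCtx S n) : TCtx S (n + 1) :=
  Γ.map (fun p => (p.1, p.2.wk))

/-- `Split Γ Γ₁ Γ₂`: the linear part of `Γ` is the disjoint union of those of `Γ₁` and `Γ₂`,
and the intuitionistic part is shared. -/
inductive Split {S : Signature.{u}} {n : ℕ} : TCtx S n → TCtx S n → TCtx S n → Prop
  | nil : Split [] [] []
  | int {Γ Γ₁ Γ₂ : TCtx S n} (σ : S.Ty n) : Split Γ Γ₁ Γ₂ →
      Split ((Use.int, σ) :: Γ) ((Use.int, σ) :: Γ₁) ((Use.int, σ) :: Γ₂)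
  | left {Γ Γ₁ Γ₂ : TCtx S n} (σ : S.Ty n) : Split Γ Γ₁ Γ₂ →
      Split ((Use.lin, σ) :: Γ) ((Use.lin, σ) :: Γ₁) ((Use.off, σ) :: Γ₂)
  | right {Γ Γ₁ Γ₂ : TCtx S n} (σ : S.Ty n) : Split Γ Γ₁ Γ₂ →
      Split ((Use.lin, σ) :: Γ) ((Use.off, σ) :: Γ₁) ((Use.lin, σ) :: Γ₂)
  | off {Γ Γ₁ Γ₂ : TCtx S n} (σ : S.Ty n) : Split Γ Γ₁ Γ₂ →
      Split ((Use.off, σ) :: Γ) ((Use.off, σ) :: Γ₁) ((Use.off, σ) :: Γ₂)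

/-- The type `Π α. (α → α) → α` of the fixed point combinator. -/
def fixTy {S : TySig.{u}} {n : ℕ} : Ty S n :=
  Ty.pi (Ty.arr (Ty.arr (Ty.var 0) (Ty.var 0)) (Ty.var 0))

/-- The typing judgement `Ξ | Γ; Δ ⊢ t : σ`. -/
inductive HasTy {S : Signature.{u}} : {n : ℕ} → TCtx S n → Tm S n → S.Ty n → Prop
  | ivar {n : ℕ} {Γ : TCtx S n} {i : ℕ} {σ : S.Ty n} :
      Γ[i]? = some (Use.int, σ) → Γ.NoLin → HasTy Γ (Tm.var i) σ
  | lvar {n : ℕ} {Γ : TCtx S n} {i : ℕ} {σ : S.Ty n} :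
      Γ[i]? = some (Use.lin, σ) → (∀ j p, Γ[j]? = some p → p.1 = Use.lin → j = i) →
      HasTy Γ (Tm.var i) σ
  | con {n : ℕ} {Γ : TCtx S n} (c : S.TmCon) :
      Γ.NoLin → HasTy Γ (Tm.con c) ((S.tmTy c).ren Fin.elim0)
  | star {n : ℕ} {Γ : TCtx S n} : Γ.NoLin → HasTy Γ Tm.star Ty.one
  | fixY {n : ℕ} {Γ : TCtx S n} : Γ.NoLin → HasTy Γ Tm.fixY fixTy
  | lam {n : ℕ} {Γ : TCtx S n} {σ τ : S.Ty n} {t : Tm S n} :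
      HasTy ((Use.lin, σ) :: Γ) t τ → HasTy Γ (Tm.lam σ t) (Ty.lolli σ τ)
  | app {n : ℕ} {Γ Γ₁ Γ₂ : TCtx S n} {σ τ : S.Ty n} {t u : Tm S n} :
      Split Γ Γ₁ Γ₂ → HasTy Γ₁ t (Ty.lolli σ τ) → HasTy Γ₂ u σ → HasTy Γ (Tm.app t u) τ
  | tensor {n : ℕ} {Γ Γ₁ Γ₂ : TCtx S n} {σ τ : S.Ty n} {t u : Tm S n} :
      Split Γ Γ₁ Γ₂ → HasTy Γ₁ t σ → HasTy Γ₂ u τ → HasTy Γ (Tm.tensor t u) (Ty.tensor σ τ)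
  | bang {n : ℕ} {Γ : TCtx S n} {σ : S.Ty n} {t : Tm S n} :
      Γ.NoLin → HasTy Γ t σ → HasTy Γ (Tm.bang t) (Ty.bang σ)
  | tlam {n : ℕ} {Γ : TCtx S n} {σ : S.Ty (n + 1)} {t : Tm S (n + 1)} :
      HasTy Γ.wkTy t σ → HasTy Γ (Tm.tlam t) (Ty.pi σ)
  | tapp {n : ℕ} {Γ : TCtx S n} {σ : S.Ty (n + 1)} {t : Tm S n} (τ : S.Ty n) :
      HasTy Γ t (Ty.pi σ) → HasTy Γ (Tm.tapp t τ) (σ.inst τ)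
  | letTensor {n : ℕ} {Γ Γ₁ Γ₂ : TCtx S n} {σ σ' τ : S.Ty n} {s t : Tm S n} :
      Split Γ Γ₁ Γ₂ → HasTy Γ₁ s (Ty.tensor σ σ') →
      HasTy ((Use.lin, σ') :: (Use.lin, σ) :: Γ₂) t τ → HasTy Γ (Tm.letTensor s t) τ
  | letBang {n : ℕ} {Γ Γ₁ Γ₂ : TCtx S n} {σ τ : S.Ty n} {s t : Tm S n} :
      Split Γ Γ₁ Γ₂ → HasTy Γ₁ s (Ty.bang σ) →
      HasTy ((Use.int, σ) :: Γ₂) t τ → HasTy Γ (Tm.letBang s t) τ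
  | letStar {n : ℕ} {Γ Γ₁ Γ₂ : TCtx S n} {σ : S.Ty n} {s t : Tm S n} :
      Split Γ Γ₁ Γ₂ → HasTy Γ₁ s Ty.one → HasTy Γ₂ t σ → HasTy Γ (Tm.letStar s t) σ

/-! ## External equality -/

/-- Linear contexts `C[-]`: terms with one hole which is not under a `!`.  In
`LinCxt S n n' k` the whole has `n` type variables, the hole has `n'` of them, and the hole is
under `k` binders of term variables (the `k` innermost indices at the hole). -/
inductive LinCxt (S : Signature.{u}) : ℕ → ℕ → ℕ → Type u
  | hole {n : ℕ} : LinCxt S n n 0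
  | lam {n n' k : ℕ} (σ : S.Ty n) (C : LinCxt S n n' k) : LinCxt S n n' (k + 1)
  | appL {n n' k : ℕ} (C : LinCxt S n n' k) (t : Tm S n) : LinCxt S n n' k
  | appR {n n' k : ℕ} (t : Tm S n) (C : LinCxt S n n' k) : LinCxt S n n' k
  | tensorL {n n' k : ℕ} (C : LinCxt S n n' k) (t : Tm S n) : LinCxt S n n' k
  | tensorR {n n' k : ℕ} (t : Tm S n) (C : LinCxt S n n' k) : LinCxt S n n' k
  | tlam {n n' k : ℕ} (C : LinCxt S (n + 1) n' k) : LinCxt S n n' k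
  | tapp {n n' k : ℕ} (C : LinCxt S n n' k) (σ : S.Ty n) : LinCxt S n n' k
  | letTensorL {n n' k : ℕ} (C : LinCxt S n n' k) (t : Tm S n) : LinCxt S n n' k
  | letTensorR {n n' k : ℕ} (t : Tm S n) (C : LinCxt S n n' k) : LinCxt S n n' (k + 2)
  | letBangL {n n' k : ℕ} (C : LinCxt S n n' k) (t : Tm S n) : LinCxt S n n' k
  | letBangR {n n' k : ℕ} (t : Tm S n) (C : LinCxt S n n' k) : LinCxt S n n' (k + 1)
  | letStarL {n n' k : ℕ} (C : LinCxt S n n' k) (t : Tm S n) : LinCxt S n n' k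
  | letStarR {n n' k : ℕ} (t : Tm S n) (C : LinCxt S n n' k) : LinCxt S n n' k

namespace LinCxt

variable {S : Signature.{u}}

/-- `C[u]`. -/
def plug : {n n' k : ℕ} → LinCxt S n n' k → Tm S n' → Tm S n
  | _, _, _, hole, u => u
  | _, _, _, lam σ C, u => Tm.lam σ (C.plug u)
  | _, _, _, appL C t, u => Tm.app (C.plug u) t
  | _, _, _, appR t C, u => Tm.app t (C.plug u)
  | _, _, _, tensorL C t, u => Tm.tensor (C.plug u) t
  | _, _, _, tensorR t C, u => Tm.tensor t (C.plug u)
  | _, _, _, tlam C, u => Tm.tlam (C.plug u)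
  | _, _, _, tapp C σ, u => Tm.tapp (C.plug u) σ
  | _, _, _, letTensorL C t, u => Tm.letTensor (C.plug u) t
  | _, _, _, letTensorR t C, u => Tm.letTensor t (C.plug u)
  | _, _, _, letBangL C t, u => Tm.letBang (C.plug u) t
  | _, _, _, letBangR t C, u => Tm.letBang t (C.plug u)
  | _, _, _, letStarL C t, u => Tm.letStar (C.plug u) t
  | _, _, _, letStarR t C, u => Tm.letStar t (C.plug u)

/-- Rename the free term variables of the context itself. -/
def ren : {n n' k : ℕ} → (ℕ → ℕ) → LinCxt S n n' k → LinCxt S n n' k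
  | _, _, _, _, hole => hole
  | _, _, _, e, lam σ C => lam σ (C.ren (upN e))
  | _, _, _, e, appL C t => appL (C.ren e) (t.ren id e)
  | _, _, _, e, appR t C => appR (t.ren id e) (C.ren e)
  | _, _, _, e, tensorL C t => tensorL (C.ren e) (t.ren id e)
  | _, _, _, e, tensorR t C => tensorR (t.ren id e) (C.ren e)
  | _, _, _, e, tlam C => tlam (C.ren e)
  | _, _, _, e, tapp C σ => tapp (C.ren e) σ
  | _, _, _, e, letTensorL C t => letTensorL (C.ren e) (t.ren id (upN (upN e)))
  | _, _, _, e, letTensorR t C => letTensorR (t.ren id e) (C.ren (upN (upN e)))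
  | _, _, _, e, letBangL C t => letBangL (C.ren e) (t.ren id (upN e))
  | _, _, _, e, letBangR t C => letBangR (t.ren id e) (C.ren (upN e))
  | _, _, _, e, letStarL C t => letStarL (C.ren e) (t.ren id e)
  | _, _, _, e, letStarR t C => letStarR (t.ren id e) (C.ren e)

/-- Transport a term from outside the context to the hole, without capture. -/
def toHole : {n n' k : ℕ} → LinCxt S n n' k → Tm S n → Tm S n'
  | _, _, _, hole, t => t
  | _, _, _, lam _ C, t => C.toHole (t.wk 1)
  | _, _, _, appL C _, t => C.toHole t
  | _, _, _, appR _ C, t => C.toHole t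
  | _, _, _, tensorL C _, t => C.toHole t
  | _, _, _, tensorR _ C, t => C.toHole t
  | _, _, _, tlam C, t => C.toHole t.wkTy
  | _, _, _, tapp C _, t => C.toHole t
  | _, _, _, letTensorL C _, t => C.toHole t
  | _, _, _, letTensorR _ C, t => C.toHole (t.wk 2)
  | _, _, _, letBangL C _, t => C.toHole t
  | _, _, _, letBangR _ C, t => C.toHole (t.wk 1)
  | _, _, _, letStarL C _, t => C.toHole t
  | _, _, _, letStarR _ C, t => C.toHole t

end LinCxt

/-- The exchange of a block of `k` innermost variables with the block of the next `b`. -/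
def rot (k b : ℕ) (i : ℕ) : ℕ :=
  if i < k then i + b else if i < k + b then i - k else i

/-- The basic equations of external equality, on raw terms.  In `commTensor` and `commBang` the
term `u` sits under the binders of `C` and, outside them on the left and inside them on the
right, under the variables bound by the `let`; `rot` accounts for the order. -/
inductive ExtStep {S : Signature.{u}} : {n : ℕ} → Tm S n → Tm S n → Prop
  | betaLam {n : ℕ} (σ : S.Ty n) (t u : Tm S n) :
      ExtStep (Tm.app (Tm.lam σ t) u) (t.inst u)
  | betaTLam {n : ℕ} (t : Tm S (n + 1)) (σ : S.Ty n) :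
      ExtStep (Tm.tapp (Tm.tlam t) σ) (t.instTy σ)
  | etaLam {n : ℕ} (σ : S.Ty n) (t : Tm S n) :
      ExtStep (Tm.lam σ (Tm.app (t.wk 1) (Tm.var 0))) t
  | etaTLam {n : ℕ} (t : Tm S n) :
      ExtStep (Tm.tlam (Tm.tapp t.wkTy (Ty.var 0))) t
  | betaStar {n : ℕ} (t : Tm S n) : ExtStep (Tm.letStar Tm.star t) t
  | etaStar {n : ℕ} (t : Tm S n) : ExtStep (Tm.letStar t Tm.star) t
  | betaTensor {n : ℕ} (s u t : Tm S n) :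
      ExtStep (Tm.letTensor (Tm.tensor s u) t) (t.inst2 s u)
  | etaTensor {n : ℕ} (t : Tm S n) :
      ExtStep (Tm.letTensor t (Tm.tensor (Tm.var 1) (Tm.var 0))) t
  | betaBang {n : ℕ} (u t : Tm S n) : ExtStep (Tm.letBang (Tm.bang u) t) (t.inst u)
  | etaBang {n : ℕ} (t : Tm S n) : ExtStep (Tm.letBang t (Tm.bang (Tm.var 0))) t
  | commStar {n n' k : ℕ} (C : LinCxt S n n' k) (t : Tm S n) (u : Tm S n') :
      ExtStep (Tm.letStar t (C.plug u)) (C.plug (Tm.letStar (C.toHole t) u))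
  | commTensor {n n' k : ℕ} (C : LinCxt S n n' k) (t : Tm S n) (u : Tm S n') :
      ExtStep (Tm.letTensor t ((C.ren (· + 2)).plug u))
        (C.plug (Tm.letTensor (C.toHole t) (u.ren id (rot k 2))))
  | commBang {n n' k : ℕ} (C : LinCxt S n n' k) (t : Tm S n) (u : Tm S n') :
      ExtStep (Tm.letBang t ((C.ren (· + 1)).plug u))
        (C.plug (Tm.letBang (C.toHole t) (u.ren id (rot k 1))))
  | fixY {n : ℕ} (σ : S.Ty n) (f : Tm S n) :
      ExtStep (Tm.app f (Tm.bang (Tm.app (Tm.tapp Tm.fixY σ) (Tm.bang f))))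
        (Tm.app (Tm.tapp Tm.fixY σ) (Tm.bang f))

/-- External equality `Ξ | Γ; Δ ⊢ t = u : σ`: the least typed congruence that contains the basic
equations between terms of the same type. -/
inductive ExtEq {S : Signature.{u}} : {n : ℕ} → TCtx S n → Tm S n → Tm S n → S.Ty n → Prop
  | step {n : ℕ} {Γ : TCtx S n} {t u : Tm S n} {σ : S.Ty n} :
      HasTy Γ t σ → HasTy Γ u σ → ExtStep t u → ExtEq Γ t u σ
  | refl {n : ℕ} {Γ : TCtx S n} {t : Tm S n} {σ : S.Ty n} : HasTy Γ t σ → ExtEq Γ t t σ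
  | symm {n : ℕ} {Γ : TCtx S n} {t u : Tm S n} {σ : S.Ty n} :
      ExtEq Γ t u σ → ExtEq Γ u t σ
  | trans {n : ℕ} {Γ : TCtx S n} {t u v : Tm S n} {σ : S.Ty n} :
      ExtEq Γ t u σ → ExtEq Γ u v σ → ExtEq Γ t v σ
  | lam {n : ℕ} {Γ : TCtx S n} {σ τ : S.Ty n} {t t' : Tm S n} :
      ExtEq ((Use.lin, σ) :: Γ) t t' τ →
      ExtEq Γ (Tm.lam σ t) (Tm.lam σ t') (Ty.lolli σ τ)
  | app {n : ℕ} {Γ Γ₁ Γ₂ : TCtx S n} {σ τ : S.Ty n} {t t' u u' : Tm S n} :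
      Split Γ Γ₁ Γ₂ → ExtEq Γ₁ t t' (Ty.lolli σ τ) → ExtEq Γ₂ u u' σ →
      ExtEq Γ (Tm.app t u) (Tm.app t' u') τ
  | tensor {n : ℕ} {Γ Γ₁ Γ₂ : TCtx S n} {σ τ : S.Ty n} {t t' u u' : Tm S n} :
      Split Γ Γ₁ Γ₂ → ExtEq Γ₁ t t' σ → ExtEq Γ₂ u u' τ →
      ExtEq Γ (Tm.tensor t u) (Tm.tensor t' u') (Ty.tensor σ τ)
  | bang {n : ℕ} {Γ : TCtx S n} {σ : S.Ty n} {t t' : Tm S n} :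
      Γ.NoLin → ExtEq Γ t t' σ → ExtEq Γ (Tm.bang t) (Tm.bang t') (Ty.bang σ)
  | tlam {n : ℕ} {Γ : TCtx S n} {σ : S.Ty (n + 1)} {t t' : Tm S (n + 1)} :
      ExtEq Γ.wkTy t t' σ → ExtEq Γ (Tm.tlam t) (Tm.tlam t') (Ty.pi σ)
  | tapp {n : ℕ} {Γ : TCtx S n} {σ : S.Ty (n + 1)} {t t' : Tm S n} (τ : S.Ty n) :
      ExtEq Γ t t' (Ty.pi σ) → ExtEq Γ (Tm.tapp t τ) (Tm.tapp t' τ) (σ.inst τ)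
  | letTensor {n : ℕ} {Γ Γ₁ Γ₂ : TCtx S n} {σ σ' τ : S.Ty n} {s s' t t' : Tm S n} :
      Split Γ Γ₁ Γ₂ → ExtEq Γ₁ s s' (Ty.tensor σ σ') →
      ExtEq ((Use.lin, σ') :: (Use.lin, σ) :: Γ₂) t t' τ →
      ExtEq Γ (Tm.letTensor s t) (Tm.letTensor s' t') τ
  | letBang {n : ℕ} {Γ Γ₁ Γ₂ : TCtx S n} {σ τ : S.Ty n} {s s' t t' : Tm S n} :
      Split Γ Γ₁ Γ₂ → ExtEq Γ₁ s s' (Ty.bang σ) →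
      ExtEq ((Use.int, σ) :: Γ₂) t t' τ → ExtEq Γ (Tm.letBang s t) (Tm.letBang s' t') τ
  | letStar {n : ℕ} {Γ Γ₁ Γ₂ : TCtx S n} {σ : S.Ty n} {s s' t t' : Tm S n} :
      Split Γ Γ₁ Γ₂ → ExtEq Γ₁ s s' Ty.one → ExtEq Γ₂ t t' σ →
      ExtEq Γ (Tm.letStar s t) (Tm.letStar s' t') σ

/-! ## Propositions and definable relations -/

mutual

/-- Propositions.  In `allRel b σ τ φ` and `exRel b σ τ φ` the bound variable ranges over the
relations (`b = false`) or the admissible relations (`b = true`) between `σ` and `τ`. -/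
inductive Form (S : Signature.{u}) : ℕ → Type u
  | eq {n : ℕ} (σ : S.Ty n) (t u : Tm S n) : Form S n
  | rel {n : ℕ} (ρ : Rel S n) (t u : Tm S n) : Form S n
  | imp {n : ℕ} (φ ψ : Form S n) : Form S n
  | bot {n : ℕ} : Form S n
  | top {n : ℕ} : Form S n
  | and {n : ℕ} (φ ψ : Form S n) : Form S n
  | or {n : ℕ} (φ ψ : Form S n) : Form S n
  | allTy {n : ℕ} (φ : Form S (n + 1)) : Form S n
  | allTm {n : ℕ} (σ : S.Ty n) (φ : Form S n) : Form S n
  | allRel {n : ℕ} (b : Bool) (σ τ : S.Ty n) (φ : Form S n) : Form S n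
  | exTy {n : ℕ} (φ : Form S (n + 1)) : Form S n
  | exTm {n : ℕ} (σ : S.Ty n) (φ : Form S n) : Form S n
  | exRel {n : ℕ} (b : Bool) (σ τ : S.Ty n) (φ : Form S n) : Form S n

/-- Definable relations: variables, `(x : σ, y : τ). φ` (with `x` at index `1` and `y` at index
`0` in `φ`), and the relational interpretation `σ[ρ₁,…,ρₖ]` of a type `σ` in `k` variables. -/
inductive Rel (S : Signature.{u}) : ℕ → Type u
  | var {n : ℕ} (i : ℕ) : Rel S n
  | abs {n : ℕ} (σ τ : S.Ty n) (φ : Form S n) : Rel S n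
  | ty {n k : ℕ} (σ : S.Ty k) (ρ : Fin k → Rel S n) : Rel S n

end

mutual

/-- Rename type, term and relation variables. -/
def Form.ren {S : Signature.{u}} : {n m : ℕ} → (Fin n → Fin m) → (ℕ → ℕ) → (ℕ → ℕ) →
    Form S n → Form S m
  | _, _, r, e, _, .eq σ t u => .eq (σ.ren r) (t.ren r e) (u.ren r e)
  | _, _, r, e, q, .rel ρ t u => .rel (ρ.ren r e q) (t.ren r e) (u.ren r e)
  | _, _, r, e, q, .imp φ ψ => .imp (φ.ren r e q) (ψ.ren r e q)
  | _, _, _, _, _, .bot => .bot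
  | _, _, _, _, _, .top => .top
  | _, _, r, e, q, .and φ ψ => .and (φ.ren r e q) (ψ.ren r e q)
  | _, _, r, e, q, .or φ ψ => .or (φ.ren r e q) (ψ.ren r e q)
  | _, _, r, e, q, .allTy φ => .allTy (φ.ren (upRen r) e q)
  | _, _, r, e, q, .allTm σ φ => .allTm (σ.ren r) (φ.ren r (upN e) q)
  | _, _, r, e, q, .allRel b σ τ φ => .allRel b (σ.ren r) (τ.ren r) (φ.ren r e (upN q))
  | _, _, r, e, q, .exTy φ => .exTy (φ.ren (upRen r) e q)
  | _, _, r, e, q, .exTm σ φ => .exTm (σ.ren r) (φ.ren r (upN e) q)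
  | _, _, r, e, q, .exRel b σ τ φ => .exRel b (σ.ren r) (τ.ren r) (φ.ren r e (upN q))

/-- Rename type, term and relation variables. -/
def Rel.ren {S : Signature.{u}} : {n m : ℕ} → (Fin n → Fin m) → (ℕ → ℕ) → (ℕ → ℕ) →
    Rel S n → Rel S m
  | _, _, _, _, q, .var i => .var (q i)
  | _, _, r, e, q, .abs σ τ φ => .abs (σ.ren r) (τ.ren r) (φ.ren r (upN (upN e)) q)
  | _, _, r, e, q, .ty σ ρ => .ty σ (fun i => (ρ i).ren r e q)

end

/-- Weakening by `k` innermost term variables. -/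
def Rel.wk {S : Signature.{u}} {n : ℕ} (k : ℕ) (ρ : Rel S n) : Rel S n := ρ.ren id (· + k) id

/-- Weakening by an innermost type variable. -/
def Rel.wkTy {S : Signature.{u}} {n : ℕ} (ρ : Rel S n) : Rel S (n + 1) := ρ.ren Fin.succ id id

/-- Weakening by an innermost relation variable. -/
def Rel.wkRel {S : Signature.{u}} {n : ℕ} (ρ : Rel S n) : Rel S n := ρ.ren id id (· + 1)

/-- Weakening by an innermost term variable. -/
def Form.wk {S : Signature.{u}} {n : ℕ} (φ : Form S n) : Form S n := φ.ren id (· + 1) id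

/-- Weakening by an innermost type variable. -/
def Form.wkTy {S : Signature.{u}} {n : ℕ} (φ : Form S n) : Form S (n + 1) :=
  φ.ren Fin.succ id id

/-- Weakening by an innermost relation variable. -/
def Form.wkRel {S : Signature.{u}} {n : ℕ} (φ : Form S n) : Form S n := φ.ren id id (· + 1)

/-- Lift a relation substitution under a relation binder. -/
def Rel.up {S : Signature.{u}} {n : ℕ} (g : ℕ → Rel S n) : ℕ → Rel S n :=
  scons (Rel.var 0) (fun i => (g i).wkRel)

mutual

/-- Simultaneous capture-avoiding substitution of types, terms and relations. -/
def Form.subst {S : Signature.{u}} : {n m : ℕ} → (Fin n → S.Ty m) → (ℕ → Tm S m) →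
    (ℕ → Rel S m) → Form S n → Form S m
  | _, _, s, e, _, .eq σ t u => .eq (σ.subst s) (t.subst s e) (u.subst s e)
  | _, _, s, e, g, .rel ρ t u => .rel (ρ.subst s e g) (t.subst s e) (u.subst s e)
  | _, _, s, e, g, .imp φ ψ => .imp (φ.subst s e g) (ψ.subst s e g)
  | _, _, _, _, _, .bot => .bot
  | _, _, _, _, _, .top => .top
  | _, _, s, e, g, .and φ ψ => .and (φ.subst s e g) (ψ.subst s e g)
  | _, _, s, e, g, .or φ ψ => .or (φ.subst s e g) (ψ.subst s e g)
  | _, _, s, e, g, .allTy φ =>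
      .allTy (φ.subst (Ty.up s) (fun i => (e i).wkTy) (fun i => (g i).wkTy))
  | _, _, s, e, g, .allTm σ φ =>
      .allTm (σ.subst s) (φ.subst s (Tm.up e) (fun i => (g i).wk 1))
  | _, _, s, e, g, .allRel b σ τ φ =>
      .allRel b (σ.subst s) (τ.subst s) (φ.subst s e (Rel.up g))
  | _, _, s, e, g, .exTy φ =>
      .exTy (φ.subst (Ty.up s) (fun i => (e i).wkTy) (fun i => (g i).wkTy))
  | _, _, s, e, g, .exTm σ φ =>
      .exTm (σ.subst s) (φ.subst s (Tm.up e) (fun i => (g i).wk 1))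
  | _, _, s, e, g, .exRel b σ τ φ =>
      .exRel b (σ.subst s) (τ.subst s) (φ.subst s e (Rel.up g))

/-- Simultaneous capture-avoiding substitution of types, terms and relations. -/
def Rel.subst {S : Signature.{u}} : {n m : ℕ} → (Fin n → S.Ty m) → (ℕ → Tm S m) →
    (ℕ → Rel S m) → Rel S n → Rel S m
  | _, _, _, _, g, .var i => g i
  | _, _, s, e, g, .abs σ τ φ =>
      .abs (σ.subst s) (τ.subst s) (φ.subst s (Tm.up (Tm.up e)) (fun i => (g i).wk 2))
  | _, _, s, e, g, .ty σ ρ => .ty σ (fun i => (ρ i).subst s e g)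

end

namespace Form

variable {S : Signature.{u}} {n : ℕ}

/-- `φ[t/x]` for the innermost term variable `x`. -/
def instTm (φ : Form S n) (t : Tm S n) : Form S n :=
  φ.subst Ty.var (scons t Tm.var) Rel.var

/-- `φ[t,u/x,y]`, where `x` has index `1` and `y` has index `0`. -/
def instTm2 (φ : Form S n) (t u : Tm S n) : Form S n :=
  φ.subst Ty.var (scons u (scons t Tm.var)) Rel.var

/-- `φ[σ/α]` for the innermost type variable `α`. -/
def instTy (φ : Form S (n + 1)) (σ : S.Ty n) : Form S n :=
  φ.subst (Ty.cons σ Ty.var) Tm.var Rel.var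

/-- `φ[ρ/R]` for the innermost relation variable `R`. -/
def instRel (φ : Form S n) (ρ : Rel S n) : Form S n :=
  φ.subst Ty.var Tm.var (scons ρ Rel.var)

def iff (φ ψ : Form S n) : Form S n := and (imp φ ψ) (imp ψ φ)

/-- `ρ ≡ ρ'`, i.e. `∀ x:σ. ∀ y:τ. ρ(x,y) ⊃⊂ ρ'(x,y)`. -/
def relEquiv (σ τ : S.Ty n) (ρ ρ' : Rel S n) : Form S n :=
  allTm σ (allTm τ (iff (rel (ρ.wk 2) (Tm.var 1) (Tm.var 0))
    (rel (ρ'.wk 2) (Tm.var 1) (Tm.var 0))))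

/-- Closure of a formula under universal quantification over all its type variables. -/
def allTys : (k : ℕ) → Form S k → Form S 0
  | 0, φ => φ
  | k + 1, φ => allTys k (allTy φ)

end Form

namespace Rel

variable {S : Signature.{u}} {n : ℕ}

/-- The graph `(x : σ, y : τ). f x = y` of `f : σ ⊸ τ`. -/
def graph (σ τ : S.Ty n) (f : Tm S n) : Rel S n :=
  abs σ τ (Form.eq τ (Tm.app (f.wk 2) (Tm.var 1)) (Tm.var 0))

/-- The equality relation, i.e. the graph of the identity. -/
def eqr (σ : S.Ty n) : Rel S n := graph σ σ (Tm.idm σ)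

/-- `(f,g)^* ρ = (x : σ', y : τ'). ρ(f x, g y)`. -/
def reindex (σ' τ' : S.Ty n) (f g : Tm S n) (ρ : Rel S n) : Rel S n :=
  abs σ' τ' (Form.rel (ρ.wk 2) (Tm.app (f.wk 2) (Tm.var 1)) (Tm.app (g.wk 2) (Tm.var 0)))

/-- `ρ ⊸ ρ'` for `ρ` between `σ` and `τ` and `ρ'` between `σ'` and `τ'`. -/
def lolli (σ τ σ' τ' : S.Ty n) (ρ ρ' : Rel S n) : Rel S n :=
  abs (Ty.lolli σ σ') (Ty.lolli τ τ')
    (Form.allTm σ (Form.allTm τ (Form.imp (Form.rel (ρ.wk 4) (Tm.var 1) (Tm.var 0))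
      (Form.rel (ρ'.wk 4) (Tm.app (Tm.var 3) (Tm.var 1)) (Tm.app (Tm.var 2) (Tm.var 0))))))

/-- `ρ → ρ'` for `ρ` between `σ` and `τ` and `ρ'` between `σ'` and `τ'`. -/
def arr (σ τ σ' τ' : S.Ty n) (ρ ρ' : Rel S n) : Rel S n :=
  abs (Ty.arr σ σ') (Ty.arr τ τ')
    (Form.allTm σ (Form.allTm τ (Form.imp (Form.rel (ρ.wk 4) (Tm.var 1) (Tm.var 0))
      (Form.rel (ρ'.wk 4) (Tm.app (Tm.var 3) (Tm.bang (Tm.var 1)))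
        (Tm.app (Tm.var 2) (Tm.bang (Tm.var 0)))))))

/-- `∀(α, β, R : Adm(α,β)). ρ`, a relation between `Π α. σ` and `Π β. τ`.  In `ρ` the variable
`α` has index `1`, `β` has index `0`, and `R` is the innermost relation variable. -/
def all (σ τ : S.Ty (n + 1)) (ρ : Rel S (n + 2)) : Rel S n :=
  abs (Ty.pi σ) (Ty.pi τ)
    (Form.allTy (Form.allTy (Form.allRel true (Ty.var 1) (Ty.var 0)
      (Form.rel (ρ.wk 2) (Tm.tapp (Tm.var 1) (Ty.var 1)) (Tm.tapp (Tm.var 0) (Ty.var 0))))))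

/-- Weakening of a relation by two type variables and one relation variable. -/
def wkAll (ρ : Rel S n) : Rel S (n + 2) := ρ.wkTy.wkTy.wkRel

/-- The map `σ ⊗ σ' ⊸ Π α. (σ ⊸ σ' ⊸ α) ⊸ α`. -/
def tensorMap (σ σ' : S.Ty n) : Tm S n :=
  Tm.lam (Ty.tensor σ σ') (Tm.letTensor (Tm.var 0)
    (Tm.tlam (Tm.lam (Ty.lolli σ.wk (Ty.lolli σ'.wk (Ty.var 0)))
      (Tm.app (Tm.app (Tm.var 0) (Tm.var 2)) (Tm.var 1)))))

/-- `ρ ⊗ ρ' = (f,f)^* ∀(α, β, R : Adm(α,β)). (ρ ⊸ ρ' ⊸ R) ⊸ R`. -/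
def tensor (σ τ σ' τ' : S.Ty n) (ρ ρ' : Rel S n) : Rel S n :=
  reindex (Ty.tensor σ σ') (Ty.tensor τ τ') (tensorMap σ σ') (tensorMap τ τ')
    (all (Ty.lolli (Ty.lolli σ.wk (Ty.lolli σ'.wk (Ty.var 0))) (Ty.var 0))
      (Ty.lolli (Ty.lolli τ.wk (Ty.lolli τ'.wk (Ty.var 0))) (Ty.var 0))
      (lolli (Ty.lolli σ.wk.wk (Ty.lolli σ'.wk.wk (Ty.var 1)))
        (Ty.lolli τ.wk.wk (Ty.lolli τ'.wk.wk (Ty.var 0))) (Ty.var 1) (Ty.var 0)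
        (lolli σ.wk.wk τ.wk.wk (Ty.lolli σ'.wk.wk (Ty.var 1)) (Ty.lolli τ'.wk.wk (Ty.var 0))
          ρ.wkAll
          (lolli σ'.wk.wk τ'.wk.wk (Ty.var 1) (Ty.var 0) ρ'.wkAll (var 0)))
        (var 0)))

/-- The map `I ⊸ Π α. α ⊸ α`. -/
def oneMap : Tm S n :=
  Tm.lam Ty.one (Tm.letStar (Tm.var 0) (Tm.tlam (Tm.idm (Ty.var 0))))

/-- `I_Rel = (f,f)^* ∀(α, β, R : Adm(α,β)). R ⊸ R`. -/
def one : Rel S n :=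
  reindex Ty.one Ty.one oneMap oneMap
    (all (Ty.lolli (Ty.var 0) (Ty.var 0)) (Ty.lolli (Ty.var 0) (Ty.var 0))
      (lolli (Ty.var 1) (Ty.var 0) (Ty.var 1) (Ty.var 0) (var 0) (var 0)))

/-- The map `!σ ⊸ Π α. (σ → α) ⊸ α`. -/
def bangMap (σ : S.Ty n) : Tm S n :=
  Tm.lam (Ty.bang σ) (Tm.tlam (Tm.lam (Ty.arr σ.wk (Ty.var 0))
    (Tm.app (Tm.var 0) (Tm.var 1))))

/-- `!ρ = (f,f)^* ∀(α, β, R : Adm(α,β)). (ρ → R) ⊸ R`. -/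
def bang (σ τ : S.Ty n) (ρ : Rel S n) : Rel S n :=
  reindex (Ty.bang σ) (Ty.bang τ) (bangMap σ) (bangMap τ)
    (all (Ty.lolli (Ty.arr σ.wk (Ty.var 0)) (Ty.var 0))
      (Ty.lolli (Ty.arr τ.wk (Ty.var 0)) (Ty.var 0))
      (lolli (Ty.arr σ.wk.wk (Ty.var 1)) (Ty.arr τ.wk.wk (Ty.var 0)) (Ty.var 1) (Ty.var 0)
        (arr σ.wk.wk τ.wk.wk (Ty.var 1) (Ty.var 0) ρ.wkAll (var 0)) (var 0)))

end Rel

/-! ## The logic -/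

/-- Declaration of a relation variable: an admissible (`adm = true`) or arbitrary
(`adm = false`) relation between `dom` and `cod`. -/
structure RelDecl (S : Signature.{u}) (n : ℕ) where
  adm : Bool
  dom : S.Ty n
  cod : S.Ty n

def RelDecl.subst {S : Signature.{u}} {n m : ℕ} (s : Fin n → S.Ty m) (d : RelDecl S n) :
    RelDecl S m := ⟨d.adm, d.dom.subst s, d.cod.subst s⟩

def RelDecl.wk {S : Signature.{u}} {n : ℕ} (d : RelDecl S n) : RelDecl S (n + 1) :=
  ⟨d.adm, d.dom.wk, d.cod.wk⟩

/-- Typing in a purely intuitionistic context, `Ξ | Γ; - ⊢ t : σ`. -/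
def HasTyI {S : Signature.{u}} {n : ℕ} (Γ : List (S.Ty n)) (t : Tm S n) (σ : S.Ty n) : Prop :=
  HasTy (Γ.map (fun τ => (Use.int, τ))) t σ

/-- External equality in a purely intuitionistic context. -/
def ExtEqI {S : Signature.{u}} {n : ℕ} (Γ : List (S.Ty n)) (t u : Tm S n) (σ : S.Ty n) : Prop :=
  ExtEq (Γ.map (fun τ => (Use.int, τ))) t u σ

/-- A set of additional axioms: propositions in contexts `Ξ | Γ | Θ`. -/
abbrev Theory (S : Signature.{u}) : Type u :=
  ∀ n : ℕ, List (S.Ty n) → List (RelDecl S n) → Form S n → Prop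

mutual

/-- Well-formed propositions, `Ξ | Γ | Θ ⊢ φ : Prop`. -/
inductive FormOk {S : Signature.{u}} (T : Theory S) :
    {n : ℕ} → List (S.Ty n) → List (RelDecl S n) → Form S n → Prop
  | eq {n : ℕ} {Γ : List (S.Ty n)} {Θ : List (RelDecl S n)} {σ : S.Ty n} {t u : Tm S n} :
      HasTyI Γ t σ → HasTyI Γ u σ → FormOk T Γ Θ (.eq σ t u)
  | rel {n : ℕ} {Γ : List (S.Ty n)} {Θ : List (RelDecl S n)} {ρ : Rel S n} {σ τ : S.Ty n}
      {t u : Tm S n} :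
      RelOk T false Γ Θ ρ σ τ → HasTyI Γ t σ → HasTyI Γ u τ → FormOk T Γ Θ (.rel ρ t u)
  | imp {n : ℕ} {Γ : List (S.Ty n)} {Θ : List (RelDecl S n)} {φ ψ : Form S n} :
      FormOk T Γ Θ φ → FormOk T Γ Θ ψ → FormOk T Γ Θ (.imp φ ψ)
  | bot {n : ℕ} {Γ : List (S.Ty n)} {Θ : List (RelDecl S n)} : FormOk T Γ Θ .bot
  | top {n : ℕ} {Γ : List (S.Ty n)} {Θ : List (RelDecl S n)} : FormOk T Γ Θ .top
  | and {n : ℕ} {Γ : List (S.Ty n)} {Θ : List (RelDecl S n)} {φ ψ : Form S n} :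
      FormOk T Γ Θ φ → FormOk T Γ Θ ψ → FormOk T Γ Θ (.and φ ψ)
  | or {n : ℕ} {Γ : List (S.Ty n)} {Θ : List (RelDecl S n)} {φ ψ : Form S n} :
      FormOk T Γ Θ φ → FormOk T Γ Θ ψ → FormOk T Γ Θ (.or φ ψ)
  | allTy {n : ℕ} {Γ : List (S.Ty n)} {Θ : List (RelDecl S n)} {φ : Form S (n + 1)} :
      FormOk T (Γ.map Ty.wk) (Θ.map RelDecl.wk) φ → FormOk T Γ Θ (.allTy φ)
  | allTm {n : ℕ} {Γ : List (S.Ty n)} {Θ : List (RelDecl S n)} {σ : S.Ty n} {φ : Form S n} :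
      FormOk T (σ :: Γ) Θ φ → FormOk T Γ Θ (.allTm σ φ)
  | allRel {n : ℕ} {Γ : List (S.Ty n)} {Θ : List (RelDecl S n)} {b : Bool} {σ τ : S.Ty n}
      {φ : Form S n} :
      FormOk T Γ (⟨b, σ, τ⟩ :: Θ) φ → FormOk T Γ Θ (.allRel b σ τ φ)
  | exTy {n : ℕ} {Γ : List (S.Ty n)} {Θ : List (RelDecl S n)} {φ : Form S (n + 1)} :
      FormOk T (Γ.map Ty.wk) (Θ.map RelDecl.wk) φ → FormOk T Γ Θ (.exTy φ)
  | exTm {n : ℕ} {Γ : List (S.Ty n)} {Θ : List (RelDecl S n)} {σ : S.Ty n} {φ : Form S n} :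
      FormOk T (σ :: Γ) Θ φ → FormOk T Γ Θ (.exTm σ φ)
  | exRel {n : ℕ} {Γ : List (S.Ty n)} {Θ : List (RelDecl S n)} {b : Bool} {σ τ : S.Ty n}
      {φ : Form S n} :
      FormOk T Γ (⟨b, σ, τ⟩ :: Θ) φ → FormOk T Γ Θ (.exRel b σ τ φ)

/-- `RelOk T false Γ Θ ρ σ τ` is `Ξ | Γ | Θ ⊢ ρ : Rel(σ,τ)`, and `RelOk T true Γ Θ ρ σ τ` is
`Ξ | Γ | Θ ⊢ ρ : AdmRel(σ,τ)`. -/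
inductive RelOk {S : Signature.{u}} (T : Theory S) :
    Bool → {n : ℕ} → List (S.Ty n) → List (RelDecl S n) → Rel S n → S.Ty n → S.Ty n → Prop
  | var {n : ℕ} {Γ : List (S.Ty n)} {Θ : List (RelDecl S n)} {i : ℕ} {b : Bool} {σ τ : S.Ty n} :
      Θ[i]? = some ⟨b, σ, τ⟩ → RelOk T b Γ Θ (.var i) σ τ
  | abs {n : ℕ} {Γ : List (S.Ty n)} {Θ : List (RelDecl S n)} {σ τ : S.Ty n} {φ : Form S n} :
      FormOk T (τ :: σ :: Γ) Θ φ → RelOk T false Γ Θ (.abs σ τ φ) σ τ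
  | ofAdm {n : ℕ} {Γ : List (S.Ty n)} {Θ : List (RelDecl S n)} {ρ : Rel S n} {σ τ : S.Ty n} :
      RelOk T true Γ Θ ρ σ τ → RelOk T false Γ Θ ρ σ τ
  | eqr {n : ℕ} {Γ : List (S.Ty n)} {Θ : List (RelDecl S n)} (σ : S.Ty n) :
      RelOk T true Γ Θ (Rel.eqr σ) σ σ
  | reindex {n : ℕ} {Γ : List (S.Ty n)} {Θ : List (RelDecl S n)} {ρ : Rel S n}
      {σ τ σ' τ' : S.Ty n} {f g : Tm S n} :
      RelOk T true Γ Θ ρ σ τ → HasTyI Γ f (Ty.lolli σ' σ) → HasTyI Γ g (Ty.lolli τ' τ) →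
      RelOk T true Γ Θ (Rel.reindex σ' τ' f g ρ) σ' τ'
  | and {n : ℕ} {Γ : List (S.Ty n)} {Θ : List (RelDecl S n)} {ρ ρ' : Rel S n} {σ τ : S.Ty n} :
      RelOk T true Γ Θ ρ σ τ → RelOk T true Γ Θ ρ' σ τ →
      RelOk T true Γ Θ (.abs σ τ (.and (.rel (ρ.wk 2) (.var 1) (.var 0))
        (.rel (ρ'.wk 2) (.var 1) (.var 0)))) σ τ
  | inv {n : ℕ} {Γ : List (S.Ty n)} {Θ : List (RelDecl S n)} {ρ : Rel S n} {σ τ : S.Ty n} :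
      RelOk T true Γ Θ ρ σ τ →
      RelOk T true Γ Θ (.abs τ σ (.rel (ρ.wk 2) (.var 0) (.var 1))) τ σ
  | top {n : ℕ} {Γ : List (S.Ty n)} {Θ : List (RelDecl S n)} (σ τ : S.Ty n) :
      RelOk T true Γ Θ (.abs σ τ .top) σ τ
  | imp {n : ℕ} {Γ : List (S.Ty n)} {Θ : List (RelDecl S n)} {φ : Form S n} {ρ : Rel S n}
      {σ τ : S.Ty n} :
      RelOk T true Γ Θ ρ σ τ → FormOk T Γ Θ φ →
      RelOk T true Γ Θ (.abs σ τ (.imp φ.wk.wk (.rel (ρ.wk 2) (.var 1) (.var 0)))) σ τ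
  | allTy {n : ℕ} {Γ : List (S.Ty n)} {Θ : List (RelDecl S n)} {ρ : Rel S (n + 1)}
      {σ τ : S.Ty n} :
      RelOk T true (Γ.map Ty.wk) (Θ.map RelDecl.wk) ρ σ.wk τ.wk →
      RelOk T true Γ Θ (.abs σ τ (.allTy (.rel (ρ.wk 2) (.var 1) (.var 0)))) σ τ
  | allTm {n : ℕ} {Γ : List (S.Ty n)} {Θ : List (RelDecl S n)} {ω : S.Ty n} {ρ : Rel S n}
      {σ τ : S.Ty n} :
      RelOk T true (ω :: Γ) Θ ρ σ τ →
      RelOk T true Γ Θ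
        (.abs σ τ (.allTm ω (.rel (ρ.ren id (upN (· + 2)) id) (.var 2) (.var 1)))) σ τ
  | allRel {n : ℕ} {Γ : List (S.Ty n)} {Θ : List (RelDecl S n)} {b : Bool} {ω ω' : S.Ty n}
      {ρ : Rel S n} {σ τ : S.Ty n} :
      RelOk T true Γ (⟨b, ω, ω'⟩ :: Θ) ρ σ τ →
      RelOk T true Γ Θ (.abs σ τ (.allRel b ω ω' (.rel (ρ.wk 2) (.var 1) (.var 0)))) σ τ
  | equiv {n : ℕ} {Γ : List (S.Ty n)} {Θ : List (RelDecl S n)} {ρ ρ' : Rel S n} {σ τ : S.Ty n} :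
      RelOk T true Γ Θ ρ σ τ → RelOk T false Γ Θ ρ' σ τ →
      Prf T Γ Θ [] (Form.relEquiv σ τ ρ ρ') → RelOk T true Γ Θ ρ' σ τ
  | ty {n k : ℕ} {Γ : List (S.Ty n)} {Θ : List (RelDecl S n)} (σ : S.Ty k) {ρ : Fin k → Rel S n}
      {τ τ' : Fin k → S.Ty n} :
      (∀ i, RelOk T true Γ Θ (ρ i) (τ i) (τ' i)) →
      RelOk T true Γ Θ (.ty σ ρ) (σ.subst τ) (σ.subst τ')

/-- Provability `Ξ | Γ | Θ | Φ ⊢ ψ` in the logic with the additional axioms `T`.  Hypotheses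
are checked for well-formedness when they are discharged. -/
inductive Prf {S : Signature.{u}} (T : Theory S) :
    {n : ℕ} → List (S.Ty n) → List (RelDecl S n) → List (Form S n) → Form S n → Prop
  | ax {n : ℕ} {Γ : List (S.Ty n)} {Θ : List (RelDecl S n)} {Φ : List (Form S n)}
      {φ : Form S n} :
      T n Γ Θ φ → FormOk T Γ Θ φ → Prf T Γ Θ Φ φ
  | hyp {n : ℕ} {Γ : List (S.Ty n)} {Θ : List (RelDecl S n)} {Φ : List (Form S n)}
      {φ : Form S n} : φ ∈ Φ → Prf T Γ Θ Φ φ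
  | mono {n : ℕ} {Γ : List (S.Ty n)} {Θ : List (RelDecl S n)} {Φ Φ' : List (Form S n)}
      {φ : Form S n} : Prf T Γ Θ Φ φ → Φ ⊆ Φ' → Prf T Γ Θ Φ' φ
  | subst {n m : ℕ} {Γ : List (S.Ty n)} {Θ : List (RelDecl S n)} {Φ : List (Form S n)}
      {φ : Form S n} {Γ' : List (S.Ty m)} {Θ' : List (RelDecl S m)}
      (s : Fin n → S.Ty m) (e : ℕ → Tm S m) (g : ℕ → Rel S m) :
      Prf T Γ Θ Φ φ →
      (∀ i σ, Γ[i]? = some σ → HasTyI Γ' (e i) (σ.subst s)) →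
      (∀ i d, Θ[i]? = some d →
        RelOk T d.adm Γ' Θ' (g i) (d.dom.subst s) (d.cod.subst s)) →
      Prf T Γ' Θ' (Φ.map (Form.subst s e g)) (φ.subst s e g)
  | topI {n : ℕ} {Γ : List (S.Ty n)} {Θ : List (RelDecl S n)} {Φ : List (Form S n)} :
      Prf T Γ Θ Φ .top
  | botE {n : ℕ} {Γ : List (S.Ty n)} {Θ : List (RelDecl S n)} {Φ : List (Form S n)}
      {φ : Form S n} : Prf T Γ Θ Φ .bot → FormOk T Γ Θ φ → Prf T Γ Θ Φ φ
  | andI {n : ℕ} {Γ : List (S.Ty n)} {Θ : List (RelDecl S n)} {Φ : List (Form S n)}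
      {φ ψ : Form S n} : Prf T Γ Θ Φ φ → Prf T Γ Θ Φ ψ → Prf T Γ Θ Φ (.and φ ψ)
  | andE₁ {n : ℕ} {Γ : List (S.Ty n)} {Θ : List (RelDecl S n)} {Φ : List (Form S n)}
      {φ ψ : Form S n} : Prf T Γ Θ Φ (.and φ ψ) → Prf T Γ Θ Φ φ
  | andE₂ {n : ℕ} {Γ : List (S.Ty n)} {Θ : List (RelDecl S n)} {Φ : List (Form S n)}
      {φ ψ : Form S n} : Prf T Γ Θ Φ (.and φ ψ) → Prf T Γ Θ Φ ψ
  | orI₁ {n : ℕ} {Γ : List (S.Ty n)} {Θ : List (RelDecl S n)} {Φ : List (Form S n)}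
      {φ ψ : Form S n} : Prf T Γ Θ Φ φ → FormOk T Γ Θ ψ → Prf T Γ Θ Φ (.or φ ψ)
  | orI₂ {n : ℕ} {Γ : List (S.Ty n)} {Θ : List (RelDecl S n)} {Φ : List (Form S n)}
      {φ ψ : Form S n} : FormOk T Γ Θ φ → Prf T Γ Θ Φ ψ → Prf T Γ Θ Φ (.or φ ψ)
  | orE {n : ℕ} {Γ : List (S.Ty n)} {Θ : List (RelDecl S n)} {Φ : List (Form S n)}
      {φ ψ χ : Form S n} :
      Prf T Γ Θ Φ (.or φ ψ) → Prf T Γ Θ (φ :: Φ) χ → Prf T Γ Θ (ψ :: Φ) χ → Prf T Γ Θ Φ χ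
  | impI {n : ℕ} {Γ : List (S.Ty n)} {Θ : List (RelDecl S n)} {Φ : List (Form S n)}
      {φ ψ : Form S n} :
      FormOk T Γ Θ φ → Prf T Γ Θ (φ :: Φ) ψ → Prf T Γ Θ Φ (.imp φ ψ)
  | impE {n : ℕ} {Γ : List (S.Ty n)} {Θ : List (RelDecl S n)} {Φ : List (Form S n)}
      {φ ψ : Form S n} : Prf T Γ Θ Φ (.imp φ ψ) → Prf T Γ Θ Φ φ → Prf T Γ Θ Φ ψ
  | allTyI {n : ℕ} {Γ : List (S.Ty n)} {Θ : List (RelDecl S n)} {Φ : List (Form S n)}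
      {φ : Form S (n + 1)} :
      Prf T (Γ.map Ty.wk) (Θ.map RelDecl.wk) (Φ.map Form.wkTy) φ → Prf T Γ Θ Φ (.allTy φ)
  | allTyE {n : ℕ} {Γ : List (S.Ty n)} {Θ : List (RelDecl S n)} {Φ : List (Form S n)}
      {φ : Form S (n + 1)} (σ : S.Ty n) :
      Prf T Γ Θ Φ (.allTy φ) → Prf T Γ Θ Φ (φ.instTy σ)
  | allTmI {n : ℕ} {Γ : List (S.Ty n)} {Θ : List (RelDecl S n)} {Φ : List (Form S n)}
      {σ : S.Ty n} {φ : Form S n} :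
      Prf T (σ :: Γ) Θ (Φ.map Form.wk) φ → Prf T Γ Θ Φ (.allTm σ φ)
  | allTmE {n : ℕ} {Γ : List (S.Ty n)} {Θ : List (RelDecl S n)} {Φ : List (Form S n)}
      {σ : S.Ty n} {φ : Form S n} {t : Tm S n} :
      Prf T Γ Θ Φ (.allTm σ φ) → HasTyI Γ t σ → Prf T Γ Θ Φ (φ.instTm t)
  | allRelI {n : ℕ} {Γ : List (S.Ty n)} {Θ : List (RelDecl S n)} {Φ : List (Form S n)}
      {b : Bool} {σ τ : S.Ty n} {φ : Form S n} :
      Prf T Γ (⟨b, σ, τ⟩ :: Θ) (Φ.map Form.wkRel) φ → Prf T Γ Θ Φ (.allRel b σ τ φ)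
  | allRelE {n : ℕ} {Γ : List (S.Ty n)} {Θ : List (RelDecl S n)} {Φ : List (Form S n)}
      {b : Bool} {σ τ : S.Ty n} {φ : Form S n} {ρ : Rel S n} :
      Prf T Γ Θ Φ (.allRel b σ τ φ) → RelOk T b Γ Θ ρ σ τ → Prf T Γ Θ Φ (φ.instRel ρ)
  | exTyI {n : ℕ} {Γ : List (S.Ty n)} {Θ : List (RelDecl S n)} {Φ : List (Form S n)}
      {φ : Form S (n + 1)} (σ : S.Ty n) :
      FormOk T (Γ.map Ty.wk) (Θ.map RelDecl.wk) φ →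
      Prf T Γ Θ Φ (φ.instTy σ) → Prf T Γ Θ Φ (.exTy φ)
  | exTyE {n : ℕ} {Γ : List (S.Ty n)} {Θ : List (RelDecl S n)} {Φ : List (Form S n)}
      {φ : Form S (n + 1)} {ψ : Form S n} :
      Prf T Γ Θ Φ (.exTy φ) →
      Prf T (Γ.map Ty.wk) (Θ.map RelDecl.wk) (φ :: Φ.map Form.wkTy) ψ.wkTy → Prf T Γ Θ Φ ψ
  | exTmI {n : ℕ} {Γ : List (S.Ty n)} {Θ : List (RelDecl S n)} {Φ : List (Form S n)}
      {σ : S.Ty n} {φ : Form S n} {t : Tm S n} :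
      FormOk T (σ :: Γ) Θ φ → HasTyI Γ t σ →
      Prf T Γ Θ Φ (φ.instTm t) → Prf T Γ Θ Φ (.exTm σ φ)
  | exTmE {n : ℕ} {Γ : List (S.Ty n)} {Θ : List (RelDecl S n)} {Φ : List (Form S n)}
      {σ : S.Ty n} {φ ψ : Form S n} :
      Prf T Γ Θ Φ (.exTm σ φ) → Prf T (σ :: Γ) Θ (φ :: Φ.map Form.wk) ψ.wk → Prf T Γ Θ Φ ψ
  | exRelI {n : ℕ} {Γ : List (S.Ty n)} {Θ : List (RelDecl S n)} {Φ : List (Form S n)}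
      {b : Bool} {σ τ : S.Ty n} {φ : Form S n} {ρ : Rel S n} :
      FormOk T Γ (⟨b, σ, τ⟩ :: Θ) φ → RelOk T b Γ Θ ρ σ τ →
      Prf T Γ Θ Φ (φ.instRel ρ) → Prf T Γ Θ Φ (.exRel b σ τ φ)
  | exRelE {n : ℕ} {Γ : List (S.Ty n)} {Θ : List (RelDecl S n)} {Φ : List (Form S n)}
      {b : Bool} {σ τ : S.Ty n} {φ ψ : Form S n} :
      Prf T Γ Θ Φ (.exRel b σ τ φ) →
      Prf T Γ (⟨b, σ, τ⟩ :: Θ) (φ :: Φ.map Form.wkRel) ψ.wkRel → Prf T Γ Θ Φ ψ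
  | eqExt {n : ℕ} {Γ : List (S.Ty n)} {Θ : List (RelDecl S n)} {Φ : List (Form S n)}
      {σ : S.Ty n} {t u : Tm S n} : ExtEqI Γ t u σ → Prf T Γ Θ Φ (.eq σ t u)
  | eqSymm {n : ℕ} {Γ : List (S.Ty n)} {Θ : List (RelDecl S n)} {Φ : List (Form S n)}
      {σ : S.Ty n} {t u : Tm S n} : Prf T Γ Θ Φ (.eq σ t u) → Prf T Γ Θ Φ (.eq σ u t)
  | eqTrans {n : ℕ} {Γ : List (S.Ty n)} {Θ : List (RelDecl S n)} {Φ : List (Form S n)}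
      {σ : S.Ty n} {t u v : Tm S n} :
      Prf T Γ Θ Φ (.eq σ t u) → Prf T Γ Θ Φ (.eq σ u v) → Prf T Γ Θ Φ (.eq σ t v)
  /-- The substitution principle `R(x,y) ∧ x = x' ∧ y = y' ⊃ R(x',y')`. -/
  | relSubst {n : ℕ} {Γ : List (S.Ty n)} {Θ : List (RelDecl S n)} {Φ : List (Form S n)}
      {ρ : Rel S n} {σ τ : S.Ty n} {t t' u u' : Tm S n} :
      RelOk T false Γ Θ ρ σ τ → Prf T Γ Θ Φ (.rel ρ t u) → Prf T Γ Θ Φ (.eq σ t t') →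
      Prf T Γ Θ Φ (.eq τ u u') → Prf T Γ Θ Φ (.rel ρ t' u')
  /-- `((x,y).φ)(t,u)` is equivalent to `φ[t,u/x,y]`. -/
  | relAbs {n : ℕ} {Γ : List (S.Ty n)} {Θ : List (RelDecl S n)} {Φ : List (Form S n)}
      {σ τ : S.Ty n} {φ : Form S n} {t u : Tm S n} :
      FormOk T (τ :: σ :: Γ) Θ φ → HasTyI Γ t σ → HasTyI Γ u τ →
      Prf T Γ Θ Φ (Form.iff (.rel (.abs σ τ φ) t u) (φ.instTm2 t u))
  /-- `αᵢ[ρ⃗] ≡ ρᵢ`. -/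
  | tyVar {n k : ℕ} {Γ : List (S.Ty n)} {Θ : List (RelDecl S n)} {Φ : List (Form S n)}
      {ρ : Fin k → Rel S n} {τ τ' : Fin k → S.Ty n} (i : Fin k) :
      (∀ i, RelOk T true Γ Θ (ρ i) (τ i) (τ' i)) →
      Prf T Γ Θ Φ (Form.relEquiv (τ i) (τ' i) (.ty (Ty.var i) ρ) (ρ i))
  /-- `(σ ⊸ σ')[ρ⃗] ≡ σ[ρ⃗] ⊸ σ'[ρ⃗]`. -/
  | tyLolli {n k : ℕ} {Γ : List (S.Ty n)} {Θ : List (RelDecl S n)} {Φ : List (Form S n)}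
      {ρ : Fin k → Rel S n} {τ τ' : Fin k → S.Ty n} (σ σ' : S.Ty k) :
      (∀ i, RelOk T true Γ Θ (ρ i) (τ i) (τ' i)) →
      Prf T Γ Θ Φ (Form.relEquiv ((Ty.lolli σ σ').subst τ) ((Ty.lolli σ σ').subst τ')
        (.ty (Ty.lolli σ σ') ρ)
        (Rel.lolli (σ.subst τ) (σ.subst τ') (σ'.subst τ) (σ'.subst τ') (.ty σ ρ) (.ty σ' ρ)))
  /-- `(σ ⊗ σ')[ρ⃗] ≡ σ[ρ⃗] ⊗ σ'[ρ⃗]`. -/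
  | tyTensor {n k : ℕ} {Γ : List (S.Ty n)} {Θ : List (RelDecl S n)} {Φ : List (Form S n)}
      {ρ : Fin k → Rel S n} {τ τ' : Fin k → S.Ty n} (σ σ' : S.Ty k) :
      (∀ i, RelOk T true Γ Θ (ρ i) (τ i) (τ' i)) →
      Prf T Γ Θ Φ (Form.relEquiv ((Ty.tensor σ σ').subst τ) ((Ty.tensor σ σ').subst τ')
        (.ty (Ty.tensor σ σ') ρ)
        (Rel.tensor (σ.subst τ) (σ.subst τ') (σ'.subst τ) (σ'.subst τ') (.ty σ ρ) (.ty σ' ρ)))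
  /-- `I[ρ⃗] ≡ I_Rel`. -/
  | tyOne {n k : ℕ} {Γ : List (S.Ty n)} {Θ : List (RelDecl S n)} {Φ : List (Form S n)}
      {ρ : Fin k → Rel S n} {τ τ' : Fin k → S.Ty n} :
      (∀ i, RelOk T true Γ Θ (ρ i) (τ i) (τ' i)) →
      Prf T Γ Θ Φ (Form.relEquiv Ty.one Ty.one (.ty Ty.one ρ) Rel.one)
  /-- `(Π β. σ)[ρ⃗] ≡ ∀(β, β', R : Adm(β,β')). σ[ρ⃗,R]`. -/
  | tyPi {n k : ℕ} {Γ : List (S.Ty n)} {Θ : List (RelDecl S n)} {Φ : List (Form S n)}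
      {ρ : Fin k → Rel S n} {τ τ' : Fin k → S.Ty n} (σ : S.Ty (k + 1)) :
      (∀ i, RelOk T true Γ Θ (ρ i) (τ i) (τ' i)) →
      Prf T Γ Θ Φ (Form.relEquiv ((Ty.pi σ).subst τ) ((Ty.pi σ).subst τ') (.ty (Ty.pi σ) ρ)
        (Rel.all (σ.subst (Ty.up τ)) (σ.subst (Ty.up τ'))
          (.ty σ (Fin.cases (.var 0) (fun i => (ρ i).wkAll)))))
  /-- `(!σ)[ρ⃗] ≡ !(σ[ρ⃗])`. -/
  | tyBang {n k : ℕ} {Γ : List (S.Ty n)} {Θ : List (RelDecl S n)} {Φ : List (Form S n)}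
      {ρ : Fin k → Rel S n} {τ τ' : Fin k → S.Ty n} (σ : S.Ty k) :
      (∀ i, RelOk T true Γ Θ (ρ i) (τ i) (τ' i)) →
      Prf T Γ Θ Φ (Form.relEquiv ((Ty.bang σ).subst τ) ((Ty.bang σ).subst τ')
        (.ty (Ty.bang σ) ρ) (Rel.bang (σ.subst τ) (σ.subst τ') (.ty σ ρ)))
  /-- `σ[ρ⃗]` depends only on the relations that are assigned to the variables of `σ`, not on
  the kind context in which the type `σ` is considered. -/
  | tyRen {n k l : ℕ} {Γ : List (S.Ty n)} {Θ : List (RelDecl S n)} {Φ : List (Form S n)}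
      {ρ : Fin k → Rel S n} {τ τ' : Fin k → S.Ty n} (σ : S.Ty l) (r : Fin l → Fin k) :
      Function.Injective r → (∀ i, RelOk T true Γ Θ (ρ i) (τ i) (τ' i)) →
      Prf T Γ Θ Φ (Form.relEquiv ((σ.ren r).subst τ) ((σ.ren r).subst τ')
        (.ty (σ.ren r) ρ) (.ty σ (fun i => ρ (r i))))
  /-- The fixed point combinator is related to itself. -/
  | fixRel {n : ℕ} {Γ : List (S.Ty n)} {Θ : List (RelDecl S n)} {Φ : List (Form S n)} :
      Prf T Γ Θ Φ (.rel (.ty (k := 0) fixTy Fin.elim0) Tm.fixY Tm.fixY)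

end

/-- The extensionality schemes are provable: in every context and for all terms `t`, `u`,
`(∀ x:σ. t x = u x) ⊃ t = u` at types `σ ⊸ τ`, and `(∀ α. t α = u α) ⊃ t = u` at types
`Π α. τ`. -/
def Extensionality {S : Signature.{u}} (T : Theory S) : Prop :=
  (∀ (n : ℕ) (Γ : List (S.Ty n)) (Θ : List (RelDecl S n)) (σ τ : S.Ty n) (t u : Tm S n),
    HasTyI Γ t (Ty.lolli σ τ) → HasTyI Γ u (Ty.lolli σ τ) →
    Prf T Γ Θ [] (.imp
      (.allTm σ (.eq τ (.app (t.wk 1) (.var 0)) (.app (u.wk 1) (.var 0))))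
      (.eq (Ty.lolli σ τ) t u))) ∧
  (∀ (n : ℕ) (Γ : List (S.Ty n)) (Θ : List (RelDecl S n)) (τ : S.Ty (n + 1)) (t u : Tm S n),
    HasTyI Γ t (Ty.pi τ) → HasTyI Γ u (Ty.pi τ) →
    Prf T Γ Θ [] (.imp
      (.allTy (.eq τ (.tapp t.wkTy (Ty.var 0)) (.tapp u.wkTy (Ty.var 0))))
      (.eq (Ty.pi τ) t u)))

/-- The identity extension schema is provable:
`∀ α₁ … αₖ. σ[eq_{α₁},…,eq_{αₖ}] ≡ eq_{σ(α₁,…,αₖ)}` for every type `σ`. -/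
def IdentityExtension {S : Signature.{u}} (T : Theory S) : Prop :=
  ∀ (k : ℕ) (σ : S.Ty k),
    Prf T [] [] [] (Form.allTys k
      (Form.relEquiv σ σ (.ty σ (fun i => Rel.eqr (Ty.var i))) (Rel.eqr σ)))

/-! ## Types as functors -/

section Functor

variable {S : Signature.{u}}

/-- The functorial action of a type, by recursion on the type.  Each type variable `i` is sent to
`A i` on the source side and to `B i` on the target side; `F i : A i ⊸ B i` is used at positive
occurrences of `i`, and `G i : B i ⊸ A i` at negative ones.  The result is a map
`σ(A) ⊸ σ(B)`. -/
def act : {n m : ℕ} → LAPL.Ty S.toTySig n → (A B : Fin n → S.Ty m) → (F G : Fin n → Tm S m) →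
    Tm S m
  | _, _, .var i, _, _, F, _ => F i
  | _, _, .con c args, A, _, _, _ => Tm.idm ((Ty.con c args).subst A)
  | _, _, .one, _, _, _, _ => Tm.idm Ty.one
  | _, _, .tensor σ τ, A, B, F, G =>
      Tm.lam ((Ty.tensor σ τ).subst A) (Tm.letTensor (Tm.var 0)
        (Tm.tensor (Tm.app ((act σ A B F G).wk 3) (Tm.var 1))
          (Tm.app ((act τ A B F G).wk 3) (Tm.var 0))))
  | _, _, .lolli σ τ, A, B, F, G =>
      Tm.lam ((Ty.lolli σ τ).subst A) (Tm.lam (σ.subst B)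
        (Tm.app ((act τ A B F G).wk 2)
          (Tm.app (Tm.var 1) (Tm.app ((act σ B A G F).wk 2) (Tm.var 0)))))
  | _, _, .bang σ, A, B, F, G =>
      Tm.lam ((Ty.bang σ).subst A) (Tm.letBang (Tm.var 0)
        (Tm.bang (Tm.app ((act σ A B F G).wk 2) (Tm.var 0))))
  | _, _, .pi σ, A, B, F, G =>
      Tm.lam ((Ty.pi σ).subst A) (Tm.tlam (Tm.app
        ((act σ (Ty.up A) (Ty.up B)
          (Fin.cases (Tm.idm (Ty.var 0)) (fun i => (F i).wkTy))
          (Fin.cases (Tm.idm (Ty.var 0)) (fun i => (G i).wkTy))).wk 1)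
        (Tm.tapp (Tm.var 0) (Ty.var 0))))

/-- For a type `σ` in which the innermost variable occurs only positively, the term
`M_σ : Π α β. (α ⊸ β) → σ(α) ⊸ σ(β)`; the other variables of `σ` are parameters. -/
def functor₁ {n : ℕ} (σ : S.Ty (n + 1)) : Tm S n :=
  Tm.tlam (Tm.tlam (Tm.ilam (Ty.lolli (Ty.var 1) (Ty.var 0))
    (act σ (Ty.cons (Ty.var 1) (fun i => Ty.var i.succ.succ))
      (Ty.cons (Ty.var 0) (fun i => Ty.var i.succ.succ))
      (Fin.cases (Tm.var 0) (fun i => Tm.idm (Ty.var i.succ.succ)))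
      (Fin.cases Tm.star (fun i => Tm.idm (Ty.var i.succ.succ))))))

/-- `σ(g) = M_σ A B !g : σ(A) ⊸ σ(B)` for `g : A ⊸ B`. -/
def map₁ {n : ℕ} (σ : S.Ty (n + 1)) (A B : S.Ty n) (g : Tm S n) : Tm S n :=
  Tm.app (Tm.tapp (Tm.tapp (functor₁ σ) A) B) (Tm.bang g)

/-- `σ(A, B)` for a type `σ(α,β)`, where `β` is the variable `0` and `α` the variable `1`. -/
def ap₂ {n : ℕ} (σ : S.Ty 2) (A B : S.Ty n) : S.Ty n := σ.subst ![B, A]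

/-- For a type `σ(α,β)` in which `α` (the variable `1`) occurs only negatively and `β`
(the variable `0`) only positively, the term
`M_σ : Π α β α' β'. (α' ⊸ α) → (β ⊸ β') → σ(α,β) ⊸ σ(α',β')`.  The components `Tm.star` belong
to positive occurrences of `α` and negative ones of `β` and are not used. -/
def functor₂ {n : ℕ} (σ : S.Ty 2) : Tm S n :=
  Tm.tlam (Tm.tlam (Tm.tlam (Tm.tlam
    (Tm.ilam (Ty.lolli (Ty.var 1) (Ty.var 3)) (Tm.ilam (Ty.lolli (Ty.var 2) (Ty.var 0))
      (act σ ![Ty.var 2, Ty.var 3] ![Ty.var 0, Ty.var 1]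
        ![Tm.var 0, Tm.star] ![Tm.star, Tm.var 1]))))))

/-- `σ(f,g) = M_σ α β α' β' !f !g : σ(α,β) ⊸ σ(α',β')` for `f : α' ⊸ α` and `g : β ⊸ β'`. -/
def map₂ {n : ℕ} (σ : S.Ty 2) (α β α' β' : S.Ty n) (f g : Tm S n) : Tm S n :=
  Tm.app (Tm.app (Tm.tapp (Tm.tapp (Tm.tapp (Tm.tapp (functor₂ σ) α) β) α') β')
    (Tm.bang f)) (Tm.bang g)

/-! ## Initial algebras and final coalgebras -/

/-- `μ α. σ = Π α. (σ ⊸ α) → α`. -/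
def mu {n : ℕ} (σ : S.Ty (n + 1)) : S.Ty n :=
  Ty.pi (Ty.arr (Ty.lolli σ (Ty.var 0)) (Ty.var 0))

/-- `fold = Λ α. λ f : σ(α) ⊸ α. λ° u : μ α. σ. u α !f`. -/
def fold {n : ℕ} (σ : S.Ty (n + 1)) : Tm S n :=
  Tm.tlam (Tm.ilam (Ty.lolli σ (Ty.var 0)) (Tm.lam (mu σ).wk
    (Tm.app (Tm.tapp (Tm.var 0) (Ty.var 0)) (Tm.bang (Tm.var 1)))))

/-- The type `σ` weakened by a new variable placed next to the innermost one. -/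
def wkUnder {n : ℕ} (σ : S.Ty (n + 1)) : S.Ty (n + 2) := σ.ren (upRen Fin.succ)

/-- `in = λ° z. Λ α. λ f : σ(α) ⊸ α. f (σ(fold α !f) z)`, of type `σ(μ α. σ) ⊸ μ α. σ`. -/
def inMap {n : ℕ} (σ : S.Ty (n + 1)) : Tm S n :=
  Tm.lam (σ.inst (mu σ)) (Tm.tlam (Tm.ilam (Ty.lolli σ (Ty.var 0))
    (Tm.app (Tm.var 0)
      (Tm.app
        (map₁ (wkUnder σ) (mu σ).wk (Ty.var 0)
          (Tm.app (Tm.tapp (fold σ).wkTy (Ty.var 0)) (Tm.bang (Tm.var 0))))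
        (Tm.var 1)))))

/-- `∐ α. σ = Π β. (Π α. σ ⊸ β) ⊸ β`. -/
def ex {n : ℕ} (σ : S.Ty (n + 1)) : S.Ty n :=
  Ty.pi (Ty.lolli (Ty.pi (Ty.lolli (wkUnder σ) (Ty.var 1))) (Ty.var 0))

/-- `pack = Λ α. λ° x : σ. Λ β. λ° f : (Π α. σ ⊸ β). f α x`. -/
def pack {n : ℕ} (σ : S.Ty (n + 1)) : Tm S n :=
  Tm.tlam (Tm.lam σ (Tm.tlam (Tm.lam
    (Ty.pi (Ty.lolli (σ.ren (Fin.cases 0 (fun i => i.succ.succ.succ))) (Ty.var 1)))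
    (Tm.app (Tm.tapp (Tm.var 0) (Ty.var 1)) (Tm.var 1)))))

/-- `!(α ⊸ σ(α)) ⊗ α`. -/
def nuBody {n : ℕ} (σ : S.Ty (n + 1)) : S.Ty (n + 1) :=
  Ty.tensor (Ty.bang (Ty.lolli (Ty.var 0) σ)) (Ty.var 0)

/-- `ν α. σ = ∐ α. !(α ⊸ σ(α)) ⊗ α`. -/
def nu {n : ℕ} (σ : S.Ty (n + 1)) : S.Ty n := ex (nuBody σ)

/-- `unfold = Λ α. λ° f : !(α ⊸ σ(α)). λ° x : α. pack α (f ⊗ x)`. -/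
def unfold {n : ℕ} (σ : S.Ty (n + 1)) : Tm S n :=
  Tm.tlam (Tm.lam (Ty.bang (Ty.lolli (Ty.var 0) σ)) (Tm.lam (Ty.var 0)
    (Tm.app (Tm.tapp (pack (nuBody σ)).wkTy (Ty.var 0)) (Tm.tensor (Tm.var 1) (Tm.var 0)))))

/-- `out = λ° x : ν α. σ. x (σ(ν α. σ)) r`, of type `ν α. σ ⊸ σ(ν α. σ)`, where
`r = Λ α. λ° y : !(α ⊸ σ(α)) ⊗ α. let w ⊗ z be y in let !f be w in σ(unfold α !f) (f z)`. -/
def outMap {n : ℕ} (σ : S.Ty (n + 1)) : Tm S n :=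
  Tm.lam (nu σ) (Tm.app (Tm.tapp (Tm.var 0) (σ.inst (nu σ)))
    (Tm.tlam (Tm.lam (nuBody σ) (Tm.letTensor (Tm.var 0) (Tm.letBang (Tm.var 1)
      (Tm.app
        (map₁ (wkUnder σ) (Ty.var 0) (nu σ).wk
          (Tm.app (Tm.tapp (unfold σ).wkTy (Ty.var 0)) (Tm.bang (Tm.var 0))))
        (Tm.app (Tm.var 0) (Tm.var 1))))))))

end Functor

/-! ## Dialgebras -/

/-- Two types and two terms, the data of a dialgebra `(τ, τ', f, f')`. -/
structure DialgData (S : Signature.{u}) (n : ℕ) where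
  pos : S.Ty n
  neg : S.Ty n
  inn : Tm S n
  out : Tm S n

/-- Regard closed data in a kind context of `n` type variables. -/
def DialgData.weaken {S : Signature.{u}} (D : DialgData S 0) (n : ℕ) : DialgData S n :=
  ⟨D.pos.ren Fin.elim0, D.neg.ren Fin.elim0, D.inn.ren Fin.elim0 id, D.out.ren Fin.elim0 id⟩

/-- `(τ, τ', f, f')` is a dialgebra for `σ`: `f : σ(τ',τ) ⊸ τ` and `f' : τ' ⊸ σ(τ,τ')`. -/
def IsDialgebra {S : Signature.{u}} {n : ℕ} (σ : S.Ty 2) (D : DialgData S n) : Prop :=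
  HasTyI [] D.inn (Ty.lolli (ap₂ σ D.neg D.pos) D.pos) ∧
  HasTyI [] D.out (Ty.lolli D.neg (ap₂ σ D.pos D.neg))

/-- `(h, h')` is a morphism of dialgebras from `D` to `E`, up to internal equality:
`h : τ₀ ⊸ τ₁` and `h' : τ₁' ⊸ τ₀'`, with `h ∘ f₀ = f₁ ∘ σ(h',h)` and
`σ(h,h') ∘ f₁' = f₀' ∘ h'` provable. -/
def IsDialgHom {S : Signature.{u}} (T : Theory S) {n : ℕ} (σ : S.Ty 2) (D E : DialgData S n)
    (h h' : Tm S n) : Prop :=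
  HasTyI [] h (Ty.lolli D.pos E.pos) ∧
  HasTyI [] h' (Ty.lolli E.neg D.neg) ∧
  Prf T [] [] [] (.eq (Ty.lolli (ap₂ σ D.neg D.pos) E.pos)
    (Tm.comp (ap₂ σ D.neg D.pos) h D.inn)
    (Tm.comp (ap₂ σ D.neg D.pos) E.inn (map₂ σ D.neg D.pos E.neg E.pos h' h))) ∧
  Prf T [] [] [] (.eq (Ty.lolli E.neg (ap₂ σ D.pos D.neg))
    (Tm.comp E.neg (map₂ σ E.pos E.neg D.pos D.neg h h') E.out)
    (Tm.comp E.neg D.out h'))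

/-- `D` is an initial dialgebra for `σ` up to internal equality, among the dialgebras in the
kind context of `n` type variables. -/
def IsInitialDialgebra {S : Signature.{u}} (T : Theory S) {n : ℕ} (σ : S.Ty 2)
    (D : DialgData S n) : Prop :=
  IsDialgebra σ D ∧
  ∀ E : DialgData S n, IsDialgebra σ E →
    ∃ h h' : Tm S n, IsDialgHom T σ D E h h' ∧
      ∀ k k' : Tm S n, IsDialgHom T σ D E k k' →
        Prf T [] [] [] (.eq (Ty.lolli D.pos E.pos) k h) ∧
        Prf T [] [] [] (.eq (Ty.lolli E.neg D.neg) k' h')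

section Construction

variable {S : Signature.{u}}

/-- `ω(α) = μ β. σ(α,β)`. -/
def omega (σ : S.Ty 2) : S.Ty 1 := mu σ

/-- `σ(ω(α),α)`. -/
def omegaDiag (σ : S.Ty 2) : S.Ty 1 := ap₂ σ (omega σ) (Ty.var 0)

/-- `τ' = ν α. σ(ω(α),α)`. -/
def recNeg (σ : S.Ty 2) : S.Ty 0 := nu (omegaDiag σ)

/-- The quadruple `(ω(τ'), τ', in, out)`, where `in : σ(τ',ω(τ')) ⊸ ω(τ')` is the algebra
structure of `ω(α)` at `α = τ'` and `out : τ' ⊸ σ(ω(τ'),τ')` is the coalgebra structure of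
`τ'`. -/
def recDialgebra (σ : S.Ty 2) : DialgData S 0 where
  pos := (omega σ).inst (recNeg σ)
  neg := recNeg σ
  inn := (inMap σ).instTy (recNeg σ)
  out := outMap (omegaDiag σ)

end Construction

end LAPL

-- The proof has two layers: a reduction of mixed variance to the two pure cases, and a derivation
-- of the pure cases from parametricity.
--
-- The reduction is Freyd's. Suppose that `in` makes μβ.ρ an initial algebra and `out` makes να.ρ a
-- final coalgebra when ρ is positive. Then ω(α) = μβ.σ(α,β) is contravariant in α and `in` is
-- natural (`omegaMap_in`). Hence for f : A ⊸ B and g : σ(A,X) ⊸ X there is exactly one k : ω(B) ⊸ X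
-- with k ∘ in = g ∘ σ(f,k), namely fold X !g ∘ ω(f) (`omegaFold_map_in`, `omega_hom_unique`). Let
-- (X, A, g, g') be a dialgebra. The first equation of a morphism (k,k') says that k is this map for
-- f = k', so k' determines k. With this value of k the second equation says that k' is a coalgebra
-- map for α ↦ σ(ω(α),α), from A with structure σ(fold X !g, A) ∘ g' to the final coalgebra τ'
-- (`negCoalg_map`). So k' exists and is unique, and then so is k.
--
-- The pure cases rest on identity extension: a term is related to itself by the interpretation of
-- its type at equalities, and at a Π-type this may be instantiated at any admissible relation. The
-- relations used are always of the form f x = g y, admissible as reindexings of equality; for g =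
-- id this is the graph of f. What has to be known is that σ[graph of h] is the graph of σ(h). This
-- comes from a single induction on types, `IRel.act`: the functorial action carries related
-- arguments to related results. Together with identity extension it yields functoriality
-- (`fmap_fmap`) and both halves of the graph lemma (`IRel.graphs_intro`, `IRel.graphs_elim`). The
-- relations at ⊗ and ! are defined through impredicative encodings, so introduction and elimination
-- rules are derived for them, and with these it is shown that maps out of !A and A ⊗ A' are
-- determined by their values at !a and a ⊗ a' (`IEq.bang_ext`, `IEq.tensor_ext`).
--
-- For μ, parametricity at the graph of an algebra map h from in to f gives h (u μ !in) = u X !f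
-- (`mu_param`). Taking for h the map fold !f at a variable algebra f, extensionality yields u μ !in
-- = u (`mu_eta`), and therefore h = fold !f (`fold_unique`). For ν, parametricity at the graph of a
-- coalgebra map shows that such maps commute with unfold (`unfold_coalg`); the η-law of existential
-- types (`ex_eta`) shows that the unfolding of out is the identity (`pun_pout`), and uniqueness
-- follows (`unfold_unique`).
--
-- The remainder is syntax: substitution, typing in split linear contexts, and β-computation.

namespace LAPL

variable {S : Signature.{u}}

/-! ## Substitution algebra of types -/

theorem upRen_id {n : ℕ} : upRen (id : Fin n → Fin n) = id := by
  funext i; exact Fin.cases rfl (fun _ => rfl) i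

theorem upRen_comp {n m k : ℕ} (r : Fin n → Fin m) (r' : Fin m → Fin k) :
    upRen r' ∘ upRen r = upRen (r' ∘ r) := by
  funext i; exact Fin.cases rfl (fun _ => rfl) i

theorem upRen_injective {n m : ℕ} {r : Fin n → Fin m} (h : Function.Injective r) :
    Function.Injective (upRen r) := by
  intro i j
  refine Fin.cases ?_ (fun i => ?_) i <;> refine Fin.cases ?_ (fun j => ?_) j
  · simp
  · intro e; exact absurd e.symm (Fin.succ_ne_zero _)
  · intro e; exact absurd e (Fin.succ_ne_zero _)
  · intro e; exact congrArg Fin.succ (h (Fin.succ_injective _ e))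

@[simp] theorem upN_id : upN id = id := by
  funext i; cases i <;> rfl

theorem upN_comp (e e' : ℕ → ℕ) : upN e' ∘ upN e = upN (e' ∘ e) := by
  funext i; cases i <;> rfl

theorem upN_injective {e : ℕ → ℕ} (h : Function.Injective e) : Function.Injective (upN e) := by
  intro i j hij
  cases i <;> cases j <;> simp [upN] at hij ⊢
  exact h hij

namespace Ty

variable {S : TySig.{u}}

theorem ren_id {n : ℕ} (σ : Ty S n) : σ.ren id = σ := by
  induction σ with
  | var i => rfl
  | con c args ih => simp [ren, ih]
  | one => rfl
  | tensor σ τ h₁ h₂ => simp [ren, h₁, h₂]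
  | lolli σ τ h₁ h₂ => simp [ren, h₁, h₂]
  | bang σ h => simp [ren, h]
  | pi σ h => simp [ren, upRen_id, h]

theorem ren_ren {n m k : ℕ} (r : Fin n → Fin m) (r' : Fin m → Fin k) (σ : Ty S n) :
    (σ.ren r).ren r' = σ.ren (r' ∘ r) := by
  induction σ generalizing m k with
  | var i => rfl
  | con c args ih => simp [ren, ih]
  | one => rfl
  | tensor σ τ h₁ h₂ => simp [ren, h₁, h₂]
  | lolli σ τ h₁ h₂ => simp [ren, h₁, h₂]
  | bang σ h => simp [ren, h]
  | pi σ h => simp [ren, upRen_comp, h]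

@[simp] theorem cons_zero {n m : ℕ} (τ : Ty S m) (s : Fin n → Ty S m) : cons τ s 0 = τ := rfl
@[simp] theorem cons_succ {n m : ℕ} (τ : Ty S m) (s : Fin n → Ty S m) (i : Fin n) :
    cons τ s i.succ = s i := rfl

theorem up_comp_upRen {n m k : ℕ} (r : Fin n → Fin m) (s : Fin m → Ty S k) :
    up s ∘ upRen r = up (s ∘ r) := by
  funext i; exact Fin.cases rfl (fun _ => rfl) i

theorem subst_ren {n m k : ℕ} (r : Fin n → Fin m) (s : Fin m → Ty S k) (σ : Ty S n) :
    (σ.ren r).subst s = σ.subst (s ∘ r) := by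
  induction σ generalizing m k with
  | var i => rfl
  | con c args ih => simp [ren, subst, ih]
  | one => rfl
  | tensor σ τ h₁ h₂ => simp [ren, subst, h₁, h₂]
  | lolli σ τ h₁ h₂ => simp [ren, subst, h₁, h₂]
  | bang σ h => simp [ren, subst, h]
  | pi σ h => simp [ren, subst, up_comp_upRen, h]

theorem ren_up {n m k : ℕ} (s : Fin n → Ty S m) (r : Fin m → Fin k) :
    (fun i => (up s i).ren (upRen r)) = up (fun i => (s i).ren r) := by
  funext i
  refine Fin.cases rfl (fun i => ?_) i
  simp only [up, cons_succ, wk, ren_ren]; rfl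

theorem ren_subst {n m k : ℕ} (s : Fin n → Ty S m) (r : Fin m → Fin k) (σ : Ty S n) :
    (σ.subst s).ren r = σ.subst (fun i => (s i).ren r) := by
  induction σ generalizing m k with
  | var i => rfl
  | con c args ih => simp [ren, subst, ih]
  | one => rfl
  | tensor σ τ h₁ h₂ => simp [ren, subst, h₁, h₂]
  | lolli σ τ h₁ h₂ => simp [ren, subst, h₁, h₂]
  | bang σ h => simp [ren, subst, h]
  | pi σ h => simp [ren, subst, ren_up, h]

theorem subst_up {n m k : ℕ} (s : Fin n → Ty S m) (s' : Fin m → Ty S k) :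
    (fun i => (up s i).subst (up s')) = up (fun i => (s i).subst s') := by
  funext i
  refine Fin.cases rfl (fun i => ?_) i
  simp only [up, cons_succ, wk, ren_subst, subst_ren]; rfl

/-- The binder case needs lifted substitutions to compose, and lifting contains a weakening, which
is a renaming. The laws for a renaming before and after a substitution therefore have to be
established first; terms follow the same order. -/
theorem subst_subst {n m k : ℕ} (s : Fin n → Ty S m) (s' : Fin m → Ty S k) (σ : Ty S n) :
    (σ.subst s).subst s' = σ.subst (fun i => (s i).subst s') := by
  induction σ generalizing m k with
  | var i => rfl
  | con c args ih => simp [subst, ih]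
  | one => rfl
  | tensor σ τ h₁ h₂ => simp [subst, h₁, h₂]
  | lolli σ τ h₁ h₂ => simp [subst, h₁, h₂]
  | bang σ h => simp [subst, h]
  | pi σ h => simp [subst, subst_up, h]

theorem up_var {n m : ℕ} (r : Fin n → Fin m) :
    up (fun i => (var (r i) : Ty S m)) = fun i => var (upRen r i) := by
  funext i; exact Fin.cases rfl (fun _ => rfl) i

theorem ren_eq_subst {n m : ℕ} (r : Fin n → Fin m) (σ : Ty S n) :
    σ.ren r = σ.subst (fun i => var (r i)) := by
  induction σ generalizing m with
  | var i => rfl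
  | con c args ih => simp [ren, subst, ih]
  | one => rfl
  | tensor σ τ h₁ h₂ => simp [ren, subst, h₁, h₂]
  | lolli σ τ h₁ h₂ => simp [ren, subst, h₁, h₂]
  | bang σ h => simp [ren, subst, h]
  | pi σ h => simp [ren, subst, up_var, h]

@[simp] theorem subst_var {n : ℕ} (σ : Ty S n) : σ.subst var = σ :=
  (ren_eq_subst id σ).symm.trans (ren_id σ)

theorem wk_subst_cons {n m : ℕ} (τ : Ty S m) (s : Fin n → Ty S m) (σ : Ty S n) :
    σ.wk.subst (cons τ s) = σ.subst s := subst_ren _ _ _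

theorem wk_ren {n m : ℕ} (r : Fin n → Fin m) (σ : Ty S n) :
    σ.wk.ren (upRen r) = (σ.ren r).wk := by
  simp only [wk, ren_ren]; rfl

theorem wk_subst_up {n m : ℕ} (s : Fin n → Ty S m) (σ : Ty S n) :
    σ.wk.subst (up s) = (σ.subst s).wk := by
  simp only [wk, subst_ren, ren_subst]; rfl

theorem inst_ren {n m : ℕ} (r : Fin n → Fin m) (σ : Ty S (n + 1)) (τ : Ty S n) :
    (σ.inst τ).ren r = (σ.ren (upRen r)).inst (τ.ren r) := by
  simp only [inst, ren_subst, subst_ren]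
  congr 1; funext i; exact Fin.cases rfl (fun _ => rfl) i

theorem subst_up_inst {n m : ℕ} (s : Fin n → Ty S m) (σ : Ty S (n + 1)) (τ : Ty S m) :
    (σ.subst (up s)).inst τ = σ.subst (cons τ s) := by
  simp only [inst, subst_subst]
  congr 1; funext i
  refine Fin.cases rfl (fun i => ?_) i
  simp [up, wk_subst_cons]

theorem inst_subst {n m : ℕ} (s : Fin n → Ty S m) (σ : Ty S (n + 1)) (τ : Ty S n) :
    (σ.inst τ).subst s = (σ.subst (up s)).inst (τ.subst s) := by
  rw [subst_up_inst, inst, subst_subst]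
  congr 1; funext i; exact Fin.cases rfl (fun _ => rfl) i

/-- A substitution instance depends only on the variables that occur. -/
theorem subst_congr_occ {n m : ℕ} {s s' : Fin n → Ty S m} {σ : Ty S n}
    (h : ∀ i p, σ.Occ p i → s i = s' i) : σ.subst s = σ.subst s' := by
  induction σ generalizing m with
  | var i => exact h i true ⟨rfl, rfl⟩
  | con c args ih =>
      simp only [subst]; congr 1; funext k
      exact ih k (fun i p hp => h i p ⟨k, p, hp⟩)
  | one => rfl
  | tensor σ τ h₁ h₂ =>
      simp only [subst]
      rw [h₁ (fun i p hp => h i p (Or.inl hp)), h₂ (fun i p hp => h i p (Or.inr hp))]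
  | lolli σ τ h₁ h₂ =>
      simp only [subst]
      rw [h₁ (fun i p hp => h i (!p) (Or.inl (by simpa using hp))),
        h₂ (fun i p hp => h i p (Or.inr hp))]
  | bang σ ih => simp only [subst]; rw [ih (fun i p hp => h i p hp)]
  | pi σ ih =>
      simp only [subst]
      rw [ih (s := up s) (s' := up s')]
      intro i p
      refine Fin.cases (fun _ => rfl) (fun i hp => ?_) i
      simp [up, h i p hp]

/-- Occurrences in a substitution instance come from occurrences in the substituted types. -/
theorem Occ.of_subst {n m : ℕ} {s : Fin n → Ty S m} {σ : Ty S n} {p : Bool} {i : Fin m}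
    (h : (σ.subst s).Occ p i) :
    ∃ j, (σ.Occ true j ∧ (s j).Occ p i) ∨ (σ.Occ false j ∧ (s j).Occ (!p) i) := by
  induction σ generalizing m p with
  | var j => exact ⟨j, Or.inl ⟨⟨rfl, rfl⟩, h⟩⟩
  | con c args ih =>
      obtain ⟨k, q, hq⟩ := h
      obtain ⟨j, hj⟩ := ih k hq
      refine ⟨j, ?_⟩
      -- An occurrence below a type constant counts with both signs. Whatever sign `q'` the
      -- occurrence of `i` in `s j` has, the sign of `j` can be chosen so that the product is `p`.
      have key : ∀ q', (∃ q₀, (args k).Occ q₀ j) → (s j).Occ q' i →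
          ((Ty.con c args).Occ true j ∧ (s j).Occ p i) ∨
            ((Ty.con c args).Occ false j ∧ (s j).Occ (!p) i) := by
        rintro q' ⟨q₀, h₀⟩ h'
        by_cases e : q' = p
        · subst e; exact Or.inl ⟨⟨k, q₀, h₀⟩, h'⟩
        · have : q' = !p := by cases q' <;> cases p <;> simp_all
          subst this; exact Or.inr ⟨⟨k, q₀, h₀⟩, h'⟩
      rcases hj with ⟨a, b⟩ | ⟨a, b⟩
      · exact key _ ⟨_, a⟩ b
      · exact key _ ⟨_, a⟩ b
  | one => exact h.elim
  | tensor σ τ h₁ h₂ =>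
      rcases h with h | h
      · obtain ⟨j, hj⟩ := h₁ h
        exact ⟨j, hj.imp (fun x => ⟨Or.inl x.1, x.2⟩) (fun x => ⟨Or.inl x.1, x.2⟩)⟩
      · obtain ⟨j, hj⟩ := h₂ h
        exact ⟨j, hj.imp (fun x => ⟨Or.inr x.1, x.2⟩) (fun x => ⟨Or.inr x.1, x.2⟩)⟩
  | lolli σ τ h₁ h₂ =>
      rcases h with h | h
      · obtain ⟨j, hj⟩ := h₁ h
        rw [Bool.not_not] at hj
        exact ⟨j, hj.symm.imp (fun x => ⟨Or.inl x.1, x.2⟩) (fun x => ⟨Or.inl x.1, x.2⟩)⟩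
      · obtain ⟨j, hj⟩ := h₂ h
        exact ⟨j, hj.imp (fun x => ⟨Or.inr x.1, x.2⟩) (fun x => ⟨Or.inr x.1, x.2⟩)⟩
  | bang σ ih => exact ih h
  | pi σ ih =>
      obtain ⟨j, hj⟩ := ih (s := up s) h
      revert hj
      refine Fin.cases (fun hj => ?_) (fun j hj => ⟨j, ?_⟩) j
      · rcases hj with ⟨_, _, b⟩ | ⟨_, _, b⟩ <;> exact absurd b (Fin.succ_ne_zero _)
      -- Under the binder the substituted type is weakened, so an occurrence has to be pulled back
      -- along an injective renaming.
      · have wkOcc : ∀ {l : ℕ} (τ : Ty S l) {l' : ℕ} (r : Fin l → Fin l')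
            (_ : Function.Injective r) (q : Bool) (a : Fin l),
            (τ.ren r).Occ q (r a) → τ.Occ q a := by
          intro l τ
          induction τ with
          | var b => intro l' r hr q a hq; exact ⟨hq.1, hr hq.2⟩
          | con c args ih => intro l' r hr q a ⟨k, q', h⟩; exact ⟨k, q', ih k r hr _ _ h⟩
          | one => intro l' r hr q a hq; exact hq
          | tensor σ τ h₁ h₂ =>
              intro l' r hr q a hq; exact hq.imp (h₁ r hr _ _) (h₂ r hr _ _)
          | lolli σ τ h₁ h₂ =>
              intro l' r hr q a hq; exact hq.imp (h₁ r hr _ _) (h₂ r hr _ _)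
          | bang σ ih => intro l' r hr q a hq; exact ih r hr q a hq
          | pi σ ih =>
              intro l' r hr q a hq; exact ih (upRen r) (upRen_injective hr) q a.succ hq
        exact hj.imp (fun x => ⟨x.1, wkOcc _ _ (Fin.succ_injective _) _ _ x.2⟩)
          (fun x => ⟨x.1, wkOcc _ _ (Fin.succ_injective _) _ _ x.2⟩)

end Ty

/-! ## Substitution algebra of terms -/

@[simp] theorem scons_zero {A : Type u} (a : A) (f : ℕ → A) : scons a f 0 = a := rfl
@[simp] theorem scons_succ {A : Type u} (a : A) (f : ℕ → A) (i : ℕ) : scons a f (i + 1) = f i := rfl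

namespace Tm

theorem ren_id {n : ℕ} (t : Tm S n) : t.ren id id = t := by
  induction t <;> simp_all [ren, Ty.ren_id, upRen_id]

theorem ren_ren {n m k : ℕ} (r : Fin n → Fin m) (e : ℕ → ℕ) (r' : Fin m → Fin k) (e' : ℕ → ℕ)
    (t : Tm S n) : (t.ren r e).ren r' e' = t.ren (r' ∘ r) (e' ∘ e) := by
  induction t generalizing m k e e' <;> simp_all [ren, Ty.ren_ren, upRen_comp, upN_comp]

theorem up_comp_upN {n : ℕ} (e : ℕ → ℕ) (f : ℕ → Tm S n) : up f ∘ upN e = up (f ∘ e) := by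
  funext i; cases i <;> rfl

theorem subst_ren {n m k : ℕ} (r : Fin n → Fin m) (e : ℕ → ℕ) (s : Fin m → S.Ty k)
    (f : ℕ → Tm S k) (t : Tm S n) :
    (t.ren r e).subst s f = t.subst (s ∘ r) (f ∘ e) := by
  induction t generalizing m k e f with
  | tlam t ih => simp only [ren, subst, ih, Ty.up_comp_upRen]; rfl
  | _ => simp_all [ren, subst, Ty.subst_ren, up_comp_upN]

theorem ren_up {n m : ℕ} (f : ℕ → Tm S n) (r : Fin n → Fin m) (e : ℕ → ℕ) :
    (fun i => (up f i).ren r (upN e)) = up (fun i => (f i).ren r e) := by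
  funext i
  cases i
  · rfl
  · simp only [up, scons_succ, wk, ren_ren]; rfl

theorem ren_wkTy {n m : ℕ} (r : Fin n → Fin m) (e : ℕ → ℕ) (t : Tm S n) :
    t.wkTy.ren (upRen r) e = (t.ren r e).wkTy := by
  simp only [wkTy, ren_ren]; rfl

theorem ren_subst {n m k : ℕ} (s : Fin n → S.Ty m) (f : ℕ → Tm S m) (r : Fin m → Fin k)
    (e : ℕ → ℕ) (t : Tm S n) :
    (t.subst s f).ren r e = t.subst (fun i => (s i).ren r) (fun i => (f i).ren r e) := by
  induction t generalizing m k e f with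
  | tlam t ih => simp only [ren, subst, ih, Ty.ren_up, ren_wkTy]
  | _ => simp_all [ren, subst, Ty.ren_subst, ren_up]

theorem subst_up {n m : ℕ} (f : ℕ → Tm S n) (s : Fin n → S.Ty m) (f' : ℕ → Tm S m) :
    (fun i => (up f i).subst s (up f')) = up (fun i => (f i).subst s f') := by
  funext i
  cases i
  · rfl
  · simp only [up, scons_succ, wk, ren_subst, subst_ren, Ty.ren_id]; rfl

theorem wkTy_subst_up {n m : ℕ} (s : Fin n → S.Ty m) (f : ℕ → Tm S m) (t : Tm S n) :
    t.wkTy.subst (Ty.up s) (fun i => (f i).wkTy) = (t.subst s f).wkTy := by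
  simp only [wkTy, ren_subst, subst_ren]; rfl

theorem subst_subst {n m k : ℕ} (s : Fin n → S.Ty m) (f : ℕ → Tm S m) (s' : Fin m → S.Ty k)
    (f' : ℕ → Tm S k) (t : Tm S n) :
    (t.subst s f).subst s' f' =
      t.subst (fun i => (s i).subst s') (fun i => (f i).subst s' f') := by
  induction t generalizing m k f f' with
  | tlam t ih => simp only [subst, ih, Ty.subst_up, wkTy_subst_up]
  | _ => simp_all [subst, Ty.subst_subst, subst_up]

theorem up_var {n : ℕ} (e : ℕ → ℕ) :
    up (fun i => (var (e i) : Tm S n)) = fun i => var (upN e i) := by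
  funext i; cases i <;> rfl

theorem ren_eq_subst {n m : ℕ} (r : Fin n → Fin m) (e : ℕ → ℕ) (t : Tm S n) :
    t.ren r e = t.subst (fun i => Ty.var (r i)) (fun i => var (e i)) := by
  induction t generalizing m e with
  | tlam t ih => simp only [ren, subst, ih, Ty.up_var, wkTy]; rfl
  | _ => simp_all [ren, subst, Ty.ren_eq_subst, up_var]

@[simp] theorem subst_var {n : ℕ} (t : Tm S n) : t.subst Ty.var var = t :=
  (ren_eq_subst id id t).symm.trans (ren_id t)

theorem wk_wk {n : ℕ} (k l : ℕ) (t : Tm S n) : (t.wk k).wk l = t.wk (k + l) := by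
  simp only [wk, ren_ren]
  congr 1; funext i; simp [Nat.add_assoc]

theorem wk_subst_up {n m : ℕ} (s : Fin n → S.Ty m) (f : ℕ → Tm S m) (t : Tm S n) :
    (t.wk 1).subst s (up f) = (t.subst s f).wk 1 := by
  simp only [wk, ren_subst, subst_ren, Ty.ren_id]; rfl

theorem wk_ren_upN {n m : ℕ} (r : Fin n → Fin m) (e : ℕ → ℕ) (t : Tm S n) :
    (t.wk 1).ren r (upN e) = (t.ren r e).wk 1 := by
  simp only [wk, ren_ren]; rfl

theorem wk_inst {n : ℕ} (t u : Tm S n) : (t.wk 1).inst u = t := by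
  simp only [wk, inst, subst_ren]; exact subst_var t

theorem wkTy_instTy {n : ℕ} (t : Tm S n) (σ : S.Ty n) : t.wkTy.instTy σ = t := by
  simp only [wkTy, instTy, subst_ren]; exact subst_var t

theorem wk_wkTy {n : ℕ} (k : ℕ) (t : Tm S n) : (t.wk k).wkTy = t.wkTy.wk k := by
  simp only [wk, wkTy, ren_ren]; rfl

end Tm

/-! ## Substitution algebra of propositions and relations -/

section FormAlgebra

mutual

theorem Form.ren_id : ∀ {n : ℕ} (φ : Form S n), φ.ren id id id = φ
  | _, .eq σ t u => by simp [Form.ren, Ty.ren_id, Tm.ren_id]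
  | _, .rel ρ t u => by simp [Form.ren, Tm.ren_id, Rel.ren_id ρ]
  | _, .imp φ ψ => by simp [Form.ren, Form.ren_id φ, Form.ren_id ψ]
  | _, .bot => rfl
  | _, .top => rfl
  | _, .and φ ψ => by simp [Form.ren, Form.ren_id φ, Form.ren_id ψ]
  | _, .or φ ψ => by simp [Form.ren, Form.ren_id φ, Form.ren_id ψ]
  | _, .allTy φ => by simp [Form.ren, upRen_id, Form.ren_id φ]
  | _, .allTm σ φ => by simp [Form.ren, Ty.ren_id, Form.ren_id φ]
  | _, .allRel b σ τ φ => by simp [Form.ren, Ty.ren_id, Form.ren_id φ]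
  | _, .exTy φ => by simp [Form.ren, upRen_id, Form.ren_id φ]
  | _, .exTm σ φ => by simp [Form.ren, Ty.ren_id, Form.ren_id φ]
  | _, .exRel b σ τ φ => by simp [Form.ren, Ty.ren_id, Form.ren_id φ]

theorem Rel.ren_id : ∀ {n : ℕ} (ρ : Rel S n), ρ.ren id id id = ρ
  | _, .var i => rfl
  | _, .abs σ τ φ => by simp [Rel.ren, Ty.ren_id, Form.ren_id φ]
  | _, .ty σ ρ => by simp only [Rel.ren]; congr 1; funext i; exact Rel.ren_id (ρ i)

end

mutual

theorem Form.ren_ren : ∀ {n m k : ℕ} (r : Fin n → Fin m) (e q : ℕ → ℕ) (r' : Fin m → Fin k)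
    (e' q' : ℕ → ℕ) (φ : Form S n),
    (φ.ren r e q).ren r' e' q' = φ.ren (r' ∘ r) (e' ∘ e) (q' ∘ q)
  | _, _, _, r, e, q, r', e', q', .eq σ t u => by simp [Form.ren, Ty.ren_ren, Tm.ren_ren]
  | _, _, _, r, e, q, r', e', q', .rel ρ t u => by
      simp [Form.ren, Tm.ren_ren, Rel.ren_ren r e q r' e' q' ρ]
  | _, _, _, r, e, q, r', e', q', .imp φ ψ => by
      simp [Form.ren, Form.ren_ren r e q r' e' q' φ, Form.ren_ren r e q r' e' q' ψ]
  | _, _, _, _, _, _, _, _, _, .bot => rfl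
  | _, _, _, _, _, _, _, _, _, .top => rfl
  | _, _, _, r, e, q, r', e', q', .and φ ψ => by
      simp [Form.ren, Form.ren_ren r e q r' e' q' φ, Form.ren_ren r e q r' e' q' ψ]
  | _, _, _, r, e, q, r', e', q', .or φ ψ => by
      simp [Form.ren, Form.ren_ren r e q r' e' q' φ, Form.ren_ren r e q r' e' q' ψ]
  | _, _, _, r, e, q, r', e', q', .allTy φ => by
      simp [Form.ren, upRen_comp, Form.ren_ren (upRen r) e q (upRen r') e' q' φ]
  | _, _, _, r, e, q, r', e', q', .allTm σ φ => by
      simp [Form.ren, Ty.ren_ren, upN_comp, Form.ren_ren r (upN e) q r' (upN e') q' φ]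
  | _, _, _, r, e, q, r', e', q', .allRel b σ τ φ => by
      simp [Form.ren, Ty.ren_ren, upN_comp, Form.ren_ren r e (upN q) r' e' (upN q') φ]
  | _, _, _, r, e, q, r', e', q', .exTy φ => by
      simp [Form.ren, upRen_comp, Form.ren_ren (upRen r) e q (upRen r') e' q' φ]
  | _, _, _, r, e, q, r', e', q', .exTm σ φ => by
      simp [Form.ren, Ty.ren_ren, upN_comp, Form.ren_ren r (upN e) q r' (upN e') q' φ]
  | _, _, _, r, e, q, r', e', q', .exRel b σ τ φ => by
      simp [Form.ren, Ty.ren_ren, upN_comp, Form.ren_ren r e (upN q) r' e' (upN q') φ]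

theorem Rel.ren_ren : ∀ {n m k : ℕ} (r : Fin n → Fin m) (e q : ℕ → ℕ) (r' : Fin m → Fin k)
    (e' q' : ℕ → ℕ) (ρ : Rel S n),
    (ρ.ren r e q).ren r' e' q' = ρ.ren (r' ∘ r) (e' ∘ e) (q' ∘ q)
  | _, _, _, _, _, _, _, _, _, .var i => rfl
  | _, _, _, r, e, q, r', e', q', .abs σ τ φ => by
      simp [Rel.ren, Ty.ren_ren, upN_comp,
        Form.ren_ren r (upN (upN e)) q r' (upN (upN e')) q' φ]
  | _, _, _, r, e, q, r', e', q', .ty σ ρ => by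
      simp only [Rel.ren]; congr 1; funext i; exact Rel.ren_ren r e q r' e' q' (ρ i)

end

theorem Rel.up_comp_upN {n : ℕ} (q : ℕ → ℕ) (g : ℕ → Rel S n) :
    Rel.up g ∘ upN q = Rel.up (g ∘ q) := by
  funext i; cases i <;> rfl

mutual

theorem Form.subst_ren : ∀ {n m k : ℕ} (r : Fin n → Fin m) (e q : ℕ → ℕ) (s : Fin m → S.Ty k)
    (f : ℕ → Tm S k) (g : ℕ → Rel S k) (φ : Form S n),
    (φ.ren r e q).subst s f g = φ.subst (s ∘ r) (f ∘ e) (g ∘ q)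
  | _, _, _, r, e, q, s, f, g, .eq σ t u => by
      simp [Form.ren, Form.subst, Ty.subst_ren, Tm.subst_ren]
  | _, _, _, r, e, q, s, f, g, .rel ρ t u => by
      simp [Form.ren, Form.subst, Tm.subst_ren, Rel.subst_ren r e q s f g ρ]
  | _, _, _, r, e, q, s, f, g, .imp φ ψ => by
      simp [Form.ren, Form.subst, Form.subst_ren r e q s f g φ, Form.subst_ren r e q s f g ψ]
  | _, _, _, _, _, _, _, _, _, .bot => rfl
  | _, _, _, _, _, _, _, _, _, .top => rfl
  | _, _, _, r, e, q, s, f, g, .and φ ψ => by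
      simp [Form.ren, Form.subst, Form.subst_ren r e q s f g φ, Form.subst_ren r e q s f g ψ]
  | _, _, _, r, e, q, s, f, g, .or φ ψ => by
      simp [Form.ren, Form.subst, Form.subst_ren r e q s f g φ, Form.subst_ren r e q s f g ψ]
  | _, _, _, r, e, q, s, f, g, .allTy φ => by
      simp only [Form.ren, Form.subst, Form.subst_ren (upRen r) e q, Ty.up_comp_upRen]; rfl
  | _, _, _, r, e, q, s, f, g, .allTm σ φ => by
      simp only [Form.ren, Form.subst, Ty.subst_ren, Form.subst_ren r (upN e) q,
        Tm.up_comp_upN]; rfl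
  | _, _, _, r, e, q, s, f, g, .allRel b σ τ φ => by
      simp only [Form.ren, Form.subst, Ty.subst_ren, Form.subst_ren r e (upN q),
        Rel.up_comp_upN]
  | _, _, _, r, e, q, s, f, g, .exTy φ => by
      simp only [Form.ren, Form.subst, Form.subst_ren (upRen r) e q, Ty.up_comp_upRen]; rfl
  | _, _, _, r, e, q, s, f, g, .exTm σ φ => by
      simp only [Form.ren, Form.subst, Ty.subst_ren, Form.subst_ren r (upN e) q,
        Tm.up_comp_upN]; rfl
  | _, _, _, r, e, q, s, f, g, .exRel b σ τ φ => by
      simp only [Form.ren, Form.subst, Ty.subst_ren, Form.subst_ren r e (upN q),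
        Rel.up_comp_upN]

theorem Rel.subst_ren : ∀ {n m k : ℕ} (r : Fin n → Fin m) (e q : ℕ → ℕ) (s : Fin m → S.Ty k)
    (f : ℕ → Tm S k) (g : ℕ → Rel S k) (ρ : Rel S n),
    (ρ.ren r e q).subst s f g = ρ.subst (s ∘ r) (f ∘ e) (g ∘ q)
  | _, _, _, _, _, _, _, _, _, .var i => rfl
  | _, _, _, r, e, q, s, f, g, .abs σ τ φ => by
      simp only [Rel.ren, Rel.subst, Ty.subst_ren, Form.subst_ren r (upN (upN e)) q,
        Tm.up_comp_upN]; rfl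
  | _, _, _, r, e, q, s, f, g, .ty σ ρ => by
      simp only [Rel.ren, Rel.subst]; congr 1; funext i
      exact Rel.subst_ren r e q s f g (ρ i)

end

theorem Rel.up_var {n : ℕ} (q : ℕ → ℕ) :
    Rel.up (fun i => (Rel.var (q i) : Rel S n)) = fun i => Rel.var (upN q i) := by
  funext i; cases i <;> rfl

mutual

theorem Form.ren_eq_subst : ∀ {n m : ℕ} (r : Fin n → Fin m) (e q : ℕ → ℕ) (φ : Form S n),
    φ.ren r e q =
      φ.subst (fun i => Ty.var (r i)) (fun i => Tm.var (e i)) (fun i => Rel.var (q i))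
  | _, _, r, e, q, .eq σ t u => by
      simp [Form.ren, Form.subst, Ty.ren_eq_subst, Tm.ren_eq_subst]
  | _, _, r, e, q, .rel ρ t u => by
      simp [Form.ren, Form.subst, Tm.ren_eq_subst, Rel.ren_eq_subst r e q ρ]
  | _, _, r, e, q, .imp φ ψ => by
      simp [Form.ren, Form.subst, Form.ren_eq_subst r e q φ, Form.ren_eq_subst r e q ψ]
  | _, _, _, _, _, .bot => rfl
  | _, _, _, _, _, .top => rfl
  | _, _, r, e, q, .and φ ψ => by
      simp [Form.ren, Form.subst, Form.ren_eq_subst r e q φ, Form.ren_eq_subst r e q ψ]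
  | _, _, r, e, q, .or φ ψ => by
      simp [Form.ren, Form.subst, Form.ren_eq_subst r e q φ, Form.ren_eq_subst r e q ψ]
  | _, _, r, e, q, .allTy φ => by
      simp only [Form.ren, Form.subst, Form.ren_eq_subst (upRen r) e q φ, Ty.up_var]; rfl
  | _, _, r, e, q, .allTm σ φ => by
      simp only [Form.ren, Form.subst, Ty.ren_eq_subst, Form.ren_eq_subst r (upN e) q φ,
        Tm.up_var]; rfl
  | _, _, r, e, q, .allRel b σ τ φ => by
      simp only [Form.ren, Form.subst, Ty.ren_eq_subst, Form.ren_eq_subst r e (upN q) φ,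
        Rel.up_var]
  | _, _, r, e, q, .exTy φ => by
      simp only [Form.ren, Form.subst, Form.ren_eq_subst (upRen r) e q φ, Ty.up_var]; rfl
  | _, _, r, e, q, .exTm σ φ => by
      simp only [Form.ren, Form.subst, Ty.ren_eq_subst, Form.ren_eq_subst r (upN e) q φ,
        Tm.up_var]; rfl
  | _, _, r, e, q, .exRel b σ τ φ => by
      simp only [Form.ren, Form.subst, Ty.ren_eq_subst, Form.ren_eq_subst r e (upN q) φ,
        Rel.up_var]

theorem Rel.ren_eq_subst : ∀ {n m : ℕ} (r : Fin n → Fin m) (e q : ℕ → ℕ) (ρ : Rel S n),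
    ρ.ren r e q =
      ρ.subst (fun i => Ty.var (r i)) (fun i => Tm.var (e i)) (fun i => Rel.var (q i))
  | _, _, _, _, _, .var i => rfl
  | _, _, r, e, q, .abs σ τ φ => by
      simp only [Rel.ren, Rel.subst, Ty.ren_eq_subst, Form.ren_eq_subst r (upN (upN e)) q φ,
        Tm.up_var]; rfl
  | _, _, r, e, q, .ty σ ρ => by
      simp only [Rel.ren, Rel.subst]; congr 1; funext i
      exact Rel.ren_eq_subst r e q (ρ i)

end

@[simp] theorem Form.subst_var {n : ℕ} (φ : Form S n) : φ.subst Ty.var Tm.var Rel.var = φ :=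
  (Form.ren_eq_subst id id id φ).symm.trans (Form.ren_id φ)

@[simp] theorem Rel.subst_var {n : ℕ} (ρ : Rel S n) : ρ.subst Ty.var Tm.var Rel.var = ρ :=
  (Rel.ren_eq_subst id id id ρ).symm.trans (Rel.ren_id ρ)

theorem Rel.wk_wk {n : ℕ} (k l : ℕ) (ρ : Rel S n) : (ρ.wk k).wk l = ρ.wk (k + l) := by
  simp only [Rel.wk, Rel.ren_ren]
  congr 1; funext i; simp [Nat.add_assoc]

end FormAlgebra

/-! ## Typing under renaming and substitution -/

section Typing

variable {S : Signature.{u}}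

-- Lookup, masking and splitting of linear contexts

theorem TCtx.getElem?_wkTy {n : ℕ} (Γ : TCtx S n) (i : ℕ) :
    Γ.wkTy[i]? = Γ[i]?.map (fun p => (p.1, p.2.wk)) := by
  simp [TCtx.wkTy]

theorem TCtx.NoLin.get {n : ℕ} {Γ : TCtx S n} (h : Γ.NoLin) {i : ℕ} {σ : S.Ty n} :
    Γ[i]? ≠ some (Use.lin, σ) := fun e => h _ (List.mem_of_getElem? e) rfl

theorem TCtx.noLin_of_get {n : ℕ} {Γ : TCtx S n} 
    (h : ∀ (i : ℕ) (σ : S.Ty n), Γ[i]? ≠ some (Use.lin, σ)) : Γ.NoLin := by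
  rintro ⟨u, σ⟩ hp rfl
  obtain ⟨i, hi⟩ := List.getElem?_of_mem hp
  exact h i σ hi

/-- Keep the linear variables at the positions selected by `f` and switch off the others. -/
noncomputable def TCtx.mask {n : ℕ} : (ℕ → Prop) → TCtx S n → TCtx S n
  | _, [] => []
  | f, (Use.int, σ) :: Γ => (Use.int, σ) :: TCtx.mask (fun i => f (i + 1)) Γ
  | f, (Use.lin, σ) :: Γ =>
      (open Classical in if f 0 then (Use.lin, σ) else (Use.off, σ)) ::
        TCtx.mask (fun i => f (i + 1)) Γ
  | f, (Use.off, σ) :: Γ => (Use.off, σ) :: TCtx.mask (fun i => f (i + 1)) Γ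

/-- A split assigns every linear variable to one side, so any predicate on positions defines one.
The target splits in the renaming and substitution lemmas are produced in this form. -/
theorem TCtx.split_mask {n : ℕ} (f : ℕ → Prop) (Γ : TCtx S n) :
    Split Γ (Γ.mask f) (Γ.mask (fun i => ¬ f i)) := by
  induction Γ generalizing f with
  | nil => exact .nil
  | cons p Γ ih =>
      obtain ⟨_ | _ | _, σ⟩ := p
      · exact .int σ (ih _)
      · by_cases h : f 0
        · simp only [mask, h, not_true, if_true, if_false]; exact .left σ (ih _)
        · simp only [mask, h, not_false_eq_true, if_true, if_false]; exact .right σ (ih _)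
      · exact .off σ (ih _)

theorem TCtx.getElem?_mask {n : ℕ} (f : ℕ → Prop) (Γ : TCtx S n) (i : ℕ) (σ : S.Ty n) :
    ((Γ.mask f)[i]? = some (Use.int, σ) ↔ Γ[i]? = some (Use.int, σ)) ∧
    ((Γ.mask f)[i]? = some (Use.lin, σ) ↔ Γ[i]? = some (Use.lin, σ) ∧ f i) := by
  induction Γ generalizing f i with
  | nil => simp [mask]
  | cons p Γ ih =>
      obtain ⟨_ | _ | _, τ⟩ := p <;> cases i <;> simp [mask]
      · exact ih _ _
      · by_cases h : f 0 <;> simp [h]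
      · exact ih _ _
      · exact ih _ _

/-- The context with all linear variables switched off. -/
noncomputable def TCtx.unlin {n : ℕ} (Γ : TCtx S n) : TCtx S n := Γ.mask (fun _ => False)

theorem TCtx.unlin_noLin {n : ℕ} (Γ : TCtx S n) : Γ.unlin.NoLin :=
  TCtx.noLin_of_get fun i σ h => (((getElem?_mask _ Γ i σ).2.1 h).2)

theorem TCtx.NoLin.unlin_eq {n : ℕ} {Γ : TCtx S n} (h : Γ.NoLin) : Γ.unlin = Γ := by
  have : ∀ f, Γ.mask f = Γ := by
    induction Γ with
    | nil => intro f; rfl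
    | cons p Γ ih =>
        intro f
        have h' : TCtx.NoLin Γ := fun p hp => h p (List.mem_cons_of_mem _ hp)
        obtain ⟨_ | _ | _, τ⟩ := p
        · simp [mask, ih h']
        · exact absurd rfl (h _ List.mem_cons_self)
        · simp [mask, ih h']
  exact this _

theorem TCtx.mask_unlin {n : ℕ} (f : ℕ → Prop) (Γ : TCtx S n) : (Γ.mask f).unlin = Γ.unlin := by
  have : ∀ f g, (∀ i, ¬ g i) → (Γ.mask f).mask g = Γ.mask g := by
    induction Γ with
    | nil => intro f g _; rfl
    | cons p Γ ih =>
        intro f g hg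
        obtain ⟨_ | _ | _, τ⟩ := p
        · simp [mask, ih _ _ (fun i => hg (i + 1))]
        · by_cases h : f 0 <;> simpa [mask, h, hg] using ih _ _ (fun _ h => h)
        · simp [mask, ih _ _ (fun i => hg (i + 1))]
  exact this _ _ (fun _ h => h)

theorem TCtx.mask_wkTy {n : ℕ} (f : ℕ → Prop) (Γ : TCtx S n) :
    (Γ.mask f).wkTy = Γ.wkTy.mask f := by
  induction Γ generalizing f with
  | nil => rfl
  | cons p Γ ih =>
      obtain ⟨_ | _ | _, τ⟩ := p
      · exact congrArg (List.cons _) (ih _)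
      · by_cases h : f 0 <;> simp only [mask, wkTy, List.map_cons, h, if_true, if_false] <;>
          exact congrArg (List.cons _) (ih _)
      · exact congrArg (List.cons _) (ih _)

/-- A split read off position by position; the last clause is the disjointness of the two linear
parts. -/
theorem Split.get {n : ℕ} {Γ Γ₁ Γ₂ : TCtx S n} (h : Split Γ Γ₁ Γ₂) (i : ℕ) (σ : S.Ty n) :
    (Γ₁[i]? = some (Use.int, σ) ↔ Γ[i]? = some (Use.int, σ)) ∧
    (Γ₂[i]? = some (Use.int, σ) ↔ Γ[i]? = some (Use.int, σ)) ∧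
    (Γ[i]? = some (Use.lin, σ) ↔ Γ₁[i]? = some (Use.lin, σ) ∨ Γ₂[i]? = some (Use.lin, σ)) ∧
    (∀ τ : S.Ty n, Γ₁[i]? = some (Use.lin, σ) → Γ₂[i]? ≠ some (Use.lin, τ)) := by
  induction h generalizing i with
  | nil => simp
  | int _ _ ih | left _ _ ih | right _ _ ih | off _ _ ih =>
      cases i <;> simp <;> exact ih _

/-- A renaming of type variables by `r` and of term variables by an injective `e` that is
typed and bijective on the linear variables. -/
structure RenOk {n m : ℕ} (r : Fin n → Fin m) (e : ℕ → ℕ) (Γ : TCtx S n) (Γ' : TCtx S m) :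
    Prop where
  inj : Function.Injective e
  int : ∀ (i : ℕ) (σ : S.Ty n), Γ[i]? = some (Use.int, σ) → Γ'[e i]? = some (Use.int, σ.ren r)
  lin : ∀ (i : ℕ) (σ : S.Ty n), Γ[i]? = some (Use.lin, σ) → Γ'[e i]? = some (Use.lin, σ.ren r)
  surj : ∀ (j : ℕ) (σ' : S.Ty m), Γ'[j]? = some (Use.lin, σ') → ∃ i : ℕ, ∃ σ : S.Ty n, e i = j ∧ Γ[i]? = some (Use.lin, σ)

namespace RenOk

variable {n m : ℕ} {r : Fin n → Fin m} {e : ℕ → ℕ} {Γ : TCtx S n} {Γ' : TCtx S m}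

theorem noLin (h : RenOk r e Γ Γ') (hΓ : Γ.NoLin) : Γ'.NoLin :=
  TCtx.noLin_of_get fun _ _ hj =>
    let ⟨_, _, _, hi⟩ := h.surj _ _ hj; hΓ.get hi

theorem cons (h : RenOk r e Γ Γ') (u : Use) (σ : S.Ty n) :
    RenOk r (upN e) ((u, σ) :: Γ) ((u, σ.ren r) :: Γ') where
  inj := upN_injective h.inj
  int := by
    rintro (_ | i) τ hi
    · simp at hi; simp [upN, hi.1, hi.2]
    · exact h.int i τ hi
  lin := by
    rintro (_ | i) τ hi
    · simp at hi; simp [upN, hi.1, hi.2]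
    · exact h.lin i τ hi
  surj := by
    rintro (_ | j) τ hj
    · simp at hj; exact ⟨0, σ, rfl, by simp [hj.1]⟩
    · obtain ⟨i, τ', rfl, hi⟩ := h.surj j τ hj
      exact ⟨i + 1, τ', rfl, hi⟩

theorem wkTy (h : RenOk r e Γ Γ') : RenOk (upRen r) e Γ.wkTy Γ'.wkTy where
  inj := h.inj
  int := by
    intro i τ hi
    rw [TCtx.getElem?_wkTy, Option.map_eq_some_iff] at hi
    obtain ⟨⟨u, σ⟩, hi, hp⟩ := hi
    simp only [Prod.mk.injEq] at hp
    obtain ⟨rfl, rfl⟩ := hp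
    rw [TCtx.getElem?_wkTy, h.int i σ hi, Ty.wk_ren]; rfl
  lin := by
    intro i τ hi
    rw [TCtx.getElem?_wkTy, Option.map_eq_some_iff] at hi
    obtain ⟨⟨u, σ⟩, hi, hp⟩ := hi
    simp only [Prod.mk.injEq] at hp
    obtain ⟨rfl, rfl⟩ := hp
    rw [TCtx.getElem?_wkTy, h.lin i σ hi, Ty.wk_ren]; rfl
  surj := by
    intro j τ hj
    rw [TCtx.getElem?_wkTy, Option.map_eq_some_iff] at hj
    obtain ⟨⟨u, σ⟩, hj, hp⟩ := hj
    simp only [Prod.mk.injEq] at hp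
    obtain ⟨rfl, rfl⟩ := hp
    obtain ⟨i, σ', rfl, hi⟩ := h.surj j σ hj
    exact ⟨i, σ'.wk, rfl, by rw [TCtx.getElem?_wkTy, hi]; rfl⟩

/-- The target is split along the image of the linear variables of `Γ₁`. Injectivity of `e` keeps
the image of `Γ₂` outside this set, and surjectivity on linear variables puts everything outside it
into the image of `Γ₂`. -/
theorem split (h : RenOk r e Γ Γ') {Γ₁ Γ₂ : TCtx S n} (hs : Split Γ Γ₁ Γ₂) :
    ∃ Γ₁' Γ₂', Split Γ' Γ₁' Γ₂' ∧ RenOk r e Γ₁ Γ₁' ∧ RenOk r e Γ₂ Γ₂' := by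
  let f : ℕ → Prop := fun j => ∃ i : ℕ, ∃ σ : S.Ty n, e i = j ∧ Γ₁[i]? = some (Use.lin, σ)
  refine ⟨Γ'.mask f, Γ'.mask (fun j => ¬ f j), TCtx.split_mask f Γ', ⟨h.inj, ?_, ?_, ?_⟩,
    ⟨h.inj, ?_, ?_, ?_⟩⟩
  · intro i σ hi
    exact (TCtx.getElem?_mask _ _ _ _).1.2 (h.int i σ ((hs.get i σ).1.1 hi))
  · intro i σ hi
    exact (TCtx.getElem?_mask _ _ _ _).2.2
      ⟨h.lin i σ ((hs.get i σ).2.2.1.2 (Or.inl hi)), i, σ, rfl, hi⟩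
  · intro j σ' hj
    obtain ⟨_, i, σ, rfl, hi⟩ := (TCtx.getElem?_mask _ _ _ _).2.1 hj
    exact ⟨i, σ, rfl, hi⟩
  · intro i σ hi
    exact (TCtx.getElem?_mask _ _ _ _).1.2 (h.int i σ ((hs.get i σ).2.1.1 hi))
  · intro i σ hi
    refine (TCtx.getElem?_mask _ _ _ _).2.2
      ⟨h.lin i σ ((hs.get i σ).2.2.1.2 (Or.inr hi)), ?_⟩
    rintro ⟨i', σ', he, hi'⟩
    obtain rfl := h.inj he
    exact (hs.get i' σ').2.2.2 σ hi' hi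
  · intro j σ' hj
    obtain ⟨hj, hf⟩ := (TCtx.getElem?_mask _ _ _ _).2.1 hj
    obtain ⟨i, σ, rfl, hi⟩ := h.surj j σ' hj
    refine ⟨i, σ, rfl, ?_⟩
    rcases (hs.get i σ).2.2.1.1 hi with h1 | h2
    · exact absurd ⟨i, σ, rfl, h1⟩ hf
    · exact h2

end RenOk

theorem HasTy.ren {n m : ℕ} {r : Fin n → Fin m} {e : ℕ → ℕ} {Γ : TCtx S n} {Γ' : TCtx S m}
    {t : Tm S n} {σ : S.Ty n} (ht : HasTy Γ t σ) (h : RenOk r e Γ Γ') :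
    HasTy Γ' (t.ren r e) (σ.ren r) := by
  induction ht generalizing m e with
  | ivar hi hl => exact .ivar (h.int _ _ hi) (h.noLin hl)
  | lvar hi hl =>
      refine .lvar (h.lin _ _ hi) ?_
      rintro j ⟨_, σ'⟩ hj rfl
      obtain ⟨i', σ, rfl, hi'⟩ := h.surj j σ' hj
      rw [hl i' _ hi' rfl]
  | con c hl =>
      rw [Ty.ren_ren, show r ∘ Fin.elim0 = Fin.elim0 from funext (fun i => i.elim0)]
      exact .con c (h.noLin hl)
  | star hl => exact .star (h.noLin hl)
  | fixY hl => exact .fixY (h.noLin hl)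
  | lam _ ih => exact .lam (ih (h.cons _ _))
  | app hs _ _ ih₁ ih₂ =>
      obtain ⟨_, _, hs', h₁, h₂⟩ := h.split hs
      exact .app hs' (ih₁ h₁) (ih₂ h₂)
  | tensor hs _ _ ih₁ ih₂ =>
      obtain ⟨_, _, hs', h₁, h₂⟩ := h.split hs
      exact .tensor hs' (ih₁ h₁) (ih₂ h₂)
  | bang hl _ ih => exact .bang (h.noLin hl) (ih h)
  | tlam _ ih => exact .tlam (ih h.wkTy)
  | tapp τ _ ih => rw [Ty.inst_ren]; exact .tapp _ (ih h)
  | letTensor hs _ _ ih₁ ih₂ =>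
      obtain ⟨_, _, hs', h₁, h₂⟩ := h.split hs
      exact .letTensor hs' (ih₁ h₁) (ih₂ ((h₂.cons _ _).cons _ _))
  | letBang hs _ _ ih₁ ih₂ =>
      obtain ⟨_, _, hs', h₁, h₂⟩ := h.split hs
      exact .letBang hs' (ih₁ h₁) (ih₂ (h₂.cons _ _))
  | letStar hs _ _ ih₁ ih₂ =>
      obtain ⟨_, _, hs', h₁, h₂⟩ := h.split hs
      exact .letStar hs' (ih₁ h₁) (ih₂ h₂)

/-- A substitution in which every linear variable is either kept in place or replaced, like the
intuitionistic variables, by a term without linear variables. -/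
structure SubOk {n m : ℕ} (s : Fin n → S.Ty m) (e : ℕ → Tm S m) (Γ : TCtx S n) (Γ' : TCtx S m) :
    Prop where
  int : ∀ (i : ℕ) (σ : S.Ty n), Γ[i]? = some (Use.int, σ) → HasTy Γ'.unlin (e i) (σ.subst s)
  lin : ∀ (i : ℕ) (σ : S.Ty n), Γ[i]? = some (Use.lin, σ) →
    (e i = Tm.var i ∧ Γ'[i]? = some (Use.lin, σ.subst s)) ∨
      ((∀ σ' : S.Ty m, Γ'[i]? ≠ some (Use.lin, σ')) ∧ HasTy Γ'.unlin (e i) (σ.subst s))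
  surj : ∀ (i : ℕ) (σ' : S.Ty m), Γ'[i]? = some (Use.lin, σ') → ∃ σ : S.Ty n, Γ[i]? = some (Use.lin, σ)

namespace SubOk

variable {n m : ℕ} {s : Fin n → S.Ty m} {e : ℕ → Tm S m} {Γ : TCtx S n} {Γ' : TCtx S m}

theorem noLin (h : SubOk s e Γ Γ') (hΓ : Γ.NoLin) : Γ'.NoLin :=
  TCtx.noLin_of_get fun _ _ hj => let ⟨_, hi⟩ := h.surj _ _ hj; hΓ.get hi

theorem _root_.LAPL.RenOk.shift {n : ℕ} {Γ : TCtx S n} (hΓ : Γ.NoLin) {u : Use}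
    (hu : u ≠ Use.lin) (σ : S.Ty n) :
    RenOk id (· + 1) Γ ((u, σ) :: Γ) where
  inj := fun _ _ h => Nat.succ_injective h
  int := fun i σ h => by simpa [Ty.ren_id] using h
  lin := fun i σ h => absurd h hΓ.get
  surj := by
    rintro (_ | j) σ' h
    · simp at h; exact absurd h.1 hu
    · exact absurd h hΓ.get

/-- After the linear variables are switched off, the head of the context is `int` or `off`, so a
term may be weakened past it however the variable was declared. -/
theorem wk_unlin {t : Tm S m} {τ : S.Ty m} (ht : HasTy Γ'.unlin t τ) (u : Use) (σ : S.Ty m) :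
    HasTy (TCtx.unlin ((u, σ) :: Γ')) (t.wk 1) τ := by
  have key : ∃ u', u' ≠ Use.lin ∧ TCtx.unlin ((u, σ) :: Γ') = (u', σ) :: Γ'.unlin := by
    cases u
    · exact ⟨Use.int, by simp, rfl⟩
    · exact ⟨Use.off, by simp, by simp [TCtx.unlin, TCtx.mask]⟩
    · exact ⟨Use.off, by simp, rfl⟩
  obtain ⟨u', hu, h⟩ := key
  rw [h]
  have := ht.ren (RenOk.shift (TCtx.unlin_noLin _) hu σ)
  rwa [Ty.ren_id] at this

theorem cons (h : SubOk s e Γ Γ') {u : Use} (σ : S.Ty n) :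
    SubOk s (Tm.up e) ((u, σ) :: Γ) ((u, σ.subst s) :: Γ') where
  int := by
    rintro (_ | i) τ hi
    · simp at hi
      obtain ⟨rfl, rfl⟩ := hi
      exact .ivar rfl (TCtx.unlin_noLin _)
    · exact wk_unlin (h.int i τ hi) _ _
  lin := by
    rintro (_ | i) τ hi
    · simp at hi
      obtain ⟨rfl, rfl⟩ := hi
      exact Or.inl ⟨rfl, rfl⟩
    · rcases h.lin i τ hi with ⟨h₁, h₂⟩ | ⟨h₁, h₂⟩
      · refine Or.inl ⟨?_, h₂⟩
        simp [Tm.up, h₁, Tm.wk, Tm.ren]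
      · exact Or.inr ⟨h₁, wk_unlin h₂ _ _⟩
  surj := by
    rintro (_ | i) τ hi
    · simp at hi; exact ⟨σ, by simp [hi.1]⟩
    · exact h.surj i τ hi

theorem _root_.LAPL.RenOk.wkTyShift {n : ℕ} {Γ : TCtx S n} : RenOk Fin.succ id Γ Γ.wkTy where
  inj := Function.injective_id
  int := fun i σ h => by rw [TCtx.getElem?_wkTy]; simp [h, Ty.wk]
  lin := fun i σ h => by rw [TCtx.getElem?_wkTy]; simp [h, Ty.wk]
  surj := by
    intro j τ hj
    rw [TCtx.getElem?_wkTy, Option.map_eq_some_iff] at hj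
    obtain ⟨⟨u, σ⟩, hj, hp⟩ := hj
    simp only [Prod.mk.injEq] at hp
    obtain ⟨rfl, rfl⟩ := hp
    exact ⟨j, σ, rfl, hj⟩

theorem wkTy (h : SubOk s e Γ Γ') :
    SubOk (Ty.up s) (fun i => (e i).wkTy) Γ.wkTy Γ'.wkTy where
  int := by
    intro i τ hi
    rw [TCtx.getElem?_wkTy, Option.map_eq_some_iff] at hi
    obtain ⟨⟨u, σ⟩, hi, hp⟩ := hi
    simp only [Prod.mk.injEq] at hp
    obtain ⟨rfl, rfl⟩ := hp
    rw [TCtx.unlin, ← TCtx.mask_wkTy, Ty.wk_subst_up]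
    exact (h.int i σ hi).ren RenOk.wkTyShift
  lin := by
    intro i τ hi
    rw [TCtx.getElem?_wkTy, Option.map_eq_some_iff] at hi
    obtain ⟨⟨u, σ⟩, hi, hp⟩ := hi
    simp only [Prod.mk.injEq] at hp
    obtain ⟨rfl, rfl⟩ := hp
    rcases h.lin i σ hi with ⟨h₁, h₂⟩ | ⟨h₁, h₂⟩
    · refine Or.inl ⟨by rw [h₁]; rfl, ?_⟩
      rw [TCtx.getElem?_wkTy, h₂, Ty.wk_subst_up]; rfl
    · refine Or.inr ⟨?_, ?_⟩
      · intro σ' h'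
        rw [TCtx.getElem?_wkTy, Option.map_eq_some_iff] at h'
        obtain ⟨⟨u, σ⟩, h', hp⟩ := h'
        simp only [Prod.mk.injEq] at hp
        obtain ⟨rfl, rfl⟩ := hp
        exact h₁ _ h'
      · rw [TCtx.unlin, ← TCtx.mask_wkTy, Ty.wk_subst_up]
        exact h₂.ren RenOk.wkTyShift
  surj := by
    intro j τ hj
    rw [TCtx.getElem?_wkTy, Option.map_eq_some_iff] at hj
    obtain ⟨⟨u, σ⟩, hj, hp⟩ := hj
    simp only [Prod.mk.injEq] at hp
    obtain ⟨rfl, rfl⟩ := hp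
    obtain ⟨σ', hi⟩ := h.surj j σ hj
    exact ⟨σ'.wk, by rw [TCtx.getElem?_wkTy, hi]; rfl⟩

/-- The terms put in place of variables live in `Γ'.unlin`, which a mask does not change, so they
are available on both sides of a split. Only the linear variables that are kept have to be
distributed. -/
theorem of_mask {Γ₁ : TCtx S n} {f : ℕ → Prop} (h : SubOk s e Γ Γ')
    (hint : ∀ (i : ℕ) (σ : S.Ty n), Γ₁[i]? = some (Use.int, σ) → Γ[i]? = some (Use.int, σ))
    (hlin : ∀ (i : ℕ) (σ : S.Ty n), Γ₁[i]? = some (Use.lin, σ) → Γ[i]? = some (Use.lin, σ) ∧ f i)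
    (hsurj : ∀ (i : ℕ) (σ : S.Ty n), Γ[i]? = some (Use.lin, σ) → f i → Γ₁[i]? = some (Use.lin, σ)) :
    SubOk s e Γ₁ (Γ'.mask f) where
  int := fun i σ hi => by rw [TCtx.mask_unlin]; exact h.int i σ (hint i σ hi)
  lin := fun i σ hi => by
    obtain ⟨hi, hf⟩ := hlin i σ hi
    rw [TCtx.mask_unlin]
    refine (h.lin i σ hi).imp (fun x => ⟨x.1, (TCtx.getElem?_mask _ _ _ _).2.2 ⟨x.2, hf⟩⟩)
      (fun x => ⟨fun σ' hσ' => x.1 σ' ((TCtx.getElem?_mask _ _ _ _).2.1 hσ').1, x.2⟩)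
  surj := fun i σ' hi => by
    obtain ⟨hi, hf⟩ := (TCtx.getElem?_mask _ _ _ _).2.1 hi
    obtain ⟨σ, hσ⟩ := h.surj i σ' hi
    exact ⟨σ, hsurj i σ hσ hf⟩

theorem split (h : SubOk s e Γ Γ') {Γ₁ Γ₂ : TCtx S n} (hs : Split Γ Γ₁ Γ₂) :
    ∃ Γ₁' Γ₂', Split Γ' Γ₁' Γ₂' ∧ SubOk s e Γ₁ Γ₁' ∧ SubOk s e Γ₂ Γ₂' := by
  let f : ℕ → Prop := fun j => ∃ σ : S.Ty n, Γ₁[j]? = some (Use.lin, σ)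
  refine ⟨_, _, TCtx.split_mask f Γ', h.of_mask ?_ ?_ ?_, h.of_mask ?_ ?_ ?_⟩
  · exact fun i σ hi => (hs.get i σ).1.1 hi
  · exact fun i σ hi => ⟨(hs.get i σ).2.2.1.2 (Or.inl hi), σ, hi⟩
  · rintro i σ hi ⟨τ, hτ⟩
    rcases (hs.get i σ).2.2.1.1 hi with h1 | h2
    · exact h1
    · exact absurd h2 ((hs.get i τ).2.2.2 σ hτ)
  · exact fun i σ hi => (hs.get i σ).2.1.1 hi
  · refine fun i σ hi => ⟨(hs.get i σ).2.2.1.2 (Or.inr hi), ?_⟩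
    rintro ⟨τ, hτ⟩
    exact (hs.get i τ).2.2.2 σ hτ hi
  · intro i σ hi hf
    rcases (hs.get i σ).2.2.1.1 hi with h1 | h2
    · exact absurd ⟨σ, h1⟩ hf
    · exact h2

end SubOk

theorem HasTy.subst {n m : ℕ} {s : Fin n → S.Ty m} {e : ℕ → Tm S m} {Γ : TCtx S n}
    {Γ' : TCtx S m} {t : Tm S n} {σ : S.Ty n} (ht : HasTy Γ t σ) (h : SubOk s e Γ Γ') :
    HasTy Γ' (t.subst s e) (σ.subst s) := by
  induction ht generalizing m with
  | ivar hi hl =>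
      have := h.int _ _ hi
      rwa [(h.noLin hl).unlin_eq] at this
  | @lvar n Γ i σ hi hl =>
      rcases h.lin _ _ hi with ⟨h₁, h₂⟩ | ⟨h₁, h₂⟩
      · simp only [Tm.subst, h₁]
        refine .lvar h₂ ?_
        rintro j ⟨_, σ'⟩ hj rfl
        obtain ⟨σ, hσ⟩ := h.surj j σ' hj
        exact hl j _ hσ rfl
      -- The single linear variable is replaced by a term without linear variables. Every linear
      -- variable of `Γ'` would sit at the same position, so there is none.
      · have : Γ'.NoLin := by
          refine TCtx.noLin_of_get fun j σ' hj => ?_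
          obtain ⟨σ, hσ⟩ := h.surj j σ' hj
          obtain rfl := hl j _ hσ rfl
          exact h₁ _ hj
        rwa [this.unlin_eq] at h₂
  | con c hl =>
      have := HasTy.con c (h.noLin hl)
      rw [Ty.ren_eq_subst] at this
      rw [Ty.subst_ren, show s ∘ Fin.elim0 = fun i => Ty.var (Fin.elim0 i) from
        funext (fun i => i.elim0)]
      exact this
  | star hl => exact .star (h.noLin hl)
  | fixY hl => exact .fixY (h.noLin hl)
  | lam _ ih => exact .lam (ih (h.cons _))
  | app hs _ _ ih₁ ih₂ =>
      obtain ⟨_, _, hs', h₁, h₂⟩ := h.split hs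
      exact .app hs' (ih₁ h₁) (ih₂ h₂)
  | tensor hs _ _ ih₁ ih₂ =>
      obtain ⟨_, _, hs', h₁, h₂⟩ := h.split hs
      exact .tensor hs' (ih₁ h₁) (ih₂ h₂)
  | bang hl _ ih => exact .bang (h.noLin hl) (ih h)
  | tlam _ ih => exact .tlam (ih h.wkTy)
  | tapp τ _ ih => rw [Ty.inst_subst]; exact .tapp _ (ih h)
  | letTensor hs _ _ ih₁ ih₂ =>
      obtain ⟨_, _, hs', h₁, h₂⟩ := h.split hs
      exact .letTensor hs' (ih₁ h₁) (ih₂ ((h₂.cons _).cons _))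
  | letBang hs _ _ ih₁ ih₂ =>
      obtain ⟨_, _, hs', h₁, h₂⟩ := h.split hs
      exact .letBang hs' (ih₁ h₁) (ih₂ (h₂.cons _))
  | letStar hs _ _ ih₁ ih₂ =>
      obtain ⟨_, _, hs', h₁, h₂⟩ := h.split hs
      exact .letStar hs' (ih₁ h₁) (ih₂ h₂)

end Typing

/-! ## Typing and external equality in intuitionistic contexts -/

/-- The intuitionistic context with the given types. -/
abbrev intCtx {n : ℕ} (Γ : List (S.Ty n)) : TCtx S n := Γ.map (fun τ => (Use.int, τ))

theorem intCtx_noLin {n : ℕ} (Γ : List (S.Ty n)) : (intCtx Γ).NoLin := by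
  rintro p hp
  obtain ⟨τ, _, rfl⟩ := List.mem_map.1 hp
  simp

theorem TCtx.NoLin.split_self {n : ℕ} {Γ : TCtx S n} (h : Γ.NoLin) : Split Γ Γ Γ := by
  induction Γ with
  | nil => exact .nil
  | cons p Γ ih =>
      have h' : TCtx.NoLin Γ := fun p hp => h p (List.mem_cons_of_mem _ hp)
      obtain ⟨_ | _ | _, τ⟩ := p
      · exact .int _ (ih h')
      · exact absurd rfl (h _ List.mem_cons_self)
      · exact .off _ (ih h')

theorem intCtx_split {n : ℕ} (Γ : List (S.Ty n)) : Split (intCtx Γ) (intCtx Γ) (intCtx Γ) :=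
  (intCtx_noLin Γ).split_self

theorem intCtx_wkTy {n : ℕ} (Γ : List (S.Ty n)) :
    (intCtx Γ).wkTy = intCtx (Γ.map Ty.wk) := by
  simp [TCtx.wkTy, intCtx]

theorem intCtx_get {n : ℕ} {Γ : List (S.Ty n)} {i : ℕ} {u : Use} {σ : S.Ty n} :
    (intCtx Γ)[i]? = some (u, σ) ↔ u = Use.int ∧ Γ[i]? = some σ := by
  simp only [intCtx, List.getElem?_map, Option.map_eq_some_iff, Prod.mk.injEq]
  constructor
  · rintro ⟨_, h, rfl, rfl⟩; exact ⟨rfl, h⟩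
  · rintro ⟨rfl, h⟩; exact ⟨σ, h, rfl, rfl⟩

-- Typing rules in contexts without linear variables, where every split is trivial

namespace HasTyI

variable {n : ℕ} {Γ : List (S.Ty n)}

theorem var {i : ℕ} {σ : S.Ty n} (h : Γ[i]? = some σ) : HasTyI Γ (Tm.var i) σ :=
  .ivar (intCtx_get.2 ⟨rfl, h⟩) (intCtx_noLin Γ)

theorem app {σ τ : S.Ty n} {t u : Tm S n} (ht : HasTyI Γ t (Ty.lolli σ τ)) (hu : HasTyI Γ u σ) :
    HasTyI Γ (Tm.app t u) τ := HasTy.app (intCtx_split Γ) ht hu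

theorem tensor {σ τ : S.Ty n} {t u : Tm S n} (ht : HasTyI Γ t σ) (hu : HasTyI Γ u τ) :
    HasTyI Γ (Tm.tensor t u) (Ty.tensor σ τ) := HasTy.tensor (intCtx_split Γ) ht hu

theorem bang {σ : S.Ty n} {t : Tm S n} (ht : HasTyI Γ t σ) :
    HasTyI Γ (Tm.bang t) (Ty.bang σ) := HasTy.bang (intCtx_noLin Γ) ht

theorem tapp {σ : S.Ty (n + 1)} {t : Tm S n} (ht : HasTyI Γ t (Ty.pi σ)) (τ : S.Ty n) :
    HasTyI Γ (Tm.tapp t τ) (σ.inst τ) := HasTy.tapp τ ht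

theorem tlam {σ : S.Ty (n + 1)} {t : Tm S (n + 1)} (ht : HasTyI (Γ.map Ty.wk) t σ) :
    HasTyI Γ (Tm.tlam t) (Ty.pi σ) :=
  HasTy.tlam (by rw [intCtx_wkTy]; exact ht)

theorem subst {m : ℕ} {Γ' : List (S.Ty m)} {s : Fin n → S.Ty m} {e : ℕ → Tm S m} {t : Tm S n}
    {σ : S.Ty n} (ht : HasTyI Γ t σ)
    (h : ∀ i τ, Γ[i]? = some τ → HasTyI Γ' (e i) (τ.subst s)) :
    HasTyI Γ' (t.subst s e) (σ.subst s) := by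
  refine HasTy.subst ht ⟨fun i τ hi => ?_, fun i τ hi => ?_, fun i τ hi => ?_⟩
  · rw [(intCtx_noLin Γ').unlin_eq]; exact h i τ (intCtx_get.1 hi).2
  · cases (intCtx_get.1 hi).1
  · cases (intCtx_get.1 hi).1

theorem ren {m : ℕ} {Γ' : List (S.Ty m)} {r : Fin n → Fin m} {e : ℕ → ℕ} {t : Tm S n}
    {σ : S.Ty n} (ht : HasTyI Γ t σ)
    (h : ∀ i τ, Γ[i]? = some τ → Γ'[e i]? = some (τ.ren r)) :
    HasTyI Γ' (t.ren r e) (σ.ren r) := by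
  rw [Tm.ren_eq_subst, Ty.ren_eq_subst]
  exact ht.subst fun i τ hi => by rw [← Ty.ren_eq_subst]; exact var (h i τ hi)

theorem wk {t : Tm S n} {σ : S.Ty n} (ht : HasTyI Γ t σ) (Δ : List (S.Ty n)) {k : ℕ}
    (hk : Δ.length = k := by rfl) : HasTyI (Δ ++ Γ) (t.wk k) σ := by
  have := ht.ren (Γ' := Δ ++ Γ) (r := id) (e := (· + k)) (fun i τ hi => by
    rw [List.getElem?_append_right (by omega), Ty.ren_id, ← hk, Nat.add_sub_cancel]; exact hi)
  rwa [Ty.ren_id] at this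

theorem wk1 {t : Tm S n} {σ : S.Ty n} (ht : HasTyI Γ t σ) {A : S.Ty n} :
    HasTyI (A :: Γ) (t.wk 1) σ := ht.wk [A]

theorem wk2 {t : Tm S n} {σ : S.Ty n} (ht : HasTyI Γ t σ) {A B : S.Ty n} :
    HasTyI (A :: B :: Γ) (t.wk 2) σ := ht.wk [A, B]

theorem wkTy {t : Tm S n} {σ : S.Ty n} (ht : HasTyI Γ t σ) :
    HasTyI (Γ.map Ty.wk) t.wkTy σ.wk :=
  ht.ren (fun i τ hi => by simp [hi, Ty.wk])

/-- Weakening by variables that are not used. -/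
theorem off {t : Tm S n} {σ : S.Ty n} (ht : HasTyI Γ t σ) (Δ : TCtx S n) (hΔ : Δ.NoLin) {k : ℕ}
    (hk : Δ.length = k := by rfl) : HasTy (Δ ++ intCtx Γ) (t.wk k) σ := by
  have := HasTy.ren (r := id) (e := (· + k)) (Γ' := Δ ++ intCtx Γ) ht
    ⟨fun _ _ h => Nat.add_right_cancel h, fun i σ hi => ?_, fun i σ hi => ?_, fun i σ hi => ?_⟩
  · rwa [Ty.ren_id] at this
  · rw [List.getElem?_append_right (by omega), Ty.ren_id, ← hk, Nat.add_sub_cancel]; exact hi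
  · cases (intCtx_get.1 hi).1
  · exact absurd hi (TCtx.NoLin.get (fun p hp => (List.mem_append.1 hp).elim (hΔ p)
      (intCtx_noLin Γ p)))

theorem off1 {t : Tm S n} {σ : S.Ty n} (ht : HasTyI Γ t σ) {u : Use} (hu : u ≠ Use.lin)
    {A : S.Ty n} : HasTy ((u, A) :: intCtx Γ) (t.wk 1) σ :=
  ht.off [(u, A)] (by simpa [TCtx.NoLin] using hu)

theorem off2 {t : Tm S n} {σ : S.Ty n} (ht : HasTyI Γ t σ) {u v : Use} (hu : u ≠ Use.lin)
    (hv : v ≠ Use.lin) {A B : S.Ty n} : HasTy ((u, A) :: (v, B) :: intCtx Γ) (t.wk 2) σ :=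
  ht.off [(u, A), (v, B)] (by simpa [TCtx.NoLin] using ⟨hu, hv⟩)

theorem off3 {t : Tm S n} {σ : S.Ty n} (ht : HasTyI Γ t σ) {u v w : Use} (hu : u ≠ Use.lin)
    (hv : v ≠ Use.lin) (hw : w ≠ Use.lin) {A B C : S.Ty n} :
    HasTy ((u, A) :: (v, B) :: (w, C) :: intCtx Γ) (t.wk 3) σ :=
  ht.off [(u, A), (v, B), (w, C)] (by simpa [TCtx.NoLin] using ⟨hu, hv, hw⟩)

/-- A closed term has its type in every context. -/
theorem closed {t : Tm S n} {σ : S.Ty n} (ht : HasTyI [] t σ) (Γ : List (S.Ty n)) :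
    HasTyI Γ t σ := by
  have := ht.subst (Γ' := Γ) (s := Ty.var) (e := Tm.var) (fun i τ hi => by simp at hi)
  simpa using this

end HasTyI

theorem HasTy.lvar0 {n : ℕ} {Γ : TCtx S n} {σ : S.Ty n} (h : Γ.NoLin) :
    HasTy ((Use.lin, σ) :: Γ) (Tm.var 0) σ :=
  .lvar rfl fun j p hj hp => by
    cases j
    · rfl
    · exact absurd hp (h p (List.mem_of_getElem? hj))

/-- Typing of a term with a linear variable that is substituted by an intuitionistic term. -/
theorem HasTy.inst_lin {n : ℕ} {Γ : List (S.Ty n)} {σ τ : S.Ty n} {t u : Tm S n}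
    (ht : HasTy ((Use.lin, σ) :: intCtx Γ) t τ) (hu : HasTyI Γ u σ) : HasTyI Γ (t.inst u) τ := by
  have := HasTy.subst (s := Ty.var) (e := scons u Tm.var) (Γ' := intCtx Γ) ht ⟨?_, ?_, ?_⟩
  · rwa [Ty.subst_var] at this
  · rintro (_ | i) τ hi
    · simp at hi
    · rw [(intCtx_noLin Γ).unlin_eq, Ty.subst_var]
      exact HasTyI.var (intCtx_get.1 hi).2
  · rintro (_ | i) τ hi
    · simp at hi
      subst hi
      refine Or.inr ⟨fun σ' h => absurd h (intCtx_noLin Γ).get, ?_⟩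
      rw [(intCtx_noLin Γ).unlin_eq, Ty.subst_var]; exact hu
    · cases (intCtx_get.1 hi).1
  · exact fun i σ' h => absurd h (intCtx_noLin Γ).get

theorem HasTy.inst2_lin {n : ℕ} {Γ : List (S.Ty n)} {σ σ' τ : S.Ty n} {t s u : Tm S n}
    (ht : HasTy ((Use.lin, σ') :: (Use.lin, σ) :: intCtx Γ) t τ) (hs : HasTyI Γ s σ)
    (hu : HasTyI Γ u σ') : HasTyI Γ (t.inst2 s u) τ := by
  have := HasTy.subst (s := Ty.var) (e := scons u (scons s Tm.var)) (Γ' := intCtx Γ) ht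
    ⟨?_, ?_, ?_⟩
  · rwa [Ty.subst_var] at this
  · rintro (_ | _ | i) τ hi
    · simp at hi
    · simp at hi
    · rw [(intCtx_noLin Γ).unlin_eq, Ty.subst_var]
      exact HasTyI.var (intCtx_get.1 hi).2
  · rintro (_ | _ | i) τ hi
    · simp at hi
      subst hi
      refine Or.inr ⟨fun σ' h => absurd h (intCtx_noLin Γ).get, ?_⟩
      rw [(intCtx_noLin Γ).unlin_eq, Ty.subst_var]; exact hu
    · simp at hi
      subst hi
      refine Or.inr ⟨fun σ' h => absurd h (intCtx_noLin Γ).get, ?_⟩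
      rw [(intCtx_noLin Γ).unlin_eq, Ty.subst_var]; exact hs
    · cases (intCtx_get.1 hi).1
  · exact fun i σ' h => absurd h (intCtx_noLin Γ).get

theorem HasTyI.inst {n : ℕ} {Γ : List (S.Ty n)} {σ τ : S.Ty n} {t u : Tm S n}
    (ht : HasTyI (σ :: Γ) t τ) (hu : HasTyI Γ u σ) : HasTyI Γ (t.inst u) τ := by
  have := ht.subst (s := Ty.var) (e := scons u Tm.var) (Γ' := Γ) ?_
  · rwa [Ty.subst_var] at this
  · rintro (_ | i) τ hi
    · simp at hi; subst hi; rw [Ty.subst_var]; exact hu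
    · rw [Ty.subst_var]; exact .var hi

theorem HasTyI.inst2 {n : ℕ} {Γ : List (S.Ty n)} {σ σ' τ : S.Ty n} {t s u : Tm S n}
    (ht : HasTyI (σ' :: σ :: Γ) t τ) (hs : HasTyI Γ s σ) (hu : HasTyI Γ u σ') :
    HasTyI Γ (t.inst2 s u) τ := by
  have := ht.subst (s := Ty.var) (e := scons u (scons s Tm.var)) (Γ' := Γ) ?_
  · rwa [Ty.subst_var] at this
  · rintro (_ | _ | i) τ hi
    · simp at hi; subst hi; rw [Ty.subst_var]; exact hu
    · simp at hi; subst hi; rw [Ty.subst_var]; exact hs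
    · rw [Ty.subst_var]; exact .var hi

theorem HasTyI.instTy {n : ℕ} {Γ : List (S.Ty n)} {τ : S.Ty (n + 1)} {t : Tm S (n + 1)}
    (ht : HasTyI (Γ.map Ty.wk) t τ) (A : S.Ty n) : HasTyI Γ (t.instTy A) (τ.inst A) := by
  refine ht.subst (s := Ty.cons A Ty.var) (e := Tm.var) (Γ' := Γ) ?_
  intro i τ hi
  rw [List.getElem?_map, Option.map_eq_some_iff] at hi
  obtain ⟨σ, hi, rfl⟩ := hi
  rw [Ty.wk_subst_cons, Ty.subst_var]; exact .var hi

/-- The basic equations are typed on both sides and the congruences preserve this, so an equation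
also supplies the typing of the next term in a chain of reductions. -/
theorem ExtEq.hasTy {n : ℕ} {Γ : TCtx S n} {t u : Tm S n} {σ : S.Ty n} (h : ExtEq Γ t u σ) :
    HasTy Γ t σ ∧ HasTy Γ u σ := by
  induction h with
  | step h₁ h₂ _ => exact ⟨h₁, h₂⟩
  | refl h => exact ⟨h, h⟩
  | symm _ ih => exact ih.symm
  | trans _ _ h₁ h₂ => exact ⟨h₁.1, h₂.2⟩
  | lam _ ih => exact ⟨.lam ih.1, .lam ih.2⟩
  | app hs _ _ h₁ h₂ => exact ⟨.app hs h₁.1 h₂.1, .app hs h₁.2 h₂.2⟩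
  | tensor hs _ _ h₁ h₂ => exact ⟨.tensor hs h₁.1 h₂.1, .tensor hs h₁.2 h₂.2⟩
  | bang hl _ ih => exact ⟨.bang hl ih.1, .bang hl ih.2⟩
  | tlam _ ih => exact ⟨.tlam ih.1, .tlam ih.2⟩
  | tapp τ _ ih => exact ⟨.tapp τ ih.1, .tapp τ ih.2⟩
  | letTensor hs _ _ h₁ h₂ => exact ⟨.letTensor hs h₁.1 h₂.1, .letTensor hs h₁.2 h₂.2⟩
  | letBang hs _ _ h₁ h₂ => exact ⟨.letBang hs h₁.1 h₂.1, .letBang hs h₁.2 h₂.2⟩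
  | letStar hs _ _ h₁ h₂ => exact ⟨.letStar hs h₁.1 h₂.1, .letStar hs h₁.2 h₂.2⟩

-- Congruence and β-rules of external equality in intuitionistic contexts

namespace ExtEqI

variable {n : ℕ} {Γ : List (S.Ty n)}

theorem app {σ τ : S.Ty n} {t t' u u' : Tm S n} (h₁ : ExtEqI Γ t t' (Ty.lolli σ τ))
    (h₂ : ExtEqI Γ u u' σ) : ExtEqI Γ (Tm.app t u) (Tm.app t' u') τ :=
  ExtEq.app (intCtx_split Γ) h₁ h₂

theorem tapp {σ : S.Ty (n + 1)} {t t' : Tm S n} (h : ExtEqI Γ t t' (Ty.pi σ)) (A : S.Ty n) :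
    ExtEqI Γ (Tm.tapp t A) (Tm.tapp t' A) (σ.inst A) := ExtEq.tapp A h

theorem beta {σ τ : S.Ty n} {t u : Tm S n} (ht : HasTy ((Use.lin, σ) :: intCtx Γ) t τ)
    (hu : HasTyI Γ u σ) : ExtEqI Γ (Tm.app (Tm.lam σ t) u) (t.inst u) τ :=
  ExtEq.step (.app (intCtx_split Γ) (.lam ht) hu) (ht.inst_lin hu) (.betaLam _ _ _)

theorem betaT {τ : S.Ty (n + 1)} {t : Tm S (n + 1)} (ht : HasTyI (Γ.map Ty.wk) t τ)
    (A : S.Ty n) : ExtEqI Γ (Tm.tapp (Tm.tlam t) A) (t.instTy A) (τ.inst A) :=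
  ExtEq.step ((HasTyI.tlam ht).tapp A) (ht.instTy A) (.betaTLam _ _)

theorem betaBang {σ τ : S.Ty n} {t u : Tm S n} (ht : HasTyI (σ :: Γ) t τ) (hu : HasTyI Γ u σ) :
    ExtEqI Γ (Tm.letBang (Tm.bang u) t) (t.inst u) τ :=
  ExtEq.step (.letBang (intCtx_split Γ) (HasTyI.bang hu) ht) (ht.inst hu) (.betaBang _ _)

theorem betaTensor {σ σ' τ : S.Ty n} {t s u : Tm S n}
    (ht : HasTy ((Use.lin, σ') :: (Use.lin, σ) :: intCtx Γ) t τ) (hs : HasTyI Γ s σ)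
    (hu : HasTyI Γ u σ') : ExtEqI Γ (Tm.letTensor (Tm.tensor s u) t) (t.inst2 s u) τ :=
  ExtEq.step (.letTensor (intCtx_split Γ) (HasTyI.tensor hs hu) ht) (ht.inst2_lin hs hu)
    (.betaTensor _ _ _)

end ExtEqI

/-- Typing of an intuitionistic abstraction. -/
theorem HasTy.ilam {n : ℕ} {Γ : TCtx S n} {σ τ : S.Ty n} {t : Tm S n}
    (ht : HasTy ((Use.int, σ) :: Γ) t τ) : HasTy Γ (Tm.ilam σ t) (Ty.arr σ τ) := by
  -- The scrutinee of the `let` uses only the bound variable of type `!σ`, so all linear variables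
  -- of `Γ` go to the body.
  have hs : ∀ Γ : TCtx S n, Split Γ Γ.unlin Γ := by
    intro Γ
    induction Γ with
    | nil => exact .nil
    | cons p Γ ih =>
        obtain ⟨_ | _ | _, τ⟩ := p
        · exact .int _ ih
        · have := Split.right τ ih
          simpa [TCtx.unlin, TCtx.mask] using this
        · exact .off _ ih
  refine .lam (.letBang (.left _ (hs Γ)) (.lvar0 (TCtx.unlin_noLin Γ)) ?_)
  have := ht.ren (r := id) (e := upN Nat.succ)
    (Γ' := (Use.int, σ) :: (Use.off, Ty.bang σ) :: Γ) ?_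
  · rwa [Ty.ren_id] at this
  · have h := RenOk.cons (r := id) (e := Nat.succ) (Γ := Γ)
      (Γ' := (Use.off, Ty.bang σ) :: Γ) ⟨Nat.succ_injective, ?_, ?_, ?_⟩ Use.int σ
    · rwa [Ty.ren_id] at h
    · intro i τ hi; rw [Ty.ren_id]; exact hi
    · intro i τ hi; rw [Ty.ren_id]; exact hi
    · rintro (_ | j) τ hj
      · simp at hj
      · exact ⟨j, τ, rfl, hj⟩

theorem Tm.subst_ilam {n m : ℕ} (s : Fin n → S.Ty m) (f : ℕ → Tm S m) (σ : S.Ty n) (t : Tm S n) :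
    (Tm.ilam σ t).subst s f = Tm.ilam (σ.subst s) (t.subst s (Tm.up f)) := by
  simp only [Tm.ilam, Tm.subst, Tm.subst_ren, Tm.ren_subst, Ty.subst, Ty.ren_id]
  congr 2
  congr 1
  funext i
  cases i
  · rfl
  · simp only [Tm.up, Function.comp, upN, scons_succ, Tm.wk, Tm.ren_ren]; rfl

theorem HasTyI.idm {n : ℕ} {Γ : List (S.Ty n)} (σ : S.Ty n) :
    HasTyI Γ (Tm.idm σ) (Ty.lolli σ σ) := .lam (.lvar0 (intCtx_noLin Γ))

theorem ExtEqI.idm {n : ℕ} {Γ : List (S.Ty n)} {σ : S.Ty n} {u : Tm S n} (hu : HasTyI Γ u σ) :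
    ExtEqI Γ (Tm.app (Tm.idm σ) u) u σ := ExtEqI.beta (.lvar0 (intCtx_noLin Γ)) hu

theorem Tm.subst_idm {n m : ℕ} (s : Fin n → S.Ty m) (f : ℕ → Tm S m) (σ : S.Ty n) :
    (Tm.idm σ).subst s f = Tm.idm (σ.subst s) := rfl

theorem Tm.ren_idm {n m : ℕ} (r : Fin n → Fin m) (e : ℕ → ℕ) (σ : S.Ty n) :
    (Tm.idm σ).ren r e = Tm.idm (σ.ren r) := rfl

theorem Tm.wk_idm {n : ℕ} (k : ℕ) (σ : S.Ty n) : (Tm.idm σ).wk k = Tm.idm σ := by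
  rw [Tm.wk, Tm.ren_idm, Ty.ren_id]

-- Composition of maps

section comp

variable {n : ℕ} {Γ : List (S.Ty n)} {A B C : S.Ty n} {f g : Tm S n}

theorem HasTyI.comp_body (hf : HasTyI Γ f (Ty.lolli B C)) (hg : HasTyI Γ g (Ty.lolli A B)) :
    HasTy ((Use.lin, A) :: intCtx Γ) (Tm.app (f.wk 1) (Tm.app (g.wk 1) (Tm.var 0))) C :=
  .app (.right _ (intCtx_split Γ)) (hf.off1 (by simp))
    (.app (.right _ (intCtx_split Γ)) (hg.off1 (by simp)) (.lvar0 (intCtx_noLin Γ)))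

theorem HasTyI.comp (hf : HasTyI Γ f (Ty.lolli B C)) (hg : HasTyI Γ g (Ty.lolli A B)) :
    HasTyI Γ (Tm.comp A f g) (Ty.lolli A C) := .lam (HasTyI.comp_body hf hg)

theorem ExtEqI.comp {u : Tm S n} (hf : HasTyI Γ f (Ty.lolli B C))
    (hg : HasTyI Γ g (Ty.lolli A B)) (hu : HasTyI Γ u A) :
    ExtEqI Γ (Tm.app (Tm.comp A f g) u) (Tm.app f (Tm.app g u)) C := by
  have := ExtEqI.beta (HasTyI.comp_body hf hg) hu
  simp only [Tm.inst, Tm.subst, scons_zero, Tm.wk, Tm.subst_ren,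
    show (scons u Tm.var ∘ (· + 1)) = Tm.var from rfl, Function.comp_id, Tm.subst_var] at this
  exact this

theorem Tm.wk_comp (k : ℕ) : (Tm.comp A f g).wk k = Tm.comp A (f.wk k) (g.wk k) := by
  simp only [Tm.comp, Tm.wk, Tm.ren, Tm.ren_ren, Ty.ren_id]
  rfl

end comp

/-! ## Renaming after substitution in propositions -/

theorem Rel.ren_up {n m : ℕ} (g : ℕ → Rel S n) (r : Fin n → Fin m) (e q : ℕ → ℕ) :
    (fun i => (Rel.up g i).ren r e (upN q)) = Rel.up (fun i => (g i).ren r e q) := by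
  funext i
  cases i
  · rfl
  · simp only [Rel.up, scons_succ, Rel.wkRel, Rel.ren_ren]; rfl

theorem Rel.ren_wkTy {n m : ℕ} (r : Fin n → Fin m) (e q : ℕ → ℕ) (ρ : Rel S n) :
    ρ.wkTy.ren (upRen r) e q = (ρ.ren r e q).wkTy := by
  simp only [Rel.wkTy, Rel.ren_ren]; rfl

theorem Rel.ren_wk1 {n m : ℕ} (r : Fin n → Fin m) (e q : ℕ → ℕ) (ρ : Rel S n) :
    (ρ.wk 1).ren r (upN e) q = (ρ.ren r e q).wk 1 := by
  simp only [Rel.wk, Rel.ren_ren]; rfl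

theorem Rel.ren_wk2 {n m : ℕ} (r : Fin n → Fin m) (e q : ℕ → ℕ) (ρ : Rel S n) :
    (ρ.wk 2).ren r (upN (upN e)) q = (ρ.ren r e q).wk 2 := by
  simp only [Rel.wk, Rel.ren_ren]; rfl

theorem Rel.ren_wk4 {n m : ℕ} (r : Fin n → Fin m) (e q : ℕ → ℕ) (ρ : Rel S n) :
    (ρ.wk 4).ren r (upN (upN (upN (upN e)))) q = (ρ.ren r e q).wk 4 := by
  simp only [Rel.wk, Rel.ren_ren]; rfl

mutual

theorem Form.ren_subst : ∀ {n m k : ℕ} (s : Fin n → S.Ty m) (f : ℕ → Tm S m) (g : ℕ → Rel S m)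
    (r : Fin m → Fin k) (e q : ℕ → ℕ) (φ : Form S n),
    (φ.subst s f g).ren r e q = φ.subst (fun i => (s i).ren r) (fun i => (f i).ren r e)
      (fun i => (g i).ren r e q)
  | _, _, _, s, f, g, r, e, q, .eq σ t u => by
      simp [Form.ren, Form.subst, Ty.ren_subst, Tm.ren_subst]
  | _, _, _, s, f, g, r, e, q, .rel ρ t u => by
      simp [Form.ren, Form.subst, Tm.ren_subst, Rel.ren_subst s f g r e q ρ]
  | _, _, _, s, f, g, r, e, q, .imp φ ψ => by
      simp [Form.ren, Form.subst, Form.ren_subst s f g r e q φ, Form.ren_subst s f g r e q ψ]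
  | _, _, _, _, _, _, _, _, _, .bot => rfl
  | _, _, _, _, _, _, _, _, _, .top => rfl
  | _, _, _, s, f, g, r, e, q, .and φ ψ => by
      simp [Form.ren, Form.subst, Form.ren_subst s f g r e q φ, Form.ren_subst s f g r e q ψ]
  | _, _, _, s, f, g, r, e, q, .or φ ψ => by
      simp [Form.ren, Form.subst, Form.ren_subst s f g r e q φ, Form.ren_subst s f g r e q ψ]
  | _, _, _, s, f, g, r, e, q, .allTy φ => by
      simp only [Form.ren, Form.subst, Form.ren_subst _ _ _ (upRen r) e q φ, Ty.ren_up,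
        Tm.ren_wkTy, Rel.ren_wkTy]
  | _, _, _, s, f, g, r, e, q, .allTm σ φ => by
      simp only [Form.ren, Form.subst, Ty.ren_subst, Form.ren_subst _ _ _ r (upN e) q φ,
        Tm.ren_up, Rel.ren_wk1]
  | _, _, _, s, f, g, r, e, q, .allRel b σ τ φ => by
      simp only [Form.ren, Form.subst, Ty.ren_subst, Form.ren_subst _ _ _ r e (upN q) φ,
        Rel.ren_up]
  | _, _, _, s, f, g, r, e, q, .exTy φ => by
      simp only [Form.ren, Form.subst, Form.ren_subst _ _ _ (upRen r) e q φ, Ty.ren_up,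
        Tm.ren_wkTy, Rel.ren_wkTy]
  | _, _, _, s, f, g, r, e, q, .exTm σ φ => by
      simp only [Form.ren, Form.subst, Ty.ren_subst, Form.ren_subst _ _ _ r (upN e) q φ,
        Tm.ren_up, Rel.ren_wk1]
  | _, _, _, s, f, g, r, e, q, .exRel b σ τ φ => by
      simp only [Form.ren, Form.subst, Ty.ren_subst, Form.ren_subst _ _ _ r e (upN q) φ,
        Rel.ren_up]

theorem Rel.ren_subst : ∀ {n m k : ℕ} (s : Fin n → S.Ty m) (f : ℕ → Tm S m) (g : ℕ → Rel S m)
    (r : Fin m → Fin k) (e q : ℕ → ℕ) (ρ : Rel S n),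
    (ρ.subst s f g).ren r e q = ρ.subst (fun i => (s i).ren r) (fun i => (f i).ren r e)
      (fun i => (g i).ren r e q)
  | _, _, _, _, _, _, _, _, _, .var i => rfl
  | _, _, _, s, f, g, r, e, q, .abs σ τ φ => by
      simp only [Rel.ren, Rel.subst, Ty.ren_subst, Form.ren_subst _ _ _ r (upN (upN e)) q φ,
        Tm.ren_up, Rel.ren_wk2]
  | _, _, _, s, f, g, r, e, q, .ty σ ρ => by
      simp only [Rel.ren, Rel.subst]; congr 1; funext i
      exact Rel.ren_subst s f g r e q (ρ i)

end

/-- The bodies of ρ ⊸ ρ' and ρ → ρ' lie under four term variables: the two related functions and the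
two quantified arguments. -/
theorem Rel.wk4_subst {n m : ℕ} (s : Fin n → S.Ty m) (f : ℕ → Tm S m) (g : ℕ → Rel S m)
    (ρ : Rel S n) :
    (ρ.wk 4).subst s (Tm.up (Tm.up (Tm.up (Tm.up f)))) (fun i => (((g i).wk 2).wk 1).wk 1) =
      (ρ.subst s f g).wk 4 := by
  simp only [Rel.wk, Rel.subst_ren, Rel.ren_subst]
  congr 1
  · funext i; exact (Ty.ren_id _).symm
  · funext i
    change ((((f i).wk 1).wk 1).wk 1).wk 1 = (f i).wk 4
    simp only [Tm.wk_wk]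
  · funext i
    change (((g i).wk 2).wk 1).wk 1 = (g i).wk 4
    simp only [Rel.wk_wk]

theorem Rel.subst_lolli {n m : ℕ} (s : Fin n → S.Ty m) (f : ℕ → Tm S m) (g : ℕ → Rel S m)
    (σ τ σ' τ' : S.Ty n) (ρ ρ' : Rel S n) :
    (Rel.lolli σ τ σ' τ' ρ ρ').subst s f g = Rel.lolli (σ.subst s) (τ.subst s) (σ'.subst s)
      (τ'.subst s) (ρ.subst s f g) (ρ'.subst s f g) := by
  simp only [Rel.lolli, Rel.subst, Form.subst, Rel.wk4_subst, Ty.subst]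
  rfl

theorem Rel.subst_arr {n m : ℕ} (s : Fin n → S.Ty m) (f : ℕ → Tm S m) (g : ℕ → Rel S m)
    (σ τ σ' τ' : S.Ty n) (ρ ρ' : Rel S n) :
    (Rel.arr σ τ σ' τ' ρ ρ').subst s f g = Rel.arr (σ.subst s) (τ.subst s) (σ'.subst s)
      (τ'.subst s) (ρ.subst s f g) (ρ'.subst s f g) := by
  simp only [Rel.arr, Rel.subst, Form.subst, Rel.wk4_subst, Ty.subst, Ty.arr]
  rfl

/-! ## Renaming of judgements -/

def RelDecl.ren {n m : ℕ} (r : Fin n → Fin m) (d : RelDecl S n) : RelDecl S m :=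
  ⟨d.adm, d.dom.ren r, d.cod.ren r⟩

/-- A renaming between contexts of the logic. -/
structure CtxRen {n m : ℕ} (r : Fin n → Fin m) (e q : ℕ → ℕ) (Γ : List (S.Ty n))
    (Θ : List (RelDecl S n)) (Γ' : List (S.Ty m)) (Θ' : List (RelDecl S m)) : Prop where
  tm : ∀ i τ, Γ[i]? = some τ → Γ'[e i]? = some (τ.ren r)
  rel : ∀ i d, Θ[i]? = some d → Θ'[q i]? = some (d.ren r)

namespace CtxRen

variable {n m : ℕ} {r : Fin n → Fin m} {e q : ℕ → ℕ} {Γ : List (S.Ty n)}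
  {Θ : List (RelDecl S n)} {Γ' : List (S.Ty m)} {Θ' : List (RelDecl S m)}

theorem consTm (h : CtxRen r e q Γ Θ Γ' Θ') (σ : S.Ty n) :
    CtxRen r (upN e) q (σ :: Γ) Θ (σ.ren r :: Γ') Θ' where
  tm := by
    rintro (_ | i) τ hi
    · simp at hi; subst hi; rfl
    · exact h.tm i τ hi
  rel := h.rel

theorem consRel (h : CtxRen r e q Γ Θ Γ' Θ') (d : RelDecl S n) :
    CtxRen r e (upN q) Γ (d :: Θ) Γ' (d.ren r :: Θ') where
  tm := h.tm
  rel := by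
    rintro (_ | i) τ hi
    · simp at hi; subst hi; rfl
    · exact h.rel i τ hi

theorem wkTy (h : CtxRen r e q Γ Θ Γ' Θ') :
    CtxRen (upRen r) e q (Γ.map Ty.wk) (Θ.map RelDecl.wk) (Γ'.map Ty.wk)
      (Θ'.map RelDecl.wk) where
  tm := by
    intro i τ hi
    rw [List.getElem?_map, Option.map_eq_some_iff] at hi
    obtain ⟨σ, hi, rfl⟩ := hi
    rw [List.getElem?_map, h.tm i σ hi, Ty.wk_ren]; rfl
  rel := by
    intro i d hi
    rw [List.getElem?_map, Option.map_eq_some_iff] at hi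
    obtain ⟨d, hi, rfl⟩ := hi
    rw [List.getElem?_map, h.rel i d hi]
    simp [RelDecl.ren, RelDecl.wk, Ty.wk_ren]

theorem shiftTm (Γ : List (S.Ty n)) (Θ : List (RelDecl S n)) (Δ : List (S.Ty n)) {k : ℕ}
    (hk : Δ.length = k := by rfl) : CtxRen id (· + k) id Γ Θ (Δ ++ Γ) Θ where
  tm := fun i τ hi => by
    rw [List.getElem?_append_right (by omega), Ty.ren_id, ← hk, Nat.add_sub_cancel]; exact hi
  rel := fun i d hi => by simpa [RelDecl.ren, Ty.ren_id] using hi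

theorem shiftTy (Γ : List (S.Ty n)) (Θ : List (RelDecl S n)) :
    CtxRen Fin.succ id id Γ Θ (Γ.map Ty.wk) (Θ.map RelDecl.wk) where
  tm := fun i τ hi => by simp [hi, Ty.wk]
  rel := fun i d hi => by simp [hi, RelDecl.ren, RelDecl.wk, Ty.wk]

theorem shiftRel (Γ : List (S.Ty n)) (Θ : List (RelDecl S n)) (d : RelDecl S n) :
    CtxRen id id (· + 1) Γ Θ Γ (d :: Θ) where
  tm := fun i τ hi => by simp [hi, Ty.ren_id]
  rel := fun i d hi => by simp [hi, RelDecl.ren, Ty.ren_id]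

end CtxRen

section Renaming

variable {T : Theory S}

theorem Prf.ren {n m : ℕ} {r : Fin n → Fin m} {e q : ℕ → ℕ} {Γ : List (S.Ty n)}
    {Θ : List (RelDecl S n)} {Γ' : List (S.Ty m)} {Θ' : List (RelDecl S m)}
    {Φ : List (Form S n)} {φ : Form S n} (h : Prf T Γ Θ Φ φ) (hr : CtxRen r e q Γ Θ Γ' Θ') :
    Prf T Γ' Θ' (Φ.map (Form.ren r e q)) (φ.ren r e q) := by
  have := Prf.subst (fun i => Ty.var (r i)) (fun i => Tm.var (e i)) (fun i => Rel.var (q i)) h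
    (Γ' := Γ') (Θ' := Θ') ?_ ?_
  · rw [show Form.ren r e q = Form.subst (S := S) (fun i => Ty.var (r i))
      (fun i => Tm.var (e i)) (fun i => Rel.var (q i)) from
        funext (fun φ => Form.ren_eq_subst r e q φ)]
    exact this
  · intro i σ hi
    rw [← Ty.ren_eq_subst]; exact .var (hr.tm i σ hi)
  · intro i d hi
    rw [← Ty.ren_eq_subst, ← Ty.ren_eq_subst]; exact .var (hr.rel i d hi)

-- Relation formers commute with renaming

theorem Rel.ren_graph {n m : ℕ} (r : Fin n → Fin m) (e q : ℕ → ℕ) (σ τ : S.Ty n) (f : Tm S n) :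
    (Rel.graph σ τ f).ren r e q = Rel.graph (σ.ren r) (τ.ren r) (f.ren r e) := by
  simp only [Rel.graph, Rel.ren, Form.ren, Tm.ren, Tm.wk, Tm.ren_ren]; rfl

theorem Rel.ren_eqr {n m : ℕ} (r : Fin n → Fin m) (e q : ℕ → ℕ) (σ : S.Ty n) :
    (Rel.eqr σ).ren r e q = Rel.eqr (σ.ren r) := Rel.ren_graph _ _ _ _ _ _

theorem Rel.ren_reindex {n m : ℕ} (r : Fin n → Fin m) (e q : ℕ → ℕ) (σ τ : S.Ty n)
    (f g : Tm S n) (ρ : Rel S n) :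
    (Rel.reindex σ τ f g ρ).ren r e q =
      Rel.reindex (σ.ren r) (τ.ren r) (f.ren r e) (g.ren r e) (ρ.ren r e q) := by
  simp only [Rel.reindex, Rel.ren, Form.ren, Tm.ren, Tm.wk, Tm.ren_ren, Rel.ren_wk2]; rfl

theorem Form.ren_wk_wk {n m : ℕ} (r : Fin n → Fin m) (e q : ℕ → ℕ) (φ : Form S n) :
    φ.wk.wk.ren r (upN (upN e)) q = (φ.ren r e q).wk.wk := by
  simp only [Form.wk, Form.ren_ren]; rfl

theorem Form.ren_relEquiv {n m : ℕ} (r : Fin n → Fin m) (e q : ℕ → ℕ) (σ τ : S.Ty n)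
    (ρ ρ' : Rel S n) : (Form.relEquiv σ τ ρ ρ').ren r e q =
      Form.relEquiv (σ.ren r) (τ.ren r) (ρ.ren r e q) (ρ'.ren r e q) := by
  simp only [Form.relEquiv, Form.iff, Form.ren, Tm.ren, Rel.ren_wk2]; rfl

/-- The admissibility rule for ∀ over terms has the quantified variable innermost, so weakening by
the two arguments of the relation happens underneath it. -/
theorem Rel.ren_shift_under {n m : ℕ} (r : Fin n → Fin m) (e q : ℕ → ℕ) (ρ : Rel S n) :
    (ρ.ren id (upN (· + 2)) id).ren r (upN (upN (upN e))) q =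
      (ρ.ren r (upN e) q).ren id (upN (· + 2)) id := by
  simp only [Rel.ren_ren]
  rw [show upN (upN (upN e)) ∘ upN (· + 2) = upN (· + 2) ∘ upN e from by
    funext i; cases i <;> rfl]
  rfl

-- The recursion runs over well-formedness alone. Derivations occur only in the `equiv` rule for
-- admissible relations, and there `Prf.ren` applies because substitution is a primitive rule of the
-- logic.
mutual

theorem FormOk.ren : ∀ {n m : ℕ} {r : Fin n → Fin m} {e q : ℕ → ℕ} {Γ : List (S.Ty n)}
    {Θ : List (RelDecl S n)} {Γ' : List (S.Ty m)} {Θ' : List (RelDecl S m)} {φ : Form S n},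
    FormOk T Γ Θ φ → CtxRen r e q Γ Θ Γ' Θ' → FormOk T Γ' Θ' (φ.ren r e q)
  | _, _, _, _, _, _, _, _, _, _, .eq h₁ h₂, h => .eq (h₁.ren h.tm) (h₂.ren h.tm)
  | _, _, _, _, _, _, _, _, _, _, .rel h₀ h₁ h₂, h =>
      .rel (h₀.ren h) (h₁.ren h.tm) (h₂.ren h.tm)
  | _, _, _, _, _, _, _, _, _, _, .imp h₁ h₂, h => .imp (h₁.ren h) (h₂.ren h)
  | _, _, _, _, _, _, _, _, _, _, .bot, _ => .bot
  | _, _, _, _, _, _, _, _, _, _, .top, _ => .top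
  | _, _, _, _, _, _, _, _, _, _, .and h₁ h₂, h => .and (h₁.ren h) (h₂.ren h)
  | _, _, _, _, _, _, _, _, _, _, .or h₁ h₂, h => .or (h₁.ren h) (h₂.ren h)
  | _, _, _, _, _, _, _, _, _, _, .allTy h₁, h => .allTy (h₁.ren h.wkTy)
  | _, _, _, _, _, _, _, _, _, _, .allTm h₁, h => .allTm (h₁.ren (h.consTm _))
  | _, _, _, _, _, _, _, _, _, _, .allRel h₁, h => .allRel (h₁.ren (h.consRel _))
  | _, _, _, _, _, _, _, _, _, _, .exTy h₁, h => .exTy (h₁.ren h.wkTy)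
  | _, _, _, _, _, _, _, _, _, _, .exTm h₁, h => .exTm (h₁.ren (h.consTm _))
  | _, _, _, _, _, _, _, _, _, _, .exRel h₁, h => .exRel (h₁.ren (h.consRel _))

theorem RelOk.ren : ∀ {n m : ℕ} {r : Fin n → Fin m} {e q : ℕ → ℕ} {b : Bool}
    {Γ : List (S.Ty n)} {Θ : List (RelDecl S n)} {Γ' : List (S.Ty m)} {Θ' : List (RelDecl S m)}
    {ρ : Rel S n} {σ τ : S.Ty n},
    RelOk T b Γ Θ ρ σ τ → CtxRen r e q Γ Θ Γ' Θ' →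
      RelOk T b Γ' Θ' (ρ.ren r e q) (σ.ren r) (τ.ren r)
  | _, _, _, _, _, _, _, _, _, _, _, _, _, .var hi, h => .var (h.rel _ _ hi)
  | _, _, _, _, _, _, _, _, _, _, _, _, _, .abs h₁, h =>
      .abs (h₁.ren ((h.consTm _).consTm _))
  | _, _, _, _, _, _, _, _, _, _, _, _, _, .ofAdm h₁, h => .ofAdm (h₁.ren h)
  | _, _, _, _, _, _, _, _, _, _, _, _, _, .eqr σ, h => by
      rw [Rel.ren_eqr]; exact .eqr _
  | _, _, _, _, _, _, _, _, _, _, _, _, _, .reindex h₁ h₂ h₃, h => by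
      rw [Rel.ren_reindex]; exact .reindex (h₁.ren h) (h₂.ren h.tm) (h₃.ren h.tm)
  | _, _, _, _, _, _, _, _, _, _, _, _, _, .and h₁ h₂, h => by
      have := RelOk.and (h₁.ren h) (h₂.ren h)
      simp only [Rel.ren, Form.ren, Rel.ren_wk2]; exact this
  | _, _, _, _, _, _, _, _, _, _, _, _, _, .inv h₁, h => by
      have := RelOk.inv (h₁.ren h)
      simp only [Rel.ren, Form.ren, Rel.ren_wk2]; exact this
  | _, _, _, _, _, _, _, _, _, _, _, _, _, .top _ _, _ => .top _ _
  | _, _, _, _, _, _, _, _, _, _, _, _, _, .imp h₁ h₂, h => by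
      have := RelOk.imp (h₁.ren h) (h₂.ren h)
      simp only [Rel.ren, Form.ren, Rel.ren_wk2, Form.ren_wk_wk]; exact this
  | _, _, _, _, _, _, _, _, _, _, _, _, _, .allTy (ρ := ρ) h₁, h => by
      have h₂ := h₁.ren h.wkTy
      rw [Ty.wk_ren, Ty.wk_ren] at h₂
      have := RelOk.allTy h₂
      simp only [Rel.ren, Form.ren, Rel.ren_wk2]; exact this
  | _, _, _, _, _, _, _, _, _, _, _, _, _, .allTm (ρ := ρ) h₁, h => by
      have := RelOk.allTm (h₁.ren (h.consTm _))
      simp only [Rel.ren, Form.ren, Rel.ren_shift_under]; exact this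
  | _, _, _, _, _, _, _, _, _, _, _, _, _, .allRel h₁, h => by
      have := RelOk.allRel (h₁.ren (h.consRel _))
      simp only [Rel.ren, Form.ren, Rel.ren_wk2]; exact this
  | _, _, _, _, _, _, _, _, _, _, _, _, _, .equiv h₁ h₂ h₃, h => by
      have := h₃.ren h
      rw [Form.ren_relEquiv] at this
      exact .equiv (h₁.ren h) (h₂.ren h) this
  | _, _, _, _, _, _, _, _, _, _, _, _, _, .ty σ h₁, h => by
      rw [Ty.ren_subst, Ty.ren_subst]
      exact .ty σ (fun i => (h₁ i).ren h)

end

end Renaming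

/-! ## Derived rules of the logic -/

section DerivedRules

variable {T : Theory S} {n : ℕ} {Γ : List (S.Ty n)} {Θ : List (RelDecl S n)}
  {Φ : List (Form S n)}

theorem Prf.wk1 {φ : Form S n} (h : Prf T Γ Θ Φ φ) (A : S.Ty n) :
    Prf T (A :: Γ) Θ (Φ.map Form.wk) φ.wk := h.ren (CtxRen.shiftTm Γ Θ [A])

theorem Prf.wkTy {φ : Form S n} (h : Prf T Γ Θ Φ φ) :
    Prf T (Γ.map Ty.wk) (Θ.map RelDecl.wk) (Φ.map Form.wkTy) φ.wkTy :=
  h.ren (CtxRen.shiftTy Γ Θ)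

theorem Prf.wkRel {φ : Form S n} (h : Prf T Γ Θ Φ φ) (d : RelDecl S n) :
    Prf T Γ (d :: Θ) (Φ.map Form.wkRel) φ.wkRel := h.ren (CtxRen.shiftRel Γ Θ d)

/-- Opening a quantifier weakens the hypotheses; the later instantiation undoes this. -/
theorem Form.map_ren_subst {m : ℕ} {r : Fin n → Fin m} {e q : ℕ → ℕ} {s : Fin m → S.Ty n}
    {f : ℕ → Tm S n} {g : ℕ → Rel S n} (hs : s ∘ r = Ty.var) (hf : f ∘ e = Tm.var)
    (hg : g ∘ q = Rel.var) (Φ : List (Form S n)) :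
    (Φ.map (Form.ren r e q)).map (Form.subst s f g) = Φ := by
  rw [List.map_map]
  conv_rhs => rw [← List.map_id Φ]
  refine List.map_congr_left fun φ _ => ?_
  simp [Form.subst_ren, hs, hf, hg]

/-- Inverse of the introduction rule: weaken the universal statement and instantiate it at the new
variable. -/
theorem Prf.allTm_open {σ : S.Ty n} {φ : Form S n} (h : Prf T Γ Θ Φ (.allTm σ φ)) :
    Prf T (σ :: Γ) Θ (Φ.map Form.wk) φ := by
  have h₁ := h.wk1 σ
  simp only [Form.wk, Form.ren, Ty.ren_id] at h₁
  have := Prf.allTmE h₁ (.var (i := 0) rfl)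
  rw [Form.instTm, Form.subst_ren] at this
  convert this using 1
  conv_lhs => rw [← Form.subst_var φ]
  congr 1
  funext i; cases i <;> rfl

theorem Prf.allTy_open {φ : Form S (n + 1)} (h : Prf T Γ Θ Φ (.allTy φ)) :
    Prf T (Γ.map Ty.wk) (Θ.map RelDecl.wk) (Φ.map Form.wkTy) φ := by
  have h₁ := h.wkTy
  simp only [Form.wkTy, Form.ren] at h₁
  have := Prf.allTyE (Ty.var 0) h₁
  rw [Form.instTy, Form.subst_ren] at this
  convert this using 1
  conv_lhs => rw [← Form.subst_var φ]
  congr 1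
  funext i; exact Fin.cases rfl (fun _ => rfl) i

theorem Prf.allRel_open {b : Bool} {σ τ : S.Ty n} {φ : Form S n}
    (h : Prf T Γ Θ Φ (.allRel b σ τ φ)) :
    Prf T Γ (⟨b, σ, τ⟩ :: Θ) (Φ.map Form.wkRel) φ := by
  have h₁ := h.wkRel ⟨b, σ, τ⟩
  simp only [Form.wkRel, Form.ren, Ty.ren_id] at h₁
  have := Prf.allRelE (ρ := .var 0) h₁ (.var rfl)
  rw [Form.instRel, Form.subst_ren] at this
  convert this using 1
  conv_lhs => rw [← Form.subst_var φ]
  congr 1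
  funext i; cases i <;> rfl

/-- Both quantifiers are opened first and then instantiated by one simultaneous substitution, so
that no two substitutions of a formula have to be composed. -/
theorem Prf.allTm_inst2 {σ τ : S.Ty n} {φ : Form S n} (h : Prf T Γ Θ Φ (.allTm σ (.allTm τ φ)))
    {a b : Tm S n} (ha : HasTyI Γ a σ) (hb : HasTyI Γ b τ) : Prf T Γ Θ Φ (φ.instTm2 a b) := by
  have := Prf.subst Ty.var (scons b (scons a Tm.var)) Rel.var h.allTm_open.allTm_open
    (Γ' := Γ) (Θ' := Θ) ?_ ?_
  · have h₁ := Form.map_ren_subst (r := id) (e := (· + 2)) (q := id) (s := Ty.var)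
      (f := scons b (scons a Tm.var)) (g := Rel.var) rfl rfl rfl Φ
    rw [show (Φ.map Form.wk).map Form.wk = Φ.map (Form.ren id (· + 2) id) from by
      rw [List.map_map]; congr 1; funext φ
      simp only [Form.wk, Function.comp, Form.ren_ren]; rfl, h₁] at this
    exact this
  · rintro (_ | _ | i) τ hi
    · simp at hi; subst hi; rw [Ty.subst_var]; exact hb
    · simp at hi; subst hi; rw [Ty.subst_var]; exact ha
    · rw [Ty.subst_var]; exact .var hi
  · intro i d hi; rw [Ty.subst_var, Ty.subst_var]; exact .var hi

/-- As for two term quantifiers, the two types and the relation between them are substituted in one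
step. This is the form in which parametricity is instantiated. -/
theorem Prf.allAdm_inst {φ : Form S (n + 2)}
    (h : Prf T Γ Θ Φ (.allTy (.allTy (.allRel true (Ty.var 1) (Ty.var 0) φ))))
    {A B : S.Ty n} {R : Rel S n} (hR : RelOk T true Γ Θ R A B) :
    Prf T Γ Θ Φ (φ.subst (Ty.cons B (Ty.cons A Ty.var)) Tm.var (scons R Rel.var)) := by
  have hs : (Ty.cons B (Ty.cons A Ty.var)) ∘ (fun i => Fin.succ (Fin.succ i)) =
    (Ty.var : Fin n → S.Ty n) := rfl
  have := Prf.subst (Ty.cons B (Ty.cons A Ty.var)) Tm.var (scons R Rel.var)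
    h.allTy_open.allTy_open.allRel_open (Γ' := Γ) (Θ' := Θ) ?_ ?_
  · have h₁ := Form.map_ren_subst (r := fun i => Fin.succ (Fin.succ i)) (e := id) (q := (· + 1))
      (f := Tm.var) (g := scons R Rel.var) hs rfl rfl Φ
    rw [show ((Φ.map Form.wkTy).map Form.wkTy).map Form.wkRel =
        Φ.map (Form.ren (fun i => Fin.succ (Fin.succ i)) id (· + 1)) from by
      rw [List.map_map, List.map_map]; congr 1; funext φ
      simp only [Form.wkTy, Form.wkRel, Function.comp, Form.ren_ren]; rfl, h₁] at this
    exact this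
  · intro i τ hi
    simp only [List.map_map, List.getElem?_map, Option.map_eq_some_iff] at hi
    obtain ⟨σ, hi, rfl⟩ := hi
    simp only [Function.comp, Ty.wk_subst_cons, Ty.subst_var]; exact .var hi
  · rintro (_ | i) d hi
    · simp at hi; subst hi; exact hR
    · simp only [List.map_map, List.getElem?_cons_succ, List.getElem?_map,
        Option.map_eq_some_iff] at hi
      obtain ⟨d, hi, rfl⟩ := hi
      simp only [Function.comp, RelDecl.wk, Ty.wk_subst_cons, Ty.subst_var]; exact .var hi

end DerivedRules

/-! ## Internal equality -/

/-- `t` and `u` are terms of type `σ` that are provably equal. -/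
structure IEq (T : Theory S) {n : ℕ} (Γ : List (S.Ty n)) (Θ : List (RelDecl S n))
    (Φ : List (Form S n)) (σ : S.Ty n) (t u : Tm S n) : Prop where
  left : HasTyI Γ t σ
  right : HasTyI Γ u σ
  prf : Prf T Γ Θ Φ (.eq σ t u)

section Equality

variable {T : Theory S} {n : ℕ} {Γ : List (S.Ty n)} {Θ : List (RelDecl S n)}
  {Φ : List (Form S n)}

theorem ExtEqI.ieq {σ : S.Ty n} {t u : Tm S n} (h : ExtEqI Γ t u σ) : IEq T Γ Θ Φ σ t u :=
  ⟨h.hasTy.1, h.hasTy.2, .eqExt h⟩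

namespace IEq

theorem rfl {σ : S.Ty n} {t : Tm S n} (h : HasTyI Γ t σ) : IEq T Γ Θ Φ σ t t :=
  ⟨h, h, .eqExt (.refl h)⟩

theorem symm {σ : S.Ty n} {t u : Tm S n} (h : IEq T Γ Θ Φ σ t u) : IEq T Γ Θ Φ σ u t :=
  ⟨h.right, h.left, .eqSymm h.prf⟩

theorem trans {σ : S.Ty n} {t u v : Tm S n} (h : IEq T Γ Θ Φ σ t u) (h' : IEq T Γ Θ Φ σ u v) :
    IEq T Γ Θ Φ σ t v := ⟨h.left, h'.right, .eqTrans h.prf h'.prf⟩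

theorem mono {Φ' : List (Form S n)} {σ : S.Ty n} {t u : Tm S n} (h : IEq T Γ Θ Φ σ t u)
    (hΦ : Φ ⊆ Φ') : IEq T Γ Θ Φ' σ t u := ⟨h.left, h.right, h.prf.mono hΦ⟩

theorem wk1 {σ : S.Ty n} {t u : Tm S n} (h : IEq T Γ Θ Φ σ t u) (A : S.Ty n) :
    IEq T (A :: Γ) Θ (Φ.map Form.wk) σ (t.wk 1) (u.wk 1) :=
  ⟨h.left.wk1, h.right.wk1, by
    have := h.prf.wk1 A
    simp only [Form.wk, Form.ren, Ty.ren_id] at this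
    exact this⟩

theorem wk2 {σ : S.Ty n} {t u : Tm S n} (h : IEq T Γ Θ Φ σ t u) (A B : S.Ty n) :
    IEq T (A :: B :: Γ) Θ ((Φ.map Form.wk).map Form.wk) σ (t.wk 2) (u.wk 2) := by
  have := (h.wk1 B).wk1 A
  simpa only [Tm.wk_wk] using this

end IEq

/-! ### Relations -/

/-- `ρ` is a definable relation between `A` and `B` that provably relates `t` and `u`. -/
structure IRel (T : Theory S) {n : ℕ} (Γ : List (S.Ty n)) (Θ : List (RelDecl S n))
    (Φ : List (Form S n)) (ρ : Rel S n) (A B : S.Ty n) (t u : Tm S n) : Prop where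
  ok : RelOk T false Γ Θ ρ A B
  left : HasTyI Γ t A
  right : HasTyI Γ u B
  prf : Prf T Γ Θ Φ (.rel ρ t u)

theorem Tm.wk2_subst2 (t s u : Tm S n) :
    (t.wk 2).subst Ty.var (scons u (scons s Tm.var)) = t := by
  rw [Tm.wk, Tm.subst_ren]; exact Tm.subst_var t

theorem Rel.wk2_subst2 (ρ : Rel S n) (s u : Tm S n) :
    (ρ.wk 2).subst Ty.var (scons u (scons s Tm.var)) Rel.var = ρ := by
  rw [Rel.wk, Rel.subst_ren]; exact Rel.subst_var ρ

namespace IRel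

theorem congr {ρ : Rel S n} {A B : S.Ty n} {t t' u u' : Tm S n} (h : IRel T Γ Θ Φ ρ A B t u)
    (h₁ : IEq T Γ Θ Φ A t t') (h₂ : IEq T Γ Θ Φ B u u') : IRel T Γ Θ Φ ρ A B t' u' :=
  ⟨h.ok, h₁.right, h₂.right, .relSubst h.ok h.prf h₁.prf h₂.prf⟩

theorem of_equiv {ρ ρ' : Rel S n} {A B : S.Ty n} {t u : Tm S n}
    (h : Prf T Γ Θ Φ (Form.relEquiv A B ρ ρ')) (ok : RelOk T false Γ Θ ρ' A B)
    (hr : IRel T Γ Θ Φ ρ A B t u) : IRel T Γ Θ Φ ρ' A B t u := by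
  refine ⟨ok, hr.left, hr.right, ?_⟩
  have := Prf.allTm_inst2 h hr.left hr.right
  simp only [Form.instTm2, Form.iff, Form.subst, Rel.wk2_subst2] at this
  exact .impE this.andE₁ hr.prf

theorem of_equiv_symm {ρ ρ' : Rel S n} {A B : S.Ty n} {t u : Tm S n}
    (h : Prf T Γ Θ Φ (Form.relEquiv A B ρ ρ')) (ok : RelOk T false Γ Θ ρ A B)
    (hr : IRel T Γ Θ Φ ρ' A B t u) : IRel T Γ Θ Φ ρ A B t u := by
  refine ⟨ok, hr.left, hr.right, ?_⟩
  have := Prf.allTm_inst2 h hr.left hr.right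
  simp only [Form.instTm2, Form.iff, Form.subst, Rel.wk2_subst2] at this
  exact .impE this.andE₂ hr.prf

theorem of_abs {A B : S.Ty n} {φ : Form S n} {t u : Tm S n}
    (hφ : FormOk T (B :: A :: Γ) Θ φ) (ht : HasTyI Γ t A) (hu : HasTyI Γ u B)
    (h : Prf T Γ Θ Φ (φ.instTm2 t u)) : IRel T Γ Θ Φ (.abs A B φ) A B t u :=
  ⟨.abs hφ, ht, hu, .impE (Prf.relAbs hφ ht hu).andE₂ h⟩

theorem abs_elim {A B : S.Ty n} {φ : Form S n} {t u : Tm S n}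
    (hφ : FormOk T (B :: A :: Γ) Θ φ) (h : IRel T Γ Θ Φ (.abs A B φ) A B t u) :
    Prf T Γ Θ Φ (φ.instTm2 t u) := .impE (Prf.relAbs hφ h.left h.right).andE₁ h.prf

theorem hyp0 {ρ : Rel S n} {A B : S.Ty n}
    (ok : RelOk T false Γ Θ ρ A B) :
    IRel T (B :: A :: Γ) Θ (.rel (ρ.wk 2) (.var 1) (.var 0) :: Φ) (ρ.wk 2) A B
      (.var 1) (.var 0) := by
  refine ⟨?_, .var rfl, .var rfl, .hyp List.mem_cons_self⟩
  have := ok.ren (CtxRen.shiftTm Γ Θ [B, A])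
  rwa [Ty.ren_id, Ty.ren_id] at this

end IRel

theorem RelOk.wk2 {b : Bool} {ρ : Rel S n} {A B : S.Ty n} (ok : RelOk T b Γ Θ ρ A B)
    (C D : S.Ty n) : RelOk T b (D :: C :: Γ) Θ (ρ.wk 2) A B := by
  have := ok.ren (CtxRen.shiftTm Γ Θ [D, C])
  rwa [Ty.ren_id, Ty.ren_id] at this

theorem RelOk.wk4 {b : Bool} {ρ : Rel S n} {A B : S.Ty n} (ok : RelOk T b Γ Θ ρ A B)
    (C D E F : S.Ty n) : RelOk T b (F :: E :: D :: C :: Γ) Θ (ρ.wk 4) A B := by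
  have := ok.ren (CtxRen.shiftTm Γ Θ [F, E, D, C])
  rwa [Ty.ren_id, Ty.ren_id] at this

/-! ### Congruence -/

namespace IEq

/-- Leibniz' principle: the substitution rule for relations is applied to the relation c[t,u] =
c[x,y], which holds at (t,u) by reflexivity. All congruence rules below are instances with a small
term `c`. -/
theorem congr2 {A B C : S.Ty n} {t t' u u' c : Tm S n} (hc : HasTyI (B :: A :: Γ) c C)
    (h₁ : IEq T Γ Θ Φ A t t') (h₂ : IEq T Γ Θ Φ B u u') :
    IEq T Γ Θ Φ C (c.inst2 t u) (c.inst2 t' u') := by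
  have hl := hc.inst2 h₁.left h₂.left
  refine ⟨hl, hc.inst2 h₁.right h₂.right, ?_⟩
  have hφ : FormOk T (B :: A :: Γ) Θ (.eq C ((c.inst2 t u).wk 2) c) := .eq hl.wk2 hc
  have := (IRel.congr (IRel.of_abs hφ h₁.left h₂.left (Φ := Φ) ?_) h₁ h₂).abs_elim hφ
  · simp only [Form.instTm2, Form.subst, Ty.subst_var, Tm.wk2_subst2] at this
    exact this
  · simp only [Form.instTm2, Form.subst, Ty.subst_var, Tm.wk2_subst2]
    exact .eqExt (.refl hl)

theorem app {A B : S.Ty n} {t t' u u' : Tm S n} (h₁ : IEq T Γ Θ Φ (Ty.lolli A B) t t')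
    (h₂ : IEq T Γ Θ Φ A u u') : IEq T Γ Θ Φ B (Tm.app t u) (Tm.app t' u') :=
  congr2 (c := Tm.app (Tm.var 1) (Tm.var 0))
    (HasTyI.app (.var (i := 1) (σ := Ty.lolli A B) (by rfl)) (.var (by rfl))) h₁ h₂

theorem appR {A B : S.Ty n} {t u u' : Tm S n} (h₁ : HasTyI Γ t (Ty.lolli A B))
    (h₂ : IEq T Γ Θ Φ A u u') : IEq T Γ Θ Φ B (Tm.app t u) (Tm.app t u') :=
  app (rfl h₁) h₂

theorem appL {A B : S.Ty n} {t t' u : Tm S n} (h₁ : IEq T Γ Θ Φ (Ty.lolli A B) t t')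
    (h₂ : HasTyI Γ u A) : IEq T Γ Θ Φ B (Tm.app t u) (Tm.app t' u) :=
  app h₁ (rfl h₂)

theorem tensor {A B : S.Ty n} {t t' u u' : Tm S n} (h₁ : IEq T Γ Θ Φ A t t')
    (h₂ : IEq T Γ Θ Φ B u u') :
    IEq T Γ Θ Φ (Ty.tensor A B) (Tm.tensor t u) (Tm.tensor t' u') :=
  congr2 (c := Tm.tensor (Tm.var 1) (Tm.var 0))
    (HasTyI.tensor (.var (i := 1) (by rfl)) (.var (by rfl))) h₁ h₂

theorem bang {A : S.Ty n} {t t' : Tm S n} (h : IEq T Γ Θ Φ A t t') :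
    IEq T Γ Θ Φ (Ty.bang A) (Tm.bang t) (Tm.bang t') :=
  congr2 (c := Tm.bang (Tm.var 0)) (HasTyI.bang (.var (by rfl))) h h

/-! ### Extensionality -/

theorem ext (hext : Extensionality T) {A B : S.Ty n} {f g : Tm S n}
    (hf : HasTyI Γ f (Ty.lolli A B)) (hg : HasTyI Γ g (Ty.lolli A B))
    (h : IEq T (A :: Γ) Θ (Φ.map Form.wk) B (Tm.app (f.wk 1) (Tm.var 0))
      (Tm.app (g.wk 1) (Tm.var 0))) : IEq T Γ Θ Φ (Ty.lolli A B) f g :=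
  ⟨hf, hg, .impE ((hext.1 n Γ Θ A B f g hf hg).mono (by simp)) (.allTmI h.prf)⟩

theorem extPi (hext : Extensionality T) {B : S.Ty (n + 1)} {f g : Tm S n}
    (hf : HasTyI Γ f (Ty.pi B)) (hg : HasTyI Γ g (Ty.pi B))
    (h : IEq T (Γ.map Ty.wk) (Θ.map RelDecl.wk) (Φ.map Form.wkTy) B
      (Tm.tapp f.wkTy (Ty.var 0)) (Tm.tapp g.wkTy (Ty.var 0))) :
    IEq T Γ Θ Φ (Ty.pi B) f g :=
  ⟨hf, hg, .impE ((hext.2 n Γ Θ B f g hf hg).mono (by simp)) (.allTyI h.prf)⟩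

end IEq

/-! ### Equality relations and their reindexings -/

theorem Rel.eqr_formOk (A : S.Ty n) : FormOk T (A :: A :: Γ) Θ
    (Form.eq A (Tm.app ((Tm.idm A).wk 2) (Tm.var 1)) (Tm.var 0)) :=
  .eq (.app (HasTyI.idm A).wk2 (.var (by rfl))) (.var (by rfl))

theorem IRel.eqr_elim {A : S.Ty n} {t u : Tm S n} (h : IRel T Γ Θ Φ (Rel.eqr A) A A t u) :
    IEq T Γ Θ Φ A t u := by
  have := h.abs_elim (Rel.eqr_formOk A)
  simp only [Form.instTm2, Form.subst, Ty.subst_var, Tm.subst, Tm.wk2_subst2, scons_zero] at this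
  exact (ExtEqI.idm h.left).ieq.symm.trans ⟨(HasTyI.idm A).app h.left, h.right, this⟩

theorem IEq.eqr {A : S.Ty n} {t u : Tm S n} (h : IEq T Γ Θ Φ A t u) :
    IRel T Γ Θ Φ (Rel.eqr A) A A t u := by
  refine IRel.of_abs (Rel.eqr_formOk A) h.left h.right ?_
  simp only [Form.instTm2, Form.subst, Ty.subst_var, Tm.subst, Tm.wk2_subst2, scons_zero]
  exact ((ExtEqI.idm h.left).ieq.trans h).prf

/-- The relation `f x = g y`. -/
def Rel.span (A B C : S.Ty n) (f g : Tm S n) : Rel S n := Rel.reindex A B f g (Rel.eqr C)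

section span

variable {A B C : S.Ty n} {f g : Tm S n}

/-- A reindexing of equality is admissible by two of the formation rules. Hence these relations may
be chosen for the relation variable of a polymorphic type, which ranges over admissible relations
only. -/
theorem RelOk.span (hf : HasTyI Γ f (Ty.lolli A C)) (hg : HasTyI Γ g (Ty.lolli B C)) :
    RelOk T true Γ Θ (Rel.span A B C f g) A B := .reindex (.eqr C) hf hg

theorem Rel.reindex_formOk {C D : S.Ty n} {ρ : Rel S n} (ok : RelOk T false Γ Θ ρ C D)
    (hf : HasTyI Γ f (Ty.lolli A C)) (hg : HasTyI Γ g (Ty.lolli B D)) :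
    FormOk T (B :: A :: Γ) Θ (Form.rel (ρ.wk 2) (Tm.app (f.wk 2) (Tm.var 1))
      (Tm.app (g.wk 2) (Tm.var 0))) :=
  .rel (ok.wk2 _ _) (.app hf.wk2 (.var (by rfl))) (.app hg.wk2 (.var (by rfl)))

theorem IRel.reindex_elim {C D : S.Ty n} {ρ : Rel S n} {t u : Tm S n}
    (ok : RelOk T false Γ Θ ρ C D)
    (hf : HasTyI Γ f (Ty.lolli A C)) (hg : HasTyI Γ g (Ty.lolli B D))
    (h : IRel T Γ Θ Φ (Rel.reindex A B f g ρ) A B t u) :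
    IRel T Γ Θ Φ ρ C D (Tm.app f t) (Tm.app g u) := by
  have := h.abs_elim (Rel.reindex_formOk ok hf hg)
  simp only [Form.instTm2, Form.subst, Tm.subst, Tm.wk2_subst2, Rel.wk2_subst2, scons_zero] at this
  exact ⟨ok, hf.app h.left, hg.app h.right, this⟩

theorem IRel.reindex_intro {C D : S.Ty n} {ρ : Rel S n} {t u : Tm S n}
    (hf : HasTyI Γ f (Ty.lolli A C)) (hg : HasTyI Γ g (Ty.lolli B D))
    (ht : HasTyI Γ t A) (hu : HasTyI Γ u B)
    (h : IRel T Γ Θ Φ ρ C D (Tm.app f t) (Tm.app g u)) :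
    IRel T Γ Θ Φ (Rel.reindex A B f g ρ) A B t u := by
  refine IRel.of_abs (Rel.reindex_formOk h.ok hf hg) ht hu ?_
  simp only [Form.instTm2, Form.subst, Tm.subst, Tm.wk2_subst2, Rel.wk2_subst2, scons_zero]
  exact h.prf

theorem IRel.span_elim {t u : Tm S n} (hf : HasTyI Γ f (Ty.lolli A C))
    (hg : HasTyI Γ g (Ty.lolli B C)) (h : IRel T Γ Θ Φ (Rel.span A B C f g) A B t u) :
    IEq T Γ Θ Φ C (Tm.app f t) (Tm.app g u) :=
  (IRel.reindex_elim (.ofAdm (.eqr C)) hf hg h).eqr_elim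

theorem IEq.span {t u : Tm S n} (hf : HasTyI Γ f (Ty.lolli A C)) (hg : HasTyI Γ g (Ty.lolli B C))
    (ht : HasTyI Γ t A) (hu : HasTyI Γ u B) (h : IEq T Γ Θ Φ C (Tm.app f t) (Tm.app g u)) :
    IRel T Γ Θ Φ (Rel.span A B C f g) A B t u :=
  IRel.reindex_intro hf hg ht hu h.eqr

end span

theorem Rel.wk_span (k : ℕ) (A B C : S.Ty n) (f g : Tm S n) :
    (Rel.span A B C f g).wk k = Rel.span A B C (f.wk k) (g.wk k) := by
  simp only [Rel.wk, Rel.span, Rel.ren_reindex, Rel.ren_eqr, Ty.ren_id]; rfl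

theorem Rel.wk_eqr (k : ℕ) (A : S.Ty n) : (Rel.eqr A).wk k = Rel.eqr A := by
  simp only [Rel.wk, Rel.ren_eqr, Ty.ren_id]

/-! ### Function relations -/

section FunctionRelations

variable {A B A' B' : S.Ty n} {ρ ρ' : Rel S n} {f f' : Tm S n}

theorem Rel.lolli_formOk (h : RelOk T false Γ Θ ρ A B) (h' : RelOk T false Γ Θ ρ' A' B') :
    FormOk T (Ty.lolli B B' :: Ty.lolli A A' :: Γ) Θ
      (.allTm A (.allTm B (.imp (.rel (ρ.wk 4) (.var 1) (.var 0))
        (.rel (ρ'.wk 4) (.app (.var 3) (.var 1)) (.app (.var 2) (.var 0)))))) :=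
  .allTm (.allTm (.imp (.rel (h.wk4 _ _ _ _) (.var (by rfl)) (.var (by rfl)))
    (.rel (h'.wk4 _ _ _ _)
      (.app (.var (i := 3) (σ := Ty.lolli A A') (by rfl)) (.var (by rfl)))
      (.app (.var (i := 2) (σ := Ty.lolli B B') (by rfl)) (.var (by rfl))))))

theorem RelOk.lolli (h : RelOk T false Γ Θ ρ A B) (h' : RelOk T false Γ Θ ρ' A' B') :
    RelOk T false Γ Θ (Rel.lolli A B A' B' ρ ρ') (Ty.lolli A A') (Ty.lolli B B') :=
  .abs (Rel.lolli_formOk h h')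

theorem Rel.arr_formOk (h : RelOk T false Γ Θ ρ A B) (h' : RelOk T false Γ Θ ρ' A' B') :
    FormOk T (Ty.arr B B' :: Ty.arr A A' :: Γ) Θ
      (.allTm A (.allTm B (.imp (.rel (ρ.wk 4) (.var 1) (.var 0))
        (.rel (ρ'.wk 4) (.app (.var 3) (.bang (.var 1))) (.app (.var 2) (.bang (.var 0))))))) :=
  .allTm (.allTm (.imp (.rel (h.wk4 _ _ _ _) (.var (by rfl)) (.var (by rfl)))
    (.rel (h'.wk4 _ _ _ _)
      (.app (.var (i := 3) (σ := Ty.arr A A') (by rfl)) (.bang (.var (by rfl))))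
      (.app (.var (i := 2) (σ := Ty.arr B B') (by rfl)) (.bang (.var (by rfl)))))))

theorem RelOk.arr (h : RelOk T false Γ Θ ρ A B) (h' : RelOk T false Γ Θ ρ' A' B') :
    RelOk T false Γ Θ (Rel.arr A B A' B' ρ ρ') (Ty.arr A A') (Ty.arr B B') :=
  .abs (Rel.arr_formOk h h')

theorem Rel.wk4_inst2 (ρ : Rel S n) (t u : Tm S n) :
    (ρ.wk 4).subst Ty.var (Tm.up (Tm.up (scons u (scons t Tm.var))))
      (fun i => (((Rel.var i : Rel S n).wk 2).wk 1).wk 1) = ρ.wk 2 := by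
  simp only [Rel.wk, Rel.subst_ren]
  exact (Rel.ren_eq_subst id (· + 2) id ρ).symm

theorem Form.lolli_inst2 (t u : Tm S n) :
    (Form.allTm A (Form.allTm B (.imp (.rel (ρ.wk 4) (.var 1) (.var 0))
        (.rel (ρ'.wk 4) (.app (.var 3) (.var 1)) (.app (.var 2) (.var 0)))))).instTm2 t u =
      .allTm A (.allTm B (.imp (.rel (ρ.wk 2) (.var 1) (.var 0))
        (.rel (ρ'.wk 2) (.app (t.wk 2) (.var 1)) (.app (u.wk 2) (.var 0))))) := by
  simp only [Form.instTm2, Form.subst, Ty.subst_var, Tm.subst]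
  rw [show t.wk 2 = (t.wk 1).wk 1 from (Tm.wk_wk 1 1 t).symm,
    show u.wk 2 = (u.wk 1).wk 1 from (Tm.wk_wk 1 1 u).symm, ← Rel.wk4_inst2 ρ t u,
    ← Rel.wk4_inst2 ρ' t u]
  rfl

theorem Form.arr_inst2 (t u : Tm S n) :
    (Form.allTm A (Form.allTm B (.imp (.rel (ρ.wk 4) (.var 1) (.var 0))
        (.rel (ρ'.wk 4) (.app (.var 3) (.bang (.var 1)))
          (.app (.var 2) (.bang (.var 0))))))).instTm2 t u =
      .allTm A (.allTm B (.imp (.rel (ρ.wk 2) (.var 1) (.var 0))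
        (.rel (ρ'.wk 2) (.app (t.wk 2) (.bang (.var 1))) (.app (u.wk 2) (.bang (.var 0)))))) := by
  simp only [Form.instTm2, Form.subst, Ty.subst_var, Tm.subst]
  rw [show t.wk 2 = (t.wk 1).wk 1 from (Tm.wk_wk 1 1 t).symm,
    show u.wk 2 = (u.wk 1).wk 1 from (Tm.wk_wk 1 1 u).symm, ← Rel.wk4_inst2 ρ t u,
    ← Rel.wk4_inst2 ρ' t u]
  rfl

theorem IRel.lolli_intro (hρ : RelOk T false Γ Θ ρ A B) (hρ' : RelOk T false Γ Θ ρ' A' B')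
    (hf : HasTyI Γ f (Ty.lolli A A')) (hf' : HasTyI Γ f' (Ty.lolli B B'))
    (h : IRel T (B :: A :: Γ) Θ
      (.rel (ρ.wk 2) (.var 1) (.var 0) :: (Φ.map Form.wk).map Form.wk) (ρ'.wk 2) A' B'
      (.app (f.wk 2) (.var 1)) (.app (f'.wk 2) (.var 0))) :
    IRel T Γ Θ Φ (Rel.lolli A B A' B' ρ ρ') (Ty.lolli A A') (Ty.lolli B B') f f' := by
  refine IRel.of_abs (Rel.lolli_formOk hρ hρ') hf hf' ?_
  rw [Form.lolli_inst2]
  exact .allTmI (.allTmI (.impI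
    (.rel (hρ.wk2 _ _) (.var (by rfl)) (.var (by rfl))) h.prf))

theorem IRel.lolli_elim {a b : Tm S n} (hρ' : RelOk T false Γ Θ ρ' A' B')
    (h : IRel T Γ Θ Φ (Rel.lolli A B A' B' ρ ρ') (Ty.lolli A A') (Ty.lolli B B') f f')
    (hab : IRel T Γ Θ Φ ρ A B a b) : IRel T Γ Θ Φ ρ' A' B' (.app f a) (.app f' b) := by
  have := h.abs_elim (Rel.lolli_formOk hab.ok hρ')
  rw [Form.lolli_inst2] at this
  have := Prf.allTm_inst2 this hab.left hab.right
  simp only [Form.instTm2, Form.subst, Rel.wk2_subst2, Tm.subst, Tm.wk2_subst2] at this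
  exact ⟨hρ', h.left.app hab.left, h.right.app hab.right, .impE this hab.prf⟩

theorem IRel.arr_intro (hρ : RelOk T false Γ Θ ρ A B) (hρ' : RelOk T false Γ Θ ρ' A' B')
    (hf : HasTyI Γ f (Ty.arr A A')) (hf' : HasTyI Γ f' (Ty.arr B B'))
    (h : IRel T (B :: A :: Γ) Θ
      (.rel (ρ.wk 2) (.var 1) (.var 0) :: (Φ.map Form.wk).map Form.wk) (ρ'.wk 2) A' B'
      (.app (f.wk 2) (.bang (.var 1))) (.app (f'.wk 2) (.bang (.var 0)))) :
    IRel T Γ Θ Φ (Rel.arr A B A' B' ρ ρ') (Ty.arr A A') (Ty.arr B B') f f' := by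
  refine IRel.of_abs (Rel.arr_formOk hρ hρ') hf hf' ?_
  rw [Form.arr_inst2]
  exact .allTmI (.allTmI (.impI
    (.rel (hρ.wk2 _ _) (.var (by rfl)) (.var (by rfl))) h.prf))

theorem IRel.arr_elim {a b : Tm S n} (hρ' : RelOk T false Γ Θ ρ' A' B')
    (h : IRel T Γ Θ Φ (Rel.arr A B A' B' ρ ρ') (Ty.arr A A') (Ty.arr B B') f f')
    (hab : IRel T Γ Θ Φ ρ A B a b) :
    IRel T Γ Θ Φ ρ' A' B' (.app f (.bang a)) (.app f' (.bang b)) := by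
  have := h.abs_elim (Rel.arr_formOk hab.ok hρ')
  rw [Form.arr_inst2] at this
  have := Prf.allTm_inst2 this hab.left hab.right
  simp only [Form.instTm2, Form.subst, Rel.wk2_subst2, Tm.subst, Tm.wk2_subst2] at this
  exact ⟨hρ', HasTyI.app h.left hab.left.bang, HasTyI.app h.right hab.right.bang,
    .impE this hab.prf⟩

end FunctionRelations

end Equality

section MoreRelations

variable {T : Theory S} {n : ℕ} {Γ : List (S.Ty n)} {Θ : List (RelDecl S n)}
  {Φ : List (Form S n)}

namespace IRel

theorem ren {m : ℕ} {r : Fin n → Fin m} {e q : ℕ → ℕ} {Γ' : List (S.Ty m)}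
    {Θ' : List (RelDecl S m)} {ρ : Rel S n} {A B : S.Ty n} {t u : Tm S n}
    (h : IRel T Γ Θ Φ ρ A B t u) (hr : CtxRen r e q Γ Θ Γ' Θ') :
    IRel T Γ' Θ' (Φ.map (Form.ren r e q)) (ρ.ren r e q) (A.ren r) (B.ren r) (t.ren r e)
      (u.ren r e) :=
  ⟨h.ok.ren hr, h.left.ren hr.tm, h.right.ren hr.tm, h.prf.ren hr⟩

theorem mono {Φ' : List (Form S n)} {ρ : Rel S n} {A B : S.Ty n} {t u : Tm S n}
    (h : IRel T Γ Θ Φ ρ A B t u) (hΦ : Φ ⊆ Φ') : IRel T Γ Θ Φ' ρ A B t u :=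
  ⟨h.ok, h.left, h.right, h.prf.mono hΦ⟩

theorem wk2 {ρ : Rel S n} {A B : S.Ty n} {t u : Tm S n} (h : IRel T Γ Θ Φ ρ A B t u)
    (C D : S.Ty n) :
    IRel T (D :: C :: Γ) Θ ((Φ.map Form.wk).map Form.wk) (ρ.wk 2) A B (t.wk 2) (u.wk 2) := by
  have := h.ren (CtxRen.shiftTm Γ Θ [D, C])
  rw [Ty.ren_id, Ty.ren_id] at this
  rw [show (Φ.map Form.wk).map Form.wk = Φ.map (Form.ren id (· + 2) id) from by
      rw [List.map_map]; congr 1; funext φ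
      simp only [Form.wk, Function.comp, Form.ren_ren]; rfl]
  exact this

theorem wkAll {ρ : Rel S n} {A B : S.Ty n} {t u : Tm S n} (h : IRel T Γ Θ Φ ρ A B t u)
    (d : RelDecl S (n + 2)) :
    IRel T ((Γ.map Ty.wk).map Ty.wk) (d :: (Θ.map RelDecl.wk).map RelDecl.wk)
      (((Φ.map Form.wkTy).map Form.wkTy).map Form.wkRel) ρ.wkAll A.wk.wk B.wk.wk
      t.wkTy.wkTy u.wkTy.wkTy := by
  have := ((h.ren (CtxRen.shiftTy Γ Θ)).ren (CtxRen.shiftTy _ _)).ren (CtxRen.shiftRel _ _ d)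
  rw [Ty.ren_id, Ty.ren_id, Tm.ren_id, Tm.ren_id] at this
  exact this

end IRel

theorem RelOk.wkAll {b : Bool} {ρ : Rel S n} {A B : S.Ty n} (h : RelOk T b Γ Θ ρ A B)
    (d : RelDecl S (n + 2)) :
    RelOk T b ((Γ.map Ty.wk).map Ty.wk) (d :: (Θ.map RelDecl.wk).map RelDecl.wk)
      ρ.wkAll A.wk.wk B.wk.wk := by
  have := ((h.ren (CtxRen.shiftTy Γ Θ)).ren (CtxRen.shiftTy _ _)).ren (CtxRen.shiftRel _ _ d)
  rw [Ty.ren_id, Ty.ren_id] at this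
  exact this

theorem Rel.wkAll_subst (ρ : Rel S n) (A B : S.Ty n) (R : Rel S n) :
    ρ.wkAll.subst (Ty.cons B (Ty.cons A Ty.var)) Tm.var (scons R Rel.var) = ρ := by
  simp only [Rel.wkAll, Rel.wkTy, Rel.wkRel, Rel.subst_ren]
  exact Rel.subst_var ρ

theorem Rel.ren_lolli {m : ℕ} (r : Fin n → Fin m) (e q : ℕ → ℕ) (σ τ σ' τ' : S.Ty n)
    (ρ ρ' : Rel S n) : (Rel.lolli σ τ σ' τ' ρ ρ').ren r e q = Rel.lolli (σ.ren r) (τ.ren r)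
      (σ'.ren r) (τ'.ren r) (ρ.ren r e q) (ρ'.ren r e q) := by
  simp only [Rel.lolli, Rel.ren, Form.ren, Rel.ren_wk4]; rfl

theorem Rel.ren_arr {m : ℕ} (r : Fin n → Fin m) (e q : ℕ → ℕ) (σ τ σ' τ' : S.Ty n)
    (ρ ρ' : Rel S n) : (Rel.arr σ τ σ' τ' ρ ρ').ren r e q = Rel.arr (σ.ren r) (τ.ren r)
      (σ'.ren r) (τ'.ren r) (ρ.ren r e q) (ρ'.ren r e q) := by
  simp only [Rel.arr, Rel.ren, Form.ren, Rel.ren_wk4]; rfl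

/-! ### Polymorphic relations -/

/-- The type `σ[α]` for the first of two new type variables. -/
def Ty.instFst (σ : S.Ty (n + 1)) : S.Ty (n + 2) :=
  σ.subst (Ty.cons (Ty.var 1) (fun i => Ty.var i.succ.succ))

/-- The type `σ[β]` for the second of two new type variables. -/
def Ty.instSnd (σ : S.Ty (n + 1)) : S.Ty (n + 2) :=
  σ.subst (Ty.cons (Ty.var 0) (fun i => Ty.var i.succ.succ))

theorem Ty.pi_wk_wk (σ : S.Ty (n + 1)) :
    (Ty.pi σ).wk.wk = Ty.pi ((σ.ren (upRen Fin.succ)).ren (upRen Fin.succ)) := rfl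

theorem Ty.instFst_eq (σ : S.Ty (n + 1)) :
    ((σ.ren (upRen Fin.succ)).ren (upRen Fin.succ)).inst (Ty.var 1) = Ty.instFst σ := by
  simp only [Ty.inst, Ty.instFst, Ty.subst_ren]
  congr 1; funext i; exact Fin.cases rfl (fun _ => rfl) i

theorem Ty.instSnd_eq (σ : S.Ty (n + 1)) :
    ((σ.ren (upRen Fin.succ)).ren (upRen Fin.succ)).inst (Ty.var 0) = Ty.instSnd σ := by
  simp only [Ty.inst, Ty.instSnd, Ty.subst_ren]
  congr 1; funext i; exact Fin.cases rfl (fun _ => rfl) i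

theorem HasTyI.tapp_fst {σ : S.Ty (n + 1)} {t : Tm S n} (h : HasTyI Γ t (Ty.pi σ)) :
    HasTyI ((Γ.map Ty.wk).map Ty.wk) (Tm.tapp t.wkTy.wkTy (Ty.var 1)) (Ty.instFst σ) := by
  have := h.wkTy.wkTy
  rw [Ty.pi_wk_wk] at this
  rw [← Ty.instFst_eq]; exact this.tapp _

theorem HasTyI.tapp_snd {σ : S.Ty (n + 1)} {t : Tm S n} (h : HasTyI Γ t (Ty.pi σ)) :
    HasTyI ((Γ.map Ty.wk).map Ty.wk) (Tm.tapp t.wkTy.wkTy (Ty.var 0)) (Ty.instSnd σ) := by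
  have := h.wkTy.wkTy
  rw [Ty.pi_wk_wk] at this
  rw [← Ty.instSnd_eq]; exact this.tapp _

section all

variable {σ τ : S.Ty (n + 1)} {ρ : Rel S (n + 2)} {t u : Tm S n}

theorem Rel.all_formOk
    (h : RelOk T false ((Γ.map Ty.wk).map Ty.wk)
      (⟨true, Ty.var 1, Ty.var 0⟩ :: (Θ.map RelDecl.wk).map RelDecl.wk) ρ
      (Ty.instFst σ) (Ty.instSnd τ)) :
    FormOk T (Ty.pi τ :: Ty.pi σ :: Γ) Θ
      (Form.allTy (Form.allTy (Form.allRel true (Ty.var 1) (Ty.var 0)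
      (Form.rel (ρ.wk 2) (Tm.tapp (Tm.var 1) (Ty.var 1)) (Tm.tapp (Tm.var 0) (Ty.var 0)))))) := by
  refine .allTy (.allTy (.allRel (.rel (h.wk2 _ _) ?_ ?_)))
  · exact HasTyI.tapp_fst (t := Tm.var 1) (.var (by rfl))
  · exact HasTyI.tapp_snd (t := Tm.var 0) (.var (by rfl))

theorem Ty.up_var' : Ty.up (Ty.var : Fin n → S.Ty n) = Ty.var := by
  funext i; exact Fin.cases rfl (fun _ => rfl) i

theorem Rel.up_var' : Rel.up (Rel.var : ℕ → Rel S n) = Rel.var := by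
  funext i; cases i <;> rfl

theorem Form.all_inst2 (t u : Tm S n) :
    (Form.allTy (Form.allTy (Form.allRel true (Ty.var 1) (Ty.var 0)
      (Form.rel (ρ.wk 2) (Tm.tapp (Tm.var 1) (Ty.var 1))
        (Tm.tapp (Tm.var 0) (Ty.var 0)))))).instTm2 t u =
    Form.allTy (Form.allTy (Form.allRel true (Ty.var 1) (Ty.var 0)
      (Form.rel ρ (Tm.tapp t.wkTy.wkTy (Ty.var 1)) (Tm.tapp u.wkTy.wkTy (Ty.var 0))))) := by
  simp only [Form.instTm2, Form.subst, Ty.up_var', Ty.subst_var, Tm.subst, Rel.wk, Rel.subst_ren]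
  have : ρ.subst (Ty.var ∘ id) ((fun i => ((scons u (scons t Tm.var) i : Tm S n).wkTy).wkTy) ∘
      (fun x => x + 2)) ((Rel.up fun i => ((Rel.var i : Rel S n).wkTy).wkTy) ∘ id) = ρ := by
    rw [show (Rel.up fun i => ((Rel.var i : Rel S n).wkTy).wkTy) = Rel.var from Rel.up_var']
    exact Rel.subst_var ρ
  rw [this]
  rfl

theorem IRel.all_intro (ht : HasTyI Γ t (Ty.pi σ)) (hu : HasTyI Γ u (Ty.pi τ))
    (h : IRel T ((Γ.map Ty.wk).map Ty.wk)
      (⟨true, Ty.var 1, Ty.var 0⟩ :: (Θ.map RelDecl.wk).map RelDecl.wk)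
      (((Φ.map Form.wkTy).map Form.wkTy).map Form.wkRel) ρ (Ty.instFst σ) (Ty.instSnd τ)
      (Tm.tapp t.wkTy.wkTy (Ty.var 1)) (Tm.tapp u.wkTy.wkTy (Ty.var 0))) :
    IRel T Γ Θ Φ (Rel.all σ τ ρ) (Ty.pi σ) (Ty.pi τ) t u := by
  refine IRel.of_abs (Rel.all_formOk h.ok) ht hu ?_
  rw [Form.all_inst2]
  exact .allTyI (.allTyI (.allRelI h.prf))

theorem Tm.wkTy_wkTy_subst (t : Tm S n) (A B : S.Ty n) :
    t.wkTy.wkTy.subst (Ty.cons B (Ty.cons A Ty.var)) Tm.var = t := by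
  simp only [Tm.wkTy, Tm.subst_ren]; exact Tm.subst_var t

theorem IRel.all_elim {A B : S.Ty n} {R : Rel S n}
    (hρ : RelOk T false ((Γ.map Ty.wk).map Ty.wk)
      (⟨true, Ty.var 1, Ty.var 0⟩ :: (Θ.map RelDecl.wk).map RelDecl.wk) ρ
      (Ty.instFst σ) (Ty.instSnd τ))
    (h : IRel T Γ Θ Φ (Rel.all σ τ ρ) (Ty.pi σ) (Ty.pi τ) t u) (hR : RelOk T true Γ Θ R A B) :
    Prf T Γ Θ Φ (.rel (ρ.subst (Ty.cons B (Ty.cons A Ty.var)) Tm.var (scons R Rel.var))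
      (Tm.tapp t A) (Tm.tapp u B)) := by
  have := h.abs_elim (Rel.all_formOk hρ)
  rw [Form.all_inst2] at this
  have := Prf.allAdm_inst this hR
  simp only [Form.subst, Tm.subst, Tm.wkTy_wkTy_subst] at this
  exact this

end all

/-! ### The relation `!ρ` -/

section bang

variable {A B : S.Ty n} {ρ : Rel S n}

theorem Ty.wk_instFst (σ : S.Ty n) : Ty.instFst σ.wk = σ.wk.wk := by
  simp only [Ty.instFst, Ty.wk, Ty.subst_ren, Ty.ren_ren]
  rw [Ty.ren_eq_subst]; rfl

theorem Ty.wk_instSnd (σ : S.Ty n) : Ty.instSnd σ.wk = σ.wk.wk := by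
  simp only [Ty.instSnd, Ty.wk, Ty.subst_ren, Ty.ren_ren]
  rw [Ty.ren_eq_subst]; rfl

theorem TCtx.NoLin.off {Γ : TCtx S n} (h : Γ.NoLin) (A : S.Ty n) :
    TCtx.NoLin ((Use.off, A) :: Γ) := by
  rintro p hp
  rcases List.mem_cons.1 hp with rfl | hp
  · simp
  · exact h p hp

theorem TCtx.NoLin.int {Γ : TCtx S n} (h : Γ.NoLin) (A : S.Ty n) :
    TCtx.NoLin ((Use.int, A) :: Γ) := by
  rintro p hp
  rcases List.mem_cons.1 hp with rfl | hp
  · simp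
  · exact h p hp

theorem HasTy.lvar1 {Γ : TCtx S n} {σ A : S.Ty n} {u : Use} (hu : u ≠ Use.lin) (h : Γ.NoLin) :
    HasTy ((u, A) :: (Use.lin, σ) :: Γ) (Tm.var 1) σ :=
  .lvar (by rfl) fun j p hj hp => by
    match j with
    | 0 => simp at hj; subst hj; exact absurd hp hu
    | 1 => rfl
    | j + 2 => exact absurd hp (h p (List.mem_of_getElem? hj))

theorem HasTy.lvar2 {Γ : TCtx S n} {σ A B : S.Ty n} {u v : Use} (hu : u ≠ Use.lin)
    (hv : v ≠ Use.lin) (h : Γ.NoLin) :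
    HasTy ((u, A) :: (v, B) :: (Use.lin, σ) :: Γ) (Tm.var 2) σ :=
  .lvar (by rfl) fun j p hj hp => by
    match j with
    | 0 => simp at hj; subst hj; exact absurd hp hu
    | 1 => simp at hj; subst hj; exact absurd hp hv
    | 2 => rfl
    | j + 3 => exact absurd hp (h p (List.mem_of_getElem? hj))

theorem TCtx.wkTy_cons (u : Use) (A : S.Ty n) (Γ : TCtx S n) :
    TCtx.wkTy ((u, A) :: Γ) = (u, A.wk) :: Γ.wkTy := rfl

theorem HasTyI.bangMap_body (A : S.Ty n) : HasTy ((Use.lin, Ty.bang A) :: intCtx Γ)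
    (Tm.tlam (Tm.lam (Ty.arr A.wk (Ty.var 0)) (Tm.app (Tm.var 0) (Tm.var 1))))
    (Ty.pi (Ty.lolli (Ty.arr A.wk (Ty.var 0)) (Ty.var 0))) := by
  refine .tlam ?_
  rw [TCtx.wkTy_cons, intCtx_wkTy]
  exact .lam (.app (.left _ (.right _ (intCtx_split _))) (.lvar0 ((intCtx_noLin _).off _))
    (.lvar1 (by simp) (intCtx_noLin _)))

theorem HasTyI.bangMap (A : S.Ty n) : HasTyI Γ (Rel.bangMap A)
    (Ty.lolli (Ty.bang A) (Ty.pi (Ty.lolli (Ty.arr A.wk (Ty.var 0)) (Ty.var 0)))) :=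
  .lam (HasTyI.bangMap_body A)

theorem Ty.arr_wk_inst (A C : S.Ty n) : (Ty.arr A.wk (Ty.var 0)).inst C = Ty.arr A C := by
  simp only [Ty.arr, Ty.inst, Ty.subst, Ty.wk_subst_cons, Ty.subst_var]; rfl

/-- `f x : C`, obtained from the encoding of `x : !A`. -/
theorem ExtEqI.bangMap {C : S.Ty n} {x f : Tm S n} (hx : HasTyI Γ x (Ty.bang A))
    (hf : HasTyI Γ f (Ty.arr A C)) :
    ExtEqI Γ (Tm.app (Tm.tapp (Tm.app (Rel.bangMap A) x) C) f) (Tm.app f x) C := by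
  have h₁ := ExtEqI.beta (HasTyI.bangMap_body A) hx
  have hb : HasTyI (Γ.map Ty.wk) (Tm.lam (Ty.arr A.wk (Ty.var 0))
      (Tm.app (Tm.var 0) (x.wkTy.wk 1))) (Ty.lolli (Ty.arr A.wk (Ty.var 0)) (Ty.var 0)) :=
    .lam (.app (.left _ (intCtx_split _)) (.lvar0 (intCtx_noLin _)) (hx.wkTy.off1 (by simp)))
  have hc : HasTy ((Use.lin, Ty.arr A C) :: intCtx Γ) (Tm.app (Tm.var 0) (x.wk 1)) C :=
    .app (.left _ (intCtx_split _)) (.lvar0 (intCtx_noLin _)) (hx.off1 (by simp))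
  have h₂ := ExtEqI.betaT hb C
  have h₃ := ExtEqI.beta hc hf
  have e₁ : (Tm.tlam (Tm.lam (Ty.arr A.wk (Ty.var 0)) (Tm.app (Tm.var 0) (Tm.var 1)))).inst x =
      Tm.tlam (Tm.lam (Ty.arr A.wk (Ty.var 0)) (Tm.app (Tm.var 0) (x.wkTy.wk 1))) := by
    simp only [Tm.inst, Tm.subst, Ty.up_var', Ty.subst_var]; rfl
  have e₂ : (Tm.lam (Ty.arr A.wk (Ty.var 0)) (Tm.app (Tm.var 0) (x.wkTy.wk 1))).instTy C =
      Tm.lam (Ty.arr A C) (Tm.app (Tm.var 0) (x.wk 1)) := by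
    have := Ty.arr_wk_inst A C
    simp only [Tm.instTy, Tm.subst, Ty.inst, Tm.wk_subst_up] at this ⊢
    rw [this, ← Tm.instTy, Tm.wkTy_instTy]; rfl
  have e₃ : (Tm.app (Tm.var 0) (x.wk 1)).inst f = Tm.app f x := by
    have := Tm.wk_inst x f
    simp only [Tm.inst, Tm.subst, scons_zero] at this ⊢
    rw [this]
  rw [e₁] at h₁
  rw [e₂] at h₂
  rw [e₃] at h₃
  have h₄ := ExtEq.trans (ExtEqI.tapp h₁ C) h₂
  have : (Ty.lolli (Ty.arr A.wk (Ty.var 0)) (Ty.var 0)).inst C = Ty.lolli (Ty.arr A C) C :=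
    congrArg₂ Ty.lolli (Ty.arr_wk_inst A C) rfl
  rw [this] at h₄
  exact ExtEq.trans (ExtEqI.app h₄ (.refl hf)) h₃

theorem Rel.bang_body_ok {B : S.Ty n} (h : RelOk T false Γ Θ ρ A B) :
    RelOk T false ((Γ.map Ty.wk).map Ty.wk)
      (⟨true, Ty.var 1, Ty.var 0⟩ :: (Θ.map RelDecl.wk).map RelDecl.wk)
      (Rel.lolli (Ty.arr A.wk.wk (Ty.var 1)) (Ty.arr B.wk.wk (Ty.var 0)) (Ty.var 1) (Ty.var 0)
        (Rel.arr A.wk.wk B.wk.wk (Ty.var 1) (Ty.var 0) ρ.wkAll (Rel.var 0)) (Rel.var 0))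
      (Ty.instFst (Ty.lolli (Ty.arr A.wk (Ty.var 0)) (Ty.var 0)))
      (Ty.instSnd (Ty.lolli (Ty.arr B.wk (Ty.var 0)) (Ty.var 0))) := by
  have hv : RelOk T false ((Γ.map Ty.wk).map Ty.wk)
      (⟨true, Ty.var 1, Ty.var 0⟩ :: (Θ.map RelDecl.wk).map RelDecl.wk) (Rel.var 0)
      (Ty.var 1 : S.Ty (n + 2)) (Ty.var 0) := .ofAdm (.var rfl)
  have := RelOk.lolli (RelOk.arr (h.wkAll ⟨true, Ty.var 1, Ty.var 0⟩) hv) hv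
  rw [← Ty.wk_instFst A, ← Ty.wk_instSnd B] at this ⊢
  exact this

theorem RelOk.bang {B : S.Ty n} (h : RelOk T false Γ Θ ρ A B) :
    RelOk T false Γ Θ (Rel.bang A B ρ) (Ty.bang A) (Ty.bang B) :=
  .abs (Rel.reindex_formOk (.abs (Rel.all_formOk (Rel.bang_body_ok h))) (.bangMap A) (.bangMap B))

/-- By definition !ρ is (ρ → R) ⊸ R for all admissible R, pulled back along the encoding of !.
Instantiating R and applying the result to f and g gives related values of the encodings, and these
reduce to f x and g y. This is why the target relation has to be admissible. -/
theorem IRel.bang_elim {B C D : S.Ty n} {R : Rel S n} {x y f g : Tm S n}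
    (hρ : RelOk T false Γ Θ ρ A B) (h : IRel T Γ Θ Φ (Rel.bang A B ρ) (Ty.bang A) (Ty.bang B) x y)
    (hR : RelOk T true Γ Θ R C D)
    (hf : IRel T Γ Θ Φ (Rel.arr A B C D ρ R) (Ty.arr A C) (Ty.arr B D) f g) :
    IRel T Γ Θ Φ R C D (Tm.app f x) (Tm.app g y) := by
  have ok := Rel.bang_body_ok hρ
  have h₁ := IRel.reindex_elim (.abs (Rel.all_formOk ok)) (.bangMap A) (.bangMap B) h
  have h₂ := IRel.all_elim ok h₁ hR
  rw [Rel.subst_lolli, Rel.subst_arr, Rel.wkAll_subst] at h₂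
  have eA : A.wk.wk.subst (Ty.cons D (Ty.cons C Ty.var)) = A := by
    simp only [Ty.wk_subst_cons, Ty.subst_var]
  have eB : B.wk.wk.subst (Ty.cons D (Ty.cons C Ty.var)) = B := by
    simp only [Ty.wk_subst_cons, Ty.subst_var]
  simp only [Ty.arr, Ty.subst, eA, eB] at h₂
  have tx := h₁.left.tapp C
  have ty := h₁.right.tapp D
  have : ∀ A C : S.Ty n, (Ty.lolli (Ty.arr A.wk (Ty.var 0)) (Ty.var 0)).inst C =
      Ty.lolli (Ty.arr A C) C := fun A C =>
    congrArg₂ Ty.lolli (Ty.arr_wk_inst A C) rfl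
  rw [this] at tx ty
  have h₃ : IRel T Γ Θ Φ _ (Ty.lolli (Ty.arr A C) C) (Ty.lolli (Ty.arr B D) D) _ _ :=
    ⟨RelOk.lolli (RelOk.arr hρ (.ofAdm hR)) (.ofAdm hR), tx, ty, h₂⟩
  have h₄ := h₃.lolli_elim (.ofAdm hR) hf
  exact h₄.congr (ExtEqI.bangMap h.left hf.left).ieq (ExtEqI.bangMap h.right hf.right).ieq

theorem Rel.bangMap_ren {m : ℕ} (r : Fin n → Fin m) (e : ℕ → ℕ) (A : S.Ty n) :
    (Rel.bangMap A).ren r e = Rel.bangMap (A.ren r) := by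
  simp only [Rel.bangMap, Tm.ren, Ty.ren, Ty.arr, Ty.wk_ren]; rfl

/-- Given a generic admissible R and functions related by ρ → R, the encodings of !a and !b reduce
to these functions at !a and !b, which R relates because ρ relates a and b. -/
theorem IRel.bang_intro {B : S.Ty n} {a b : Tm S n} (h : IRel T Γ Θ Φ ρ A B a b) :
    IRel T Γ Θ Φ (Rel.bang A B ρ) (Ty.bang A) (Ty.bang B) (Tm.bang a) (Tm.bang b) := by
  have ha := h.left.bang
  have hb := h.right.bang
  refine IRel.reindex_intro (.bangMap A) (.bangMap B) ha hb ?_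
  refine IRel.all_intro (HasTyI.app (.bangMap A) ha) (HasTyI.app (.bangMap B) hb) ?_
  have h' := h.wkAll (⟨true, Ty.var 1, Ty.var 0⟩ : RelDecl S (n + 2))
  have hv : RelOk T false ((Γ.map Ty.wk).map Ty.wk)
      (⟨true, Ty.var 1, Ty.var 0⟩ :: (Θ.map RelDecl.wk).map RelDecl.wk) (Rel.var 0)
      (Ty.var 1 : S.Ty (n + 2)) (Ty.var 0) := .ofAdm (.var rfl)
  have ta := HasTyI.tapp_fst (HasTyI.app (.bangMap A) ha)
  have tb := HasTyI.tapp_snd (HasTyI.app (.bangMap B) hb)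
  have ea : Ty.instFst (Ty.lolli (Ty.arr A.wk (Ty.var 0)) (Ty.var 0)) =
      Ty.lolli (Ty.arr A.wk.wk (Ty.var 1)) (Ty.var 1) := by
    rw [← Ty.wk_instFst A]; rfl
  have eb : Ty.instSnd (Ty.lolli (Ty.arr B.wk (Ty.var 0)) (Ty.var 0)) =
      Ty.lolli (Ty.arr B.wk.wk (Ty.var 0)) (Ty.var 0) := by
    rw [← Ty.wk_instSnd B]; rfl
  rw [ea] at ta ⊢
  rw [eb] at tb ⊢
  refine IRel.lolli_intro (RelOk.arr h'.ok hv) hv ta tb ?_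
  have hhyp := IRel.hyp0 (Φ := ((((Φ.map Form.wkTy).map Form.wkTy).map Form.wkRel).map
    Form.wk).map Form.wk) (RelOk.arr h'.ok hv)
  have e : (Rel.arr A.wk.wk B.wk.wk (Ty.var 1) (Ty.var 0) ρ.wkAll (Rel.var 0)).wk 2 =
      Rel.arr A.wk.wk B.wk.wk (Ty.var 1) (Ty.var 0) (ρ.wkAll.wk 2) (Rel.var 0) := by
    simp only [Rel.wk, Rel.ren_arr, Ty.ren_id]; rfl
  rw [e] at hhyp ⊢
  have hab := (h'.wk2 (Ty.arr A.wk.wk (Ty.var 1)) (Ty.arr B.wk.wk (Ty.var 0))).mono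
    (List.subset_cons_self (Form.rel (Rel.arr A.wk.wk B.wk.wk (Ty.var 1) (Ty.var 0)
      (ρ.wkAll.wk 2) (Rel.var 0)) (.var 1) (.var 0)) _)
  -- The hypothetical related functions are the two new variables, applied at the weakened pair `a`,
  -- `b`.
  have key := hhyp.arr_elim (hv.wk2 _ _) hab
  have wm : ∀ A : S.Ty n, ((Rel.bangMap A).wkTy.wkTy).wk 2 = Rel.bangMap A.wk.wk := fun A => by
    simp only [Tm.wkTy, Tm.wk, Rel.bangMap_ren, Ty.ren_id]; rfl
  refine key.congr ?_ ?_
  · have := (ExtEqI.bangMap (hab.left.bang) hhyp.left).ieq (T := T)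
      (Θ := ⟨true, Ty.var 1, Ty.var 0⟩ :: (Θ.map RelDecl.wk).map RelDecl.wk)
      (Φ := (Form.rel (Rel.arr A.wk.wk B.wk.wk (Ty.var 1) (Ty.var 0)
      (ρ.wkAll.wk 2) (Rel.var 0)) (.var 1) (.var 0)) :: ((((Φ.map Form.wkTy).map
        Form.wkTy).map Form.wkRel).map Form.wk).map Form.wk)
    rw [← wm A] at this
    exact this.symm
  · have := (ExtEqI.bangMap (hab.right.bang) hhyp.right).ieq (T := T)
      (Θ := ⟨true, Ty.var 1, Ty.var 0⟩ :: (Θ.map RelDecl.wk).map RelDecl.wk)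
      (Φ := (Form.rel (Rel.arr A.wk.wk B.wk.wk (Ty.var 1) (Ty.var 0)
      (ρ.wkAll.wk 2) (Rel.var 0)) (.var 1) (.var 0)) :: ((((Φ.map Form.wkTy).map
        Form.wkTy).map Form.wkRel).map Form.wk).map Form.wk)
    rw [← wm B] at this
    exact this.symm

end bang

end MoreRelations

/-! ## Evaluation of substitutions -/

section Evaluation

variable {n m : ℕ}

attribute [simp] Ty.up_var' Tm.subst_var Tm.wk_inst Tm.wk2_subst2

@[simp] theorem scons_one {X : Type u} (a : X) (f : ℕ → X) : scons a f 1 = f 0 := rfl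
@[simp] theorem scons_two {X : Type u} (a : X) (f : ℕ → X) : scons a f 2 = f 1 := rfl
@[simp] theorem scons_three {X : Type u} (a : X) (f : ℕ → X) : scons a f 3 = f 2 := rfl

@[simp] theorem Tm.up_zero (e : ℕ → Tm S n) : Tm.up e 0 = Tm.var 0 := rfl
@[simp] theorem Tm.up_one (e : ℕ → Tm S n) : Tm.up e 1 = (e 0).wk 1 := rfl
@[simp] theorem Tm.up_two (e : ℕ → Tm S n) : Tm.up e 2 = (e 1).wk 1 := rfl
@[simp] theorem Tm.up_three (e : ℕ → Tm S n) : Tm.up e 3 = (e 2).wk 1 := rfl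

@[simp] theorem Tm.up_var' : Tm.up (Tm.var : ℕ → Tm S n) = Tm.var := by
  funext i; cases i <;> rfl

@[simp] theorem Tm.wk_var (k i : ℕ) : (Tm.var i : Tm S n).wk k = Tm.var (i + k) := rfl
@[simp] theorem Tm.wkTy_var (i : ℕ) : (Tm.var i : Tm S n).wkTy = Tm.var i := rfl

@[simp] theorem Tm.wkTy_var_fun : (fun i => (Tm.var i : Tm S n).wkTy) = Tm.var := rfl

@[simp] theorem Tm.wkTy_scons (u : Tm S n) (e : ℕ → Tm S n) :
    (fun i => (scons u e i).wkTy) = scons u.wkTy (fun i => (e i).wkTy) := by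
  funext i; cases i <;> rfl

@[simp] theorem Tm.wkTy_up (e : ℕ → Tm S n) :
    (fun i => (Tm.up e i).wkTy) = Tm.up (fun i => (e i).wkTy) := by
  funext i
  cases i
  · rfl
  · exact Tm.wk_wkTy 1 _

theorem Tm.wk_two (t : Tm S n) : t.wk 2 = (t.wk 1).wk 1 := (Tm.wk_wk 1 1 t).symm
theorem Tm.wk_three (t : Tm S n) : t.wk 3 = ((t.wk 1).wk 1).wk 1 := by
  rw [Tm.wk_wk, Tm.wk_wk]

@[simp] theorem Tm.wk_subst_scons (s : Fin n → S.Ty m) (u : Tm S m) (e : ℕ → Tm S m)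
    (t : Tm S n) : (t.wk 1).subst s (scons u e) = t.subst s e := by
  rw [Tm.wk, Tm.subst_ren]; rfl

@[simp] theorem Tm.wk_one_subst_up (s : Fin n → S.Ty m) (e : ℕ → Tm S m)
    (t : Tm S n) : (t.wk 1).subst s (Tm.up e) = (t.subst s e).wk 1 := Tm.wk_subst_up s e t

@[simp] theorem Tm.wk_two_subst_up (s : Fin n → S.Ty m) (e : ℕ → Tm S m)
    (t : Tm S n) : (t.wk 2).subst s (Tm.up e) = ((t.wk 1).subst s e).wk 1 := by
  rw [Tm.wk_two, Tm.wk_one_subst_up]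

@[simp] theorem Tm.wk_three_subst_up (s : Fin n → S.Ty m) (e : ℕ → Tm S m)
    (t : Tm S n) : (t.wk 3).subst s (Tm.up e) = ((t.wk 2).subst s e).wk 1 := by
  rw [Tm.wk_three, Tm.wk_one_subst_up, ← Tm.wk_two]

@[simp] theorem Tm.wkTy_subst_cons (A : S.Ty m) (s : Fin n → S.Ty m) (e : ℕ → Tm S m)
    (t : Tm S n) : t.wkTy.subst (Ty.cons A s) e = t.subst s e := by
  rw [Tm.wkTy, Tm.subst_ren]; rfl

@[simp] theorem Tm.wk_subst_var (s : Fin n → S.Ty m) (k : ℕ) (t : Tm S n) :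
    (t.wk k).subst s Tm.var = (t.subst s Tm.var).wk k := by
  rw [Tm.wk, Tm.subst_ren, Tm.wk, Tm.ren_subst]
  congr 1
  funext i; exact (Ty.ren_id _).symm

attribute [simp] Ty.wk_subst_cons

end Evaluation

/-! ## Inversion of typing and reduction -/

section Inversion

variable {n : ℕ} {Γ : List (S.Ty n)}

theorem TCtx.NoLin.split_eq {Γ Γ₁ Γ₂ : TCtx S n} (h : Γ.NoLin) (hs : Split Γ Γ₁ Γ₂) :
    Γ₁ = Γ ∧ Γ₂ = Γ := by
  induction hs with
  | nil => exact ⟨rfl, rfl⟩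
  | int σ _ ih =>
      obtain ⟨rfl, rfl⟩ := ih fun p hp => h p (List.mem_cons_of_mem _ hp)
      exact ⟨rfl, rfl⟩
  | left σ _ _ => exact absurd rfl (h _ List.mem_cons_self)
  | right σ _ _ => exact absurd rfl (h _ List.mem_cons_self)
  | off σ _ ih =>
      obtain ⟨rfl, rfl⟩ := ih fun p hp => h p (List.mem_cons_of_mem _ hp)
      exact ⟨rfl, rfl⟩

namespace HasTyI

theorem app_inv {t u : Tm S n} {τ : S.Ty n} (h : HasTyI Γ (Tm.app t u) τ) :
    ∃ σ, HasTyI Γ t (Ty.lolli σ τ) ∧ HasTyI Γ u σ := by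
  unfold HasTyI at h
  cases h with
  | app hs ht hu =>
      obtain ⟨rfl, rfl⟩ := (intCtx_noLin Γ).split_eq hs
      exact ⟨_, ht, hu⟩

theorem lam_inv {t : Tm S n} {σ τ : S.Ty n} (h : HasTyI Γ (Tm.lam σ t) τ) :
    ∃ τ', τ = Ty.lolli σ τ' ∧ HasTy ((Use.lin, σ) :: intCtx Γ) t τ' := by
  unfold HasTyI at h
  cases h with
  | lam h => exact ⟨_, rfl, h⟩

theorem tlam_inv {t : Tm S (n + 1)} {τ : S.Ty n} (h : HasTyI Γ (Tm.tlam t) τ) :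
    ∃ τ', τ = Ty.pi τ' ∧ HasTyI (Γ.map Ty.wk) t τ' := by
  unfold HasTyI at h
  cases h with
  | tlam h => exact ⟨_, rfl, by rw [intCtx_wkTy] at h; exact h⟩

theorem tapp_inv {t : Tm S n} {σ τ : S.Ty n} (h : HasTyI Γ (Tm.tapp t σ) τ) :
    ∃ τ', τ = τ'.inst σ ∧ HasTyI Γ t (Ty.pi τ') := by
  unfold HasTyI at h
  cases h with
  | tapp _ h => exact ⟨_, rfl, h⟩

theorem bang_inv {t : Tm S n} {τ : S.Ty n} (h : HasTyI Γ (Tm.bang t) τ) :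
    ∃ σ, τ = Ty.bang σ ∧ HasTyI Γ t σ := by
  unfold HasTyI at h
  cases h with
  | bang _ h => exact ⟨_, rfl, h⟩

theorem tensor_inv {t u : Tm S n} {τ : S.Ty n} (h : HasTyI Γ (Tm.tensor t u) τ) :
    ∃ σ σ', τ = Ty.tensor σ σ' ∧ HasTyI Γ t σ ∧ HasTyI Γ u σ' := by
  unfold HasTyI at h
  cases h with
  | tensor hs ht hu =>
      obtain ⟨rfl, rfl⟩ := (intCtx_noLin Γ).split_eq hs
      exact ⟨_, _, rfl, ht, hu⟩

theorem letBang_inv {s t : Tm S n} {τ : S.Ty n} (h : HasTyI Γ (Tm.letBang s t) τ) :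
    ∃ σ, HasTyI Γ s (Ty.bang σ) ∧ HasTyI (σ :: Γ) t τ := by
  unfold HasTyI at h
  cases h with
  | letBang hs h₁ h₂ =>
      obtain ⟨rfl, rfl⟩ := (intCtx_noLin Γ).split_eq hs
      exact ⟨_, h₁, h₂⟩

theorem letTensor_inv {s t : Tm S n} {τ : S.Ty n} (h : HasTyI Γ (Tm.letTensor s t) τ) :
    ∃ σ σ', HasTyI Γ s (Ty.tensor σ σ') ∧
      HasTy ((Use.lin, σ') :: (Use.lin, σ) :: intCtx Γ) t τ := by
  unfold HasTyI at h
  cases h with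
  | letTensor hs h₁ h₂ =>
      obtain ⟨rfl, rfl⟩ := (intCtx_noLin Γ).split_eq hs
      exact ⟨_, _, h₁, h₂⟩

end HasTyI

namespace ExtEqI

/-- Inversion recovers the argument type from the typing of the redex. So chains of reductions can
be run on terms alone, each equation supplying the typing that the next one needs. -/
theorem lamβ {σ τ : S.Ty n} {t u : Tm S n} (h : HasTyI Γ (Tm.app (Tm.lam σ t) u) τ) :
    ExtEqI Γ (Tm.app (Tm.lam σ t) u) (t.inst u) τ := by
  obtain ⟨κ, h₁, h₂⟩ := h.app_inv
  obtain ⟨κ', e, h₁⟩ := h₁.lam_inv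
  cases e
  exact beta h₁ h₂

theorem tlamβ {σ τ : S.Ty n} {t : Tm S (n + 1)} (h : HasTyI Γ (Tm.tapp (Tm.tlam t) σ) τ) :
    ExtEqI Γ (Tm.tapp (Tm.tlam t) σ) (t.instTy σ) τ := by
  obtain ⟨τ', rfl, h₁⟩ := h.tapp_inv
  obtain ⟨κ', e, h₁⟩ := h₁.tlam_inv
  cases e
  exact betaT h₁ σ

theorem bangβ {τ : S.Ty n} {t u : Tm S n} (h : HasTyI Γ (Tm.letBang (Tm.bang u) t) τ) :
    ExtEqI Γ (Tm.letBang (Tm.bang u) t) (t.inst u) τ := by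
  obtain ⟨κ, h₁, h₂⟩ := h.letBang_inv
  obtain ⟨κ', e, h₁⟩ := h₁.bang_inv
  cases e
  exact betaBang h₂ h₁

theorem tensorβ {τ : S.Ty n} {t s u : Tm S n}
    (h : HasTyI Γ (Tm.letTensor (Tm.tensor s u) t) τ) :
    ExtEqI Γ (Tm.letTensor (Tm.tensor s u) t) (t.inst2 s u) τ := by
  obtain ⟨κ, κ', h₁, h₂⟩ := h.letTensor_inv
  obtain ⟨_, _, e, h₁, h₃⟩ := h₁.tensor_inv
  cases e
  exact betaTensor h₂ h₁ h₃

theorem ilamβ {σ τ : S.Ty n} {t u : Tm S n}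
    (h : HasTyI Γ (Tm.app (Tm.ilam σ t) (Tm.bang u)) τ) :
    ExtEqI Γ (Tm.app (Tm.ilam σ t) (Tm.bang u)) (t.inst u) τ := by
  have h₁ := lamβ h
  have e : (Tm.letBang (Tm.var 0) (t.ren id (upN Nat.succ))).inst (Tm.bang u) =
      Tm.letBang (Tm.bang u) t := by
    simp only [Tm.inst, Tm.subst, scons_zero, Tm.subst_ren]
    congr 1
    conv_rhs => rw [← Tm.subst_var t]
    congr 1
    funext i; cases i <;> rfl
  rw [e] at h₁
  exact .trans h₁ (bangβ h₁.hasTy.2)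

end ExtEqI

end Inversion

section Tensor

variable {T : Theory S} {n : ℕ} {Γ : List (S.Ty n)} {Θ : List (RelDecl S n)}
  {Φ : List (Form S n)} {A A' B B' C D : S.Ty n} {ρ ρ' R : Rel S n}

/-! ### The relation `ρ ⊗ ρ'` -/

/-- The curried form `λ° x. λ° y. h (x ⊗ y)` of `h`. -/
def Tm.curry (A A' : S.Ty n) (h : Tm S n) : Tm S n :=
  Tm.lam A (Tm.lam A' (Tm.app (h.wk 2) (Tm.tensor (Tm.var 1) (Tm.var 0))))

theorem Tm.curry_ren {m : ℕ} (r : Fin n → Fin m) (e : ℕ → ℕ) (h : Tm S n) :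
    (Tm.curry A A' h).ren r e = Tm.curry (A.ren r) (A'.ren r) (h.ren r e) := by
  simp only [Tm.curry, Tm.ren, Tm.wk_two, Tm.wk_ren_upN]; rfl

theorem Tm.curry_wk (k : ℕ) (h : Tm S n) : (Tm.curry A A' h).wk k = Tm.curry A A' (h.wk k) := by
  rw [Tm.wk, Tm.curry_ren, Ty.ren_id, Ty.ren_id]; rfl

theorem HasTyI.curry {h : Tm S n} (hh : HasTyI Γ h (Ty.lolli (Ty.tensor A A') C)) :
    HasTyI Γ (Tm.curry A A' h) (Ty.lolli A (Ty.lolli A' C)) :=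
  .lam (.lam (.app (.right _ (.right _ (intCtx_split _))) (hh.off2 (by simp) (by simp))
    (.tensor (.right _ (.left _ (intCtx_split _))) (.lvar1 (by simp) (intCtx_noLin _))
      (.lvar0 ((intCtx_noLin _).off _)))))

theorem ExtEqI.curry {h a b : Tm S n} (hh : HasTyI Γ h (Ty.lolli (Ty.tensor A A') C))
    (ha : HasTyI Γ a A) (hb : HasTyI Γ b A') :
    ExtEqI Γ (Tm.app (Tm.app (Tm.curry A A' h) a) b) (Tm.app h (Tm.tensor a b)) C := by
  have h₁ := ExtEqI.lamβ (hh.curry.app ha)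
  have e : (Tm.lam A' (Tm.app (h.wk 2) (Tm.tensor (Tm.var 1) (Tm.var 0)))).inst a =
      Tm.lam A' (Tm.app (h.wk 1) (Tm.tensor (a.wk 1) (Tm.var 0))) := by
    simp [Tm.inst, Tm.subst, Tm.wk_two]
  rw [e] at h₁
  have h₂ := ExtEqI.app h₁ (.refl hb)
  have h₃ := ExtEqI.lamβ h₂.hasTy.2
  have e₂ : (Tm.app (h.wk 1) (Tm.tensor (a.wk 1) (Tm.var 0))).inst b =
      Tm.app h (Tm.tensor a b) := by
    have e₁ := Tm.wk_inst a b
    have e₂ := Tm.wk_inst h b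
    simp only [Tm.inst, Tm.subst] at e₁ e₂ ⊢
    rw [e₁, e₂]; rfl
  rw [e₂] at h₃
  exact .trans h₂ h₃

theorem Ty.tensorEnc_inst (A A' C : S.Ty n) :
    (Ty.lolli (Ty.lolli A.wk (Ty.lolli A'.wk (Ty.var 0))) (Ty.var 0)).inst C =
      Ty.lolli (Ty.lolli A (Ty.lolli A' C)) C := by
  simp only [Ty.inst, Ty.subst, Ty.wk_subst_cons, Ty.subst_var]; rfl

theorem HasTyI.tensorMap (A A' : S.Ty n) : HasTyI Γ (Rel.tensorMap A A')
    (Ty.lolli (Ty.tensor A A')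
      (Ty.pi (Ty.lolli (Ty.lolli A.wk (Ty.lolli A'.wk (Ty.var 0))) (Ty.var 0)))) := by
  refine .lam (.letTensor (.left _ (intCtx_split _)) (.lvar0 (intCtx_noLin _)) (.tlam ?_))
  rw [TCtx.wkTy_cons, TCtx.wkTy_cons, TCtx.wkTy_cons, intCtx_wkTy]
  have hn := (intCtx_noLin (Γ.map Ty.wk)).off (Ty.tensor A A').wk
  exact .lam (.app (.left _ (.right _ (.left _ (.off _ (intCtx_split _)))))
    (.app (.left _ (.off _ (.right _ (.off _ (intCtx_split _)))))
      (.lvar0 ((hn.off _).off _)) (.lvar2 (by simp) (by simp) hn))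
    (.lvar1 (by simp) (hn.off _)))

theorem ExtEqI.tensorMap_pair {a b f : Tm S n} (ha : HasTyI Γ a A) (hb : HasTyI Γ b A')
    (hf : HasTyI Γ f (Ty.lolli A (Ty.lolli A' C))) :
    ExtEqI Γ (Tm.app (Tm.tapp (Tm.app (Rel.tensorMap A A') (Tm.tensor a b)) C) f)
      (Tm.app (Tm.app f a) b) C := by
  have h₁ := ExtEqI.lamβ ((HasTyI.tensorMap A A').app (ha.tensor hb))
  simp [Tm.inst, Tm.subst] at h₁
  have h₂ := ExtEq.trans h₁ (ExtEqI.tensorβ h₁.hasTy.2)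
  simp [Tm.inst2, Tm.subst] at h₂
  have h₃ := ExtEqI.tapp h₂ C
  have h₄ := ExtEq.trans h₃ (ExtEqI.tlamβ h₃.hasTy.2)
  rw [Ty.tensorEnc_inst] at h₄
  have h₅ := ExtEqI.app h₄ (.refl hf)
  simp [Tm.instTy, Tm.subst] at h₅
  have h₆ := ExtEqI.lamβ h₅.hasTy.2
  simp [Tm.inst, Tm.subst] at h₆
  exact .trans h₅ h₆

/-- The encoding of `x`, applied to the curried form of `h`, is `h x`. -/
theorem ExtEqI.tensorMap_curry {h x : Tm S n} (hx : HasTyI Γ x (Ty.tensor A A'))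
    (hh : HasTyI Γ h (Ty.lolli (Ty.tensor A A') C)) :
    ExtEqI Γ (Tm.app (Tm.tapp (Tm.app (Rel.tensorMap A A') x) C) (Tm.curry A A' h))
      (Tm.app h x) C := by
  have h₁ := ExtEqI.lamβ ((HasTyI.tensorMap A A').app hx)
  simp [Tm.inst, Tm.subst] at h₁
  have h₂ := ExtEqI.tapp h₁ C
  rw [Ty.tensorEnc_inst] at h₂
  have h₃ := ExtEqI.app h₂ (.refl hh.curry)
  refine .trans h₃ ?_
  clear h₁ h₂
  have hn := intCtx_noLin Γ
  have sp := intCtx_split Γ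
  have hq : HasTy ((Use.off, A') :: (Use.off, A) :: intCtx Γ) ((Tm.curry A A' h).wk 2)
    (Ty.lolli A (Ty.lolli A' C)) := hh.curry.off2 (by simp) (by simp)
  -- Neither commuting conversion below moves the `let` past a binder, so the exchange of variables
  -- in `commTensor` is trivial.
  have r : rot 0 2 = id := by funext i; simp only [rot]; split_ifs <;> simp_all
  have ty₀ : HasTy ((Use.lin, A') :: (Use.lin, A) :: intCtx Γ) (Tm.tlam (Tm.lam
      (Ty.lolli A.wk (Ty.lolli A'.wk (Ty.var 0)))
      (Tm.app (Tm.app (Tm.var 0) (Tm.var 2)) (Tm.var 1))))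
      (Ty.pi (Ty.lolli (Ty.lolli A.wk (Ty.lolli A'.wk (Ty.var 0))) (Ty.var 0))) := by
    refine .tlam (.lam ?_)
    rw [TCtx.wkTy_cons, TCtx.wkTy_cons, intCtx_wkTy]
    exact .app (.left _ (.right _ (.left _ (intCtx_split _))))
      (.app (.left _ (.off _ (.right _ (intCtx_split _)))) (.lvar0 (((intCtx_noLin _).off _).off _))
      (.lvar2 (by simp) (by simp) (intCtx_noLin _))) (.lvar1 (by simp) ((intCtx_noLin _).off _))
  have ty₁ := HasTy.tapp C ty₀
  rw [Ty.tensorEnc_inst] at ty₁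
  have ty₂ : HasTy ((Use.lin, A') :: (Use.lin, A) :: intCtx Γ) _ C :=
    .app (.left _ (.left _ sp)) ty₁ hq
  have ty₃ : HasTy ((Use.lin, A') :: (Use.lin, A) :: intCtx Γ)
      (Tm.lam (Ty.lolli A (Ty.lolli A' C)) (Tm.app (Tm.app (Tm.var 0) (Tm.var 2)) (Tm.var 1)))
      (Ty.lolli (Ty.lolli A (Ty.lolli A' C)) C) :=
    .lam (.app (.left _ (.right _ (.left _ (intCtx_split _))))
      (.app (.left _ (.off _ (.right _ (intCtx_split _)))) (.lvar0 (((intCtx_noLin _).off _).off _))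
      (.lvar2 (by simp) (by simp) (intCtx_noLin _))) (.lvar1 (by simp) ((intCtx_noLin _).off _)))
  have ty₄ : HasTy ((Use.lin, A') :: (Use.lin, A) :: intCtx Γ)
      (Tm.app (Tm.app ((Tm.curry A A' h).wk 2) (Tm.var 1)) (Tm.var 0)) C :=
    .app (.right _ (.left _ sp)) (.app (.off _ (.right _ sp)) hq (.lvar1 (by simp) hn))
      (.lvar0 (hn.off _))
  have ty₅ : HasTy ((Use.off, A') :: (Use.lin, A) :: intCtx Γ)
      (Tm.lam A' (Tm.app (h.wk 3) (Tm.tensor (Tm.var 2) (Tm.var 0)))) (Ty.lolli A' C) :=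
    .lam (.app (.right _ (.off _ (.right _ sp))) (hh.off3 (by simp) (by simp) (by simp))
      (.tensor (.right _ (.off _ (.left _ sp))) (.lvar2 (by simp) (by simp) hn)
      (.lvar0 ((hn.off _).off _))))
  have ty₆ : HasTy ((Use.lin, A') :: (Use.lin, A) :: intCtx Γ)
      (Tm.app (h.wk 2) (Tm.tensor (Tm.var 1) (Tm.var 0))) C :=
    .app (.right _ (.right _ sp)) (hh.off2 (by simp) (by simp))
      (.tensor (.right _ (.left _ sp)) (.lvar1 (by simp) hn) (.lvar0 (hn.off _)))
  -- Since x need not be a pair, the `let` is stuck and the reduction has to happen in its body,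
  -- where both components are linear variables: the encoded pair applied to the curried h becomes h
  -- of the pair. Every intermediate term is typed with its own split, because the rules of external
  -- equality are typed.
  have eq₁ : ExtEq ((Use.lin, A') :: (Use.lin, A) :: intCtx Γ) _ _
      (Ty.lolli (Ty.lolli A (Ty.lolli A' C)) C) := .step ty₁ ty₃ (by
    convert ExtStep.betaTLam _ _ using 1
    simp [Tm.instTy, Tm.subst, Ty.subst])
  have eq₂ : ExtEq ((Use.lin, A') :: (Use.lin, A) :: intCtx Γ) _
      (Tm.app (Tm.app ((Tm.curry A A' h).wk 2) (Tm.var 1)) (Tm.var 0)) C :=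
    .step (.app (.left _ (.left _ sp)) ty₃ hq) ty₄ (.betaLam _ _ _)
  have eq₃ : ExtEq ((Use.off, A') :: (Use.lin, A) :: intCtx Γ)
      (Tm.app ((Tm.curry A A' h).wk 2) (Tm.var 1)) 
      (Tm.lam A' (Tm.app (h.wk 3) (Tm.tensor (Tm.var 2) (Tm.var 0)))) (Ty.lolli A' C) :=
    .step (.app (.off _ (.right _ sp)) hq (.lvar1 (by simp) hn)) ty₅ (by
      rw [Tm.curry_wk, Tm.curry]
      convert ExtStep.betaLam _ _ _ using 1
      simp [Tm.inst, Tm.subst, Tm.wk_three, Tm.wk_two])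
  have eq₄ : ExtEq ((Use.lin, A') :: (Use.lin, A) :: intCtx Γ) _
      (Tm.app (h.wk 2) (Tm.tensor (Tm.var 1) (Tm.var 0))) C :=
    .step (.app (.right _ (.left _ sp)) ty₅ (.lvar0 (hn.off _))) ty₆ (by
      convert ExtStep.betaLam _ _ _ using 1
      simp [Tm.inst, Tm.subst, Tm.wk_three, Tm.wk_two])
  have eq₅ := ExtEq.trans (ExtEq.app (.left _ (.left _ sp)) eq₁ (.refl hq))
    (.trans eq₂ (.trans (.app (.right _ (.left _ sp)) eq₃ (.refl (.lvar0 (hn.off _)))) eq₄))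
  have eq₆ := ExtEq.letTensor sp (.refl hx) eq₅
  have hp : HasTyI Γ (Tm.letTensor x (Tm.tensor (Tm.var 1) (Tm.var 0))) (Ty.tensor A A') :=
    .letTensor sp hx (.tensor (.right _ (.left _ sp)) (.lvar1 (by simp) hn) (.lvar0 (hn.off _)))
  -- The first conversion brings the application to the curried h inside the `let`. The second takes
  -- h out of the `let` again, leaving the η-redex of x as its argument.
  have c₁ := ExtStep.commTensor (.appL (.tapp .hole C) (Tm.curry A A' h)) x (Tm.tlam (Tm.lam
      (Ty.lolli A.wk (Ty.lolli A'.wk (Ty.var 0)))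
      (Tm.app (Tm.app (Tm.var 0) (Tm.var 2)) (Tm.var 1))))
  have c₂ := ExtStep.commTensor (.appR h .hole) x (Tm.tensor (Tm.var 1) (Tm.var 0))
  simp only [LinCxt.ren, LinCxt.plug, LinCxt.toHole, r, Tm.ren_id] at c₁ c₂
  have eq₇ : ExtEqI Γ _ _ C := .step eq₆.hasTy.1 h₃.hasTy.2 c₁
  have eq₈ : ExtEqI Γ _ _ C := .step eq₆.hasTy.2 (hh.app hp) c₂
  exact .trans (.symm eq₇) (.trans eq₆ (.trans eq₈
    (ExtEqI.app (.refl hh) (.step hp hx (.etaTensor x)))))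

theorem Ty.tensorEnc_instFst (A A' : S.Ty n) :
    Ty.instFst (Ty.lolli (Ty.lolli A.wk (Ty.lolli A'.wk (Ty.var 0))) (Ty.var 0)) =
      Ty.lolli (Ty.lolli A.wk.wk (Ty.lolli A'.wk.wk (Ty.var 1))) (Ty.var 1) := by
  rw [← Ty.wk_instFst A, ← Ty.wk_instFst A']; rfl

theorem Ty.tensorEnc_instSnd (A A' : S.Ty n) :
    Ty.instSnd (Ty.lolli (Ty.lolli A.wk (Ty.lolli A'.wk (Ty.var 0))) (Ty.var 0)) =
      Ty.lolli (Ty.lolli A.wk.wk (Ty.lolli A'.wk.wk (Ty.var 0))) (Ty.var 0) := by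
  rw [← Ty.wk_instSnd A, ← Ty.wk_instSnd A']; rfl

theorem RelOk.relVar0 {b : Bool} (σ τ : S.Ty n) :
    RelOk T false Γ (⟨b, σ, τ⟩ :: Θ) (Rel.var 0) σ τ := by
  cases b
  · exact .var rfl
  · exact .ofAdm (.var rfl)

theorem Rel.tensor_body_ok (h : RelOk T false Γ Θ ρ A B) (h' : RelOk T false Γ Θ ρ' A' B') :
    RelOk T false ((Γ.map Ty.wk).map Ty.wk)
      (⟨true, Ty.var 1, Ty.var 0⟩ :: (Θ.map RelDecl.wk).map RelDecl.wk)
      (Rel.lolli (Ty.lolli A.wk.wk (Ty.lolli A'.wk.wk (Ty.var 1)))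
        (Ty.lolli B.wk.wk (Ty.lolli B'.wk.wk (Ty.var 0))) (Ty.var 1) (Ty.var 0)
        (Rel.lolli A.wk.wk B.wk.wk (Ty.lolli A'.wk.wk (Ty.var 1)) (Ty.lolli B'.wk.wk (Ty.var 0))
          ρ.wkAll
          (Rel.lolli A'.wk.wk B'.wk.wk (Ty.var 1) (Ty.var 0) ρ'.wkAll (.var 0)))
        (.var 0))
      (Ty.instFst (Ty.lolli (Ty.lolli A.wk (Ty.lolli A'.wk (Ty.var 0))) (Ty.var 0)))
      (Ty.instSnd (Ty.lolli (Ty.lolli B.wk (Ty.lolli B'.wk (Ty.var 0))) (Ty.var 0))) := by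
  rw [Ty.tensorEnc_instFst, Ty.tensorEnc_instSnd]
  exact .lolli (.lolli (h.wkAll _) (.lolli (h'.wkAll _) (.relVar0 _ _))) (.relVar0 _ _)

theorem RelOk.tensor (h : RelOk T false Γ Θ ρ A B) (h' : RelOk T false Γ Θ ρ' A' B') :
    RelOk T false Γ Θ (Rel.tensor A B A' B' ρ ρ') (Ty.tensor A A') (Ty.tensor B B') :=
  .abs (Rel.reindex_formOk (.abs (Rel.all_formOk (Rel.tensor_body_ok h h'))) (.tensorMap A A')
    (.tensorMap B B'))

/-- As for !: instantiate the encoding at R and apply it to curried functions. By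
`ExtEqI.tensorMap_curry` the result is f x and g y even when x and y are not pairs, so relatedness
only has to be checked on related components. -/
theorem IRel.tensor_elim {x y f g : Tm S n}
    (hρ : RelOk T false Γ Θ ρ A B) (hρ' : RelOk T false Γ Θ ρ' A' B')
    (h : IRel T Γ Θ Φ (Rel.tensor A B A' B' ρ ρ') (Ty.tensor A A') (Ty.tensor B B') x y)
    (hR : RelOk T true Γ Θ R C D)
    (tf : HasTyI Γ f (Ty.lolli (Ty.tensor A A') C))
    (tg : HasTyI Γ g (Ty.lolli (Ty.tensor B B') D))
    (hf : IRel T Γ Θ Φ (Rel.lolli A B (Ty.lolli A' C) (Ty.lolli B' D) ρ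
      (Rel.lolli A' B' C D ρ' R)) (Ty.lolli A (Ty.lolli A' C)) (Ty.lolli B (Ty.lolli B' D))
      (Tm.curry A A' f) (Tm.curry B B' g)) :
    IRel T Γ Θ Φ R C D (Tm.app f x) (Tm.app g y) := by
  have ok := Rel.tensor_body_ok hρ hρ'
  have h₁ := IRel.reindex_elim (.abs (Rel.all_formOk ok)) (.tensorMap A A') (.tensorMap B B') h
  have h₂ := IRel.all_elim ok h₁ hR
  rw [Rel.subst_lolli, Rel.subst_lolli, Rel.subst_lolli, Rel.wkAll_subst, Rel.wkAll_subst] at h₂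
  simp only [Ty.subst, Ty.wk_subst_cons, Ty.subst_var] at h₂
  have tx := h₁.left.tapp C
  have ty := h₁.right.tapp D
  rw [Ty.tensorEnc_inst] at tx ty
  have h₃ : IRel T Γ Θ Φ _ (Ty.lolli (Ty.lolli A (Ty.lolli A' C)) C)
      (Ty.lolli (Ty.lolli B (Ty.lolli B' D)) D) _ _ := ⟨.lolli hf.ok (.ofAdm hR), tx, ty, h₂⟩
  have h₄ := h₃.lolli_elim (.ofAdm hR) hf
  exact h₄.congr (ExtEqI.tensorMap_curry h.left tf).ieq (ExtEqI.tensorMap_curry h.right tg).ieq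

theorem Rel.tensorMap_ren {m : ℕ} (r : Fin n → Fin m) (e : ℕ → ℕ) (A A' : S.Ty n) :
    (Rel.tensorMap A A').ren r e = Rel.tensorMap (A.ren r) (A'.ren r) := by
  simp only [Rel.tensorMap, Tm.ren, Ty.ren, Ty.wk_ren]; rfl

/-- Against a generic admissible R, the encoding of a pair hands its components to the given curried
function one after the other, and ρ and ρ' relate these components. -/
theorem IRel.tensor_intro {a b a' b' : Tm S n} (h : IRel T Γ Θ Φ ρ A B a b)
    (h' : IRel T Γ Θ Φ ρ' A' B' a' b') :
    IRel T Γ Θ Φ (Rel.tensor A B A' B' ρ ρ') (Ty.tensor A A') (Ty.tensor B B')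
      (Tm.tensor a a') (Tm.tensor b b') := by
  have ta := h.left.tensor h'.left
  have tb := h.right.tensor h'.right
  refine IRel.reindex_intro (.tensorMap A A') (.tensorMap B B') ta tb ?_
  refine IRel.all_intro (HasTyI.app (.tensorMap A A') ta) (HasTyI.app (.tensorMap B B') tb) ?_
  have hA := h.wkAll (⟨true, Ty.var 1, Ty.var 0⟩ : RelDecl S (n + 2))
  have hA' := h'.wkAll (⟨true, Ty.var 1, Ty.var 0⟩ : RelDecl S (n + 2))
  have hv := RelOk.relVar0 (T := T) (b := true) (Γ := (Γ.map Ty.wk).map Ty.wk)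
    (Θ := (Θ.map RelDecl.wk).map RelDecl.wk) (Ty.var 1) (Ty.var 0)
  have t₁ := HasTyI.tapp_fst (HasTyI.app (.tensorMap A A') ta)
  have t₂ := HasTyI.tapp_snd (HasTyI.app (.tensorMap B B') tb)
  rw [Ty.tensorEnc_instFst] at t₁ ⊢
  rw [Ty.tensorEnc_instSnd] at t₂ ⊢
  have okf := RelOk.lolli hA.ok (.lolli hA'.ok hv)
  refine IRel.lolli_intro okf hv t₁ t₂ ?_
  have hhyp := IRel.hyp0 (Φ := ((((Φ.map Form.wkTy).map Form.wkTy).map Form.wkRel).map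
    Form.wk).map Form.wk) okf
  generalize hψ : Form.rel _ (Tm.var 1) (Tm.var 0) = ψ at hhyp ⊢
  have e : (Rel.lolli A.wk.wk B.wk.wk (Ty.lolli A'.wk.wk (Ty.var 1))
      (Ty.lolli B'.wk.wk (Ty.var 0)) ρ.wkAll
      (Rel.lolli A'.wk.wk B'.wk.wk (Ty.var 1) (Ty.var 0) ρ'.wkAll (.var 0))).wk 2 =
      Rel.lolli A.wk.wk B.wk.wk (Ty.lolli A'.wk.wk (Ty.var 1))
      (Ty.lolli B'.wk.wk (Ty.var 0)) (ρ.wkAll.wk 2)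
      (Rel.lolli A'.wk.wk B'.wk.wk (Ty.var 1) (Ty.var 0) (ρ'.wkAll.wk 2) (.var 0)) := by
    simp only [Rel.wk, Rel.ren_lolli, Ty.ren_id]; rfl
  rw [e] at hhyp
  have hab := (hA.wk2 (Ty.lolli A.wk.wk (Ty.lolli A'.wk.wk (Ty.var 1)))
    (Ty.lolli B.wk.wk (Ty.lolli B'.wk.wk (Ty.var 0)))).mono (List.subset_cons_self ψ _)
  have hab' := (hA'.wk2 (Ty.lolli A.wk.wk (Ty.lolli A'.wk.wk (Ty.var 1)))
    (Ty.lolli B.wk.wk (Ty.lolli B'.wk.wk (Ty.var 0)))).mono (List.subset_cons_self ψ _)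
  have key := (hhyp.lolli_elim (.lolli hab'.ok (hv.wk2 _ _)) hab).lolli_elim (hv.wk2 _ _) hab'
  have wm : ∀ A A' : S.Ty n,
      ((Rel.tensorMap A A').wkTy.wkTy).wk 2 = Rel.tensorMap A.wk.wk A'.wk.wk := fun A A' => by
    simp only [Tm.wkTy, Tm.wk, Rel.tensorMap_ren, Ty.ren_id]; rfl
  have e₁ := ExtEqI.tensorMap_pair hab.left hab'.left hhyp.left
  have e₂ := ExtEqI.tensorMap_pair hab.right hab'.right hhyp.right
  rw [← wm] at e₁ e₂
  exact key.congr e₁.ieq.symm e₂.ieq.symm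

end Tensor

section TypeRelations

variable {T : Theory S} {n k : ℕ} {Γ : List (S.Ty n)} {Θ : List (RelDecl S n)}
  {Φ : List (Form S n)}

/-! ## Relational interpretations of types -/

section

variable {ρ : Fin k → Rel S n} {τ τ' : Fin k → S.Ty n} {t u : Tm S n}

namespace IRel

theorem ty_var (hρ : ∀ i, RelOk T true Γ Θ (ρ i) (τ i) (τ' i)) (i : Fin k) :
    IRel T Γ Θ Φ (.ty (Ty.var i) ρ) (τ i) (τ' i) t u ↔ IRel T Γ Θ Φ (ρ i) (τ i) (τ' i) t u :=
  ⟨of_equiv (.tyVar i hρ) (.ofAdm (hρ i)),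
    of_equiv_symm (.tyVar i hρ) (.ofAdm (.ty (Ty.var i) hρ))⟩

theorem ty_lolli {σ σ' : S.Ty k} (hρ : ∀ i, RelOk T true Γ Θ (ρ i) (τ i) (τ' i)) :
    IRel T Γ Θ Φ (.ty (Ty.lolli σ σ') ρ) (Ty.lolli (σ.subst τ) (σ'.subst τ))
      (Ty.lolli (σ.subst τ') (σ'.subst τ')) t u ↔
    IRel T Γ Θ Φ (Rel.lolli (σ.subst τ) (σ.subst τ') (σ'.subst τ) (σ'.subst τ') (.ty σ ρ)
      (.ty σ' ρ)) (Ty.lolli (σ.subst τ) (σ'.subst τ)) (Ty.lolli (σ.subst τ') (σ'.subst τ')) t u :=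
  ⟨of_equiv (.tyLolli σ σ' hρ) (.lolli (.ofAdm (.ty σ hρ)) (.ofAdm (.ty σ' hρ))),
    of_equiv_symm (.tyLolli σ σ' hρ) (.ofAdm (.ty (Ty.lolli σ σ') hρ))⟩

theorem ty_tensor {σ σ' : S.Ty k} (hρ : ∀ i, RelOk T true Γ Θ (ρ i) (τ i) (τ' i)) :
    IRel T Γ Θ Φ (.ty (Ty.tensor σ σ') ρ) (Ty.tensor (σ.subst τ) (σ'.subst τ))
      (Ty.tensor (σ.subst τ') (σ'.subst τ')) t u ↔
    IRel T Γ Θ Φ (Rel.tensor (σ.subst τ) (σ.subst τ') (σ'.subst τ) (σ'.subst τ') (.ty σ ρ)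
      (.ty σ' ρ)) (Ty.tensor (σ.subst τ) (σ'.subst τ))
      (Ty.tensor (σ.subst τ') (σ'.subst τ')) t u :=
  ⟨of_equiv (.tyTensor σ σ' hρ) (.tensor (.ofAdm (.ty σ hρ)) (.ofAdm (.ty σ' hρ))),
    of_equiv_symm (.tyTensor σ σ' hρ) (.ofAdm (.ty (Ty.tensor σ σ') hρ))⟩

theorem ty_bang {σ : S.Ty k} (hρ : ∀ i, RelOk T true Γ Θ (ρ i) (τ i) (τ' i)) :
    IRel T Γ Θ Φ (.ty (Ty.bang σ) ρ) (Ty.bang (σ.subst τ)) (Ty.bang (σ.subst τ')) t u ↔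
    IRel T Γ Θ Φ (Rel.bang (σ.subst τ) (σ.subst τ') (.ty σ ρ)) (Ty.bang (σ.subst τ))
      (Ty.bang (σ.subst τ')) t u :=
  ⟨of_equiv (.tyBang σ hρ) (.bang (.ofAdm (.ty σ hρ))),
    of_equiv_symm (.tyBang σ hρ) (.ofAdm (.ty (Ty.bang σ) hρ))⟩

theorem ty_ren {l : ℕ} {σ : S.Ty l} {r : Fin l → Fin k} (hr : Function.Injective r)
    (hρ : ∀ i, RelOk T true Γ Θ (ρ i) (τ i) (τ' i)) :
    IRel T Γ Θ Φ (.ty (σ.ren r) ρ) (σ.subst (τ ∘ r)) (σ.subst (τ' ∘ r)) t u ↔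
    IRel T Γ Θ Φ (.ty σ (fun i => ρ (r i))) (σ.subst (τ ∘ r)) (σ.subst (τ' ∘ r)) t u := by
  have h : Prf T Γ Θ Φ _ := .tyRen σ r hr hρ
  have ok : RelOk T true Γ Θ _ _ _ := .ty (σ.ren r) hρ
  rw [Ty.subst_ren, Ty.subst_ren] at h ok
  exact ⟨of_equiv h (.ofAdm (.ty σ fun i => hρ (r i))), of_equiv_symm h (.ofAdm ok)⟩

theorem ty_one (hρ : ∀ i, RelOk T true Γ Θ (ρ i) (τ i) (τ' i)) :
    IRel T Γ Θ Φ (.ty Ty.one ρ) Ty.one Ty.one t u ↔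
      IRel T Γ Θ Φ Rel.one Ty.one Ty.one t u := by
  refine ⟨of_equiv (.tyOne hρ) ?_, of_equiv_symm (.tyOne hρ) (.ofAdm (.ty Ty.one hρ))⟩
  refine .abs (Rel.reindex_formOk (C := Ty.pi (Ty.lolli (Ty.var 0) (Ty.var 0)))
    (D := Ty.pi (Ty.lolli (Ty.var 0) (Ty.var 0))) (.abs (Rel.all_formOk ?_)) ?_ ?_)
  · exact .lolli (.relVar0 _ _) (.relVar0 _ _)
  all_goals
    refine .lam (.letStar (.left _ (intCtx_split _)) (.lvar0 (intCtx_noLin _)) (.tlam ?_))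
    rw [TCtx.wkTy_cons, intCtx_wkTy]
    exact .lam (.lvar0 ((intCtx_noLin _).off _))

end IRel

theorem Ty.subst_up_instFst (σ : S.Ty (k + 1)) (τ : Fin k → S.Ty n) :
    Ty.instFst (σ.subst (Ty.up τ)) = σ.subst (Ty.cons (Ty.var 1) (fun i => (τ i).wk.wk)) := by
  rw [Ty.instFst, Ty.subst_subst]
  congr 1
  funext i
  refine Fin.cases rfl (fun i => ?_) i
  exact Ty.wk_instFst (τ i)

theorem Ty.subst_up_instSnd (σ : S.Ty (k + 1)) (τ : Fin k → S.Ty n) :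
    Ty.instSnd (σ.subst (Ty.up τ)) = σ.subst (Ty.cons (Ty.var 0) (fun i => (τ i).wk.wk)) := by
  rw [Ty.instSnd, Ty.subst_subst]
  congr 1
  funext i
  refine Fin.cases rfl (fun i => ?_) i
  exact Ty.wk_instSnd (τ i)

/-- Extension of a vector of relations. -/
def Rel.cons (R : Rel S n) (ρ : Fin k → Rel S n) : Fin (k + 1) → Rel S n := Fin.cases R ρ

theorem RelOk.cons {R : Rel S n} {A B : S.Ty n} {b : Bool} (hR : RelOk T b Γ Θ R A B)
    (hρ : ∀ i, RelOk T b Γ Θ (ρ i) (τ i) (τ' i)) (i : Fin (k + 1)) :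
    RelOk T b Γ Θ (Rel.cons R ρ i) (Ty.cons A τ i) (Ty.cons B τ' i) :=
  Fin.cases hR hρ i

theorem RelOk.ty_pi_body (σ : S.Ty (k + 1)) (hρ : ∀ i, RelOk T true Γ Θ (ρ i) (τ i) (τ' i)) :
    RelOk T false ((Γ.map Ty.wk).map Ty.wk)
      (⟨true, Ty.var 1, Ty.var 0⟩ :: (Θ.map RelDecl.wk).map RelDecl.wk)
      (.ty σ (Fin.cases (.var 0) (fun i => (ρ i).wkAll)))
      (Ty.instFst (σ.subst (Ty.up τ))) (Ty.instSnd (σ.subst (Ty.up τ'))) := by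
  rw [Ty.subst_up_instFst, Ty.subst_up_instSnd]
  exact .ofAdm (.ty σ (RelOk.cons (.var rfl) fun i => (hρ i).wkAll _))

namespace IRel

/-- Instantiation extends the vector of relations by R: the weakenings in the clause for Π disappear
when the generic relation variable is replaced. -/
theorem ty_pi_elim {σ : S.Ty (k + 1)} {R : Rel S n} {A B : S.Ty n}
    (hρ : ∀ i, RelOk T true Γ Θ (ρ i) (τ i) (τ' i)) (hR : RelOk T true Γ Θ R A B)
    (h : IRel T Γ Θ Φ (.ty (Ty.pi σ) ρ) (Ty.pi (σ.subst (Ty.up τ))) (Ty.pi (σ.subst (Ty.up τ')))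
      t u) :
    IRel T Γ Θ Φ (.ty σ (Rel.cons R ρ)) (σ.subst (Ty.cons A τ)) (σ.subst (Ty.cons B τ'))
      (Tm.tapp t A) (Tm.tapp u B) := by
  have ok := RelOk.ty_pi_body σ hρ
  have h₁ := (h.of_equiv (.tyPi σ hρ) (.abs (Rel.all_formOk ok))).all_elim ok hR
  have hl := h.left.tapp A
  have hr := h.right.tapp B
  rw [Ty.subst_up_inst] at hl hr
  refine ⟨.ofAdm (.ty σ (hR.cons hρ)), hl, hr, ?_⟩
  rw [Rel.subst] at h₁
  convert h₁ using 3
  funext i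
  refine Fin.cases rfl (fun i => ?_) i
  exact (Rel.wkAll_subst (ρ i) A B R).symm

theorem ty_pi_intro {σ : S.Ty (k + 1)} (hρ : ∀ i, RelOk T true Γ Θ (ρ i) (τ i) (τ' i))
    (ht : HasTyI Γ t (Ty.pi (σ.subst (Ty.up τ)))) (hu : HasTyI Γ u (Ty.pi (σ.subst (Ty.up τ'))))
    (h : IRel T ((Γ.map Ty.wk).map Ty.wk)
      (⟨true, Ty.var 1, Ty.var 0⟩ :: (Θ.map RelDecl.wk).map RelDecl.wk)
      (((Φ.map Form.wkTy).map Form.wkTy).map Form.wkRel)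
      (.ty σ (Rel.cons (.var 0) (fun i => (ρ i).wkAll)))
      (σ.subst (Ty.cons (Ty.var 1) (fun i => (τ i).wk.wk)))
      (σ.subst (Ty.cons (Ty.var 0) (fun i => (τ' i).wk.wk)))
      (Tm.tapp t.wkTy.wkTy (Ty.var 1)) (Tm.tapp u.wkTy.wkTy (Ty.var 0))) :
    IRel T Γ Θ Φ (.ty (Ty.pi σ) ρ) (Ty.pi (σ.subst (Ty.up τ))) (Ty.pi (σ.subst (Ty.up τ')))
      t u := by
  rw [← Ty.subst_up_instFst, ← Ty.subst_up_instSnd] at h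
  exact (IRel.all_intro ht hu h).of_equiv_symm (.tyPi σ hρ) (.ofAdm (.ty (Ty.pi σ) hρ))

end IRel

end

/-! ### Identity extension -/

theorem Prf.allTys_open : ∀ {k : ℕ} {φ : Form S k}, Prf T [] [] [] (Form.allTys k φ) →
    Prf T [] [] [] φ
  | 0, _, h => h
  | _ + 1, _, h => Prf.allTy_open (Γ := []) (Θ := []) (Φ := []) (Prf.allTys_open h)

theorem Rel.subst_eqr {m : ℕ} (s : Fin n → S.Ty m) (e : ℕ → Tm S m) (g : ℕ → Rel S m) (A : S.Ty n) :
    (Rel.eqr A).subst s e g = Rel.eqr (A.subst s) := by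
  simp only [Rel.eqr, Rel.graph, Rel.subst, Form.subst, Tm.subst, Tm.wk_idm, Tm.subst_idm]
  rfl

/-- Identity extension is assumed for type variables. Opening the quantifiers and substituting gives
it at arbitrary types, in every context and under any hypotheses. -/
theorem idext_equiv (hid : IdentityExtension T) (σ : S.Ty k) (s : Fin k → S.Ty n) :
    Prf T Γ Θ Φ (Form.relEquiv (σ.subst s) (σ.subst s) (.ty σ (fun i => Rel.eqr (s i)))
      (Rel.eqr (σ.subst s))) := by
  have := (Prf.subst s Tm.var Rel.var (hid k σ).allTys_open (Γ' := Γ) (Θ' := Θ)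
    (fun i σ h => by simp at h) (fun i σ h => by simp at h)).mono (Φ' := Φ) (by simp)
  simp only [Form.relEquiv, Form.iff, Form.subst, Tm.subst, Rel.wk, Rel.ren, Rel.ren_eqr,
    Rel.subst, Rel.subst_eqr, Ty.ren_id, Ty.subst] at this ⊢
  exact this

theorem RelOk.eqr_vec (s : Fin k → S.Ty n) (i : Fin k) :
    RelOk T true Γ Θ (Rel.eqr (s i)) (s i) (s i) := .eqr (s i)

theorem IEq.of_ty (hid : IdentityExtension T) {σ : S.Ty k} {s : Fin k → S.Ty n} {t u : Tm S n}
    (h : IRel T Γ Θ Φ (.ty σ (fun i => Rel.eqr (s i))) (σ.subst s) (σ.subst s) t u) :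
    IEq T Γ Θ Φ (σ.subst s) t u :=
  (h.of_equiv (idext_equiv hid σ s) (.ofAdm (.eqr _))).eqr_elim

/-- Applied to reflexivity this is parametricity: a term is related to itself by its type with every
variable read as equality. It and the preceding converse are the only ways in which identity
extension enters. -/
theorem IEq.ty (hid : IdentityExtension T) {σ : S.Ty k} {s : Fin k → S.Ty n} {t u : Tm S n}
    (h : IEq T Γ Θ Φ (σ.subst s) t u) :
    IRel T Γ Θ Φ (.ty σ (fun i => Rel.eqr (s i))) (σ.subst s) (σ.subst s) t u :=
  h.eqr.of_equiv_symm (idext_equiv hid σ s) (.ofAdm (.ty σ (RelOk.eqr_vec s)))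

/-! ### Extensionality at `!` and `⊗` -/

theorem Rel.wk_lolli (j : ℕ) (σ τ σ' τ' : S.Ty n) (ρ ρ' : Rel S n) :
    (Rel.lolli σ τ σ' τ' ρ ρ').wk j = Rel.lolli σ τ σ' τ' (ρ.wk j) (ρ'.wk j) := by
  simp only [Rel.wk, Rel.ren_lolli, Ty.ren_id]

theorem IEq.ren {m : ℕ} {r : Fin n → Fin m} {e q : ℕ → ℕ} {Γ' : List (S.Ty m)}
    {Θ' : List (RelDecl S m)} {A : S.Ty n} {t u : Tm S n}
    (h : IEq T Γ Θ Φ A t u) (hr : CtxRen r e q Γ Θ Γ' Θ') :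
    IEq T Γ' Θ' (Φ.map (Form.ren r e q)) (A.ren r) (t.ren r e) (u.ren r e) :=
  ⟨h.left.ren hr.tm, h.right.ren hr.tm, h.prf.ren hr⟩

/-- Identity extension at !α relates x : !A to itself by !eq. Eliminating this against equality on C
leaves f !a = g !b for equal a and b, which the hypothesis and congruence provide. -/
theorem IEq.bang_ext (hext : Extensionality T) (hid : IdentityExtension T) {A C : S.Ty n}
    {f g : Tm S n} (hf : HasTyI Γ f (Ty.lolli (Ty.bang A) C))
    (hg : HasTyI Γ g (Ty.lolli (Ty.bang A) C))
    (h : IEq T (A :: Γ) Θ (Φ.map Form.wk) C (Tm.app (f.wk 1) (Tm.bang (Tm.var 0)))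
      (Tm.app (g.wk 1) (Tm.bang (Tm.var 0)))) : IEq T Γ Θ Φ (Ty.lolli (Ty.bang A) C) f g := by
  refine IEq.ext hext hf hg ?_
  have hx : HasTyI (Ty.bang A :: Γ) (Tm.var 0) (Ty.bang A) := HasTyI.var (by rfl)
  have h₁ := IEq.ty (T := T) (Θ := Θ) (Φ := Φ.map Form.wk) hid (σ := Ty.bang (Ty.var 0))
    (s := fun _ : Fin 1 => A) (.rfl hx)
  have ok : RelOk T false (Ty.bang A :: Γ) Θ (.ty (Ty.var 0) fun _ : Fin 1 => Rel.eqr A) A A :=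
    .ofAdm (.ty (Ty.var 0) (RelOk.eqr_vec fun _ : Fin 1 => A))
  have h₂ := IRel.bang_elim (R := Rel.eqr C) ok ((IRel.ty_bang (RelOk.eqr_vec _)).1 h₁) (.eqr C)
    (f := f.wk 1) (g := g.wk 1) ?_
  · exact h₂.eqr_elim
  · refine IRel.arr_intro ok (.ofAdm (.eqr C)) hf.wk1 hg.wk1 ?_
    rw [Rel.wk_eqr]
    refine IEq.eqr ?_
    have h₃ := IRel.hyp0 (Φ := ((Φ.map Form.wk).map Form.wk).map Form.wk) ok
    rw [show (Rel.ty (Ty.var 0) fun _ : Fin 1 => Rel.eqr A).wk 2 =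
      Rel.ty (Ty.var 0) fun _ : Fin 1 => Rel.eqr A by
        simp only [Rel.wk, Rel.ren, Rel.ren_eqr, Ty.ren_id]] at h₃ ⊢
    have h₄ := (IRel.ty_var (RelOk.eqr_vec (fun _ : Fin 1 => A)) 0).1 h₃
    -- The hypothesis is moved to the first of the two related variables: index 0 goes to 1, and the
    -- variables of `Γ` skip both of them as well as x.
    have h₅ := h.ren (r := id) (e := fun i => Nat.casesOn i 1 (fun i => i + 3)) (q := id)
      (Γ' := A :: A :: Ty.bang A :: Γ) (Θ' := Θ) ⟨fun i τ hi => ?_, fun i d hi => ?_⟩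
    · rw [Ty.ren_id] at h₅
      have e : ∀ f : Tm S n, (f.wk 1).ren id (fun i => Nat.casesOn i 1 (fun i => i + 3)) =
          (f.wk 1).wk 2 := fun f => by
        simp only [Tm.wk, Tm.ren_ren]; rfl
      have e' : (Φ.map Form.wk).map
          (Form.ren id (fun i => Nat.casesOn i 1 (fun i => i + 3)) id) =
          ((Φ.map Form.wk).map Form.wk).map Form.wk := by
        simp only [List.map_map]
        congr 1; funext φ
        simp only [Form.wk, Function.comp, Form.ren_ren]
        rfl
      simp only [Tm.ren, e, e'] at h₅
      exact (h₅.mono (List.subset_cons_self _ _)).trans (.appR hg.wk1.wk2 h₄.eqr_elim.bang)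
    · cases i with
      | zero => simp at hi ⊢; rw [Ty.ren_id]; exact hi
      | succ i => simp at hi ⊢; rw [Ty.ren_id]; exact hi
    · rw [show d.ren id = d by simp only [RelDecl.ren, Ty.ren_id]]; exact hi

/-- The clause for ⊸ unfolds the outermost arrow only; monotonicity in the codomain lets it be
applied again to the right of a ⊸. -/
theorem IRel.lolli_mono_right {A B A' B' : S.Ty n} {ρ ρ' ρ'' : Rel S n} {f g : Tm S n}
    (h : IRel T Γ Θ Φ (Rel.lolli A B A' B' ρ ρ') (Ty.lolli A A') (Ty.lolli B B') f g)
    (hρ : RelOk T false Γ Θ ρ A B) (hρ' : RelOk T false Γ Θ ρ' A' B')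
    (hρ'' : RelOk T false Γ Θ ρ'' A' B')
    (hm : ∀ {Φ : List (Form S n)} {t u : Tm S n}, IRel T (B :: A :: Γ) Θ Φ (ρ'.wk 2) A' B' t u →
      IRel T (B :: A :: Γ) Θ Φ (ρ''.wk 2) A' B' t u) :
    IRel T Γ Θ Φ (Rel.lolli A B A' B' ρ ρ'') (Ty.lolli A A') (Ty.lolli B B') f g := by
  refine IRel.lolli_intro hρ hρ'' h.left h.right (hm ?_)
  have h₁ := (h.wk2 A B).mono (List.subset_cons_self
    (Form.rel (ρ.wk 2) (Tm.var 1) (Tm.var 0)) _)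
  rw [Rel.wk_lolli] at h₁
  exact h₁.lolli_elim (hρ'.wk2 _ _) (IRel.hyp0 hρ)

/-- The curried forms of f and g are equal by extensionality in two arguments, hence related by
identity extension at α ⊸ α' ⊸ γ. Identity extension at α ⊗ α' relates x to itself, and elimination
against equality on C gives f x = g x. -/
theorem IEq.tensor_ext (hext : Extensionality T) (hid : IdentityExtension T) {A A' C : S.Ty n}
    {f g : Tm S n} (hf : HasTyI Γ f (Ty.lolli (Ty.tensor A A') C))
    (hg : HasTyI Γ g (Ty.lolli (Ty.tensor A A') C))
    (h : IEq T (A' :: A :: Γ) Θ ((Φ.map Form.wk).map Form.wk) C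
      (Tm.app (f.wk 2) (Tm.tensor (Tm.var 1) (Tm.var 0)))
      (Tm.app (g.wk 2) (Tm.tensor (Tm.var 1) (Tm.var 0)))) :
    IEq T Γ Θ Φ (Ty.lolli (Ty.tensor A A') C) f g := by
  have hc : IEq T Γ Θ Φ (Ty.lolli A (Ty.lolli A' C)) (Tm.curry A A' f) (Tm.curry A A' g) := by
    refine IEq.ext hext hf.curry hg.curry (IEq.ext hext (.app hf.curry.wk1 (.var (by rfl)))
      (.app hg.curry.wk1 (.var (by rfl))) ?_)
    have e : ∀ {f : Tm S n}, HasTyI Γ f (Ty.lolli (Ty.tensor A A') C) → IEq T (A' :: A :: Γ) Θ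
        ((Φ.map Form.wk).map Form.wk) C (Tm.app ((Tm.app ((Tm.curry A A' f).wk 1)
          (Tm.var 0)).wk 1) (Tm.var 0)) (Tm.app (f.wk 2) (Tm.tensor (Tm.var 1) (Tm.var 0))) := by
      intro f hf
      have := (ExtEqI.curry (a := Tm.var 1) (b := Tm.var 0) (hf.wk2 (A := A') (B := A))
        (.var (by rfl)) (.var (by rfl))).ieq (T := T) (Θ := Θ) (Φ := (Φ.map Form.wk).map Form.wk)
      rw [← Tm.curry_wk, Tm.wk_two] at this
      exact this
    exact (e hf).trans (h.trans (e hg).symm)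
  refine IEq.ext hext hf hg ?_
  have hx : HasTyI (Ty.tensor A A' :: Γ) (Tm.var 0) (Ty.tensor A A') := HasTyI.var (by rfl)
  -- One assignment of types to three variables serves both uses of identity extension, so that the
  -- relations match syntactically.
  let s : Fin 3 → S.Ty n := Ty.cons A (Ty.cons A' (fun _ => C))
  have ok : ∀ i, RelOk T true (Ty.tensor A A' :: Γ) Θ (Rel.eqr (s i)) (s i) (s i) := RelOk.eqr_vec s
  have h₁ := IEq.ty (T := T) (Θ := Θ) (Φ := Φ.map Form.wk) hid
    (σ := Ty.tensor (Ty.var 0) (Ty.var 1)) (s := s) (.rfl hx)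
  have h₂ := IEq.ty hid (σ := Ty.lolli (Ty.var 0) (Ty.lolli (Ty.var 1) (Ty.var 2))) (s := s)
    (hc.wk1 (Ty.tensor A A'))
  have ok' : ∀ i, RelOk T false (Ty.tensor A A' :: Γ) Θ (.ty (Ty.var i) (fun i => Rel.eqr (s i)))
    (s i) (s i) := fun i => .ofAdm (.ty (Ty.var i) ok)
  have h₃ := ((IRel.ty_lolli ok).1 h₂).lolli_mono_right (ok' 0)
    (.ofAdm (.ty (Ty.lolli (Ty.var 1) (Ty.var 2)) ok)) (.lolli (ok' 1) (ok' 2)) fun h => by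
      rw [Rel.wk_lolli]; exact (IRel.ty_lolli fun i => (ok i).wk2 _ _).1 h
  have h₄ := IRel.tensor_elim (ok' 0) (ok' 1) ((IRel.ty_tensor ok).1 h₁) (.ty (Ty.var 2) ok)
    hf.wk1 hg.wk1 (by rw [← Tm.curry_wk, ← Tm.curry_wk]; exact h₃)
  exact ((IRel.ty_var ok 2).1 h₄).eqr_elim

end TypeRelations

/-! ## The functorial action of types -/

section ActAlgebra

theorem cases_comp {k : ℕ} {X Y : Type*} (f : X → Y) (a : X) (g : Fin k → X) :
    (fun i => f ((Fin.cases a g : Fin (k + 1) → X) i)) =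
      (Fin.cases (f a) (fun i => f (g i)) : Fin (k + 1) → Y) := by
  funext i; exact Fin.cases rfl (fun _ => rfl) i

theorem act_subst {k n m : ℕ} (σ : S.Ty k) (A B : Fin k → S.Ty n) (F G : Fin k → Tm S n)
    (s : Fin n → S.Ty m) (f : ℕ → Tm S m) :
    (act σ A B F G).subst s f = act σ (fun i => (A i).subst s) (fun i => (B i).subst s)
      (fun i => (F i).subst s f) (fun i => (G i).subst s f) := by
  induction σ generalizing n m with
  | var i => rfl
  | con c args => simp only [act, Tm.subst_idm, Ty.subst_subst]
  | one => rfl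
  | tensor σ τ ih₁ ih₂ =>
      simp only [act, Tm.subst, Ty.subst, Ty.subst_subst, Tm.wk_three, Tm.wk_subst_up, ih₁, ih₂]
      rfl
  | lolli σ τ ih₁ ih₂ =>
      simp only [act, Tm.subst, Ty.subst, Ty.subst_subst, Tm.wk_two, Tm.wk_subst_up, ih₁, ih₂]
      rfl
  | bang σ ih =>
      simp only [act, Tm.subst, Ty.subst, Ty.subst_subst, Tm.wk_two, Tm.wk_subst_up, ih]
      rfl
  | pi σ ih =>
      simp only [act, Tm.subst, Ty.subst_subst, Tm.wkTy_up, Tm.wk_subst_up, ih, cases_comp,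
        Tm.wkTy_subst_up, Ty.subst_up]
      rfl

theorem act_ren {k n m : ℕ} (σ : S.Ty k) (A B : Fin k → S.Ty n) (F G : Fin k → Tm S n)
    (r : Fin n → Fin m) (e : ℕ → ℕ) :
    (act σ A B F G).ren r e = act σ (fun i => (A i).ren r) (fun i => (B i).ren r)
      (fun i => (F i).ren r e) (fun i => (G i).ren r e) := by
  simp only [Tm.ren_eq_subst, Ty.ren_eq_subst, act_subst]

theorem act_wk {k n : ℕ} (σ : S.Ty k) (A B : Fin k → S.Ty n) (F G : Fin k → Tm S n) (j : ℕ) :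
    (act σ A B F G).wk j = act σ A B (fun i => (F i).wk j) (fun i => (G i).wk j) := by
  simp only [Tm.wk, act_ren, Ty.ren_id]

theorem act_wkTy {k n : ℕ} (σ : S.Ty k) (A B : Fin k → S.Ty n) (F G : Fin k → Tm S n) :
    (act σ A B F G).wkTy = act σ (fun i => (A i).wk) (fun i => (B i).wk)
      (fun i => (F i).wkTy) (fun i => (G i).wkTy) := act_ren _ _ _ _ _ _ _

theorem cases_upRen {k l : ℕ} {X : Type*} (a : X) (g : Fin k → X) (r : Fin l → Fin k) :
    (fun i => (Fin.cases a g : Fin (k + 1) → X) (upRen r i)) = Fin.cases a (fun i => g (r i)) := by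
  funext i; exact Fin.cases rfl (fun _ => rfl) i

theorem act_ty_ren {l k n : ℕ} (σ : S.Ty l) (r : Fin l → Fin k) (A B : Fin k → S.Ty n)
    (F G : Fin k → Tm S n) :
    act (σ.ren r) A B F G = act σ (fun i => A (r i)) (fun i => B (r i)) (fun i => F (r i))
      (fun i => G (r i)) := by
  induction σ generalizing k n with
  | var i => rfl
  | con c args => simp only [Ty.ren, act, Ty.subst, Ty.subst_ren]; rfl
  | one => rfl
  | tensor σ τ ih₁ ih₂ => simp only [Ty.ren, act, Ty.subst, Ty.subst_ren, ih₁, ih₂]; rfl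
  | lolli σ τ ih₁ ih₂ => simp only [Ty.ren, act, Ty.subst, Ty.subst_ren, ih₁, ih₂]; rfl
  | bang σ ih => simp only [Ty.ren, act, Ty.subst, Ty.subst_ren, ih]; rfl
  | pi σ ih =>
      simp only [Ty.ren, act, Ty.subst, Ty.subst_ren, ih, cases_upRen, Ty.up_comp_upRen]
      have h : ∀ A : Fin k → S.Ty n, (fun i => Ty.up A (upRen r i)) = Ty.up (A ∘ r) :=
        fun A => Ty.up_comp_upRen r A
      simp only [h]; rfl

/-- Action of a composite type: the inner types contribute their own actions, and at negative places
these with source and target exchanged. This identifies the action of α ↦ σ(ω(α),α). -/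
theorem act_ty_subst {l k n : ℕ} (σ : S.Ty l) (τ : Fin l → S.Ty k) (A B : Fin k → S.Ty n)
    (F G : Fin k → Tm S n) :
    act (σ.subst τ) A B F G = act σ (fun i => (τ i).subst A) (fun i => (τ i).subst B)
      (fun i => act (τ i) A B F G) (fun i => act (τ i) B A G F) := by
  induction σ generalizing k n with
  | var i => rfl
  | con c args => simp only [Ty.subst, act, Ty.subst_subst]
  | one => rfl
  | tensor σ τ ih₁ ih₂ => simp only [Ty.subst, act, Ty.subst_subst, ih₁, ih₂]
  | lolli σ τ ih₁ ih₂ => simp only [Ty.subst, act, Ty.subst_subst, ih₁, ih₂]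
  | bang σ ih => simp only [Ty.subst, act, Ty.subst_subst, ih]
  | pi σ ih =>
      simp only [Ty.subst, act, Ty.subst_subst, ih]
      have h : ∀ A : Fin k → S.Ty n, (fun i => (Ty.up τ i).subst (Ty.up A)) =
        Ty.up (fun i => (τ i).subst A) := fun A => Ty.subst_up τ A
      have h' : ∀ (A B : Fin k → S.Ty n) (F G : Fin k → Tm S n), (fun i => act (Ty.up τ i) (Ty.up A)
          (Ty.up B) (Fin.cases (Tm.idm (Ty.var 0)) fun i => (F i).wkTy)
          (Fin.cases (Tm.idm (Ty.var 0)) fun i => (G i).wkTy)) =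
          Fin.cases (Tm.idm (Ty.var 0)) (fun i => (act (τ i) A B F G).wkTy) := by
        intro A B F G
        funext i
        refine Fin.cases rfl (fun i => ?_) i
        exact (act_ty_ren (τ i) Fin.succ _ _ _ _).trans (act_wkTy (τ i) A B F G).symm
      simp only [h, h']

/-- Only `F` at positive and `G` at negative occurrences enter the term. The placeholder `Tm.star`
in the other components may therefore be replaced by anything, in particular by an identity. -/
theorem act_congr {k n : ℕ} {σ : S.Ty k} {A B : Fin k → S.Ty n} {F F' G G' : Fin k → Tm S n}
    (hF : ∀ i, σ.Occ true i → F i = F' i) (hG : ∀ i, σ.Occ false i → G i = G' i) :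
    act σ A B F G = act σ A B F' G' := by
  induction σ generalizing n with
  | var i => exact hF i ⟨rfl, rfl⟩
  | con c args => rfl
  | one => rfl
  | tensor σ τ ih₁ ih₂ =>
      simp only [act]
      rw [ih₁ (fun i h => hF i (.inl h)) (fun i h => hG i (.inl h)),
        ih₂ (fun i h => hF i (.inr h)) (fun i h => hG i (.inr h))]
  | lolli σ τ ih₁ ih₂ =>
      simp only [act]
      rw [ih₁ (fun i h => hG i (.inl h)) (fun i h => hF i (.inl h)),
        ih₂ (fun i h => hF i (.inr h)) (fun i h => hG i (.inr h))]
  | bang σ ih => simp only [act]; rw [ih hF hG]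
  | pi σ ih =>
      simp only [act]
      rw [ih (F' := Fin.cases (Tm.idm (Ty.var 0)) fun i => (F' i).wkTy)
        (G' := Fin.cases (Tm.idm (Ty.var 0)) fun i => (G' i).wkTy)]
      · exact fun i => Fin.cases (fun _ => rfl) (fun i h => congrArg Tm.wkTy (hF i h)) i
      · exact fun i => Fin.cases (fun _ => rfl) (fun i h => congrArg Tm.wkTy (hG i h)) i

end ActAlgebra

/-! ### Typing -/

/-- The data at which the functorial action of `σ` is well typed. -/
structure ActOk {k n : ℕ} (Γ : List (S.Ty n)) (σ : S.Ty k) (A B : Fin k → S.Ty n)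
    (F G : Fin k → Tm S n) : Prop where
  pos : ∀ i, σ.Occ true i → HasTyI Γ (F i) (Ty.lolli (A i) (B i))
  neg : ∀ i, σ.Occ false i → HasTyI Γ (G i) (Ty.lolli (B i) (A i))
  both : ∀ i, σ.Occ true i → σ.Occ false i → A i = B i

namespace ActOk

variable {k n : ℕ} {Γ : List (S.Ty n)} {A B : Fin k → S.Ty n} {F G : Fin k → Tm S n}

theorem tensor_left {σ τ : S.Ty k} (h : ActOk Γ (Ty.tensor σ τ) A B F G) : ActOk Γ σ A B F G :=
  ⟨fun i o => h.pos i (.inl o), fun i o => h.neg i (.inl o),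
    fun i o o' => h.both i (.inl o) (.inl o')⟩

theorem tensor_right {σ τ : S.Ty k} (h : ActOk Γ (Ty.tensor σ τ) A B F G) : ActOk Γ τ A B F G :=
  ⟨fun i o => h.pos i (.inr o), fun i o => h.neg i (.inr o),
    fun i o o' => h.both i (.inr o) (.inr o')⟩

theorem lolli_left {σ τ : S.Ty k} (h : ActOk Γ (Ty.lolli σ τ) A B F G) : ActOk Γ σ B A G F :=
  ⟨fun i o => h.neg i (.inl o), fun i o => h.pos i (.inl o),
    fun i o o' => (h.both i (.inl o') (.inl o)).symm⟩

theorem lolli_right {σ τ : S.Ty k} (h : ActOk Γ (Ty.lolli σ τ) A B F G) : ActOk Γ τ A B F G :=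
  ⟨fun i o => h.pos i (.inr o), fun i o => h.neg i (.inr o),
    fun i o o' => h.both i (.inr o) (.inr o')⟩

theorem bang {σ : S.Ty k} (h : ActOk Γ (Ty.bang σ) A B F G) : ActOk Γ σ A B F G :=
  ⟨h.pos, h.neg, h.both⟩

theorem pi {σ : S.Ty (k + 1)} (h : ActOk Γ (Ty.pi σ) A B F G) :
    ActOk (Γ.map Ty.wk) σ (Ty.up A) (Ty.up B)
      (Fin.cases (Tm.idm (Ty.var 0)) (fun i => (F i).wkTy))
      (Fin.cases (Tm.idm (Ty.var 0)) (fun i => (G i).wkTy)) :=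
  ⟨fun i => Fin.cases (fun _ => .idm _) (fun i o => (h.pos i o).wkTy) i,
    fun i => Fin.cases (fun _ => .idm _) (fun i o => (h.neg i o).wkTy) i,
    fun i => Fin.cases (fun _ _ => rfl) (fun i o o' => congrArg Ty.wk (h.both i o o')) i⟩

/-- A variable below a constant occurs with both signs, so its source and target agree. This is what
makes the identity a well-typed action at a type constant. -/
theorem con {c : S.Con} {args : Fin (S.arity c) → S.Ty k} (h : ActOk Γ (Ty.con c args) A B F G) :
    (Ty.con c args).subst A = (Ty.con c args).subst B :=
  Ty.subst_congr_occ fun i p o => by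
    obtain ⟨j, q, o⟩ := o
    exact h.both i ⟨j, q, o⟩ ⟨j, q, o⟩

end ActOk

theorem Ty.ren_upRen_inst {n : ℕ} (σ : S.Ty (n + 1)) :
    (σ.ren (upRen Fin.succ)).inst (Ty.var 0) = σ := by
  rw [Ty.inst, Ty.subst_ren]
  conv_rhs => rw [← Ty.subst_var σ]
  congr 1
  funext i; exact Fin.cases rfl (fun _ => rfl) i

theorem act_hasTy {k n : ℕ} {Γ : List (S.Ty n)} {σ : S.Ty k} {A B : Fin k → S.Ty n}
    {F G : Fin k → Tm S n} (h : ActOk Γ σ A B F G) :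
    HasTyI Γ (act σ A B F G) (Ty.lolli (σ.subst A) (σ.subst B)) := by
  induction σ generalizing n with
  | var i => exact h.pos i ⟨rfl, rfl⟩
  | con c args => rw [← h.con]; exact .idm _
  | one => exact .idm _
  | tensor σ τ ih₁ ih₂ =>
      have h₁ := ih₁ h.tensor_left
      have h₂ := ih₂ h.tensor_right
      exact .lam (.letTensor (.left _ (intCtx_split _)) (.lvar0 (intCtx_noLin _))
        (.tensor (.right _ (.left _ (.off _ (intCtx_split _))))
          (.app (.off _ (.right _ (.off _ (intCtx_split _)))) (h₁.off3 (by simp) (by simp) (by simp))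
            (.lvar1 (by simp) ((intCtx_noLin _).off _)))
          (.app (.right _ (.off _ (.off _ (intCtx_split _)))) (h₂.off3 (by simp) (by simp) (by simp))
            (.lvar0 (((intCtx_noLin _).off _).off _)))))
  | lolli σ τ ih₁ ih₂ =>
      have h₁ := ih₁ h.lolli_left
      have h₂ := ih₂ h.lolli_right
      exact .lam (.lam (.app (.right _ (.right _ (intCtx_split _))) (h₂.off2 (by simp) (by simp))
        (.app (.right _ (.left _ (intCtx_split _))) (.lvar1 (by simp) (intCtx_noLin _))
          (.app (.right _ (.off _ (intCtx_split _))) (h₁.off2 (by simp) (by simp))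
            (.lvar0 ((intCtx_noLin _).off _))))))
  | bang σ ih =>
      have h₁ := ih h.bang
      have hn := ((intCtx_noLin Γ).off (Ty.bang (σ.subst A))).int (σ.subst A)
      exact .lam (.letBang (.left _ (intCtx_split _)) (.lvar0 (intCtx_noLin _))
        (.bang hn (.app hn.split_self (h₁.off2 (by simp) (by simp))
          (.ivar rfl hn))))
  | pi σ ih =>
      have h₁ := ih h.pi
      refine .lam (.tlam ?_)
      rw [TCtx.wkTy_cons, intCtx_wkTy]
      refine .app (.right _ (intCtx_split _)) (h₁.off1 (by simp)) ?_
      have := HasTy.tapp (Ty.var 0) (HasTy.lvar0 (intCtx_noLin (Γ.map Ty.wk))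
        (σ := (Ty.pi (σ.subst (Ty.up A))).wk))
      rw [Ty.ren_upRen_inst] at this
      exact this

-- Computation rules of the functorial action

section ActBeta

variable {k n : ℕ} {Γ : List (S.Ty n)} {A B : Fin k → S.Ty n} {F G : Fin k → Tm S n}

theorem ExtEqI.act_tensor {σ τ : S.Ty k} (h : ActOk Γ (Ty.tensor σ τ) A B F G) {a b : Tm S n}
    (ha : HasTyI Γ a (σ.subst A)) (hb : HasTyI Γ b (τ.subst A)) :
    ExtEqI Γ (Tm.app (act (Ty.tensor σ τ) A B F G) (Tm.tensor a b))
      (Tm.tensor (Tm.app (act σ A B F G) a) (Tm.app (act τ A B F G) b))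
      (Ty.tensor (σ.subst B) (τ.subst B)) := by
  have h₁ := ExtEqI.lamβ ((act_hasTy h).app (ha.tensor hb))
  simp [Tm.inst, Tm.subst] at h₁
  have h₂ := ExtEqI.tensorβ h₁.hasTy.2
  simp [Tm.inst2, Tm.subst] at h₂
  exact .trans h₁ h₂

theorem ExtEqI.act_lolli {σ τ : S.Ty k} (h : ActOk Γ (Ty.lolli σ τ) A B F G) {x z : Tm S n}
    (hx : HasTyI Γ x (Ty.lolli (σ.subst A) (τ.subst A))) (hz : HasTyI Γ z (σ.subst B)) :
    ExtEqI Γ (Tm.app (Tm.app (act (Ty.lolli σ τ) A B F G) x) z)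
      (Tm.app (act τ A B F G) (Tm.app x (Tm.app (act σ B A G F) z))) (τ.subst B) := by
  have h₁ := ExtEqI.lamβ ((act_hasTy h).app hx)
  simp [Tm.inst, Tm.subst] at h₁
  have h₂ := ExtEqI.app h₁ (.refl hz)
  have h₃ := ExtEqI.lamβ h₂.hasTy.2
  simp [Tm.inst, Tm.subst] at h₃
  exact .trans h₂ h₃

theorem ExtEqI.act_bang {σ : S.Ty k} (h : ActOk Γ (Ty.bang σ) A B F G) {a : Tm S n}
    (ha : HasTyI Γ a (σ.subst A)) :
    ExtEqI Γ (Tm.app (act (Ty.bang σ) A B F G) (Tm.bang a))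
      (Tm.bang (Tm.app (act σ A B F G) a)) (Ty.bang (σ.subst B)) := by
  have h₁ := ExtEqI.lamβ ((act_hasTy h).app ha.bang)
  simp [Tm.inst, Tm.subst] at h₁
  have h₂ := ExtEqI.bangβ h₁.hasTy.2
  simp [Tm.inst, Tm.subst] at h₂
  exact .trans h₁ h₂

theorem ExtEqI.act_pi {σ : S.Ty (k + 1)} (h : ActOk Γ (Ty.pi σ) A B F G) {x : Tm S n}
    (hx : HasTyI Γ x (Ty.pi (σ.subst (Ty.up A)))) (C : S.Ty n) :
    ExtEqI Γ (Tm.tapp (Tm.app (act (Ty.pi σ) A B F G) x) C)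
      (Tm.app (act σ (Ty.cons C A) (Ty.cons C B) (Fin.cases (Tm.idm C) F)
        (Fin.cases (Tm.idm C) G)) (Tm.tapp x C)) (σ.subst (Ty.cons C B)) := by
  have h₁ := ExtEqI.lamβ ((act_hasTy h).app hx)
  simp [Tm.inst, Tm.subst] at h₁
  have h₂ := ExtEqI.tapp h₁ C
  have h₃ := ExtEqI.tlamβ h₂.hasTy.2
  have h₄ := ExtEq.trans h₂ h₃
  rw [Ty.subst_up_inst] at h₄
  convert h₄ using 1
  simp [Tm.instTy, Tm.subst, act_subst, cases_comp, Ty.subst]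
  have e : ∀ A : Fin k → S.Ty n, (fun i => (Ty.up A i).subst (Ty.cons C Ty.var)) = Ty.cons C A := by
    intro A; funext i
    refine Fin.cases rfl (fun i => ?_) i
    simp [Ty.up]
  simp [e, Tm.idm, Tm.subst, Ty.subst]
  exact Iff.rfl

end ActBeta

-- The action at identities

section ActId

variable {T : Theory S}

/-- The family of identities. -/
def idv {k n : ℕ} (A : Fin k → S.Ty n) (i : Fin k) : Tm S n := Tm.idm (A i)

theorem ActOk.id {k n : ℕ} (Γ : List (S.Ty n)) (σ : S.Ty k) (A : Fin k → S.Ty n) :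
    ActOk Γ σ A A (idv A) (idv A) := ⟨fun _ _ => .idm _, fun _ _ => .idm _, fun _ _ _ => rfl⟩

theorem act_idv_wk {k n : ℕ} (σ : S.Ty k) (A : Fin k → S.Ty n) (j : ℕ) :
    (act σ A A (idv A) (idv A)).wk j = act σ A A (idv A) (idv A) := by
  rw [act_wk]; simp only [idv, Tm.wk_idm]; rfl

theorem act_idv_wkTy {k n : ℕ} (σ : S.Ty k) (A : Fin k → S.Ty n) :
    (act σ A A (idv A) (idv A)).wkTy =
      act σ (fun i => (A i).wk) (fun i => (A i).wk) (idv fun i => (A i).wk)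
        (idv fun i => (A i).wk) := act_wkTy _ _ _ _ _

theorem cases_idv {k n : ℕ} (A : Fin k → S.Ty n) (C : S.Ty n) :
    (Fin.cases (Tm.idm C) (idv A) : Fin (k + 1) → Tm S n) = idv (Ty.cons C A) := by
  funext i; exact Fin.cases rfl (fun _ => rfl) i

/-- `σ(id) = id`. -/
theorem act_id (hext : Extensionality T) (hid : IdentityExtension T) {k n : ℕ} (σ : S.Ty k)
    (A : Fin k → S.Ty n) (Γ : List (S.Ty n)) (Θ : List (RelDecl S n)) (Φ : List (Form S n)) :
    IEq T Γ Θ Φ (Ty.lolli (σ.subst A) (σ.subst A)) (act σ A A (idv A) (idv A))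
      (Tm.idm (σ.subst A)) := by
  induction σ generalizing n with
  | var i => exact .rfl (.idm _)
  | con c args => exact .rfl (.idm _)
  | one => exact .rfl (.idm _)
  | tensor σ τ ih₁ ih₂ =>
      refine IEq.tensor_ext hext hid (act_hasTy (.id Γ _ A)) (.idm _) ?_
      rw [act_idv_wk, Tm.wk_idm]
      have v1 : HasTyI (τ.subst A :: σ.subst A :: Γ) (Tm.var 1) (σ.subst A) := .var rfl
      have v0 : HasTyI (τ.subst A :: σ.subst A :: Γ) (Tm.var 0) (τ.subst A) := .var rfl
      have h₁ := (IEq.appL (ih₁ A _ Θ ((Φ.map Form.wk).map Form.wk)) v1).trans (ExtEqI.idm v1).ieq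
      have h₂ := (IEq.appL (ih₂ A _ Θ ((Φ.map Form.wk).map Form.wk)) v0).trans (ExtEqI.idm v0).ieq
      exact ((ExtEqI.act_tensor (.id _ _ A) v1 v0).ieq.trans (h₁.tensor h₂)).trans
        (ExtEqI.idm (v1.tensor v0)).ieq.symm
  | lolli σ τ ih₁ ih₂ =>
      refine IEq.ext hext (act_hasTy (.id Γ _ A)) (.idm _) ?_
      rw [act_idv_wk, Tm.wk_idm]
      have w0 : HasTyI (Ty.lolli (σ.subst A) (τ.subst A) :: Γ) (Tm.var 0)
        (Ty.lolli (σ.subst A) (τ.subst A)) := .var rfl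
      refine .trans ?_ (ExtEqI.idm w0).ieq.symm
      refine IEq.ext hext ((act_hasTy (.id _ _ A)).app w0) w0 ?_
      rw [Tm.wk, Tm.ren, ← Tm.wk, act_idv_wk]
      have v1 : HasTyI (σ.subst A :: Ty.lolli (σ.subst A) (τ.subst A) :: Γ) (Tm.var 1)
        (Ty.lolli (σ.subst A) (τ.subst A)) := .var rfl
      have v0 : HasTyI (σ.subst A :: Ty.lolli (σ.subst A) (τ.subst A) :: Γ) (Tm.var 0)
        (σ.subst A) := .var rfl
      have h₁ := (IEq.appL (ih₁ A _ Θ ((Φ.map Form.wk).map Form.wk)) v0).trans (ExtEqI.idm v0).ieq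
      have h₂ := ((ih₂ A _ Θ ((Φ.map Form.wk).map Form.wk)).app (.appR v1 h₁)).trans
        (ExtEqI.idm (v1.app v0)).ieq
      exact (ExtEqI.act_lolli (.id _ _ A) v1 v0).ieq.trans h₂
  | bang σ ih =>
      refine IEq.bang_ext hext hid (act_hasTy (.id Γ _ A)) (.idm _) ?_
      rw [act_idv_wk, Tm.wk_idm]
      have v0 : HasTyI (σ.subst A :: Γ) (Tm.var 0) (σ.subst A) := .var rfl
      have h₁ := (IEq.appL (ih A _ Θ (Φ.map Form.wk)) v0).trans (ExtEqI.idm v0).ieq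
      exact ((ExtEqI.act_bang (.id _ _ A) v0).ieq.trans h₁.bang).trans (ExtEqI.idm v0.bang).ieq.symm
  | pi σ ih =>
      refine IEq.ext hext (act_hasTy (.id Γ _ A)) (.idm _) ?_
      rw [act_idv_wk, Tm.wk_idm]
      have w0 : HasTyI ((Ty.pi σ).subst A :: Γ) (Tm.var 0) ((Ty.pi σ).subst A) := .var rfl
      refine .trans ?_ (ExtEqI.idm w0).ieq.symm
      refine IEq.extPi hext ((act_hasTy (.id _ _ A)).app w0) w0 ?_
      rw [Tm.wkTy, Tm.ren, ← Tm.wkTy, act_idv_wkTy]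
      have v0 : HasTyI (((Ty.pi σ).subst A :: Γ).map Ty.wk) (Tm.var 0)
          ((Ty.pi σ).subst fun i => (A i).wk) := .var (by
        simp only [List.map_cons, List.getElem?_cons_zero, Ty.wk, Ty.ren_subst])
      have h₁ := ExtEqI.act_pi (.id _ _ fun i => (A i).wk) v0 (Ty.var 0)
      have h₂ := ih (Ty.up A) (((Ty.pi σ).subst A :: Γ).map Ty.wk) (Θ.map RelDecl.wk)
        ((Φ.map Form.wk).map Form.wkTy)
      rw [cases_idv] at h₁
      have v1 := v0.tapp (Ty.var 0)
      rw [Ty.subst_up_inst] at v1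
      exact h₁.ieq.trans ((h₂.appL v1).trans (ExtEqI.idm v1).ieq)

end ActId

/-! ### Types in fewer variables -/

theorem Ty.exists_ren {k l : ℕ} (σ : S.Ty k) (r : Fin l → Fin k)
    (h : ∀ i p, σ.Occ p i → ∃ j, r j = i) : ∃ σ' : S.Ty l, σ = σ'.ren r := by
  induction σ generalizing l with
  | var i =>
      obtain ⟨j, rfl⟩ := h i true ⟨rfl, rfl⟩
      exact ⟨.var j, rfl⟩
  | con c args ih =>
      choose f hf using fun k => ih k r fun i p o => h i p ⟨k, p, o⟩
      exact ⟨.con c f, by simp only [Ty.ren, ← hf]⟩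
  | one => exact ⟨.one, rfl⟩
  | tensor σ τ ih₁ ih₂ =>
      obtain ⟨σ', rfl⟩ := ih₁ r fun i p o => h i p (.inl o)
      obtain ⟨τ', rfl⟩ := ih₂ r fun i p o => h i p (.inr o)
      exact ⟨.tensor σ' τ', rfl⟩
  | lolli σ τ ih₁ ih₂ =>
      obtain ⟨σ', rfl⟩ := ih₁ r fun i p o => h i (!p) (.inl (by simpa using o))
      obtain ⟨τ', rfl⟩ := ih₂ r fun i p o => h i p (.inr o)
      exact ⟨.lolli σ' τ', rfl⟩
  | bang σ ih =>
      obtain ⟨σ', rfl⟩ := ih r fun i p o => h i p o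
      exact ⟨.bang σ', rfl⟩
  | pi σ ih =>
      obtain ⟨σ', rfl⟩ := ih (upRen r) fun i p => Fin.cases (fun _ => ⟨0, rfl⟩) (fun i o => by
        obtain ⟨j, rfl⟩ := h i p o
        exact ⟨j.succ, rfl⟩) i
      exact ⟨.pi σ', rfl⟩

-- Every type is an injective renaming of a type all of whose variables are mapped to occurring
-- ones. In this form the rule `tyRen` can discard the relations at variables that do not occur.
open Classical in
theorem Ty.exists_occ_ren {k : ℕ} (σ : S.Ty k) : ∃ (l : ℕ) (r : Fin l → Fin k) (σ' : S.Ty l),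
    Function.Injective r ∧ (∀ j, ∃ p, σ.Occ p (r j)) ∧ σ = σ'.ren r := by
  let e := (Fintype.equivFin {i : Fin k // ∃ p, σ.Occ p i}).symm
  obtain ⟨σ', h⟩ := Ty.exists_ren σ (fun j => (e j).1) fun i p o =>
    ⟨e.symm ⟨i, p, o⟩, by simp⟩
  exact ⟨_, _, σ', Subtype.val_injective.comp e.injective, fun j => (e j).2, h⟩

/-! ### The functorial action preserves relations -/

section ActRel

variable {T : Theory S}

/-- The logic has no clause that unfolds the interpretation of a type constant. Independence of the
relations at absent variables is therefore obtained by passing to a type in the occurring variables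
only and back. -/
theorem IRel.ty_congr {n k : ℕ} {Γ : List (S.Ty n)} {Θ : List (RelDecl S n)}
    {Φ : List (Form S n)} {σ : S.Ty k} {A A' B B' : Fin k → S.Ty n} {ρ ρ' : Fin k → Rel S n}
    {t u : Tm S n} (hρ : ∀ i, RelOk T true Γ Θ (ρ i) (A i) (A' i))
    (hρ' : ∀ i, RelOk T true Γ Θ (ρ' i) (B i) (B' i))
    (h : ∀ i p, σ.Occ p i → A i = B i ∧ A' i = B' i ∧ ρ i = ρ' i)
    (hr : IRel T Γ Θ Φ (.ty σ ρ) (σ.subst A) (σ.subst A') t u) :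
    IRel T Γ Θ Φ (.ty σ ρ') (σ.subst B) (σ.subst B') t u := by
  obtain ⟨l, r, σ', hi, ho, rfl⟩ := Ty.exists_occ_ren σ
  rw [Ty.subst_ren, Ty.subst_ren] at hr ⊢
  have h₁ := (IRel.ty_ren hi hρ).1 hr
  refine (IRel.ty_ren hi hρ').2 ?_
  have e₁ : A ∘ r = B ∘ r := funext fun j => (h _ _ (ho j).choose_spec).1
  have e₂ : A' ∘ r = B' ∘ r := funext fun j => (h _ _ (ho j).choose_spec).2.1
  have e₃ : (fun j => ρ (r j)) = fun j => ρ' (r j) :=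
    funext fun j => (h _ _ (ho j).choose_spec).2.2
  rw [e₁, e₂, e₃] at h₁
  exact h₁

/-- Data for two functorial actions of `σ` that are related at the variables of `σ`. -/
structure ActRel (T : Theory S) {k n : ℕ} (Γ : List (S.Ty n)) (Θ : List (RelDecl S n))
    (Φ : List (Form S n)) (σ : S.Ty k) (A A' B B' : Fin k → S.Ty n) (ρ ρ' : Fin k → Rel S n)
    (F F' G G' : Fin k → Tm S n) : Prop where
  dom : ∀ i, RelOk T true Γ Θ (ρ i) (A i) (A' i)
  cod : ∀ i, RelOk T true Γ Θ (ρ' i) (B i) (B' i)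
  pos : ∀ i, σ.Occ true i → IRel T Γ Θ Φ (Rel.lolli (A i) (A' i) (B i) (B' i) (ρ i) (ρ' i))
    (Ty.lolli (A i) (B i)) (Ty.lolli (A' i) (B' i)) (F i) (F' i)
  neg : ∀ i, σ.Occ false i → IRel T Γ Θ Φ (Rel.lolli (B i) (B' i) (A i) (A' i) (ρ' i) (ρ i))
    (Ty.lolli (B i) (A i)) (Ty.lolli (B' i) (A' i)) (G i) (G' i)
  both : ∀ i, σ.Occ true i → σ.Occ false i → A i = B i ∧ A' i = B' i ∧ ρ i = ρ' i

theorem IRel.idm {n : ℕ} {Γ : List (S.Ty n)} {Θ : List (RelDecl S n)} {Φ : List (Form S n)}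
    {R : Rel S n} {A B : S.Ty n} (hR : RelOk T false Γ Θ R A B) :
    IRel T Γ Θ Φ (Rel.lolli A B A B R R) (Ty.lolli A A) (Ty.lolli B B) (Tm.idm A) (Tm.idm B) := by
  refine IRel.lolli_intro hR hR (.idm _) (.idm _) ?_
  rw [Tm.wk_idm, Tm.wk_idm]
  have h := IRel.hyp0 (Φ := (Φ.map Form.wk).map Form.wk) hR
  exact h.congr (ExtEqI.idm h.left).ieq.symm (ExtEqI.idm h.right).ieq.symm

theorem Rel.wkAll_lolli {n : ℕ} (σ τ σ' τ' : S.Ty n) (ρ ρ' : Rel S n) :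
    (Rel.lolli σ τ σ' τ' ρ ρ').wkAll =
      Rel.lolli σ.wk.wk τ.wk.wk σ'.wk.wk τ'.wk.wk ρ.wkAll ρ'.wkAll := by
  simp only [Rel.wkAll, Rel.wkTy, Rel.wkRel, Rel.ren_lolli, Ty.ren_id]; rfl

theorem ActOk.wkTy {k n : ℕ} {Γ : List (S.Ty n)} {σ : S.Ty k} {A B : Fin k → S.Ty n}
    {F G : Fin k → Tm S n} (h : ActOk Γ σ A B F G) :
    ActOk (Γ.map Ty.wk) σ (fun i => (A i).wk) (fun i => (B i).wk) (fun i => (F i).wkTy)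
      (fun i => (G i).wkTy) :=
  ⟨fun i o => (h.pos i o).wkTy, fun i o => (h.neg i o).wkTy,
    fun i o o' => congrArg Ty.wk (h.both i o o')⟩

namespace ActRel

variable {k n : ℕ} {Γ : List (S.Ty n)} {Θ : List (RelDecl S n)} {Φ : List (Form S n)}
  {A A' B B' : Fin k → S.Ty n} {ρ ρ' : Fin k → Rel S n} {F F' G G' : Fin k → Tm S n}

section

variable {σ τ : S.Ty k}

theorem left (h : ActRel T Γ Θ Φ σ A A' B B' ρ ρ' F F' G G') : ActOk Γ σ A B F G :=
  ⟨fun i o => (h.pos i o).left, fun i o => (h.neg i o).left, fun i o o' => (h.both i o o').1⟩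

theorem right (h : ActRel T Γ Θ Φ σ A A' B B' ρ ρ' F F' G G') : ActOk Γ σ A' B' F' G' :=
  ⟨fun i o => (h.pos i o).right, fun i o => (h.neg i o).right,
    fun i o o' => (h.both i o o').2.1⟩

theorem tensor_left (h : ActRel T Γ Θ Φ (Ty.tensor σ τ) A A' B B' ρ ρ' F F' G G') :
    ActRel T Γ Θ Φ σ A A' B B' ρ ρ' F F' G G' :=
  ⟨h.dom, h.cod, fun i o => h.pos i (.inl o), fun i o => h.neg i (.inl o),
    fun i o o' => h.both i (.inl o) (.inl o')⟩

theorem tensor_right (h : ActRel T Γ Θ Φ (Ty.tensor σ τ) A A' B B' ρ ρ' F F' G G') :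
    ActRel T Γ Θ Φ τ A A' B B' ρ ρ' F F' G G' :=
  ⟨h.dom, h.cod, fun i o => h.pos i (.inr o), fun i o => h.neg i (.inr o),
    fun i o o' => h.both i (.inr o) (.inr o')⟩

theorem lolli_left (h : ActRel T Γ Θ Φ (Ty.lolli σ τ) A A' B B' ρ ρ' F F' G G') :
    ActRel T Γ Θ Φ σ B B' A A' ρ' ρ G G' F F' :=
  ⟨h.cod, h.dom, fun i o => h.neg i (.inl o), fun i o => h.pos i (.inl o), fun i o o' => by
    obtain ⟨h₁, h₂, h₃⟩ := h.both i (.inl o') (.inl o)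
    exact ⟨h₁.symm, h₂.symm, h₃.symm⟩⟩

theorem lolli_right (h : ActRel T Γ Θ Φ (Ty.lolli σ τ) A A' B B' ρ ρ' F F' G G') :
    ActRel T Γ Θ Φ τ A A' B B' ρ ρ' F F' G G' :=
  ⟨h.dom, h.cod, fun i o => h.pos i (.inr o), fun i o => h.neg i (.inr o),
    fun i o o' => h.both i (.inr o) (.inr o')⟩

theorem bang (h : ActRel T Γ Θ Φ (Ty.bang σ) A A' B B' ρ ρ' F F' G G') :
    ActRel T Γ Θ Φ σ A A' B B' ρ ρ' F F' G G' := ⟨h.dom, h.cod, h.pos, h.neg, h.both⟩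

theorem wk2 (h : ActRel T Γ Θ Φ σ A A' B B' ρ ρ' F F' G G') (C D : S.Ty n) (φ : Form S n) :
    ActRel T (D :: C :: Γ) Θ (φ :: (Φ.map Form.wk).map Form.wk) σ A A' B B'
      (fun i => (ρ i).wk 2) (fun i => (ρ' i).wk 2) (fun i => (F i).wk 2) (fun i => (F' i).wk 2)
      (fun i => (G i).wk 2) (fun i => (G' i).wk 2) where
  dom i := (h.dom i).wk2 _ _
  cod i := (h.cod i).wk2 _ _
  pos i o := by
    rw [← Rel.wk_lolli]
    exact ((h.pos i o).wk2 C D).mono (List.subset_cons_self _ _)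
  neg i o := by
    rw [← Rel.wk_lolli]
    exact ((h.neg i o).wk2 C D).mono (List.subset_cons_self _ _)
  both i o o' := by
    obtain ⟨h₁, h₂, h₃⟩ := h.both i o o'
    exact ⟨h₁, h₂, congrArg (Rel.wk 2) h₃⟩

end

/-- At the bound variable both actions are identities, and these preserve the generic admissible
relation between the two new types. -/
theorem pi {σ : S.Ty (k + 1)} (h : ActRel T Γ Θ Φ (Ty.pi σ) A A' B B' ρ ρ' F F' G G') :
    ActRel T ((Γ.map Ty.wk).map Ty.wk)
      (⟨true, Ty.var 1, Ty.var 0⟩ :: (Θ.map RelDecl.wk).map RelDecl.wk)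
      (((Φ.map Form.wkTy).map Form.wkTy).map Form.wkRel) σ
      (Ty.cons (Ty.var 1) fun i => (A i).wk.wk) (Ty.cons (Ty.var 0) fun i => (A' i).wk.wk)
      (Ty.cons (Ty.var 1) fun i => (B i).wk.wk) (Ty.cons (Ty.var 0) fun i => (B' i).wk.wk)
      (Rel.cons (.var 0) fun i => (ρ i).wkAll) (Rel.cons (.var 0) fun i => (ρ' i).wkAll)
      (Fin.cases (Tm.idm (Ty.var 1)) fun i => (F i).wkTy.wkTy)
      (Fin.cases (Tm.idm (Ty.var 0)) fun i => (F' i).wkTy.wkTy)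
      (Fin.cases (Tm.idm (Ty.var 1)) fun i => (G i).wkTy.wkTy)
      (Fin.cases (Tm.idm (Ty.var 0)) fun i => (G' i).wkTy.wkTy) where
  dom := RelOk.cons (.var rfl) fun i => (h.dom i).wkAll _
  cod := RelOk.cons (.var rfl) fun i => (h.cod i).wkAll _
  pos i := Fin.cases (fun _ => .idm (.relVar0 _ _)) (fun i o => by
    have := (h.pos i o).wkAll (⟨true, Ty.var 1, Ty.var 0⟩ : RelDecl S (n + 2))
    rw [Rel.wkAll_lolli] at this
    exact this) i
  neg i := Fin.cases (fun _ => .idm (.relVar0 _ _)) (fun i o => by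
    have := (h.neg i o).wkAll (⟨true, Ty.var 1, Ty.var 0⟩ : RelDecl S (n + 2))
    rw [Rel.wkAll_lolli] at this
    exact this) i
  both i := Fin.cases (fun _ _ => ⟨rfl, rfl, rfl⟩) (fun i o o' => by
    obtain ⟨h₁, h₂, h₃⟩ := h.both i o o'
    exact ⟨congrArg (fun τ => τ.wk.wk) h₁, congrArg (fun τ => τ.wk.wk) h₂,
      congrArg Rel.wkAll h₃⟩) i

end ActRel

/-- The functorial action of a type on related maps preserves the relational interpretation of
the type. -/
theorem IRel.act {k n : ℕ} {Γ : List (S.Ty n)} {Θ : List (RelDecl S n)} {Φ : List (Form S n)}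
    {σ : S.Ty k} {A A' B B' : Fin k → S.Ty n} {ρ ρ' : Fin k → Rel S n}
    {F F' G G' : Fin k → Tm S n} (h : ActRel T Γ Θ Φ σ A A' B B' ρ ρ' F F' G G') {x y : Tm S n}
    (hxy : IRel T Γ Θ Φ (.ty σ ρ) (σ.subst A) (σ.subst A') x y) :
    IRel T Γ Θ Φ (.ty σ ρ') (σ.subst B) (σ.subst B') (Tm.app (act σ A B F G) x)
      (Tm.app (act σ A' B' F' G') y) := by
  induction σ generalizing n x y with
  | var i =>
      exact (IRel.ty_var h.cod i).2 ((h.pos i ⟨rfl, rfl⟩).lolli_elim (.ofAdm (h.cod i))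
        ((IRel.ty_var h.dom i).1 hxy))
  | con c args =>
      have h₁ := hxy.congr (ExtEqI.idm hxy.left).ieq.symm (ExtEqI.idm hxy.right).ieq.symm
      -- The action is the identity here. Every variable involved occurs with both signs, so `both`
      -- says that its types and relations coincide on the two sides.
      refine IRel.ty_congr h.dom h.cod (fun i p o => ?_) h₁
      obtain ⟨j, q, o⟩ := o
      exact h.both i ⟨j, q, o⟩ ⟨j, q, o⟩
  | one =>
      have h₁ := hxy.congr (ExtEqI.idm hxy.left).ieq.symm (ExtEqI.idm hxy.right).ieq.symm
      -- The interpretation of I does not depend on the vector of relations, so it can be read with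
      -- either one.
      exact (IRel.ty_one h.cod).2 ((IRel.ty_one h.dom).1 h₁)
  | tensor σ τ ih₁ ih₂ =>
      have okσ : RelOk T false Γ Θ (.ty σ ρ) _ _ := .ofAdm (.ty σ h.dom)
      have okτ : RelOk T false Γ Θ (.ty τ ρ) _ _ := .ofAdm (.ty τ h.dom)
      have okc : RelOk T true Γ Θ (.ty (Ty.tensor σ τ) ρ') _ _ := .ty (Ty.tensor σ τ) h.cod
      have tl := act_hasTy h.left
      have tr := act_hasTy h.right
      -- The elimination rule asks for an admissible target. The interpretation of the whole tensor
      -- at `ρ'` qualifies, and on pairs the action computes componentwise.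
      refine IRel.tensor_elim okσ okτ ((IRel.ty_tensor h.dom).1 hxy) okc tl tr ?_
      refine IRel.lolli_intro okσ (.lolli okτ (.ofAdm okc)) tl.curry tr.curry ?_
      rw [Rel.wk_lolli]
      refine IRel.lolli_intro (okτ.wk2 _ _) (RelOk.wk2 (.ofAdm okc) _ _)
        (.app tl.curry.wk2 (.var (by rfl))) (.app tr.curry.wk2 (.var (by rfl))) ?_
      have h₂ := (h.wk2 (σ.subst A) (σ.subst A')
        (.rel (Rel.wk 2 (.ty σ ρ)) (.var 1) (.var 0))).wk2 (τ.subst A) (τ.subst A')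
        (.rel (Rel.wk 2 (Rel.wk 2 (.ty τ ρ))) (.var 1) (.var 0))
      have x₁ := ((IRel.hyp0 okσ (Φ := (Φ.map Form.wk).map Form.wk)).wk2 (τ.subst A)
        (τ.subst A')).mono (List.subset_cons_self
          (Form.rel (Rel.wk 2 (Rel.wk 2 (.ty τ ρ))) (.var 1) (.var 0)) _)
      have x₂ := IRel.hyp0 (Φ := ((((Form.rel (Rel.wk 2 (.ty σ ρ)) (.var 1) (.var 0))) ::
        (Φ.map Form.wk).map Form.wk).map Form.wk).map Form.wk)
        (okτ.wk2 (σ.subst A) (σ.subst A'))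
      have key := (IRel.ty_tensor h₂.cod).2
        ((ih₁ h₂.tensor_left x₁).tensor_intro (ih₂ h₂.tensor_right x₂))
      have e : ∀ (A B : Fin _ → S.Ty n) (F G : Fin _ → Tm S n),
          ((Tm.curry (σ.subst A) (τ.subst A) (LAPL.act (Ty.tensor σ τ) A B F G)).wk 2).wk 2 =
          Tm.curry (σ.subst A) (τ.subst A) (LAPL.act (Ty.tensor σ τ) A B
            (fun i => ((F i).wk 2).wk 2) (fun i => ((G i).wk 2).wk 2)) := by
        intro A B F G
        rw [Tm.curry_wk, Tm.curry_wk, act_wk, act_wk]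
      have c₁ := ExtEq.trans (ExtEqI.curry (act_hasTy h₂.left) x₁.left x₂.left)
        (ExtEqI.act_tensor h₂.left x₁.left x₂.left)
      have c₂ := ExtEq.trans (ExtEqI.curry (act_hasTy h₂.right) x₁.right x₂.right)
        (ExtEqI.act_tensor h₂.right x₁.right x₂.right)
      rw [← e] at c₁ c₂
      exact key.congr (ExtEqI.ieq c₁).symm (ExtEqI.ieq c₂).symm
  | lolli σ τ ih₁ ih₂ =>
      have h₁ := (IRel.ty_lolli h.dom).1 hxy
      refine (IRel.ty_lolli h.cod).2 (IRel.lolli_intro (.ofAdm (.ty σ h.cod))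
        (.ofAdm (.ty τ h.cod)) ((act_hasTy h.left).app hxy.left)
        ((act_hasTy h.right).app hxy.right) ?_)
      have h₂ := h.wk2 (σ.subst B) (σ.subst B') (.rel (Rel.wk 2 (.ty σ ρ')) (.var 1) (.var 0))
      have x₂ := (h₁.wk2 (σ.subst B) (σ.subst B')).mono (List.subset_cons_self
        (Form.rel (Rel.wk 2 (.ty σ ρ')) (.var 1) (.var 0)) _)
      rw [Rel.wk_lolli] at x₂
      have z := IRel.hyp0 (Φ := (Φ.map Form.wk).map Form.wk)
        (T := T) (Γ := Γ) (Θ := Θ) (.ofAdm (.ty σ h.cod))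
      -- An argument in the target goes back along the action of the domain, where the two vectors
      -- of relations change places, then through the related functions, and forward along the
      -- action of the codomain.
      have key := ih₂ h₂.lolli_right (x₂.lolli_elim (.ofAdm (.ty τ h₂.dom)) (ih₁ h₂.lolli_left z))
      have c₁ := ExtEqI.act_lolli h₂.left x₂.left z.left
      have c₂ := ExtEqI.act_lolli h₂.right x₂.right z.right
      rw [← act_wk] at c₁ c₂
      exact key.congr c₁.ieq.symm c₂.ieq.symm
  | bang σ ih =>
      have okσ : RelOk T false Γ Θ (.ty σ ρ) _ _ := .ofAdm (.ty σ h.dom)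
      have okc : RelOk T true Γ Θ (.ty (Ty.bang σ) ρ') _ _ := .ty (Ty.bang σ) h.cod
      refine IRel.bang_elim okσ ((IRel.ty_bang h.dom).1 hxy) okc ?_
      refine IRel.arr_intro okσ (.ofAdm okc) (act_hasTy h.left) (act_hasTy h.right) ?_
      have h₂ := h.wk2 (σ.subst A) (σ.subst A') (.rel (Rel.wk 2 (.ty σ ρ)) (.var 1) (.var 0))
      have z := IRel.hyp0 (Φ := (Φ.map Form.wk).map Form.wk) okσ
      have key := (IRel.ty_bang h₂.cod).2 (ih h₂.bang z).bang_intro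
      have c₁ := ExtEqI.act_bang h₂.left z.left
      have c₂ := ExtEqI.act_bang h₂.right z.right
      rw [← act_wk] at c₁ c₂
      exact key.congr c₁.ieq.symm c₂.ieq.symm
  | pi σ ih =>
      refine IRel.ty_pi_intro h.cod ((act_hasTy h.left).app hxy.left)
        ((act_hasTy h.right).app hxy.right) ?_
      have hw := hxy.wkAll (⟨true, Ty.var 1, Ty.var 0⟩ : RelDecl S (n + 2))
      have e : ∀ A : Fin _ → S.Ty n, ((Ty.pi σ).subst A).wk.wk =
          (Ty.pi σ).subst fun i => (A i).wk.wk := fun A => by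
        simp only [Ty.wk, Ty.ren_subst]
      rw [e, e] at hw
      have h₂ := h.pi
      have key := ih h₂ (IRel.ty_pi_elim (fun i => (h.dom i).wkAll _) (.var rfl) hw)
      have c₁ := ExtEqI.act_pi h.left.wkTy.wkTy hw.left (Ty.var 1)
      have c₂ := ExtEqI.act_pi h.right.wkTy.wkTy hw.right (Ty.var 0)
      rw [← act_wkTy, ← act_wkTy] at c₁ c₂
      exact key.congr c₁.ieq.symm c₂.ieq.symm

end ActRel

/-! ### Functions between equality relations and spans -/

theorem Tm.wk_app {n : ℕ} (k : ℕ) (t u : Tm S n) : (Tm.app t u).wk k = Tm.app (t.wk k) (u.wk k) :=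
  rfl

section Spans

variable {T : Theory S} {n : ℕ} {Γ : List (S.Ty n)} {Θ : List (RelDecl S n)}
  {Φ : List (Form S n)} {A B C D : S.Ty n} {f g m F F' : Tm S n}

/-- Maps F and F' carry equal arguments to related ones when f ∘ F = g ∘ F'. With its companion
below this produces the hypotheses of `IRel.act` from commuting squares. -/
theorem IRel.eqr_span (hf : HasTyI Γ f (Ty.lolli B D)) (hg : HasTyI Γ g (Ty.lolli C D))
    (hF : HasTyI Γ F (Ty.lolli A B)) (hF' : HasTyI Γ F' (Ty.lolli A C))
    (h : IEq T (A :: Γ) Θ (Φ.map Form.wk) D (Tm.app (f.wk 1) (Tm.app (F.wk 1) (Tm.var 0)))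
      (Tm.app (g.wk 1) (Tm.app (F'.wk 1) (Tm.var 0)))) :
    IRel T Γ Θ Φ (Rel.lolli A A B C (Rel.eqr A) (Rel.span B C D f g)) (Ty.lolli A B)
      (Ty.lolli A C) F F' := by
  refine IRel.lolli_intro (.ofAdm (.eqr A)) (.ofAdm (.span hf hg)) hF hF' ?_
  have hv := IRel.hyp0 (Φ := (Φ.map Form.wk).map Form.wk) (T := T) (Γ := Γ) (Θ := Θ)
    (.ofAdm (.eqr A))
  rw [Rel.wk_eqr] at hv ⊢
  have h₁ := (h.wk1 A).mono (List.subset_cons_self (Form.rel (Rel.eqr A) (.var 1) (.var 0)) _)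
  simp only [Tm.wk_app, Tm.wk_wk] at h₁
  have h₂ := h₁.trans (.appR hg.wk2 (.appR hF'.wk2 hv.eqr_elim))
  rw [Rel.wk_span]
  exact h₂.span hf.wk2 hg.wk2 (hF.wk2.app hv.left) (hF'.wk2.app hv.right)

/-- If F and F' factor as m ∘ f and m ∘ g, arguments with f x = g y are sent to equal values. -/
theorem IRel.span_eqr (hf : HasTyI Γ f (Ty.lolli A D)) (hg : HasTyI Γ g (Ty.lolli B D))
    (hm : HasTyI Γ m (Ty.lolli D C)) (hF : HasTyI Γ F (Ty.lolli A C))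
    (hF' : HasTyI Γ F' (Ty.lolli B C))
    (h : IEq T (A :: Γ) Θ (Φ.map Form.wk) C (Tm.app (F.wk 1) (Tm.var 0))
      (Tm.app (m.wk 1) (Tm.app (f.wk 1) (Tm.var 0))))
    (h' : IEq T (B :: Γ) Θ (Φ.map Form.wk) C (Tm.app (F'.wk 1) (Tm.var 0))
      (Tm.app (m.wk 1) (Tm.app (g.wk 1) (Tm.var 0)))) :
    IRel T Γ Θ Φ (Rel.lolli A B C C (Rel.span A B D f g) (Rel.eqr C)) (Ty.lolli A C)
      (Ty.lolli B C) F F' := by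
  refine IRel.lolli_intro (.ofAdm (.span hf hg)) (.ofAdm (.eqr C)) hF hF' ?_
  have hv := IRel.hyp0 (Φ := (Φ.map Form.wk).map Form.wk) (T := T) (Γ := Γ) (Θ := Θ)
    (.ofAdm (.span hf hg))
  rw [Rel.wk_span] at hv ⊢
  rw [Rel.wk_eqr]
  have e := hv.span_elim hf.wk2 hg.wk2
  have h₁ := (h.wk1 B).mono (List.subset_cons_self (Form.rel (Rel.span A B D (f.wk 2) (g.wk 2))
    (.var 1) (.var 0)) _)
  -- The equation for F' concerns the second related variable, so the first one is inserted at index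
  -- 1: index 0 stays and `i + 1` goes to `i + 2`.
  have hr : CtxRen id (fun i => Nat.casesOn i 0 (fun i => i + 2)) id (B :: Γ) Θ
      (B :: A :: Γ) Θ := by
    refine ⟨fun i τ hi => ?_, fun i d hi => ?_⟩
    · rw [Ty.ren_id]
      cases i <;> exact hi
    · rw [show d.ren id = d by simp only [RelDecl.ren, Ty.ren_id]]; exact hi
  have h₂ := (h'.ren hr).mono (List.subset_cons_self (Form.rel
      (Rel.span A B D (f.wk 2) (g.wk 2)) (.var 1) (.var 0)) _)
  have e₁ : ∀ t : Tm S n, (t.wk 1).ren id (fun i => Nat.casesOn i 0 (fun i => i + 2)) =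
      t.wk 2 := fun t => by
    rw [Tm.wk, Tm.ren_ren]; rfl
  have e₂ : (Φ.map Form.wk).map (Form.ren id (fun i => Nat.casesOn i 0 (fun i => i + 2)) id) =
      (Φ.map Form.wk).map Form.wk := by
    rw [List.map_map, List.map_map]; congr 1; funext φ
    simp only [Function.comp, Form.wk, Form.ren_ren]; rfl
  simp only [Tm.wk_app, Tm.wk_wk] at h₁
  rw [Ty.ren_id, e₂] at h₂
  simp only [Tm.ren, e₁] at h₂
  exact ((h₁.trans (.appR hm.wk2 e)).trans h₂.symm).eqr

end Spans

/-! ### Reduction of closures -/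

section Closures

variable {n m : ℕ} {Γ : List (S.Ty n)} {s : Fin m → S.Ty n} {f : ℕ → Tm S n} {t u : Tm S n}

theorem Tm.subst_up_instTy (b : Tm S (m + 1)) (s : Fin m → S.Ty n) (f : ℕ → Tm S n) (C : S.Ty n) :
    (b.subst (Ty.up s) fun i => (f i).wkTy).instTy C = b.subst (Ty.cons C s) f := by
  rw [Tm.instTy, Tm.subst_subst]
  congr 1
  · funext i
    refine Fin.cases rfl (fun i => ?_) i
    change (s i).wk.subst _ = s i
    rw [Ty.wk_subst_cons, Ty.subst_var]
  · funext i
    rw [Tm.wkTy_subst_cons, Tm.subst_var]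

theorem Tm.subst_up_inst (b : Tm S m) (s : Fin m → S.Ty n) (f : ℕ → Tm S n) (u : Tm S n) :
    (b.subst s (Tm.up f)).inst u = b.subst s (scons u f) := by
  rw [Tm.inst, Tm.subst_subst]
  congr 1
  · funext i; exact Ty.subst_var _
  · funext i
    cases i with
    | zero => rfl
    | succ i => exact Tm.wk_inst _ _

/-- Start of an evaluation with the empty environment. In the rules that follow the arguments
consumed so far are kept as one simultaneous substitution, and each β-step merely extends it. -/
theorem ExtEqI.self_subst {X : S.Ty n} (h : HasTyI Γ t X) :
    ExtEqI Γ t (t.subst Ty.var Tm.var) (X.subst Ty.var) := by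
  rw [Tm.subst_var, Ty.subst_var]; exact .refl h

theorem ExtEqI.tapp_subst {b : Tm S (m + 1)} {X : S.Ty (m + 1)}
    (h : ExtEqI Γ t ((Tm.tlam b).subst s f) ((Ty.pi X).subst s)) (C : S.Ty n) :
    ExtEqI Γ (Tm.tapp t C) (b.subst (Ty.cons C s) f) (X.subst (Ty.cons C s)) := by
  have h₁ := ExtEqI.tapp h C
  have h₂ := ExtEq.trans h₁ (ExtEqI.tlamβ h₁.hasTy.2)
  rw [Tm.subst_up_instTy, Ty.subst_up_inst] at h₂
  exact h₂

theorem ExtEqI.lam_subst {b : Tm S m} {X : S.Ty m} {A B : S.Ty n}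
    (h : ExtEqI Γ t ((Tm.lam X b).subst s f) (Ty.lolli A B)) (hu : HasTyI Γ u A) :
    ExtEqI Γ (Tm.app t u) (b.subst s (scons u f)) B := by
  have h₁ := ExtEqI.app h (.refl hu)
  have h₂ := ExtEq.trans h₁ (ExtEqI.lamβ h₁.hasTy.2)
  rw [Tm.subst_up_inst] at h₂
  exact h₂

theorem ExtEqI.ilam_subst {b : Tm S m} {X : S.Ty m} {A B : S.Ty n}
    (h : ExtEqI Γ t ((Tm.ilam X b).subst s f) (Ty.arr A B)) (hu : HasTyI Γ u A) :
    ExtEqI Γ (Tm.app t (Tm.bang u)) (b.subst s (scons u f)) B := by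
  rw [Tm.subst_ilam] at h
  have h₁ := ExtEqI.app h (.refl hu.bang)
  have h₂ := ExtEq.trans h₁ (ExtEqI.ilamβ h₁.hasTy.2)
  rw [Tm.subst_up_inst] at h₂
  exact h₂

end Closures

/-! ### Functors of mixed variance -/

/-- The functorial action of `σ(α,β)`, contravariant in `α` and covariant in `β`. -/
def fmap {n : ℕ} (σ : S.Ty 2) (α β α' β' : S.Ty n) (f g : Tm S n) : Tm S n :=
  act σ ![β, α] ![β', α'] ![g, Tm.star] ![Tm.star, f]

section Fmap

variable {T : Theory S} {n : ℕ} {Γ : List (S.Ty n)} {Θ : List (RelDecl S n)}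
  {Φ : List (Form S n)} {σ : S.Ty 2} {α β α' β' α₁ β₁ α₂ β₂ : S.Ty n} {f g f' g' : Tm S n}

theorem fmap_ok (hα : σ.OnlyNeg 1) (hβ : σ.OnlyPos 0) (hf : HasTyI Γ f (Ty.lolli α' α))
    (hg : HasTyI Γ g (Ty.lolli β β')) :
    ActOk Γ σ ![β, α] ![β', α'] ![g, Tm.star] ![Tm.star, f] :=
  ⟨fun i o => match i, o with
    | 0, _ => hg
    | 1, o => (hα o).elim,
  fun i o => match i, o with
    | 0, o => (hβ o).elim
    | 1, _ => hf,
  fun i o o' => match i, o, o' with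
    | 0, _, o' => (hβ o').elim
    | 1, o, _ => (hα o).elim⟩

theorem fmap_hasTy (hα : σ.OnlyNeg 1) (hβ : σ.OnlyPos 0) (hf : HasTyI Γ f (Ty.lolli α' α))
    (hg : HasTyI Γ g (Ty.lolli β β')) :
    HasTyI Γ (fmap σ α β α' β' f g) (Ty.lolli (ap₂ σ α β) (ap₂ σ α' β')) :=
  act_hasTy (fmap_ok hα hβ hf hg)

theorem fmap_wk (j : ℕ) : (fmap σ α β α' β' f g).wk j = fmap σ α β α' β' (f.wk j) (g.wk j) := by
  rw [fmap, act_wk, fmap]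
  congr 1
  · funext i; match i with | 0 => rfl | 1 => rfl
  · funext i; match i with | 0 => rfl | 1 => rfl

/-- The unused components are replaced by identities, after which `act_id` applies. -/
theorem fmap_idm (hext : Extensionality T) (hid : IdentityExtension T) (hα : σ.OnlyNeg 1)
    (hβ : σ.OnlyPos 0) {x : Tm S n} (hx : HasTyI Γ x (ap₂ σ α β)) :
    IEq T Γ Θ Φ (ap₂ σ α β) (Tm.app (fmap σ α β α β (Tm.idm α) (Tm.idm β)) x) x := by
  have e : fmap σ α β α β (Tm.idm α) (Tm.idm β) =
      act σ ![β, α] ![β, α] (idv ![β, α]) (idv ![β, α]) := act_congr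
    (fun i o => match i, o with
      | 0, _ => rfl
      | 1, o => (hα o).elim)
    (fun i o => match i, o with
      | 0, o => (hβ o).elim
      | 1, _ => rfl)
  rw [e]
  exact ((act_id hext hid σ ![β, α] Γ Θ Φ).appL hx).trans (ExtEqI.idm hx).ieq

/-- Functoriality. -/
theorem fmap_fmap (hext : Extensionality T) (hid : IdentityExtension T) (hα : σ.OnlyNeg 1)
    (hβ : σ.OnlyPos 0) {f₁ f₂ g₁ g₂ : Tm S n} (hf₁ : HasTyI Γ f₁ (Ty.lolli α₁ α))
    (hg₁ : HasTyI Γ g₁ (Ty.lolli β β₁)) (hf₂ : HasTyI Γ f₂ (Ty.lolli α₂ α₁))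
    (hg₂ : HasTyI Γ g₂ (Ty.lolli β₁ β₂)) (hf : HasTyI Γ f (Ty.lolli α₂ α))
    (hg : HasTyI Γ g (Ty.lolli β β₂))
    (h : IEq T (α₂ :: Γ) Θ (Φ.map Form.wk) α (Tm.app (f₁.wk 1) (Tm.app (f₂.wk 1) (Tm.var 0)))
      (Tm.app (f.wk 1) (Tm.var 0)))
    (h' : IEq T (β :: Γ) Θ (Φ.map Form.wk) β₂ (Tm.app (g₂.wk 1) (Tm.app (g₁.wk 1) (Tm.var 0)))
      (Tm.app (g.wk 1) (Tm.var 0))) {x : Tm S n} (hx : HasTyI Γ x (ap₂ σ α β)) :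
    IEq T Γ Θ Φ (ap₂ σ α₂ β₂)
      (Tm.app (fmap σ α₁ β₁ α₂ β₂ f₂ g₂) (Tm.app (fmap σ α β α₁ β₁ f₁ g₁) x))
      (Tm.app (fmap σ α β α₂ β₂ f g) x) := by
  -- The intermediate relations are g₂ x = y between `β₁` and `β₂`, and x = f₂ y between `α₁` and
  -- `α₂`.
  have okβ : RelOk T true Γ Θ (Rel.span β₁ β₂ β₂ g₂ (Tm.idm β₂)) β₁ β₂ := .span hg₂ (.idm _)
  have okα : RelOk T true Γ Θ (Rel.span α₁ α₂ α₁ (Tm.idm α₁) f₂) α₁ α₂ := .span (.idm _) hf₂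
  have ok : ∀ i, RelOk T true Γ Θ ((![Rel.span β₁ β₂ β₂ g₂ (Tm.idm β₂),
      Rel.span α₁ α₂ α₁ (Tm.idm α₁) f₂] : Fin 2 → Rel S n) i) (![β₁, α₁] i) (![β₂, α₂] i) :=
    fun i => match i with | 0 => okβ | 1 => okα
  -- From equality to these relations: (f₁,g₁) on the left and the composite (f,g) on the right. The
  -- two triangle hypotheses are exactly what is required.
  have s₁ : ActRel T Γ Θ Φ σ ![β, α] ![β, α] ![β₁, α₁] ![β₂, α₂]
      (fun i => Rel.eqr ((![β, α] : Fin 2 → S.Ty n) i))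
      ![Rel.span β₁ β₂ β₂ g₂ (Tm.idm β₂), Rel.span α₁ α₂ α₁ (Tm.idm α₁) f₂]
      ![g₁, Tm.star] ![g, Tm.star] ![Tm.star, f₁] ![Tm.star, f] :=
    { dom := RelOk.eqr_vec _
      cod := ok
      pos := fun i o => match i, o with
        | 0, _ => .eqr_span hg₂ (.idm _) hg₁ hg (by
            rw [Tm.wk_idm]
            exact h'.trans (ExtEqI.idm h'.right).ieq.symm)
        | 1, o => (hα o).elim
      neg := fun i o => match i, o with
        | 0, o => (hβ o).elim
        | 1, _ => .span_eqr (.idm _) hf₂ hf₁ hf₁ hf (by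
            rw [Tm.wk_idm]
            exact (IEq.appR hf₁.wk1 (ExtEqI.idm (.var (by rfl))).ieq).symm) h.symm
      both := fun i o o' => match i, o, o' with
        | 0, _, o' => (hβ o').elim
        | 1, o, _ => (hα o).elim }
  -- From these relations back to equality: (f₂,g₂) on the left and identities on the right.
  -- Identity extension turns the outcome into σ(f₂,g₂)(σ(f₁,g₁) x) = σ(id,id)(σ(f,g) x).
  have s₂ : ActRel T Γ Θ Φ σ ![β₁, α₁] ![β₂, α₂] ![β₂, α₂] ![β₂, α₂]
      ![Rel.span β₁ β₂ β₂ g₂ (Tm.idm β₂), Rel.span α₁ α₂ α₁ (Tm.idm α₁) f₂]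
      (fun i => Rel.eqr ((![β₂, α₂] : Fin 2 → S.Ty n) i))
      ![g₂, Tm.star] ![Tm.idm β₂, Tm.star] ![Tm.star, f₂] ![Tm.star, Tm.idm α₂] :=
    { dom := ok
      cod := RelOk.eqr_vec _
      pos := fun i o => match i, o with
        | 0, _ => .span_eqr hg₂ (.idm _) (.idm _) hg₂ (.idm _)
            (by
              rw [Tm.wk_idm]
              exact (ExtEqI.idm (hg₂.wk1.app (.var (by rfl)))).ieq.symm)
            (by
              change IEq T (β₂ :: Γ) Θ (Φ.map Form.wk) β₂ (Tm.app ((Tm.idm β₂).wk 1) (Tm.var 0))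
                (Tm.app ((Tm.idm β₂).wk 1) (Tm.app ((Tm.idm β₂).wk 1) (Tm.var 0)))
              rw [Tm.wk_idm]
              have v : HasTyI (β₂ :: Γ) (Tm.var 0) β₂ := .var (by rfl)
              exact (ExtEqI.idm ((HasTyI.idm _).app v)).ieq.symm)
        | 1, o => (hα o).elim
      neg := fun i o => match i, o with
        | 0, o => (hβ o).elim
        | 1, _ => .eqr_span (.idm _) hf₂ hf₂ (.idm _) (by
            change IEq T (α₂ :: Γ) Θ (Φ.map Form.wk) α₁
              (Tm.app ((Tm.idm α₁).wk 1) (Tm.app (f₂.wk 1) (Tm.var 0)))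
              (Tm.app (f₂.wk 1) (Tm.app ((Tm.idm α₂).wk 1) (Tm.var 0)))
            rw [Tm.wk_idm, Tm.wk_idm]
            have v : HasTyI (α₂ :: Γ) (Tm.var 0) α₂ := .var (by rfl)
            exact (ExtEqI.idm (hf₂.wk1.app v)).ieq.trans
              (IEq.appR hf₂.wk1 (ExtEqI.idm v).ieq).symm)
      both := fun i o o' => match i, o, o' with
        | 0, _, o' => (hβ o').elim
        | 1, o, _ => (hα o).elim }
  have k₁ := IRel.act s₁ (IEq.ty hid (.rfl hx))
  have k₂ := IEq.of_ty hid (IRel.act s₂ k₁)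
  exact k₂.trans (fmap_idm hext hid hα hβ ((fmap_hasTy hα hβ hf hg).app hx))

/-- Provable equality of f and f' is not a congruence of terms, so the action is compared by
functoriality: identities composed with f and g are provably f' and g'. -/
theorem fmap_congr (hext : Extensionality T) (hid : IdentityExtension T) (hα : σ.OnlyNeg 1)
    (hβ : σ.OnlyPos 0) (hf : IEq T Γ Θ Φ (Ty.lolli α' α) f f')
    (hg : IEq T Γ Θ Φ (Ty.lolli β β') g g') {x y : Tm S n} (hx : IEq T Γ Θ Φ (ap₂ σ α β) x y) :
    IEq T Γ Θ Φ (ap₂ σ α' β') (Tm.app (fmap σ α β α' β' f g) x)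
      (Tm.app (fmap σ α β α' β' f' g') y) := by
  refine .trans ?_ (.appR (fmap_hasTy hα hβ hf.right hg.right) hx)
  have v : HasTyI (α' :: Γ) (Tm.var 0) α' := .var (by rfl)
  have w : HasTyI (β :: Γ) (Tm.var 0) β := .var (by rfl)
  have h₁ := fmap_fmap hext hid hα hβ (Θ := Θ) (Φ := Φ) hf.left hg.left (.idm α') (.idm β') hf.right hg.right
    (by
      rw [Tm.wk_idm]
      exact (IEq.appR hf.left.wk1 (ExtEqI.idm v).ieq).trans ((hf.wk1 α').appL v))
    (by
      rw [Tm.wk_idm]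
      exact (ExtEqI.idm (hg.left.wk1.app w)).ieq.trans ((hg.wk1 β).appL w)) hx.left
  exact (fmap_idm hext hid hα hβ ((fmap_hasTy hα hβ hf.left hg.left).app hx.left)).symm.trans h₁

theorem HasTyI.ilam {A B : S.Ty n} {t : Tm S n} (h : HasTyI (A :: Γ) t B) :
    HasTyI Γ (Tm.ilam A t) (Ty.arr A B) := HasTy.ilam h

theorem functor₂_hasTy (hα : σ.OnlyNeg 1) (hβ : σ.OnlyPos 0) :
    HasTyI Γ (functor₂ σ) (Ty.pi (Ty.pi (Ty.pi (Ty.pi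
      (Ty.arr (Ty.lolli (Ty.var 1) (Ty.var 3)) (Ty.arr (Ty.lolli (Ty.var 2) (Ty.var 0))
        (Ty.lolli (ap₂ σ (Ty.var 3) (Ty.var 2)) (ap₂ σ (Ty.var 1) (Ty.var 0))))))))) := by
  refine .tlam (.tlam (.tlam (.tlam (.ilam (.ilam ?_)))))
  exact fmap_hasTy hα hβ (.var (by rfl)) (.var (by rfl))

theorem ap₂_subst {m : ℕ} (s : Fin m → S.Ty n) (A B : S.Ty m) :
    (ap₂ σ A B).subst s = ap₂ σ (A.subst s) (B.subst s) := by
  rw [ap₂, Ty.subst_subst, ap₂]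
  congr 1
  funext i; match i with | 0 => rfl | 1 => rfl

/-- The polymorphic term M_σ reduces to the direct action once its six arguments are supplied. The
equations of dialgebra morphisms are thus statements about `fmap`. -/
theorem ExtEqI.map₂ (hα : σ.OnlyNeg 1) (hβ : σ.OnlyPos 0) (hf : HasTyI Γ f (Ty.lolli α' α))
    (hg : HasTyI Γ g (Ty.lolli β β')) :
    ExtEqI Γ (map₂ σ α β α' β' f g) (fmap σ α β α' β' f g)
      (Ty.lolli (ap₂ σ α β) (ap₂ σ α' β')) := by
  have h₁ := ExtEqI.self_subst (functor₂_hasTy hα hβ (Γ := Γ))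
  have h₂ := ((((h₁.tapp_subst α).tapp_subst β).tapp_subst α').tapp_subst β')
  simp only [Ty.arr, Ty.subst, ap₂_subst] at h₂
  have h₃ := (h₂.ilam_subst hf).ilam_subst hg
  rw [act_subst] at h₃
  rw [fmap]
  convert h₃ using 2
  all_goals first | rfl | (funext i; match i with | 0 => rfl | 1 => rfl)

end Fmap

/-! ### Closed terms -/

theorem Split.length {n : ℕ} {Γ Γ₁ Γ₂ : TCtx S n} (h : Split Γ Γ₁ Γ₂) :
    Γ₁.length = Γ.length ∧ Γ₂.length = Γ.length := by
  induction h with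
  | nil => exact ⟨rfl, rfl⟩
  | int _ _ ih | left _ _ ih | right _ _ ih | off _ _ ih => simp [ih.1, ih.2]

/-- A typed term mentions no index beyond the length of its context, so the values there are
irrelevant. -/
theorem HasTy.subst_congr {n m : ℕ} {Γ : TCtx S n} {t : Tm S n} {τ : S.Ty n} (h : HasTy Γ t τ)
    (s : Fin n → S.Ty m) {f f' : ℕ → Tm S m} (hf : ∀ i < Γ.length, f i = f' i) :
    t.subst s f = t.subst s f' := by
  have hup : ∀ {N : ℕ} {f f' : ℕ → Tm S m}, (∀ i < N, f i = f' i) →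
      ∀ i < N + 1, Tm.up f i = Tm.up f' i := by
    rintro N f f' h (_ | i) hi
    · rfl
    · exact congrArg (Tm.wk 1) (h i (by omega))
  induction h generalizing m with
  | ivar h _ | lvar h _ => exact hf _ (List.getElem?_eq_some_iff.1 h).1
  | con _ _ | star _ | fixY _ => rfl
  | lam _ ih => exact congrArg (Tm.lam _) (ih s (hup hf) hup)
  | app hs _ _ ih₁ ih₂ =>
      exact congrArg₂ Tm.app (ih₁ s (by rwa [hs.length.1]) hup) (ih₂ s (by rwa [hs.length.2]) hup)
  | tensor hs _ _ ih₁ ih₂ =>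
      exact congrArg₂ Tm.tensor (ih₁ s (by rwa [hs.length.1]) hup)
        (ih₂ s (by rwa [hs.length.2]) hup)
  | bang _ _ ih => exact congrArg Tm.bang (ih s hf hup)
  | tlam _ ih =>
      refine congrArg Tm.tlam (ih _ (fun i hi => congrArg Tm.wkTy (hf i ?_)) ?_)
      · simpa [TCtx.wkTy] using hi
      · rintro N f f' h (_ | i) hi
        · rfl
        · exact congrArg (Tm.wk 1) (h i (by omega))
  | tapp _ _ ih => exact congrArg (Tm.tapp · _) (ih s hf hup)
  | letTensor hs _ _ ih₁ ih₂ =>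
      exact congrArg₂ Tm.letTensor (ih₁ s (by rwa [hs.length.1]) hup)
        (ih₂ s (by simpa [hs.length.2] using hup (hup hf)) hup)
  | letBang hs _ _ ih₁ ih₂ =>
      exact congrArg₂ Tm.letBang (ih₁ s (by rwa [hs.length.1]) hup)
        (ih₂ s (by simpa [hs.length.2] using hup hf) hup)
  | letStar hs _ _ ih₁ ih₂ =>
      exact congrArg₂ Tm.letStar (ih₁ s (by rwa [hs.length.1]) hup)
        (ih₂ s (by rwa [hs.length.2]) hup)

/-- Evaluation leaves closed subterms under whatever environment has accumulated; it can be
exchanged for the trivial one. -/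
theorem HasTyI.subst_closed {n m : ℕ} {t : Tm S n} {τ : S.Ty n} (h : HasTyI [] t τ)
    (s : Fin n → S.Ty m) (f f' : ℕ → Tm S m) : t.subst s f = t.subst s f' :=
  HasTy.subst_congr h s fun i hi => by simp at hi

theorem HasTyI.wk_closed {n : ℕ} {t : Tm S n} {τ : S.Ty n} (h : HasTyI [] t τ) (k : ℕ) :
    t.wk k = t := by
  rw [Tm.wk, Tm.ren_eq_subst]
  conv_rhs => rw [← Tm.subst_var t]
  exact h.subst_closed _ _ _

theorem HasTyI.closed_subst {n m : ℕ} {t : Tm S n} {τ : S.Ty n} (h : HasTyI [] t τ)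
    (Γ : List (S.Ty m)) (s : Fin n → S.Ty m) (f : ℕ → Tm S m) :
    HasTyI Γ (t.subst s f) (τ.subst s) := h.subst fun i τ hi => by simp at hi

theorem HasTyI.off_append {n : ℕ} {Γ : List (S.Ty n)} {t : Tm S n} {σ : S.Ty n}
    (ht : HasTyI Γ t σ) (Δ : TCtx S n) (hΔ : Δ.NoLin) : HasTy (intCtx Γ ++ Δ) t σ := by
  have := HasTy.ren (r := id) (e := id) (Γ' := intCtx Γ ++ Δ) ht
    ⟨fun _ _ h => h, fun i σ hi => ?_, fun i σ hi => ?_, fun i σ hi => ?_⟩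
  · rwa [Ty.ren_id, Tm.ren_id] at this
  · rw [Ty.ren_id]
    exact (List.getElem?_append_left (List.getElem?_eq_some_iff.1 hi).1).trans hi
  · cases (intCtx_get.1 hi).1
  · exact absurd hi (TCtx.NoLin.get (fun p hp => (List.mem_append.1 hp).elim
      (intCtx_noLin Γ p) (hΔ p)))

/-! ### Functors of one variable with parameters -/

/-- The functorial action of `σ(α)` at fixed values `A` of the parameters. -/
def pmap {n k : ℕ} (σ : S.Ty (k + 1)) (A : Fin k → S.Ty n) (X Y : S.Ty n) (g : Tm S n) : Tm S n :=
  act σ (Ty.cons X A) (Ty.cons Y A) (Fin.cases g (idv A)) (Fin.cases Tm.star (idv A))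

section Pmap

variable {T : Theory S} {n k : ℕ} {Γ : List (S.Ty n)} {Θ : List (RelDecl S n)}
  {Φ : List (Form S n)} {σ : S.Ty (k + 1)} {A : Fin k → S.Ty n} {X Y : S.Ty n} {f g h z w : Tm S n}

theorem pmap_ok (hσ : σ.OnlyPos 0) (hg : HasTyI Γ g (Ty.lolli X Y)) :
    ActOk Γ σ (Ty.cons X A) (Ty.cons Y A) (Fin.cases g (idv A)) (Fin.cases Tm.star (idv A)) :=
  ⟨fun i => Fin.cases (fun _ => hg) (fun _ _ => .idm _) i,
    fun i => Fin.cases (fun o => (hσ o).elim) (fun _ _ => .idm _) i,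
    fun i => Fin.cases (fun _ o => (hσ o).elim) (fun _ _ _ => rfl) i⟩

theorem pmap_hasTy (hσ : σ.OnlyPos 0) (hg : HasTyI Γ g (Ty.lolli X Y)) :
    HasTyI Γ (pmap σ A X Y g) (Ty.lolli (σ.subst (Ty.cons X A)) (σ.subst (Ty.cons Y A))) :=
  act_hasTy (pmap_ok hσ hg)

theorem pmap_wk (j : ℕ) : (pmap σ A X Y g).wk j = pmap σ A X Y (g.wk j) := by
  rw [pmap, act_wk, pmap]
  congr 1
  all_goals funext i; exact Fin.cases rfl (fun _ => Tm.wk_idm _ _) i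

theorem pmap_idm (hext : Extensionality T) (hid : IdentityExtension T) (hσ : σ.OnlyPos 0)
    (hz : HasTyI Γ z (σ.subst (Ty.cons X A))) :
    IEq T Γ Θ Φ (σ.subst (Ty.cons X A)) (Tm.app (pmap σ A X X (Tm.idm X)) z) z := by
  have e : pmap σ A X X (Tm.idm X) = act σ (Ty.cons X A) (Ty.cons X A) (idv (Ty.cons X A))
      (idv (Ty.cons X A)) := act_congr
    (fun i => Fin.cases (fun _ => rfl) (fun _ _ => rfl) i)
    (fun i => Fin.cases (fun o => (hσ o).elim) (fun _ _ => rfl) i)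
  rw [e]
  exact ((act_id hext hid σ (Ty.cons X A) Γ Θ Φ).appL hz).trans (ExtEqI.idm hz).ieq

/-- The relation `h x = y`, at parameters that are identified. -/
def Rel.graphs (A : Fin k → S.Ty n) (X Y : S.Ty n) (h : Tm S n) : Fin (k + 1) → Rel S n :=
  Rel.cons (Rel.span X Y Y h (Tm.idm Y)) fun i => Rel.eqr (A i)

theorem RelOk.graphs (hh : HasTyI Γ h (Ty.lolli X Y)) (i : Fin (k + 1)) :
    RelOk T true Γ Θ (Rel.graphs A X Y h i) (Ty.cons X A i) (Ty.cons Y A i) :=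
  RelOk.cons (.span hh (.idm _)) (RelOk.eqr_vec A) i

/-- One half of the graph lemma. The pair (h, id) carries the graph of h to equality on Y, so by
`IRel.act` and identity extension σ(h) z = σ(id) w = w. -/
theorem IRel.graphs_elim (hext : Extensionality T) (hid : IdentityExtension T)
    (hσ : σ.OnlyPos 0) (hh : HasTyI Γ h (Ty.lolli X Y))
    (hr : IRel T Γ Θ Φ (.ty σ (Rel.graphs A X Y h)) (σ.subst (Ty.cons X A))
      (σ.subst (Ty.cons Y A)) z w) :
    IEq T Γ Θ Φ (σ.subst (Ty.cons Y A)) (Tm.app (pmap σ A X Y h) z) w := by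
  have s : ActRel T Γ Θ Φ σ (Ty.cons X A) (Ty.cons Y A) (Ty.cons Y A) (Ty.cons Y A)
      (Rel.graphs A X Y h) (fun i => Rel.eqr (Ty.cons Y A i))
      (Fin.cases h (idv A)) (Fin.cases (Tm.idm Y) (idv A))
      (Fin.cases Tm.star (idv A)) (Fin.cases Tm.star (idv A)) :=
    { dom := RelOk.graphs hh
      cod := RelOk.eqr_vec _
      pos := fun i => Fin.cases (fun _ => .span_eqr hh (.idm _) (.idm _) hh (.idm _)
          (by
            rw [Tm.wk_idm]
            exact (ExtEqI.idm (hh.wk1.app (.var (by rfl)))).ieq.symm)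
          (by
            have v : HasTyI (Y :: Γ) (Tm.var 0) Y := .var (by rfl)
            change IEq T (Y :: Γ) Θ (Φ.map Form.wk) Y (Tm.app ((Tm.idm Y).wk 1) (Tm.var 0))
              (Tm.app ((Tm.idm Y).wk 1) (Tm.app ((Tm.idm Y).wk 1) (Tm.var 0)))
            rw [Tm.wk_idm]
            exact (ExtEqI.idm ((HasTyI.idm _).app v)).ieq.symm))
        (fun i _ => .idm (.ofAdm (.eqr _))) i
      neg := fun i => Fin.cases (fun o => (hσ o).elim) (fun i _ => .idm (.ofAdm (.eqr _))) i
      both := fun i => Fin.cases (fun _ o => (hσ o).elim) (fun _ _ _ => ⟨rfl, rfl, rfl⟩) i }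
  exact (IEq.of_ty hid (IRel.act s hr)).trans (pmap_idm hext hid hσ hr.right)

/-- The other half: the pair (id, h) carries equality on X to the graph of h, so z, which is related
to itself, gives σ(id) z = z related to σ(h) z. -/
theorem IRel.graphs_intro (hext : Extensionality T) (hid : IdentityExtension T)
    (hσ : σ.OnlyPos 0) (hh : HasTyI Γ h (Ty.lolli X Y))
    (hz : HasTyI Γ z (σ.subst (Ty.cons X A))) :
    IRel T Γ Θ Φ (.ty σ (Rel.graphs A X Y h)) (σ.subst (Ty.cons X A))
      (σ.subst (Ty.cons Y A)) z (Tm.app (pmap σ A X Y h) z) := by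
  have s : ActRel T Γ Θ Φ σ (Ty.cons X A) (Ty.cons X A) (Ty.cons X A) (Ty.cons Y A)
      (fun i => Rel.eqr (Ty.cons X A i)) (Rel.graphs A X Y h)
      (Fin.cases (Tm.idm X) (idv A)) (Fin.cases h (idv A))
      (Fin.cases Tm.star (idv A)) (Fin.cases Tm.star (idv A)) :=
    { dom := RelOk.eqr_vec _
      cod := RelOk.graphs hh
      pos := fun i => Fin.cases (fun _ => .eqr_span hh (.idm _) (.idm _) hh
          (by
            have v : HasTyI (X :: Γ) (Tm.var 0) X := .var (by rfl)
            change IEq T (X :: Γ) Θ (Φ.map Form.wk) Y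
              (Tm.app (h.wk 1) (Tm.app ((Tm.idm X).wk 1) (Tm.var 0)))
              (Tm.app ((Tm.idm Y).wk 1) (Tm.app (h.wk 1) (Tm.var 0)))
            rw [Tm.wk_idm, Tm.wk_idm]
            exact (IEq.appR hh.wk1 (ExtEqI.idm v).ieq).trans (ExtEqI.idm (hh.wk1.app v)).ieq.symm))
        (fun i _ => .idm (.ofAdm (.eqr _))) i
      neg := fun i => Fin.cases (fun o => (hσ o).elim) (fun i _ => .idm (.ofAdm (.eqr _))) i
      both := fun i => Fin.cases (fun _ o => (hσ o).elim) (fun _ _ _ => ⟨rfl, rfl, rfl⟩) i }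
  have k := IRel.act s (IEq.ty hid (.rfl hz))
  exact k.congr (pmap_idm hext hid hσ hz) (.rfl k.right)

theorem functor₁_hasTy {Γ : List (S.Ty k)} (hσ : σ.OnlyPos 0) :
    HasTyI Γ (functor₁ σ) (Ty.pi (Ty.pi (Ty.arr (Ty.lolli (Ty.var 1) (Ty.var 0))
      (Ty.lolli (σ.subst (Ty.cons (Ty.var 1) fun i => Ty.var i.succ.succ))
        (σ.subst (Ty.cons (Ty.var 0) fun i => Ty.var i.succ.succ)))))) := by
  refine .tlam (.tlam (.ilam ?_))
  exact pmap_hasTy hσ (.var (by rfl))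

theorem ExtEqI.functor₁ (hσ : σ.OnlyPos 0) (e : ℕ → Tm S n) (hg : HasTyI Γ g (Ty.lolli X Y)) :
    ExtEqI Γ (Tm.app (Tm.tapp (Tm.tapp ((functor₁ σ).subst A e) X) Y) (Tm.bang g))
      (pmap σ A X Y g) (Ty.lolli (σ.subst (Ty.cons X A)) (σ.subst (Ty.cons Y A))) := by
  have h₁ := ExtEq.refl ((functor₁_hasTy hσ).closed_subst Γ A e)
  have h₂ := (ExtEqI.tapp_subst h₁ X).tapp_subst Y
  simp only [Ty.arr, Ty.subst, Ty.subst_subst] at h₂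
  have h₃ := h₂.ilam_subst hg
  rw [act_subst] at h₃
  rw [pmap]
  convert h₃ using 2
  all_goals first | rfl | (funext i; exact Fin.cases rfl (fun _ => rfl) i) |
    (congr 1; funext i; exact Fin.cases rfl (fun _ => rfl) i)

/-- The added variable does not occur, so its value is irrelevant. It arises because the bodies of
`in` and `out` use the functor under a type abstraction. -/
theorem pmap_wkUnder (C : S.Ty n) : pmap (wkUnder σ) (Ty.cons C A) X Y g = pmap σ A X Y g := by
  rw [pmap, wkUnder, act_ty_ren, pmap]
  congr 1
  all_goals funext i; exact Fin.cases rfl (fun _ => rfl) i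

theorem map₁_hasTy {Γ : List (S.Ty k)} {X Y : S.Ty k} {g : Tm S k} (hσ : σ.OnlyPos 0)
    (hg : HasTyI Γ g (Ty.lolli X Y)) :
    HasTyI Γ (map₁ σ X Y g) (Ty.lolli (σ.inst X) (σ.inst Y)) := by
  have h := (ExtEqI.functor₁ (A := Ty.var) hσ Tm.var hg).hasTy.1
  rw [Tm.subst_var] at h
  exact h

end Pmap

/-! ## Initial algebras -/

theorem Ty.cons_var {k : ℕ} : Ty.cons (Ty.var 0) (fun i => Ty.var i.succ) =
    (Ty.var : Fin (k + 1) → S.Ty (k + 1)) := by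
  funext i; exact Fin.cases rfl (fun _ => rfl) i

theorem wkUnder_subst {k n : ℕ} (σ : S.Ty (k + 1)) (X Y : S.Ty n) (A : Fin k → S.Ty n) :
    (wkUnder σ).subst (Ty.cons Y (Ty.cons X A)) = σ.subst (Ty.cons Y A) := by
  rw [wkUnder, Ty.subst_ren]
  congr 1
  funext i; exact Fin.cases rfl (fun _ => rfl) i

theorem Ty.OnlyPos.wkUnder {k : ℕ} {σ : S.Ty (k + 1)} (hσ : σ.OnlyPos 0) :
    (LAPL.wkUnder σ).OnlyPos 0 := by
  intro o
  rw [LAPL.wkUnder, Ty.ren_eq_subst] at o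
  obtain ⟨j, ⟨o, h, -⟩ | ⟨o, -, h⟩⟩ := o.of_subst
  · cases h
  · revert o h
    exact Fin.cases (fun o _ => hσ o) (fun i _ h => (Fin.succ_ne_zero i.succ h.symm).elim) j

theorem wkUnder_inst_wk {k : ℕ} (σ : S.Ty (k + 1)) (C : S.Ty k) :
    (wkUnder σ).inst C.wk = (σ.inst C).wk := by
  rw [wkUnder, Ty.inst, Ty.subst_ren, Ty.inst, Ty.wk, Ty.wk, Ty.ren_subst]
  congr 1
  funext i; exact Fin.cases rfl (fun _ => rfl) i

section InitialAlgebra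

variable {T : Theory S} {n k : ℕ} {Γ : List (S.Ty n)} {Θ : List (RelDecl S n)}
  {Φ : List (Form S n)} {σ : S.Ty (k + 1)} {A : Fin k → S.Ty n} {X Y : S.Ty n} {f g h z u w : Tm S n}

theorem fold_hasTy (σ : S.Ty (k + 1)) : HasTyI [] (fold σ) (Ty.pi (Ty.arr (Ty.lolli σ (Ty.var 0))
    (Ty.lolli (mu σ).wk (Ty.var 0)))) := by
  refine .tlam (.ilam (.lam (.app (σ := Ty.bang (Ty.lolli σ (Ty.var 0)))
    (.left _ (.int _ .nil)) ?_ (.bang ?_ (.ivar (by rfl) ?_)))))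
  · have h := HasTy.tapp (Γ := [(Use.lin, (mu σ).wk), (Use.int, Ty.lolli σ (Ty.var 0))])
      (t := Tm.var 0) (Ty.var 0) (.lvar0 (by simp [TCtx.NoLin]))
    change HasTy _ _ (Ty.arr (Ty.lolli ((σ.ren (upRen Fin.succ)).inst (Ty.var 0)) (Ty.var 0))
      (Ty.var 0)) at h
    rw [Ty.ren_upRen_inst] at h
    exact h
  all_goals simp [TCtx.NoLin]

theorem ExtEqI.fold (hf : HasTyI Γ f (Ty.lolli (σ.subst (Ty.cons X A)) X))
    (hu : HasTyI Γ u ((mu σ).subst A)) (e : ℕ → Tm S n) :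
    ExtEqI Γ (Tm.app (Tm.app (Tm.tapp ((fold σ).subst A e) X) (Tm.bang f)) u)
      (Tm.app (Tm.tapp u X) (Tm.bang f)) X := by
  have h₁ := ExtEq.refl ((fold_hasTy σ).closed_subst Γ A e)
  have h₂ := ExtEqI.tapp_subst h₁ X
  simp only [Ty.arr, Ty.subst, Ty.wk_subst_cons] at h₂
  exact (h₂.ilam_subst hf).lam_subst hu

theorem fold_app_hasTy (hf : HasTyI Γ f (Ty.lolli (σ.subst (Ty.cons X A)) X)) (e : ℕ → Tm S n) :
    HasTyI Γ (Tm.app (Tm.tapp ((fold σ).subst A e) X) (Tm.bang f))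
      (Ty.lolli ((mu σ).subst A) X) := by
  have h₁ := ExtEq.refl ((fold_hasTy σ).closed_subst Γ A e)
  have h₂ := ExtEqI.tapp_subst h₁ X
  simp only [Ty.arr, Ty.subst, Ty.wk_subst_cons] at h₂
  exact HasTyI.app h₂.hasTy.1 hf.bang

theorem inMap_hasTy (hσ : σ.OnlyPos 0) :
    HasTyI [] (inMap σ) (Ty.lolli (σ.inst (mu σ)) (mu σ)) := by
  refine .lam (.tlam (.ilam (.app (.int _ (.right _ .nil)) (.ivar (by rfl) (by simp [TCtx.NoLin]))
    (.app (σ := (σ.inst (mu σ)).wk) (.int _ (.right _ .nil)) ?_ (.lvar1 (by simp) ?_)))))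
  · have h := map₁_hasTy (Γ := [Ty.lolli σ (Ty.var 0)]) (X := (mu σ).wk) (Y := Ty.var 0)
      (g := Tm.app (Tm.tapp (fold σ).wkTy (Ty.var 0)) (Tm.bang (Tm.var 0))) hσ.wkUnder ?_
    · rw [wkUnder_inst_wk, wkUnder, Ty.ren_upRen_inst] at h
      exact h.off_append [(Use.off, (σ.inst (mu σ)).wk)] (by simp [TCtx.NoLin])
    · have h := fold_app_hasTy (σ := σ) (A := fun i => Ty.var i.succ) (X := Ty.var 0)
        (Γ := [Ty.lolli σ (Ty.var 0)]) (f := Tm.var 0) ?_ Tm.var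
      · rw [← Tm.ren_eq_subst, ← Ty.ren_eq_subst] at h
        exact h
      · rw [Ty.cons_var]
        exact .var (by rw [Ty.subst_var]; rfl)
  · simp [TCtx.NoLin]

/-- The algebra structure of `μ α. σ` at the parameters `A`. -/
def pin (σ : S.Ty (k + 1)) (A : Fin k → S.Ty n) : Tm S n := (inMap σ).subst A Tm.var

theorem pin_hasTy (hσ : σ.OnlyPos 0) (Γ : List (S.Ty n)) :
    HasTyI Γ (pin σ A) (Ty.lolli (σ.subst (Ty.cons ((mu σ).subst A) A)) ((mu σ).subst A)) := by
  have h := (inMap_hasTy hσ).closed_subst Γ A Tm.var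
  rw [Ty.subst, Ty.inst, Ty.subst_subst] at h
  rw [pin]
  convert h using 3
  funext i; exact Fin.cases rfl (fun _ => rfl) i

/-- The defining β-reduction of `in` at parameters `A`: after three arguments the body is a
functorial action at fold X !f, with closed subterms still under the environment. -/
theorem ExtEqI.pin (hσ : σ.OnlyPos 0) (hf : HasTyI Γ f (Ty.lolli (σ.subst (Ty.cons X A)) X))
    (hz : HasTyI Γ z (σ.subst (Ty.cons ((mu σ).subst A) A))) :
    ExtEqI Γ (Tm.app (Tm.tapp (Tm.app (pin σ A) z) X) (Tm.bang f))
      (Tm.app f (Tm.app (pmap σ A ((mu σ).subst A) X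
        (Tm.app (Tm.tapp ((LAPL.fold σ).subst A Tm.var) X) (Tm.bang f))) z)) X := by
  have h₁ := ExtEqI.lam_subst (ExtEq.refl (pin_hasTy (A := A) hσ Γ)) hz
  have h₂ := ExtEqI.tapp_subst h₁ X
  simp only [Ty.arr, Ty.subst] at h₂
  refine ExtEq.trans (h₂.ilam_subst hf) ?_
  have h₄ := ExtEqI.functor₁ (A := Ty.cons X A) (X := (mu σ).subst A) (Y := X) hσ.wkUnder
    (scons f (scons z Tm.var)) (fold_app_hasTy hf Tm.var)
  rw [pmap_wkUnder, wkUnder_subst, wkUnder_subst] at h₄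
  have h₅ := ExtEqI.app (.refl hf) (ExtEqI.app h₄ (.refl hz))
  simp only [Tm.subst, map₁, Tm.wkTy_subst_cons, Ty.wk_subst_cons]
  rw [(fold_hasTy σ).subst_closed A _ Tm.var]
  exact h₅

theorem pin_wk (hσ : σ.OnlyPos 0) (j : ℕ) : (pin σ A).wk j = pin σ A :=
  (pin_hasTy hσ []).wk_closed j

theorem pin_wkTy : (pin σ A).wkTy = pin σ fun i => (A i).wk := by
  rw [pin, pin, Tm.wkTy, Tm.ren_subst]; rfl

theorem Rel.graphs_wk (hh : Tm S n) (j : ℕ) (i : Fin (k + 1)) :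
    (Rel.graphs A X Y hh i).wk j = Rel.graphs A X Y (hh.wk j) i := by
  refine Fin.cases ?_ (fun i => ?_) i
  · change (Rel.span _ _ _ _ _).wk j = Rel.span _ _ _ _ _
    rw [Rel.wk_span, Tm.wk_idm]
  · exact Rel.wk_eqr _ _

/-- Parametricity of u at the graph of h. The hypothesis `hc` says that h is a map of algebras, that
is, that `pin` and f are related functions; u then sends them to related results. -/
theorem mu_param (hext : Extensionality T) (hid : IdentityExtension T) (hσ : σ.OnlyPos 0)
    (hh : HasTyI Γ h (Ty.lolli ((mu σ).subst A) X))
    (hf : HasTyI Γ f (Ty.lolli (σ.subst (Ty.cons X A)) X))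
    (hc : IEq T (σ.subst (Ty.cons ((mu σ).subst A) A) :: Γ) Θ (Φ.map Form.wk) X
      (Tm.app (h.wk 1) (Tm.app (pin σ A) (Tm.var 0)))
      (Tm.app (f.wk 1) (Tm.app (pmap σ A ((mu σ).subst A) X (h.wk 1)) (Tm.var 0))))
    (hu : HasTyI Γ u ((mu σ).subst A)) :
    IEq T Γ Θ Φ X (Tm.app h (Tm.app (Tm.tapp u ((mu σ).subst A)) (Tm.bang (pin σ A))))
      (Tm.app (Tm.tapp u X) (Tm.bang f)) := by
  have ok : ∀ i, RelOk T true Γ Θ (Rel.graphs A ((mu σ).subst A) X h i) _ _ := RelOk.graphs hh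
  -- Identity extension relates u to itself, and the type variable is instantiated at μ on the left
  -- and `X` on the right, with the relation h x = y.
  have h₁ := IRel.ty_pi_elim (RelOk.eqr_vec A) (RelOk.span (T := T) (Θ := Θ) hh (.idm X))
    (IEq.ty hid (IEq.rfl (T := T) (Θ := Θ) (Φ := Φ) hu))
  have h₂ := (IRel.ty_lolli ok).1 h₁
  -- Related arguments z, w of the two algebras satisfy σ(h) z = w by the graph lemma, so the
  -- algebra equation for h gives h (in z) = f w.
  have h₃ : IRel T Γ Θ Φ (.ty (Ty.lolli σ (Ty.var 0)) (Rel.graphs A ((mu σ).subst A) X h))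
      (Ty.lolli (σ.subst (Ty.cons ((mu σ).subst A) A)) ((mu σ).subst A))
      (Ty.lolli (σ.subst (Ty.cons X A)) X) (pin σ A) f := by
    refine (IRel.ty_lolli ok).2 (IRel.lolli_intro (.ofAdm (.ty σ ok)) (.ofAdm (.ty (Ty.var 0) ok))
      (pin_hasTy hσ Γ) hf ?_)
    have hv := IRel.hyp0 (Φ := (Φ.map Form.wk).map Form.wk) (T := T) (.ofAdm (.ty σ ok))
    have e : ∀ τ : S.Ty (k + 1), (Rel.ty τ (Rel.graphs A ((mu σ).subst A) X h)).wk 2 =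
        .ty τ (Rel.graphs A ((mu σ).subst A) X (h.wk 2)) := fun τ => by
      rw [Rel.wk, Rel.ren]
      congr 1
      funext i; exact Rel.graphs_wk h 2 i
    rw [e] at hv
    rw [e, e]
    refine (IRel.ty_var (RelOk.graphs hh.wk2) 0).2 ?_
    rw [pin_wk hσ]
    have k₁ := (hc.wk1 (σ.subst (Ty.cons X A))).mono (List.subset_cons_self (Form.rel
      (.ty σ (Rel.graphs A ((mu σ).subst A) X (h.wk 2))) (.var 1) (.var 0)) _)
    simp only [Tm.wk_app, Tm.wk_wk, pmap_wk, pin_wk hσ] at k₁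
    have k₂ := (k₁.trans (.appR hf.wk2 (IRel.graphs_elim hext hid hσ hh.wk2 hv))).trans
      (ExtEqI.idm (hf.wk2.app hv.right)).ieq.symm
    exact k₂.span hh.wk2 (.idm X) ((pin_hasTy hσ _).app hv.left) (hf.wk2.app hv.right)
  have h₄ := h₂.lolli_elim (.ofAdm (.ty (Ty.var 0) ok)) ((IRel.ty_bang ok).2 h₃.bang_intro)
  have h₅ := ((IRel.ty_var ok 0).1 h₄).span_elim hh (.idm X)
  exact h₅.trans (ExtEqI.idm h₄.right).ieq

theorem fold_comm (hσ : σ.OnlyPos 0) (hf : HasTyI Γ f (Ty.lolli (σ.subst (Ty.cons X A)) X))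
    (hz : HasTyI Γ z (σ.subst (Ty.cons ((mu σ).subst A) A))) :
    IEq T Γ Θ Φ X
      (Tm.app (Tm.app (Tm.tapp ((LAPL.fold σ).subst A Tm.var) X) (Tm.bang f))
        (Tm.app (pin σ A) z))
      (Tm.app f (Tm.app (pmap σ A ((mu σ).subst A) X
        (Tm.app (Tm.tapp ((LAPL.fold σ).subst A Tm.var) X) (Tm.bang f))) z)) :=
  (ExtEqI.fold hf ((pin_hasTy hσ Γ).app hz) Tm.var).ieq.trans (ExtEqI.pin hσ hf hz).ieq

theorem fold_app_wk (j : ℕ) : (Tm.app (Tm.tapp ((LAPL.fold σ).subst A Tm.var) X) (Tm.bang f)).wk j =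
    Tm.app (Tm.tapp ((LAPL.fold σ).subst A Tm.var) X) (Tm.bang (f.wk j)) := by
  have h := ((fold_hasTy σ).closed_subst [] A Tm.var).wk_closed j
  simp only [Tm.wk, Tm.ren, Ty.ren_id] at h ⊢
  rw [h]

theorem mu_tapp (hu : HasTyI Γ u ((mu σ).subst A)) (C : S.Ty n) :
    HasTyI Γ (Tm.tapp u C) (Ty.arr (Ty.lolli (σ.subst (Ty.cons C A)) C) C) := by
  have h : HasTyI Γ (Tm.tapp u C)
    (Ty.arr (Ty.lolli ((σ.subst (Ty.up A)).inst C) C) C) := HasTyI.tapp hu C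
  rwa [Ty.subst_up_inst] at h

/-- By extensionality both sides are compared at a type variable and an algebra variable f. There an
element of μ applied to f is fold !f of that element, and fold !f is an algebra map, so `mu_param`
gives the equation. -/
theorem mu_eta (hext : Extensionality T) (hid : IdentityExtension T) (hσ : σ.OnlyPos 0)
    (hu : HasTyI Γ u ((mu σ).subst A)) :
    IEq T Γ Θ Φ ((mu σ).subst A) (Tm.app (Tm.tapp u ((mu σ).subst A)) (Tm.bang (pin σ A))) u := by
  have hl := HasTyI.app (mu_tapp hu ((mu σ).subst A)) (pin_hasTy (A := A) hσ Γ).bang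
  have e : ((mu σ).subst A).wk = (mu σ).subst fun i => (A i).wk := Ty.ren_subst _ _ _
  have hu' := hu.wkTy
  have hl' := hl.wkTy
  rw [e] at hu' hl'
  refine IEq.extPi hext hl hu (IEq.bang_ext hext hid (mu_tapp hl' (Ty.var 0))
    (mu_tapp hu' (Ty.var 0)) ?_)
  have v : HasTyI (Ty.lolli (σ.subst (Ty.up A)) (Ty.var 0) :: Γ.map Ty.wk) (Tm.var 0)
    (Ty.lolli (σ.subst (Ty.up A)) (Ty.var 0)) := .var (by rfl)
  have hu₁ := hu'.wk1 (A := Ty.lolli (σ.subst (Ty.up A)) (Ty.var 0))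
  have hl₁ := hl'.wk1 (A := Ty.lolli (σ.subst (Ty.up A)) (Ty.var 0))
  have k₁ := (ExtEqI.fold v hl₁ Tm.var).ieq (T := T) (Θ := Θ.map RelDecl.wk)
    (Φ := (Φ.map Form.wkTy).map Form.wk)
  refine k₁.symm.trans ?_
  have el : ((Tm.app (Tm.tapp u ((mu σ).subst A)) (Tm.bang (pin σ A))).wkTy).wk 1 =
      Tm.app (Tm.tapp (u.wkTy.wk 1) ((mu σ).subst fun i => (A i).wk))
        (Tm.bang (pin σ fun i => (A i).wk)) := by
    have e₁ := pin_wkTy (σ := σ) (A := A)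
    have e₂ := pin_wk (A := fun i => (A i).wk) hσ 1
    simp only [Tm.wk, Tm.wkTy, Ty.wk, Tm.ren, Ty.ren_id] at e e₁ e₂ ⊢
    rw [e, e₁, e₂]
  rw [el]
  refine mu_param hext hid hσ (fold_app_hasTy v Tm.var) v ?_ hu₁
  rw [fold_app_wk]
  exact fold_comm hσ v.wk1 (.var (by rfl))

/-- Initiality: replace u by u μ !in and move h inside by parametricity. -/
theorem fold_unique (hext : Extensionality T) (hid : IdentityExtension T) (hσ : σ.OnlyPos 0)
    (hh : HasTyI Γ h (Ty.lolli ((mu σ).subst A) X))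
    (hf : HasTyI Γ f (Ty.lolli (σ.subst (Ty.cons X A)) X))
    (hc : IEq T (σ.subst (Ty.cons ((mu σ).subst A) A) :: Γ) Θ (Φ.map Form.wk) X
      (Tm.app (h.wk 1) (Tm.app (pin σ A) (Tm.var 0)))
      (Tm.app (f.wk 1) (Tm.app (pmap σ A ((mu σ).subst A) X (h.wk 1)) (Tm.var 0))))
    (hu : HasTyI Γ u ((mu σ).subst A)) :
    IEq T Γ Θ Φ X (Tm.app h u) (Tm.app (Tm.tapp u X) (Tm.bang f)) :=
  (IEq.appR hh (mu_eta hext hid hσ hu)).symm.trans (mu_param hext hid hσ hh hf hc hu)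

end InitialAlgebra

/-! ## Existential types -/

/-- `Π α. ρ ⊸ β`, with `β` the innermost variable. -/
def exArg {k : ℕ} (ρ : S.Ty (k + 1)) : S.Ty (k + 1) := Ty.pi (Ty.lolli (wkUnder ρ) (Ty.var 1))

theorem ActOk.pi_inst {k n : ℕ} {Γ : List (S.Ty n)} {σ : S.Ty (k + 1)} {A B : Fin k → S.Ty n}
    {F G : Fin k → Tm S n} (h : ActOk Γ (Ty.pi σ) A B F G) (C : S.Ty n) :
    ActOk Γ σ (Ty.cons C A) (Ty.cons C B) (Fin.cases (Tm.idm C) F) (Fin.cases (Tm.idm C) G) :=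
  ⟨fun i => Fin.cases (fun _ => .idm _) (fun i o => h.pos i o) i,
    fun i => Fin.cases (fun _ => .idm _) (fun i o => h.neg i o) i,
    fun i => Fin.cases (fun _ _ => rfl) (fun i o o' => h.both i o o') i⟩

theorem pmap_wkTy {n k : ℕ} {σ : S.Ty (k + 1)} {A : Fin k → S.Ty n} {X Y : S.Ty n}
    {g : Tm S n} : (pmap σ A X Y g).wkTy =
      pmap σ (fun i => (A i).wk) X.wk Y.wk g.wkTy := by
  rw [pmap, act_wkTy, pmap]
  congr 1
  all_goals funext i; exact Fin.cases rfl (fun _ => rfl) i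

section Existential

variable {T : Theory S} {n k : ℕ} {Γ : List (S.Ty n)} {Θ : List (RelDecl S n)}
  {Φ : List (Form S n)} {ρ : S.Ty (k + 1)} {A : Fin k → S.Ty n} {X C D : S.Ty n}
  {f g h p q x y : Tm S n}

theorem ex_tapp (hx : HasTyI Γ x ((ex ρ).subst A)) (C : S.Ty n) :
    HasTyI Γ (Tm.tapp x C) (Ty.lolli ((exArg ρ).subst (Ty.cons C A)) C) := by
  have h : HasTyI Γ (Tm.tapp x C) (((Ty.lolli (exArg ρ) (Ty.var 0)).subst (Ty.up A)).inst C) :=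
    HasTyI.tapp hx C
  rwa [Ty.subst_up_inst] at h

theorem exArg_tapp (hp : HasTyI Γ p ((exArg ρ).subst (Ty.cons C A))) (X : S.Ty n) :
    HasTyI Γ (Tm.tapp p X) (Ty.lolli (ρ.subst (Ty.cons X A)) C) := by
  have h : HasTyI Γ (Tm.tapp p X)
      (((Ty.lolli (wkUnder ρ) (Ty.var 1)).subst (Ty.up (Ty.cons C A))).inst X) :=
    HasTyI.tapp hp X
  rw [Ty.subst_up_inst, Ty.subst, wkUnder_subst] at h
  exact h

theorem pack_hasTy (ρ : S.Ty (k + 1)) : HasTyI [] (pack ρ) (Ty.pi (Ty.lolli ρ (ex ρ).wk)) := by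
  have e : (ex ρ).wk = Ty.pi (Ty.lolli (Ty.pi (Ty.lolli
      (ρ.ren (Fin.cases 0 (fun i => i.succ.succ.succ))) (Ty.var 1))) (Ty.var 0)) := by
    change Ty.pi (Ty.lolli (Ty.pi (Ty.lolli ((wkUnder ρ).ren (upRen (upRen Fin.succ)))
      (Ty.var 1))) (Ty.var 0)) = _
    rw [wkUnder, Ty.ren_ren]
    congr 4
    congr 1
    funext i; exact Fin.cases rfl (fun _ => rfl) i
  rw [e]
  refine .tlam (.lam (.tlam (.lam (.app (σ := ρ.wk) (.left _ (.right _ .nil)) ?_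
    (.lvar1 (by simp) (by simp [TCtx.NoLin]))))))
  have h := HasTy.tapp (Γ := [(Use.lin, Ty.pi (Ty.lolli
    (ρ.ren (Fin.cases 0 (fun i => i.succ.succ.succ))) (Ty.var 1))), (Use.off, ρ.wk)])
      (t := Tm.var 0) (Ty.var 1) (.lvar0 (by simp [TCtx.NoLin]))
  rw [Ty.inst, Ty.subst, Ty.subst_ren] at h
  convert h using 2
  · rw [Ty.wk, Ty.ren_eq_subst]
    congr 1
    funext i; exact Fin.cases rfl (fun _ => rfl) i
  · rfl

theorem pack_app_hasTy (e : ℕ → Tm S n) (X : S.Ty n) :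
    HasTyI Γ (Tm.tapp ((pack ρ).subst A e) X)
      (Ty.lolli (ρ.subst (Ty.cons X A)) ((ex ρ).subst A)) := by
  have h := ExtEqI.tapp_subst (ExtEq.refl ((pack_hasTy ρ).closed_subst Γ A e)) X
  rw [Ty.subst, Ty.wk_subst_cons] at h
  exact h.hasTy.1

theorem ExtEqI.pack (e : ℕ → Tm S n) (hy : HasTyI Γ y (ρ.subst (Ty.cons X A)))
    (hp : HasTyI Γ p ((exArg ρ).subst (Ty.cons C A))) :
    ExtEqI Γ (Tm.app (Tm.tapp (Tm.app (Tm.tapp ((pack ρ).subst A e) X) y) C) p)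
      (Tm.app (Tm.tapp p X) y) C := by
  have h₁ := ExtEqI.tapp_subst (ExtEq.refl ((pack_hasTy ρ).closed_subst Γ A e)) X
  have h₂ := ExtEqI.lam_subst h₁ hy
  have h₃ := ExtEqI.tapp_subst (X := (Ty.lolli (exArg ρ) (Ty.var 0)).ren (upRen Fin.succ)) h₂ C
  have e : ((Ty.lolli (exArg ρ) (Ty.var 0)).ren (upRen Fin.succ)).subst
      (Ty.cons C (Ty.cons X A)) = Ty.lolli ((exArg ρ).subst (Ty.cons C A)) C :=
    wkUnder_subst (Ty.lolli (exArg ρ) (Ty.var 0)) X C A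
  rw [e] at h₃
  exact h₃.lam_subst hp

/-- The quantified target β is the codomain of the arrow, and the domain is weakened past it. So
every map between targets acts on such families. -/
theorem exArg_onlyPos (ρ : S.Ty (k + 1)) : (exArg ρ).OnlyPos 0 := by
  rintro (o | ⟨h, -⟩)
  · rw [wkUnder, Ty.ren_eq_subst] at o
    obtain ⟨j, ⟨-, -, h⟩ | ⟨-, -, h⟩⟩ := o.of_subst
    all_goals
      revert h
      exact Fin.cases (fun h => (Fin.succ_ne_zero _ h).elim)
        (fun i h => (Fin.succ_ne_zero _ (Fin.succ_injective _ h).symm).elim) j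
  · cases h

/-- A map that carries `p` to `q` carries `x p` to `x q`. -/
theorem ex_param (hext : Extensionality T) (hid : IdentityExtension T)
    (hx : HasTyI Γ x ((ex ρ).subst A)) (hh : HasTyI Γ h (Ty.lolli C D))
    (hp : HasTyI Γ p ((exArg ρ).subst (Ty.cons C A)))
    (hq : HasTyI Γ q ((exArg ρ).subst (Ty.cons D A)))
    (hc : IEq T (ρ.subst (Ty.up A) :: Γ.map Ty.wk) (Θ.map RelDecl.wk)
      ((Φ.map Form.wkTy).map Form.wk) D.wk
      (Tm.app (h.wkTy.wk 1) (Tm.app (Tm.tapp (p.wkTy.wk 1) (Ty.var 0)) (Tm.var 0)))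
      (Tm.app (Tm.tapp (q.wkTy.wk 1) (Ty.var 0)) (Tm.var 0))) :
    IEq T Γ Θ Φ D (Tm.app h (Tm.app (Tm.tapp x C) p)) (Tm.app (Tm.tapp x D) q) := by
  have ok : ∀ i, RelOk T true Γ Θ (Rel.graphs A C D h i) _ _ := RelOk.graphs hh
  have h₁ := IRel.ty_pi_elim (RelOk.eqr_vec A) (RelOk.span (T := T) (Θ := Θ) hh (.idm D))
    (IEq.ty hid (IEq.rfl (T := T) (Θ := Θ) (Φ := Φ) hx))
  have h₂ := (IRel.ty_lolli (σ := exArg ρ) (σ' := Ty.var 0) ok).1 h₁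
  -- The action of h on the family p is postcomposition with h, and the hypothesis says that this is
  -- q. By the graph lemma p and q are then related at the graph of h, so x carries them to related
  -- values.
  have key : IEq T Γ Θ Φ ((exArg ρ).subst (Ty.cons D A))
      (Tm.app (pmap (exArg ρ) A C D h) p) q := by
    have hl := (pmap_hasTy (A := A) (exArg_onlyPos ρ) hh).app hp
    have eA : ∀ C : S.Ty n, Ty.up (Ty.cons C A) =
        Ty.cons (Ty.var 0) (Ty.cons C.wk fun i => (A i).wk) := fun C => by
      funext i; refine Fin.cases rfl (fun i => ?_) i
      exact Fin.cases rfl (fun _ => rfl) i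
    have eC : ∀ C : S.Ty n, ((exArg ρ).subst (Ty.cons C A)).wk =
        (exArg ρ).subst (Ty.cons C.wk fun i => (A i).wk) := fun C => by
      rw [Ty.wk, Ty.ren_subst]
      congr 1
      funext i; exact Fin.cases rfl (fun _ => rfl) i
    have eρ : (wkUnder ρ).subst (Ty.up (Ty.cons D A)) = ρ.subst (Ty.up A) := by
      rw [eA, wkUnder_subst]; rfl
    have hp' := hp.wkTy
    have hq' := hq.wkTy
    have hl' := hl.wkTy
    rw [eC] at hp' hq' hl'
    refine IEq.extPi hext hl hq ?_
    change IEq T (Γ.map Ty.wk) (Θ.map RelDecl.wk) (Φ.map Form.wkTy)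
      (Ty.lolli ((wkUnder ρ).subst (Ty.up (Ty.cons D A))) D.wk) _ _
    rw [eρ]
    refine IEq.ext hext (exArg_tapp hl' (Ty.var 0)) (exArg_tapp hq' (Ty.var 0)) ?_
    have v : HasTyI (ρ.subst (Ty.up A) :: Γ.map Ty.wk) (Tm.var 0) (ρ.subst (Ty.up A)) :=
      .var (by rfl)
    have hp₁ := hp'.wk1 (A := ρ.subst (Ty.up A))
    have hh₁ : HasTyI (ρ.subst (Ty.up A) :: Γ.map Ty.wk) (h.wkTy.wk 1) (Ty.lolli C.wk D.wk) :=
      hh.wkTy.wk1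
    have ok₁ := pmap_ok (A := fun i => (A i).wk) (exArg_onlyPos ρ) hh₁
    have k₁ := ExtEqI.act_pi ok₁ hp₁ (Ty.var 0)
    have v₁ : HasTyI (ρ.subst (Ty.up A) :: Γ.map Ty.wk) (Tm.var 0)
        ((wkUnder ρ).subst (Ty.cons (Ty.var 0) (Ty.cons D.wk fun i => (A i).wk))) := by
      rw [wkUnder_subst]; exact v
    have t₁ : HasTyI (ρ.subst (Ty.up A) :: Γ.map Ty.wk) (Tm.tapp (p.wkTy.wk 1) (Ty.var 0))
        (Ty.lolli ((wkUnder ρ).subst (Ty.cons (Ty.var 0) (Ty.cons C.wk fun i => (A i).wk)))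
          C.wk) := by
      rw [wkUnder_subst]; exact exArg_tapp hp₁ (Ty.var 0)
    have k₂ := ExtEqI.act_lolli (ok₁.pi_inst (Ty.var 0)) t₁ v₁
    have k₃ := ExtEq.trans (ExtEqI.app k₁ (.refl v₁)) k₂
    -- The body ρ does not contain the target variable, so its part of the action consists of
    -- identities only.
    have ea : act (wkUnder ρ) (Ty.cons (Ty.var 0) (Ty.cons D.wk fun i => (A i).wk))
        (Ty.cons (Ty.var 0) (Ty.cons C.wk fun i => (A i).wk))
        (Fin.cases (Tm.idm (Ty.var 0)) (Fin.cases Tm.star (idv fun i => (A i).wk)))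
        (Fin.cases (Tm.idm (Ty.var 0)) (Fin.cases (h.wkTy.wk 1) (idv fun i => (A i).wk))) =
        act ρ (Ty.up A) (Ty.up A) (idv (Ty.up A)) (idv (Ty.up A)) := by
      rw [wkUnder, act_ty_ren]
      congr 1
      all_goals funext i; exact Fin.cases rfl (fun _ => rfl) i
    rw [ea] at k₃
    have k₄ := ((act_id hext hid ρ (Ty.up A) (ρ.subst (Ty.up A) :: Γ.map Ty.wk)
      (Θ.map RelDecl.wk) ((Φ.map Form.wkTy).map Form.wk)).appL v).trans (ExtEqI.idm v).ieq
    have k₅ := ((ExtEqI.ieq k₃).trans (IEq.appR hh₁ (.appR (exArg_tapp hp₁ (Ty.var 0)) k₄))).trans hc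
    have el : ((Tm.app (pmap (exArg ρ) A C D h) p).wkTy).wk 1 =
        Tm.app (pmap (exArg ρ) (fun i => (A i).wk) C.wk D.wk (h.wkTy.wk 1)) (p.wkTy.wk 1) := by
      rw [← pmap_wk, ← pmap_wkTy]; rfl
    have e₁ : ∀ t : Tm S n, (Tm.tapp t.wkTy (Ty.var 0)).wk 1 =
        Tm.tapp (t.wkTy.wk 1) (Ty.var 0) := fun t => rfl
    rw [e₁, e₁, el]
    exact k₅
  have h₃ := (IRel.graphs_intro hext hid (Φ := Φ) (Θ := Θ) (exArg_onlyPos ρ) hh hp).congr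
    (.rfl hp) key
  have h₄ := h₂.lolli_elim (.ofAdm (.ty (Ty.var 0) ok)) h₃
  have h₅ := ((IRel.ty_var ok 0).1 h₄).span_elim hh (.idm D)
  exact h₅.trans (ExtEqI.idm h₄.right).ieq

/-- Evaluation `λ° x. x C p` at `p`, for `x` of type `N`. -/
def evalAt (N C : S.Ty n) (p : Tm S n) : Tm S n :=
  Tm.lam N (Tm.app (Tm.tapp (Tm.var 0) C) (p.wk 1))

theorem evalAt_ren {m : ℕ} (N C : S.Ty n) (r : Fin n → Fin m) (e : ℕ → ℕ) :
    (evalAt N C p).ren r e = evalAt (N.ren r) (C.ren r) (p.ren r e) := by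
  simp only [evalAt, Tm.ren, Tm.wk_ren_upN]; rfl

theorem evalAt_hasTy (hp : HasTyI Γ p ((exArg ρ).subst (Ty.cons C A))) :
    HasTyI Γ (evalAt ((ex ρ).subst A) C p) (Ty.lolli ((ex ρ).subst A) C) := by
  refine .lam (.app (.left _ (intCtx_split _)) ?_ (hp.off1 (by simp)))
  have h := HasTy.tapp C (HasTy.lvar0 (σ := (ex ρ).subst A) (intCtx_noLin Γ))
  change HasTy _ _ (((Ty.lolli (exArg ρ) (Ty.var 0)).subst (Ty.up A)).inst C) at h
  rwa [Ty.subst_up_inst] at h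

theorem ExtEqI.evalAt (hp : HasTyI Γ p ((exArg ρ).subst (Ty.cons C A)))
    (hx : HasTyI Γ x ((ex ρ).subst A)) :
    ExtEqI Γ (Tm.app (evalAt ((ex ρ).subst A) C p) x) (Tm.app (Tm.tapp x C) p) C := by
  have h := ExtEqI.lamβ ((evalAt_hasTy hp).app hx)
  simp [Tm.inst, Tm.subst] at h
  exact h

theorem exArg_subst : (exArg ρ).subst (Ty.cons C A) = Ty.pi (Ty.lolli (ρ.subst (Ty.up A)) C.wk) := by
  change Ty.pi (Ty.lolli ((wkUnder ρ).subst (Ty.up (Ty.cons C A))) C.wk) = _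
  rw [wkUnder, Ty.subst_ren]
  congr 2
  congr 1
  funext i; exact Fin.cases rfl (fun _ => rfl) i

theorem pack_hasTy_exArg (e : ℕ → Tm S n) :
    HasTyI Γ ((pack ρ).subst A e) ((exArg ρ).subst (Ty.cons ((ex ρ).subst A) A)) := by
  rw [exArg_subst, ← Ty.wk_subst_up]
  exact (pack_hasTy ρ).closed_subst Γ A e

theorem ex_wk : ((ex ρ).subst A).wk = (ex ρ).subst fun i => (A i).wk := Ty.ren_subst _ _ _

theorem exArg_wk : ((exArg ρ).subst (Ty.cons C A)).wk =
    (exArg ρ).subst (Ty.cons C.wk fun i => (A i).wk) := by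
  rw [Ty.wk, Ty.ren_subst]
  congr 1
  funext i; exact Fin.cases rfl (fun _ => rfl) i

theorem pack_wk (j : ℕ) : ((pack ρ).subst A Tm.var).wk j = (pack ρ).subst A Tm.var :=
  ((pack_hasTy ρ).closed_subst [] A Tm.var).wk_closed j

theorem pack_wkTy : ((pack ρ).subst A Tm.var).wkTy =
    (pack ρ).subst (fun i => (A i).wk) Tm.var := by
  rw [Tm.wkTy, Tm.ren_subst]; rfl

/-- Dual to `mu_eta`: both sides are compared at a target type and a family p, both variables.
Evaluation at p carries the family `pack` to p by β, and `ex_param` moves this evaluation inside. -/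
theorem ex_eta (hext : Extensionality T) (hid : IdentityExtension T)
    (hx : HasTyI Γ x ((ex ρ).subst A)) :
    IEq T Γ Θ Φ ((ex ρ).subst A) (Tm.app (Tm.tapp x ((ex ρ).subst A)) ((pack ρ).subst A Tm.var))
      x := by
  have hl := (ex_tapp hx _).app (pack_hasTy_exArg (Γ := Γ) (ρ := ρ) (A := A) Tm.var)
  have hx' := hx.wkTy
  have hl' := hl.wkTy
  rw [ex_wk] at hx' hl'
  refine IEq.extPi hext hl hx (IEq.ext hext (ex_tapp hl' (Ty.var 0)) (ex_tapp hx' (Ty.var 0)) ?_)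
  have v : HasTyI ((exArg ρ).subst (Ty.up A) :: Γ.map Ty.wk) (Tm.var 0)
    ((exArg ρ).subst (Ty.up A)) := .var (by rfl)
  have hx₁ := hx'.wk1 (A := (exArg ρ).subst (Ty.up A))
  have hl₁ := hl'.wk1 (A := (exArg ρ).subst (Ty.up A))
  refine (ExtEqI.evalAt v hl₁).ieq.symm.trans ?_
  have el : ((Tm.app (Tm.tapp x ((ex ρ).subst A)) ((pack ρ).subst A Tm.var)).wkTy).wk 1 =
      Tm.app (Tm.tapp (x.wkTy.wk 1) ((ex ρ).subst fun i => (A i).wk))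
        ((pack ρ).subst (fun i => (A i).wk) Tm.var) := by
    have e₁ := pack_wkTy (ρ := ρ) (A := A)
    have e₂ := pack_wk (ρ := ρ) (A := fun i => (A i).wk) 1
    have e₃ := ex_wk (ρ := ρ) (A := A)
    simp only [Tm.wk, Tm.wkTy, Ty.wk, Tm.ren, Ty.ren_id] at e₁ e₂ e₃ ⊢
    rw [e₁, e₂, e₃]
  rw [el]
  refine ex_param hext hid hx₁ (evalAt_hasTy v) (pack_hasTy_exArg Tm.var) v ?_
  have e₁ : ((evalAt ((ex ρ).subst fun i => (A i).wk) (Ty.var 0) (Tm.var 0)).wkTy).wk 1 =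
      evalAt ((ex ρ).subst fun i => (A i).wk.wk) (Ty.var 1) (Tm.var 1) := by
    rw [Tm.wkTy, evalAt_ren, Tm.wk, evalAt_ren, Ty.ren_id, Ty.ren_id]
    rw [← ex_wk (A := fun i => (A i).wk)]; rfl
  rw [e₁, pack_wkTy, pack_wk]
  have v₁ : HasTyI (ρ.subst (Ty.up fun i => (A i).wk) ::
      ((exArg ρ).subst (Ty.up A) :: Γ.map Ty.wk).map Ty.wk) (Tm.var 1)
      ((exArg ρ).subst (Ty.cons (Ty.var 1) fun i => (A i).wk.wk)) := by
    refine .var ?_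
    change some ((exArg ρ).subst (Ty.cons (Ty.var 0) fun i => (A i).wk)).wk = _
    rw [exArg_wk]; rfl
  have v₀ : HasTyI (ρ.subst (Ty.up fun i => (A i).wk) ::
      ((exArg ρ).subst (Ty.up A) :: Γ.map Ty.wk).map Ty.wk) (Tm.var 0)
      (ρ.subst (Ty.cons (Ty.var 0) fun i => (A i).wk.wk)) := .var (by rfl)
  exact ((ExtEqI.evalAt v₁ ((pack_app_hasTy Tm.var _).app v₀)).ieq.trans
    (ExtEqI.pack Tm.var v₀ v₁).ieq)

end Existential

/-! ## Final coalgebras -/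

section Closures

variable {n m : ℕ} {Γ : List (S.Ty n)} {c : Fin m → S.Ty n} {e : ℕ → Tm S n} {C : S.Ty n}
  {t a b : Tm S n}

theorem ExtEqI.letTensor_subst {s r : Tm S m}
    (h : ExtEqI Γ t ((Tm.letTensor s r).subst c e) C) (hs : s.subst c e = Tm.tensor a b) :
    ExtEqI Γ t (r.subst c (scons b (scons a e))) C := by
  rw [Tm.subst, hs] at h
  have h₁ := ExtEq.trans h (ExtEqI.tensorβ h.hasTy.2)
  rw [Tm.inst2, Tm.subst_subst] at h₁
  change ExtEqI _ _ _ _ at h₁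
  convert h₁ using 2
  · funext i; exact (Ty.subst_var _).symm
  · funext i
    match i with
    | 0 => rfl
    | 1 => rfl
    | i + 2 =>
      change e i = (((e i).wk 1).wk 1).subst _ _
      rw [Tm.wk_wk, Tm.wk, Tm.subst_ren]
      exact (Tm.subst_var _).symm

theorem ExtEqI.letBang_subst {s r : Tm S m}
    (h : ExtEqI Γ t ((Tm.letBang s r).subst c e) C) (hs : s.subst c e = Tm.bang a) :
    ExtEqI Γ t (r.subst c (scons a e)) C := by
  rw [Tm.subst, hs] at h
  have h₁ := ExtEq.trans h (ExtEqI.bangβ h.hasTy.2)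
  rw [Tm.subst_up_inst] at h₁
  exact h₁

end Closures

/-- Maps out of `!A ⊗ B` agree when they agree at all `!a ⊗ b`. -/
theorem IEq.bang_tensor_ext {T : Theory S} {n : ℕ} {Γ : List (S.Ty n)} {Θ : List (RelDecl S n)}
    {Φ : List (Form S n)} (hext : Extensionality T) (hid : IdentityExtension T) {A B C : S.Ty n}
    {f g : Tm S n} (hf : HasTyI Γ f (Ty.lolli (Ty.tensor (Ty.bang A) B) C))
    (hg : HasTyI Γ g (Ty.lolli (Ty.tensor (Ty.bang A) B) C))
    (h : IEq T (B :: A :: Γ) Θ ((Φ.map Form.wk).map Form.wk) C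
      (Tm.app (f.wk 2) (Tm.tensor (Tm.bang (Tm.var 1)) (Tm.var 0)))
      (Tm.app (g.wk 2) (Tm.tensor (Tm.bang (Tm.var 1)) (Tm.var 0)))) :
    IEq T Γ Θ Φ (Ty.lolli (Ty.tensor (Ty.bang A) B) C) f g := by
  have hc : IEq T Γ Θ Φ (Ty.lolli (Ty.bang A) (Ty.lolli B C)) (Tm.curry (Ty.bang A) B f)
      (Tm.curry (Ty.bang A) B g) := by
    have v : HasTyI (A :: Γ) (Tm.bang (Tm.var 0)) (Ty.bang A) := HasTyI.bang (.var (by rfl))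
    refine IEq.bang_ext hext hid hf.curry hg.curry (IEq.ext hext (.app hf.curry.wk1 v)
      (.app hg.curry.wk1 v) ?_)
    have e : ∀ {f : Tm S n}, HasTyI Γ f (Ty.lolli (Ty.tensor (Ty.bang A) B) C) →
        IEq T (B :: A :: Γ) Θ ((Φ.map Form.wk).map Form.wk) C
          (Tm.app ((Tm.app ((Tm.curry (Ty.bang A) B f).wk 1) (Tm.bang (Tm.var 0))).wk 1)
            (Tm.var 0)) (Tm.app (f.wk 2) (Tm.tensor (Tm.bang (Tm.var 1)) (Tm.var 0))) := by
      intro f hf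
      have := (ExtEqI.curry (a := Tm.bang (Tm.var 1)) (b := Tm.var 0) (hf.wk2 (A := B) (B := A))
        (.bang (.var (by rfl))) (.var (by rfl))).ieq (T := T) (Θ := Θ)
          (Φ := (Φ.map Form.wk).map Form.wk)
      rw [← Tm.curry_wk, Tm.wk_two] at this
      exact this
    exact (e hf).trans (h.trans (e hg).symm)
  refine IEq.tensor_ext hext hid hf hg ?_
  have v₁ : HasTyI (B :: Ty.bang A :: Γ) (Tm.var 1) (Ty.bang A) := .var (by rfl)
  have v₀ : HasTyI (B :: Ty.bang A :: Γ) (Tm.var 0) B := .var (by rfl)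
  have h₁ := ((hc.wk2 B (Ty.bang A)).appL v₁).appL v₀
  rw [Tm.curry_wk, Tm.curry_wk] at h₁
  exact (ExtEqI.curry hf.wk2 v₁ v₀).ieq.symm.trans (h₁.trans (ExtEqI.curry hg.wk2 v₁ v₀).ieq)

/-- The map `Λ α. λ° y. let w ⊗ z be y in let !f be w in σ(unfold α !f) (f z)`. -/
def outArg {k : ℕ} (σ : S.Ty (k + 1)) : Tm S k :=
  Tm.tlam (Tm.lam (nuBody σ) (Tm.letTensor (Tm.var 0) (Tm.letBang (Tm.var 1)
    (Tm.app
      (map₁ (wkUnder σ) (Ty.var 0) (nu σ).wk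
        (Tm.app (Tm.tapp (unfold σ).wkTy (Ty.var 0)) (Tm.bang (Tm.var 0))))
      (Tm.app (Tm.var 0) (Tm.var 1))))))

/-- `unfold X !f` at the parameters `A`. -/
def pun {n k : ℕ} (σ : S.Ty (k + 1)) (A : Fin k → S.Ty n) (X : S.Ty n) (f : Tm S n) : Tm S n :=
  Tm.app (Tm.tapp ((unfold σ).subst A Tm.var) X) (Tm.bang f)

/-- The coalgebra structure of `ν α. σ` at the parameters `A`. -/
def pout {n k : ℕ} (σ : S.Ty (k + 1)) (A : Fin k → S.Ty n) : Tm S n := (outMap σ).subst A Tm.var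

section FinalCoalgebra

variable {T : Theory S} {n k : ℕ} {Γ : List (S.Ty n)} {Θ : List (RelDecl S n)}
  {Φ : List (Form S n)} {σ : S.Ty (k + 1)} {A : Fin k → S.Ty n} {X Y C : S.Ty n}
  {f g h p x z w : Tm S n}

theorem unfold_hasTy (σ : S.Ty (k + 1)) : HasTyI [] (unfold σ)
    (Ty.pi (Ty.lolli (Ty.bang (Ty.lolli (Ty.var 0) σ)) (Ty.lolli (Ty.var 0) (nu σ).wk))) := by
  have hp := pack_app_hasTy (Γ := []) (ρ := nuBody σ) (A := fun i => Ty.var i.succ) Tm.var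
    (Ty.var 0)
  rw [Ty.cons_var, Ty.subst_var, ← Tm.ren_eq_subst, ← Ty.ren_eq_subst] at hp
  refine .tlam (.lam (.lam (.app (.right _ (.right _ .nil))
    (hp.off_append [(Use.off, Ty.var 0), (Use.off, Ty.bang (Ty.lolli (Ty.var 0) σ))] ?_)
    (.tensor (.right _ (.left _ .nil)) (.lvar1 (by simp) ?_) (.lvar0 ?_)))))
  all_goals simp [TCtx.NoLin]

theorem pun_hasTy (hf : HasTyI Γ f (Ty.lolli X (σ.subst (Ty.cons X A)))) :
    HasTyI Γ (pun σ A X f) (Ty.lolli X ((nu σ).subst A)) := by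
  have h₂ := ExtEqI.tapp_subst (ExtEq.refl ((unfold_hasTy σ).closed_subst Γ A Tm.var)) X
  simp only [Ty.subst, Ty.wk_subst_cons] at h₂
  exact HasTyI.app h₂.hasTy.1 hf.bang

theorem ExtEqI.pun (hf : HasTyI Γ f (Ty.lolli X (σ.subst (Ty.cons X A)))) (hz : HasTyI Γ z X) :
    ExtEqI Γ (Tm.app (pun σ A X f) z)
      (Tm.app (Tm.tapp ((LAPL.pack (nuBody σ)).subst A Tm.var) X) (Tm.tensor (Tm.bang f) z))
      ((nu σ).subst A) := by
  have h₂ := ExtEqI.tapp_subst (ExtEq.refl ((unfold_hasTy σ).closed_subst Γ A Tm.var)) X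
  simp only [Ty.subst, Ty.wk_subst_cons] at h₂
  have h₃ := (h₂.lam_subst hf.bang).lam_subst hz
  simp only [Tm.subst, Tm.wkTy_subst_cons] at h₃
  rw [(pack_hasTy (nuBody σ)).subst_closed A _ Tm.var] at h₃
  exact h₃

theorem pun_wk (j : ℕ) : (LAPL.pun σ A X f).wk j = LAPL.pun σ A X (f.wk j) := by
  have h := ((unfold_hasTy σ).closed_subst [] A Tm.var).wk_closed j
  simp only [LAPL.pun, Tm.wk, Tm.ren, Ty.ren_id] at h ⊢
  rw [h]

theorem pun_wkTy : (LAPL.pun σ A X f).wkTy = LAPL.pun σ (fun i => (A i).wk) X.wk f.wkTy := by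
  have h : ((unfold σ).subst A Tm.var).wkTy = (unfold σ).subst (fun i => (A i).wk) Tm.var := by
    rw [Tm.wkTy, Tm.ren_subst]; rfl
  simp only [LAPL.pun, Tm.wkTy, Tm.ren] at h ⊢
  rw [h]; rfl

/-- The two `let`s consume the two linear binders, so what remains is a linear variable in X and an
intuitionistic coalgebra on it. Being intuitionistic, the coalgebra may be used twice: it is applied
once and unfolded once. -/
theorem outArg_hasTy (hσ : σ.OnlyPos 0) :
    HasTyI [] (outArg σ) (Ty.pi (Ty.lolli (nuBody σ) (σ.inst (nu σ)).wk)) := by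
  refine .tlam (.lam (.letTensor (.left _ .nil) (.lvar0 ?_)
    (.letBang (.right _ (.left _ (.off _ .nil))) (.lvar1 (by simp) ?_)
      (.app (.int _ (.right _ (.off _ (.off _ .nil)))) ?_
        (.app (.int _ (.right _ (.off _ (.off _ .nil)))) (.ivar (by rfl) ?_)
          (.lvar1 (by simp) ?_))))))
  rotate_left 2
  · have h := map₁_hasTy (Γ := [Ty.lolli (Ty.var 0) σ]) (X := Ty.var 0) (Y := (nu σ).wk)
      (g := Tm.app (Tm.tapp (unfold σ).wkTy (Ty.var 0)) (Tm.bang (Tm.var 0))) hσ.wkUnder ?_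
    · rw [wkUnder_inst_wk, wkUnder, Ty.ren_upRen_inst] at h
      exact h.off_append [(Use.off, Ty.var 0), (Use.off, Ty.bang (Ty.lolli (Ty.var 0) σ)),
        (Use.off, nuBody σ)] (by simp [TCtx.NoLin])
    · have h := pun_hasTy (σ := σ) (A := fun i => Ty.var i.succ) (X := Ty.var 0)
        (Γ := [Ty.lolli (Ty.var 0) σ]) (f := Tm.var 0) ?_
      · rw [LAPL.pun, ← Tm.ren_eq_subst, ← Ty.ren_eq_subst] at h
        exact h
      · rw [Ty.cons_var]
        exact .var (by rw [Ty.subst_var]; rfl)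
  all_goals simp [TCtx.NoLin]

theorem outMap_hasTy (hσ : σ.OnlyPos 0) :
    HasTyI [] (outMap σ) (Ty.lolli (nu σ) (σ.inst (nu σ))) := by
  refine .lam (.app (.left _ .nil) ?_
    ((outArg_hasTy hσ).off_append [(Use.off, nu σ)] (by simp [TCtx.NoLin])))
  have h := HasTy.tapp (Γ := [(Use.lin, nu σ)]) (t := Tm.var 0) (σ.inst (nu σ))
    (.lvar0 (by simp [TCtx.NoLin]))
  change HasTy _ _ (Ty.lolli (Ty.pi (Ty.lolli
    ((wkUnder (nuBody σ)).subst (Ty.up (Ty.cons (σ.inst (nu σ)) Ty.var))) _)) _) at h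
  convert h using 4
  · rw [wkUnder, Ty.subst_ren]
    conv_lhs => rw [← Ty.subst_var (nuBody σ)]
    congr 1
    funext i; exact Fin.cases rfl (fun _ => rfl) i
  all_goals rfl

theorem nu_inst_subst : (σ.inst (nu σ)).subst A = σ.subst (Ty.cons ((nu σ).subst A) A) := by
  rw [Ty.inst, Ty.subst_subst]
  congr 1
  funext i; exact Fin.cases rfl (fun _ => rfl) i

theorem pout_hasTy (hσ : σ.OnlyPos 0) (Γ : List (S.Ty n)) :
    HasTyI Γ (pout σ A) (Ty.lolli ((nu σ).subst A) (σ.subst (Ty.cons ((nu σ).subst A) A))) := by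
  have h := (outMap_hasTy hσ).closed_subst Γ A Tm.var
  rw [Ty.subst, nu_inst_subst] at h
  exact h

theorem pout_wk (hσ : σ.OnlyPos 0) (j : ℕ) : (pout σ A).wk j = pout σ A :=
  (pout_hasTy hσ []).wk_closed j

theorem pout_wkTy : (pout σ A).wkTy = pout σ fun i => (A i).wk := by
  rw [pout, pout, Tm.wkTy, Tm.ren_subst]; rfl

theorem ExtEqI.pout (hσ : σ.OnlyPos 0) (hx : HasTyI Γ x ((nu σ).subst A)) :
    ExtEqI Γ (Tm.app (pout σ A) x)
      (Tm.app (Tm.tapp x (σ.subst (Ty.cons ((nu σ).subst A) A))) ((outArg σ).subst A Tm.var))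
      (σ.subst (Ty.cons ((nu σ).subst A) A)) := by
  have h₁ := ExtEqI.lam_subst (ExtEq.refl (pout_hasTy (A := A) hσ Γ)) hx
  change ExtEqI Γ _ (Tm.app (Tm.tapp x ((σ.inst (nu σ)).subst A)) ((outArg σ).subst A _)) _ at h₁
  rw [nu_inst_subst, (outArg_hasTy hσ).subst_closed A _ Tm.var] at h₁
  exact h₁

theorem outArg_hasTy_exArg (hσ : σ.OnlyPos 0) (Γ : List (S.Ty n)) :
    HasTyI Γ ((outArg σ).subst A Tm.var)
      ((exArg (nuBody σ)).subst (Ty.cons (σ.subst (Ty.cons ((nu σ).subst A) A)) A)) := by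
  have h := (outArg_hasTy hσ).closed_subst Γ A Tm.var
  rw [exArg_subst, ← nu_inst_subst, ← Ty.wk_subst_up]
  exact h

theorem ExtEqI.outArg (hσ : σ.OnlyPos 0) (hf : HasTyI Γ f (Ty.lolli X (σ.subst (Ty.cons X A))))
    (hz : HasTyI Γ z X) :
    ExtEqI Γ (Tm.app (Tm.tapp ((outArg σ).subst A Tm.var) X) (Tm.tensor (Tm.bang f) z))
      (Tm.app (pmap σ A X ((nu σ).subst A) (LAPL.pun σ A X f)) (Tm.app f z))
      (σ.subst (Ty.cons ((nu σ).subst A) A)) := by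
  have h₁ := ExtEqI.tapp_subst (ExtEq.refl ((outArg_hasTy hσ).closed_subst Γ A Tm.var)) X
  rw [Ty.subst, Ty.wk_subst_cons, nu_inst_subst] at h₁
  have h₂ := h₁.lam_subst (HasTyI.tensor hf.bang hz)
  have h₃ := (h₂.letTensor_subst (a := Tm.bang f) (b := z) (by rfl)).letBang_subst (a := f) (by rfl)
  refine ExtEq.trans h₃ ?_
  have h₄ := ExtEqI.functor₁ (A := Ty.cons X A) (X := X) (Y := (nu σ).subst A) hσ.wkUnder
    (scons f (scons z (scons (Tm.bang f) (scons (Tm.tensor (Tm.bang f) z) Tm.var)))) (pun_hasTy hf)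
  rw [pmap_wkUnder, wkUnder_subst, wkUnder_subst] at h₄
  have h₅ := ExtEqI.app h₄ (.refl (hf.app hz))
  simp only [Tm.subst, map₁, Tm.wkTy_subst_cons, Ty.wk_subst_cons]
  rw [(unfold_hasTy σ).subst_closed A _ Tm.var]
  exact h₅

/-- Pure β: unfold packs !f ⊗ z, and `out` passes its own family to that package, where it computes.
-/
theorem unfold_comm (hσ : σ.OnlyPos 0) (hf : HasTyI Γ f (Ty.lolli X (σ.subst (Ty.cons X A))))
    (hz : HasTyI Γ z X) :
    IEq T Γ Θ Φ (σ.subst (Ty.cons ((nu σ).subst A) A))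
      (Tm.app (pout σ A) (Tm.app (pun σ A X f) z))
      (Tm.app (pmap σ A X ((nu σ).subst A) (pun σ A X f)) (Tm.app f z)) := by
  have h := pout_hasTy (A := A) hσ Γ
  have hb := HasTyI.tensor hf.bang hz
  exact ((IEq.appR h (ExtEqI.pun hf hz).ieq).trans
    (ExtEqI.pout hσ ((pack_app_hasTy Tm.var X).app hb)).ieq).trans
      ((ExtEqI.pack Tm.var hb (outArg_hasTy_exArg hσ Γ)).ieq.trans
        (ExtEqI.outArg hσ hf hz).ieq)

/-- Parametricity, at the graph of h, of a family p that maps !(α ⊸ σ(α)) ⊗ α to C for every α. The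
hypothesis `hc` says that h is a coalgebra map, so f and g are related; x and h x are related by
definition. As C does not involve the quantified type, related results are equal. -/
theorem nu_param (hext : Extensionality T) (hid : IdentityExtension T) (hσ : σ.OnlyPos 0)
    (hp : HasTyI Γ p ((exArg (nuBody σ)).subst (Ty.cons C A)))
    (hf : HasTyI Γ f (Ty.lolli X (σ.subst (Ty.cons X A))))
    (hg : HasTyI Γ g (Ty.lolli Y (σ.subst (Ty.cons Y A))))
    (hh : HasTyI Γ h (Ty.lolli X Y))
    (hc : IEq T (X :: Γ) Θ (Φ.map Form.wk) (σ.subst (Ty.cons Y A))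
      (Tm.app (g.wk 1) (Tm.app (h.wk 1) (Tm.var 0)))
      (Tm.app (pmap σ A X Y (h.wk 1)) (Tm.app (f.wk 1) (Tm.var 0))))
    (hx : HasTyI Γ x X) :
    IEq T Γ Θ Φ C (Tm.app (Tm.tapp p X) (Tm.tensor (Tm.bang f) x))
      (Tm.app (Tm.tapp p Y) (Tm.tensor (Tm.bang g) (Tm.app h x))) := by
  have ok : ∀ i, RelOk T true Γ Θ (Rel.graphs (Ty.cons C A) X Y h i) _ _ := RelOk.graphs hh
  have h₁ := IRel.ty_pi_elim (RelOk.eqr_vec (Ty.cons C A))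
    (RelOk.span (T := T) (Θ := Θ) hh (.idm Y)) (IEq.ty hid (IEq.rfl (T := T) (Θ := Θ) (Φ := Φ) hp))
  have h₂ := (IRel.ty_lolli (σ := wkUnder (nuBody σ)) (σ' := Ty.var 1) ok).1 h₁
  have e : ∀ Z : S.Ty n, (wkUnder σ).subst (Ty.cons Z (Ty.cons C A)) = σ.subst (Ty.cons Z A) :=
    fun Z => wkUnder_subst _ _ _ _
  have hf' := hf
  have hg' := hg
  rw [← e] at hf' hg'
  -- An argument of f is related to w when w is its image under h. Then σ(h) applied to the value of
  -- f equals g w, and the graph lemma turns this into relatedness of the two values.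
  have h₃ : IRel T Γ Θ Φ (.ty (Ty.lolli (Ty.var 0) (wkUnder σ)) (Rel.graphs (Ty.cons C A) X Y h))
      (Ty.lolli X ((wkUnder σ).subst (Ty.cons X (Ty.cons C A))))
      (Ty.lolli Y ((wkUnder σ).subst (Ty.cons Y (Ty.cons C A)))) f g := by
    refine (IRel.ty_lolli (σ := Ty.var 0) ok).2 (IRel.lolli_intro (.ofAdm (.ty (Ty.var 0) ok))
      (.ofAdm (.ty _ ok)) hf' hg' ?_)
    have hv := IRel.hyp0 (Φ := (Φ.map Form.wk).map Form.wk) (T := T) (.ofAdm (.ty (Ty.var 0) ok))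
    have e₂ : ∀ τ : S.Ty (k + 2), (Rel.ty τ (Rel.graphs (Ty.cons C A) X Y h)).wk 2 =
        .ty τ (Rel.graphs (Ty.cons C A) X Y (h.wk 2)) := fun τ => by
      rw [Rel.wk, Rel.ren]
      congr 1
      funext i; exact Rel.graphs_wk h 2 i
    rw [e₂] at hv
    rw [e₂, e₂]
    have hv₁ := ((IRel.ty_var (RelOk.graphs hh.wk2) 0).1 hv).span_elim hh.wk2 (.idm Y)
    have hv₂ := hv₁.trans (ExtEqI.idm hv.right).ieq
    have k₁ := (hc.wk1 Y).mono (List.subset_cons_self (Form.rel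
      (.ty (Ty.var 0) (Rel.graphs (Ty.cons C A) X Y (h.wk 2))) (.var 1) (.var 0)) _)
    simp only [Tm.wk_app, Tm.wk_wk, pmap_wk] at k₁
    have k₂ := k₁.symm.trans (.appR hg.wk2 hv₂)
    have k₃ := IRel.graphs_intro hext hid (T := T) (Θ := Θ) (A := Ty.cons C A) (X := X) (Y := Y)
      (Φ := Form.rel (.ty (Ty.var 0) (Rel.graphs (Ty.cons C A) X Y (h.wk 2))) (.var 1) (.var 0) ::
        (Φ.map Form.wk).map Form.wk) hσ.wkUnder hh.wk2 (hf'.wk2.app hv.left)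
    rw [pmap_wkUnder] at k₃
    rw [← e] at k₂
    exact k₃.congr (.rfl k₃.left) k₂
  have h₄ : IRel T Γ Θ Φ (.ty (Ty.var 0) (Rel.graphs (Ty.cons C A) X Y h)) X Y x (Tm.app h x) :=
    (IRel.ty_var ok 0).2 (IEq.span hh (.idm Y) hx (hh.app hx) (ExtEqI.idm (hh.app hx)).ieq.symm)
  have h₅ : IRel T Γ Θ Φ (.ty (wkUnder (nuBody σ)) (Rel.graphs (Ty.cons C A) X Y h))
      ((wkUnder (nuBody σ)).subst (Ty.cons X (Ty.cons C A)))
      ((wkUnder (nuBody σ)).subst (Ty.cons Y (Ty.cons C A)))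
      (Tm.tensor (Tm.bang f) x) (Tm.tensor (Tm.bang g) (Tm.app h x)) :=
    (IRel.ty_tensor (σ := Ty.bang (Ty.lolli (Ty.var 0) (wkUnder σ))) (σ' := Ty.var 0) ok).2
      (IRel.tensor_intro ((IRel.ty_bang ok).2 h₃.bang_intro) h₄)
  exact IEq.of_ty hid (σ := Ty.var 0) (s := fun _ : Fin 1 => C)
    ((IRel.ty_var (RelOk.eqr_vec fun _ : Fin 1 => C) 0).2
      ((IRel.ty_var ok 1).1 (h₂.lolli_elim (.ofAdm (.ty (Ty.var 1) ok)) h₅)))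

/-- Coalgebra maps commute with `unfold`. -/
theorem unfold_coalg (hext : Extensionality T) (hid : IdentityExtension T) (hσ : σ.OnlyPos 0)
    (hf : HasTyI Γ f (Ty.lolli X (σ.subst (Ty.cons X A))))
    (hg : HasTyI Γ g (Ty.lolli Y (σ.subst (Ty.cons Y A))))
    (hh : HasTyI Γ h (Ty.lolli X Y))
    (hc : IEq T (X :: Γ) Θ (Φ.map Form.wk) (σ.subst (Ty.cons Y A))
      (Tm.app (g.wk 1) (Tm.app (h.wk 1) (Tm.var 0)))
      (Tm.app (pmap σ A X Y (h.wk 1)) (Tm.app (f.wk 1) (Tm.var 0))))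
    (hx : HasTyI Γ x X) :
    IEq T Γ Θ Φ ((nu σ).subst A) (Tm.app (pun σ A X f) x)
      (Tm.app (pun σ A Y g) (Tm.app h x)) :=
  ((ExtEqI.pun hf hx).ieq.trans
    (nu_param hext hid hσ (pack_hasTy_exArg Tm.var) hf hg hh hc hx)).trans
      (ExtEqI.pun hg (hh.app hx)).ieq.symm

/-- It suffices to compare at !f ⊗ x with f and x variables. There `pack` is the unfolding of f,
which is a coalgebra map from f to `out` by `unfold_comm`, and so commutes with unfolding by
`unfold_coalg`. -/
theorem pun_pout_pack (hext : Extensionality T) (hid : IdentityExtension T) (hσ : σ.OnlyPos 0)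
    (X : S.Ty n) :
    IEq T Γ Θ Φ (Ty.lolli ((nuBody σ).subst (Ty.cons X A)) ((nu σ).subst A))
      (Tm.comp ((nuBody σ).subst (Ty.cons X A)) (pun σ A ((nu σ).subst A) (pout σ A))
        (Tm.tapp ((pack (nuBody σ)).subst A Tm.var) X))
      (Tm.tapp ((pack (nuBody σ)).subst A Tm.var) X) := by
  have ho := pout_hasTy (A := A) hσ
  have hp : HasTyI Γ (Tm.tapp ((pack (nuBody σ)).subst A Tm.var) X) _ := pack_app_hasTy Tm.var X
  have hκ := pun_hasTy (ho Γ)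
  refine IEq.bang_tensor_ext hext hid (hκ.comp hp) hp ?_
  have v₁ : HasTyI (X :: Ty.lolli X (σ.subst (Ty.cons X A)) :: Γ) (Tm.var 1)
    (Ty.lolli X (σ.subst (Ty.cons X A))) := .var (by rfl)
  have v₀ : HasTyI (X :: Ty.lolli X (σ.subst (Ty.cons X A)) :: Γ) (Tm.var 0) X := .var (by rfl)
  rw [Tm.wk_comp]
  have e : (Tm.tapp ((pack (nuBody σ)).subst A Tm.var) X).wk 2 =
      Tm.tapp ((pack (nuBody σ)).subst A Tm.var) X := by
    have h := pack_wk (ρ := nuBody σ) (A := A) 2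
    simp only [Tm.wk, Tm.ren, Ty.ren_id] at h ⊢
    rw [h]
  have hp₂ : HasTyI (X :: Ty.lolli X (σ.subst (Ty.cons X A)) :: Γ)
    (Tm.tapp ((pack (nuBody σ)).subst A Tm.var) X) _ := pack_app_hasTy Tm.var X
  rw [e, pun_wk, pout_wk hσ]
  have k := (ExtEqI.pun v₁ v₀).ieq (T := T) (Θ := Θ) (Φ := (Φ.map Form.wk).map Form.wk)
  have hκ₂ := pun_hasTy (ho (X :: Ty.lolli X (σ.subst (Ty.cons X A)) :: Γ))
  refine ((ExtEqI.comp hκ₂ hp₂ (HasTyI.tensor v₁.bang v₀)).ieq.trans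
    (IEq.appR hκ₂ k.symm)).trans (IEq.trans (IEq.symm ?_) k)
  refine unfold_coalg hext hid hσ v₁ (ho _) (pun_hasTy v₁) ?_ v₀
  rw [pun_wk, pout_wk hσ]
  exact unfold_comm hσ v₁.wk1 (.var (by rfl))

/-- By `ex_eta` an element w is the result of w at the family `pack`. The unfolding of `out` carries
`pack` to itself, so by `ex_param` it fixes w. -/
theorem pun_pout (hext : Extensionality T) (hid : IdentityExtension T) (hσ : σ.OnlyPos 0)
    (hw : HasTyI Γ w ((nu σ).subst A)) :
    IEq T Γ Θ Φ ((nu σ).subst A) (Tm.app (pun σ A ((nu σ).subst A) (pout σ A)) w) w := by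
  have hκ := pun_hasTy (pout_hasTy (A := A) hσ Γ)
  have η := ex_eta hext hid (Θ := Θ) (Φ := Φ) hw
  refine (IEq.appR hκ η.symm).trans (IEq.trans ?_ η)
  have hp : HasTyI Γ ((pack (nuBody σ)).subst A Tm.var) _ := pack_hasTy_exArg Tm.var
  refine ex_param hext hid hw hκ hp hp ?_
  have v : HasTyI ((nuBody σ).subst (Ty.up A) :: Γ.map Ty.wk) (Tm.var 0)
    ((nuBody σ).subst (Ty.up A)) := .var (by rfl)
  have k := (pun_pout_pack hext hid hσ (A := fun i => (A i).wk) (Γ := Γ.map Ty.wk)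
    (Θ := Θ.map RelDecl.wk) (Φ := Φ.map Form.wkTy) (Ty.var 0)).wk1 ((nuBody σ).subst (Ty.up A))
  have k₁ := k.appL v
  rw [Tm.wk_comp] at k₁
  have e : (Tm.tapp ((pack (nuBody σ)).subst (fun i => (A i).wk) Tm.var) (Ty.var 0)).wk 1 =
      Tm.tapp ((pack (nuBody σ)).subst (fun i => (A i).wk) Tm.var) (Ty.var 0) := by
    have h := pack_wk (ρ := nuBody σ) (A := fun i => (A i).wk) 1
    simp only [Tm.wk, Tm.ren, Ty.ren_id] at h ⊢
    rw [h]
  rw [e, pun_wk, pout_wk hσ] at k₁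
  have e₂ : ((nu σ).subst A).wk = (nu σ).subst fun i => (A i).wk := ex_wk
  have k₂ := ExtEqI.comp (pun_hasTy (pout_hasTy (A := fun i => (A i).wk) hσ
    ((nuBody σ).subst (Ty.up A) :: Γ.map Ty.wk))) (pack_app_hasTy Tm.var (Ty.var 0)) v
  rw [pun_wkTy, pun_wk, pout_wkTy, pout_wk hσ, pack_wkTy, pack_wk, e₂]
  exact k₂.ieq.symm.trans k₁

/-- Finality: a coalgebra map h into ν commutes with unfolding, and unfolding `out` is the identity.
-/
theorem unfold_unique (hext : Extensionality T) (hid : IdentityExtension T) (hσ : σ.OnlyPos 0)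
    (hf : HasTyI Γ f (Ty.lolli X (σ.subst (Ty.cons X A))))
    (hh : HasTyI Γ h (Ty.lolli X ((nu σ).subst A)))
    (hc : IEq T (X :: Γ) Θ (Φ.map Form.wk) (σ.subst (Ty.cons ((nu σ).subst A) A))
      (Tm.app (pout σ A) (Tm.app (h.wk 1) (Tm.var 0)))
      (Tm.app (pmap σ A X ((nu σ).subst A) (h.wk 1)) (Tm.app (f.wk 1) (Tm.var 0))))
    (hx : HasTyI Γ x X) :
    IEq T Γ Θ Φ ((nu σ).subst A) (Tm.app h x) (Tm.app (pun σ A X f) x) :=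
  (pun_pout hext hid hσ (hh.app hx)).symm.trans
    (unfold_coalg hext hid hσ hf (pout_hasTy hσ Γ) hh (by rwa [pout_wk hσ]) hx).symm

end FinalCoalgebra

/-! ## The functor `ω(α) = μ β. σ(α,β)` -/

/-- `ω(B) = μ β. σ(B,β)`. -/
abbrev omegaAt {n : ℕ} (σ : S.Ty 2) (B : S.Ty n) : S.Ty n := (omega σ).subst fun _ => B

/-- `in : σ(B,ω(B)) ⊸ ω(B)`. -/
abbrev omegaIn {n : ℕ} (σ : S.Ty 2) (B : S.Ty n) : Tm S n := pin (k := 1) σ fun _ => B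

/-- The map `fold X !g : ω(B) ⊸ X`. -/
abbrev omegaFold {n : ℕ} (σ : S.Ty 2) (B X : S.Ty n) (g : Tm S n) : Tm S n :=
  Tm.app (Tm.tapp ((fold (n := 1) σ).subst (fun _ => B) Tm.var) X) (Tm.bang g)

/-- `ω(f) : ω(B) ⊸ ω(A)` for `f : A ⊸ B`. -/
def omegaMap {n : ℕ} (σ : S.Ty 2) (A B : S.Ty n) (f : Tm S n) : Tm S n :=
  act (omega σ) (fun _ => B) (fun _ => A) (fun _ => Tm.star) (fun _ => f)

/-- The action `p ↦ p ∘ σ(f,X)` on maps `p : σ(A,X) ⊸ X`, for `f : A ⊸ B`. -/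
def omegaAlg {n : ℕ} (σ : S.Ty 2) (A B X : S.Ty n) (f : Tm S n) : Tm S n :=
  act (Ty.lolli σ (Ty.var 0)) (Ty.cons X fun _ : Fin 1 => A) (Ty.cons X fun _ => B)
    (Fin.cases (Tm.idm X) fun _ => f) (Fin.cases (Tm.idm X) fun _ => Tm.star)

section Omega

variable {T : Theory S} {n : ℕ} {Γ : List (S.Ty n)} {Θ : List (RelDecl S n)}
  {Φ : List (Form S n)} {σ : S.Ty 2} {A B X Y : S.Ty n} {f g p u z : Tm S n}

theorem Ty.cons_const (X B : S.Ty n) : Ty.cons X (fun _ : Fin 1 => B) = ![X, B] := by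
  funext i; match i with | 0 => rfl | 1 => rfl

theorem pmap_eq_fmap (hα : σ.OnlyNeg 1) (hβ : σ.OnlyPos 0) :
    pmap (k := 1) σ (fun _ => B) X Y g = fmap σ B X B Y (Tm.idm B) g := by
  rw [pmap, fmap, Ty.cons_const, Ty.cons_const]
  exact act_congr (fun i o => match i, o with | 0, _ => rfl | 1, o => (hα o).elim)
    (fun i o => match i, o with | 0, o => (hβ o).elim | 1, _ => rfl)

theorem omegaIn_hasTy (hβ : σ.OnlyPos 0) (Γ : List (S.Ty n)) :
    HasTyI Γ (omegaIn σ B) (Ty.lolli (ap₂ σ B (omegaAt σ B)) (omegaAt σ B)) := by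
  have h := pin_hasTy (k := 1) (A := fun _ => B) hβ Γ
  rw [Ty.cons_const] at h
  exact h

theorem omegaFold_hasTy (hg : HasTyI Γ g (Ty.lolli (ap₂ σ B X) X)) :
    HasTyI Γ (omegaFold σ B X g) (Ty.lolli (omegaAt σ B) X) :=
  fold_app_hasTy (k := 1) (A := fun _ => B) (by rw [Ty.cons_const]; exact hg) Tm.var

theorem omegaFold_app (hg : HasTyI Γ g (Ty.lolli (ap₂ σ B X) X))
    (hu : HasTyI Γ u (omegaAt σ B)) :
    IEq T Γ Θ Φ X (Tm.app (omegaFold σ B X g) u) (Tm.app (Tm.tapp u X) (Tm.bang g)) :=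
  (ExtEqI.fold (k := 1) (A := fun _ => B) (by rw [Ty.cons_const]; exact hg) hu Tm.var).ieq

theorem omegaFold_in (hα : σ.OnlyNeg 1) (hβ : σ.OnlyPos 0)
    (hg : HasTyI Γ g (Ty.lolli (ap₂ σ B X) X)) (hz : HasTyI Γ z (ap₂ σ B (omegaAt σ B))) :
    IEq T Γ Θ Φ X (Tm.app (omegaFold σ B X g) (Tm.app (omegaIn σ B) z))
      (Tm.app g (Tm.app (fmap σ B (omegaAt σ B) B X (Tm.idm B) (omegaFold σ B X g)) z)) := by
  have h := fold_comm (k := 1) (T := T) (Θ := Θ) (Φ := Φ) (A := fun _ => B) hβ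
    (by rw [Ty.cons_const]; exact hg) (by rw [Ty.cons_const]; exact hz)
  rw [pmap_eq_fmap hα hβ] at h
  exact h

theorem omega_onlyNeg (hα : σ.OnlyNeg 1) : (omega σ).OnlyNeg 0 := by
  rintro ((o | ⟨-, h⟩) | ⟨-, h⟩)
  · exact hα o
  · cases h
  · cases h

theorem omegaMap_ok (hα : σ.OnlyNeg 1) (hf : HasTyI Γ f (Ty.lolli A B)) :
    ActOk Γ (omega σ) (fun _ => B) (fun _ => A) (fun _ => Tm.star) (fun _ => f) :=
  ⟨fun i o => match i, o with | 0, o => (omega_onlyNeg hα o).elim, fun _ _ => hf,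
    fun i o _ => match i, o with | 0, o => (omega_onlyNeg hα o).elim⟩

theorem omegaMap_hasTy (hα : σ.OnlyNeg 1) (hf : HasTyI Γ f (Ty.lolli A B)) :
    HasTyI Γ (omegaMap σ A B f) (Ty.lolli (omegaAt σ B) (omegaAt σ A)) :=
  act_hasTy (omegaMap_ok hα hf)

theorem omegaMap_wk (j : ℕ) : (omegaMap σ A B f).wk j = omegaMap σ A B (f.wk j) := act_wk _ _ _ _ _ _

theorem omegaAlg_ok (hα : σ.OnlyNeg 1) (hf : HasTyI Γ f (Ty.lolli A B)) :
    ActOk Γ (Ty.lolli σ (Ty.var 0)) (Ty.cons X fun _ : Fin 1 => A) (Ty.cons X fun _ => B)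
      (Fin.cases (Tm.idm X) fun _ => f) (Fin.cases (Tm.idm X) fun _ => Tm.star) := by
  have h : ¬ (Ty.lolli σ (Ty.var 0)).Occ false 1 := by
    rintro (o | ⟨h, -⟩)
    · exact hα o
    · cases h
  exact ⟨fun i o => match i, o with | 0, _ => .idm X | 1, _ => hf,
    fun i o => match i, o with | 0, _ => .idm X | 1, o => (h o).elim,
    fun i o o' => match i, o, o' with | 0, _, _ => rfl | 1, _, o' => (h o').elim⟩

theorem omegaAlg_app_hasTy (hα : σ.OnlyNeg 1)
    (hf : HasTyI Γ f (Ty.lolli A B)) (hp : HasTyI Γ p (Ty.lolli (ap₂ σ A X) X)) :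
    HasTyI Γ (Tm.app (omegaAlg σ A B X f) p) (Ty.lolli (ap₂ σ B X) X) := by
  have h := act_hasTy (omegaAlg_ok (X := X) hα hf)
  simp only [Ty.subst, Ty.cons_const] at h
  have h' := HasTyI.app h hp
  rw [omegaAlg, Ty.cons_const, Ty.cons_const]
  exact h'

theorem omegaAlg_app (hα : σ.OnlyNeg 1) (hβ : σ.OnlyPos 0)
    (hf : HasTyI Γ f (Ty.lolli A B)) (hp : HasTyI Γ p (Ty.lolli (ap₂ σ A X) X))
    (hz : HasTyI Γ z (ap₂ σ B X)) :
    IEq T Γ Θ Φ X (Tm.app (Tm.app (omegaAlg σ A B X f) p) z)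
      (Tm.app p (Tm.app (fmap σ B X A X f (Tm.idm X)) z)) := by
  have h := ExtEqI.act_lolli (omegaAlg_ok (X := X) hα hf) (x := p) (z := z)
    (by rw [Ty.cons_const]; exact hp) (by rw [Ty.cons_const]; exact hz)
  have e : act σ (Ty.cons X fun _ : Fin 1 => B) (Ty.cons X fun _ => A)
      (Fin.cases (Tm.idm X) fun _ => Tm.star) (Fin.cases (Tm.idm X) fun _ => f) =
      fmap σ B X A X f (Tm.idm X) := by
    rw [fmap, Ty.cons_const, Ty.cons_const]
    exact act_congr (fun i o => match i, o with | 0, _ => rfl | 1, o => (hα o).elim)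
      (fun i o => match i, o with | 0, o => (hβ o).elim | 1, _ => rfl)
  rw [e] at h
  exact h.ieq.trans (ExtEqI.idm (hp.app ((fmap_hasTy hα hβ hf (.idm X)).app hz))).ieq

/-- Running through the Π, ⊸ and ! clauses of the action: on the encoding, ω(f) hands u the algebra
p precomposed with σ(f,X). -/
theorem omegaMap_tapp (hα : σ.OnlyNeg 1)
    (hf : HasTyI Γ f (Ty.lolli A B)) (hp : HasTyI Γ p (Ty.lolli (ap₂ σ A X) X))
    (hu : HasTyI Γ u (omegaAt σ B)) :
    IEq T Γ Θ Φ X (Tm.app (Tm.tapp (Tm.app (omegaMap σ A B f) u) X) (Tm.bang p))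
      (Tm.app (Tm.tapp u X) (Tm.bang (Tm.app (omegaAlg σ A B X f) p))) := by
  have ok := omegaMap_ok hα hf
  have hp' : HasTyI Γ p (Ty.lolli (σ.subst (Ty.cons X fun _ : Fin 1 => A)) X) := by
    rw [Ty.cons_const]; exact hp
  have hu' := mu_tapp (k := 1) (A := fun _ => B) hu X
  have k₁ := ExtEqI.app (ExtEqI.act_pi ok hu X) (ExtEq.refl hp'.bang)
  have k₂ := ExtEqI.act_lolli (ok.pi_inst X) hu' hp'.bang
  have ok₂ : ActOk Γ (Ty.bang (Ty.lolli σ (Ty.var 0))) (Ty.cons X fun _ : Fin 1 => A)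
      (Ty.cons X fun _ => B) (Fin.cases (Tm.idm X) fun _ => f)
      (Fin.cases (Tm.idm X) fun _ => Tm.star) := (ok.pi_inst X).lolli_left
  have k₃ := ExtEqI.act_bang ok₂ hp'
  have hq := omegaAlg_app_hasTy (X := X) hα hf hp
  have hq' : HasTyI Γ (Tm.app (omegaAlg σ A B X f) p)
      (Ty.lolli (σ.subst (Ty.cons X fun _ : Fin 1 => B)) X) := by
    rw [Ty.cons_const]; exact hq
  refine (ExtEqI.ieq k₁).trans (k₂.ieq.trans ((ExtEqI.idm (hu'.app k₃.hasTy.1)).ieq.trans ?_))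
  exact (ExtEqI.app (ExtEq.refl hu') k₃).ieq

/-- Naturality of `in`. -/
theorem omegaMap_in (hext : Extensionality T) (hid : IdentityExtension T) (hα : σ.OnlyNeg 1)
    (hβ : σ.OnlyPos 0) (hf : HasTyI Γ f (Ty.lolli A B))
    (hz : HasTyI Γ z (ap₂ σ B (omegaAt σ B))) :
    IEq T Γ Θ Φ (omegaAt σ A) (Tm.app (omegaMap σ A B f) (Tm.app (omegaIn σ B) z))
      (Tm.app (omegaIn σ A)
        (Tm.app (fmap σ B (omegaAt σ B) A (omegaAt σ A) f (omegaMap σ A B f)) z)) := by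
  have hi := omegaIn_hasTy (B := A) hβ Γ
  have hm := omegaMap_hasTy (σ := σ) hα hf
  have hq := omegaAlg_app_hasTy hα hf hi
  have hF := omegaFold_hasTy hq
  have hiz := (omegaIn_hasTy (B := B) hβ Γ).app hz
  -- By the η-law, ω(f) applied to in z is determined by its instance at `in`, which is the fold of
  -- the algebra `in` ∘ σ(f, id); the computation rule of fold then applies.
  have k₁ := mu_eta (k := 1) (Θ := Θ) (Φ := Φ) (A := fun _ => A) hext hid hβ (hm.app hiz)
  have k₂ := omegaMap_tapp (T := T) (Θ := Θ) (Φ := Φ) hα hf hi hiz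
  have k₃ := (omegaFold_app (T := T) (Θ := Θ) (Φ := Φ) hq hiz).symm.trans
    (omegaFold_in hα hβ hq hz)
  have hw := (fmap_hasTy hα hβ (.idm B) hF).app hz
  have k₄ := omegaAlg_app (T := T) (Θ := Θ) (Φ := Φ) hα hβ hf hi hw
  refine (k₁.symm.trans k₂).trans (k₃.trans (k₄.trans (.appR hi ?_)))
  -- σ(f, id) ∘ σ(id, fold) is to be σ(f, ω(f)). The second side goal says that folding with the
  -- precomposed algebra is ω(f) itself, which is again `omegaMap_tapp` with the η-law.
  refine fmap_fmap hext hid hα hβ (.idm B) hF hf (.idm _) hf hm ?_ ?_ hz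
  · rw [Tm.wk_idm]
    exact (ExtEqI.idm (hf.wk1.app (.var (by rfl)))).ieq
  · have v : HasTyI (omegaAt σ B :: Γ) (Tm.var 0) (omegaAt σ B) := .var (by rfl)
    rw [Tm.wk_idm]
    refine (ExtEqI.idm (hF.wk1.app v)).ieq.trans ?_
    have e : (Tm.app (omegaAlg σ A B (omegaAt σ A) f) (omegaIn σ A)).wk 1 =
        Tm.app (omegaAlg σ A B (omegaAt σ A) (f.wk 1)) (omegaIn σ A) := by
      rw [Tm.wk_app, pin_wk hβ, omegaAlg, act_wk, omegaAlg]
      congr 2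
      all_goals funext i; match i with | 0 => exact Tm.wk_idm _ _ | 1 => rfl
    rw [fold_app_wk, e, omegaMap_wk]
    have hi₁ := omegaIn_hasTy (B := A) hβ (omegaAt σ B :: Γ)
    exact ((omegaFold_app (omegaAlg_app_hasTy hα hf.wk1 hi₁) v).trans
      (omegaMap_tapp hα hf.wk1 hi₁ v).symm).trans
        (mu_eta (k := 1) (A := fun _ => A) hext hid hβ ((omegaMap_hasTy hα hf.wk1).app v))

/-- Maps out of `ω(B)` that commute with the algebra structures are unique. -/
theorem omega_unique (hext : Extensionality T) (hid : IdentityExtension T) (hα : σ.OnlyNeg 1)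
    (hβ : σ.OnlyPos 0) {h : Tm S n} (hf : HasTyI Γ f (Ty.lolli A B))
    (hg : HasTyI Γ g (Ty.lolli (ap₂ σ A X) X)) (hh : HasTyI Γ h (Ty.lolli (omegaAt σ B) X))
    (hc : IEq T (ap₂ σ B (omegaAt σ B) :: Γ) Θ (Φ.map Form.wk) X
      (Tm.app (h.wk 1) (Tm.app (omegaIn σ B) (Tm.var 0)))
      (Tm.app (g.wk 1) (Tm.app (fmap σ B (omegaAt σ B) A X (f.wk 1) (h.wk 1)) (Tm.var 0))))
    (hu : HasTyI Γ u (omegaAt σ B)) :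
    IEq T Γ Θ Φ X (Tm.app h u)
      (Tm.app (Tm.tapp u X)
        (Tm.bang (Tm.comp (ap₂ σ B X) g (fmap σ B X A X f (Tm.idm X))))) := by
  have hF := fmap_hasTy hα hβ hf (.idm X)
  -- A map over f is an ordinary algebra map over B once σ(f,h) is factored as σ(f,X) ∘ σ(B,h): the
  -- algebra becomes g ∘ σ(f,X).
  refine fold_unique (k := 1) (A := fun _ => B) hext hid hβ hh
    (by rw [Ty.cons_const]; exact hg.comp hF) ?_ hu
  rw [pmap_eq_fmap hα hβ, Ty.cons_const, Tm.wk_comp, fmap_wk, Tm.wk_idm]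
  have v : HasTyI (ap₂ σ B (omegaAt σ B) :: Γ) (Tm.var 0) (ap₂ σ B (omegaAt σ B)) :=
    .var (by rfl)
  have hF₁ := fmap_hasTy hα hβ (hf.wk1 (A := ap₂ σ B (omegaAt σ B))) (.idm X)
  have hw := (fmap_hasTy hα hβ (.idm B) hh.wk1).app v
  refine hc.trans (IEq.trans ?_ (ExtEqI.comp hg.wk1 hF₁ hw).ieq.symm)
  refine (IEq.appR hg.wk1 (fmap_fmap hext hid hα hβ (.idm B) hh.wk1 hf.wk1 (.idm X) hf.wk1
    hh.wk1 ?_ ?_ v)).symm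
  · rw [Tm.wk_idm]
    exact (ExtEqI.idm (hf.wk1.wk1.app (.var (by rfl)))).ieq
  · rw [Tm.wk_idm]
    exact (ExtEqI.idm (hh.wk1.wk1.app (.var (by rfl)))).ieq

/-- The variable is placed at the positive argument of σ directly, and at the negative one through
ω, which is itself negative. -/
theorem omegaDiag_onlyPos (hα : σ.OnlyNeg 1) (hβ : σ.OnlyPos 0) : (omegaDiag σ).OnlyPos 0 := by
  intro o
  obtain ⟨j, ⟨o, o'⟩ | ⟨o, o'⟩⟩ := Ty.Occ.of_subst o
  · match j, o, o' with
    | 0, _, o' => cases o'.1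
    | 1, o, _ => exact hα o
  · match j, o, o' with
    | 0, o, _ => exact hβ o
    | 1, _, o' => exact omega_onlyNeg hα o'

theorem omegaDiag_subst (s : Fin 0 → S.Ty n) (X : S.Ty n) :
    (omegaDiag σ).subst (Ty.cons X s) = ap₂ σ (omegaAt σ X) X := by
  rw [omegaDiag, ap₂_subst, omegaAt]
  congr 2
  funext i; match i with | 0 => rfl

/-- The action of a composite type, with the components that do not matter discarded: at f it is
σ(ω(f), f). -/
theorem pmap_omegaDiag (hα : σ.OnlyNeg 1) (hβ : σ.OnlyPos 0) (s : Fin 0 → S.Ty n) :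
    pmap (omegaDiag σ) s X Y f =
      fmap σ (omegaAt σ X) X (omegaAt σ Y) Y (omegaMap σ X Y f) f := by
  have e : ∀ Z : S.Ty n, Ty.cons Z s = fun _ => Z := fun Z => by
    funext i; match i with | 0 => rfl
  have e' : ∀ t : Tm S n, (Fin.cases t (idv s) : Fin 1 → Tm S n) = fun _ => t := fun t => by
    funext i; match i with | 0 => rfl
  rw [pmap, omegaDiag, ap₂, act_ty_subst, fmap, e, e, e', e']
  have e₂ : ∀ Z : S.Ty n, (fun i => ((![Ty.var 0, omega σ] : Fin 2 → S.Ty 1) i).subst fun _ => Z) =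
      ![Z, omegaAt σ Z] := fun Z => by
    funext i; match i with | 0 => rfl | 1 => rfl
  rw [e₂, e₂]
  exact act_congr (fun i o => match i, o with | 0, _ => rfl | 1, o => (hα o).elim)
    (fun i o => match i, o with | 0, o => (hβ o).elim | 1, _ => rfl)

end Omega

/-! ## The initial dialgebra -/

/-- `τ'` in a kind context of `n` variables. -/
abbrev recNegAt (σ : S.Ty 2) (n : ℕ) : S.Ty n := (nu (omegaDiag σ)).subst Fin.elim0

theorem recNeg_ren (σ : S.Ty 2) (n : ℕ) : (recNeg σ).ren Fin.elim0 = recNegAt σ n := by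
  rw [Ty.ren_eq_subst, recNegAt, recNeg]
  congr 1
  funext i; exact i.elim0

/-- The data are closed, so weakening amounts to substitution along the empty family. This puts them
in the form of the parametrized μ and ν, to which the results above apply. -/
theorem recDialgebra_weaken (σ : S.Ty 2) (n : ℕ) : (recDialgebra σ).weaken n =
    ⟨omegaAt σ (recNegAt σ n), recNegAt σ n, omegaIn σ (recNegAt σ n),
      pout (omegaDiag σ) Fin.elim0⟩ := by
  have e : (fun i => ((Ty.cons (recNeg σ) Ty.var : Fin 1 → S.Ty 0) i).ren Fin.elim0) =
      fun _ => recNegAt σ n := by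
    funext i; match i with | 0 => exact recNeg_ren σ n
  rw [DialgData.weaken]
  congr 1
  · change ((omega σ).subst _).ren _ = _
    rw [Ty.ren_subst, e]
  · exact recNeg_ren σ n
  · change ((inMap σ).subst _ _).ren _ _ = _
    rw [Tm.ren_subst, e]; rfl
  · change (outMap (omegaDiag σ)).ren _ _ = _
    rw [Tm.ren_eq_subst, pout]
    congr 1
    funext i; exact i.elim0

section Dialgebra

variable {T : Theory S} {n : ℕ} {σ : S.Ty 2} {A B X : S.Ty n} {a c f f' g g' k k' m z : Tm S n}

theorem recDialgebra_isDialgebra (hα : σ.OnlyNeg 1) (hβ : σ.OnlyPos 0) (n : ℕ) :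
    IsDialgebra σ ((recDialgebra σ).weaken n) := by
  rw [recDialgebra_weaken]
  refine ⟨omegaIn_hasTy hβ [], ?_⟩
  have h := pout_hasTy (A := (Fin.elim0 : Fin 0 → S.Ty n)) (omegaDiag_onlyPos hα hβ) []
  rw [omegaDiag_subst] at h
  exact h

theorem HasTyI.wk_one {t : Tm S n} (h : HasTyI [] t A) : t.wk 1 = t := h.wk_closed 1

theorem IEq.append {Γ : List (S.Ty n)} {t u : Tm S n} (h : IEq T Γ [] [] A t u)
    (Δ : List (S.Ty n)) : IEq T (Γ ++ Δ) [] [] A t u := by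
  have h₁ := h.ren (r := id) (e := id) (q := id) (Γ' := Γ ++ Δ) (Θ' := [])
    ⟨fun i τ hi => ?_, fun i d hi => ?_⟩
  · simpa [Ty.ren_id, Tm.ren_id] using h₁
  · rw [Ty.ren_id]
    exact (List.getElem?_append_left (List.getElem?_eq_some_iff.1 hi).1).trans hi
  · simp at hi

/-- Equality of composites, pointwise. -/
theorem IEq.comp_iff (hext : Extensionality T) {A B B' C : S.Ty n}
    (hf : HasTyI [] f (Ty.lolli B C)) (hg : HasTyI [] g (Ty.lolli A B))
    (hf' : HasTyI [] f' (Ty.lolli B' C)) (hg' : HasTyI [] g' (Ty.lolli A B')) :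
    Prf T [] [] [] (.eq (Ty.lolli A C) (Tm.comp A f g) (Tm.comp A f' g')) ↔
      IEq T [A] [] [] C (Tm.app f (Tm.app g (Tm.var 0))) (Tm.app f' (Tm.app g' (Tm.var 0))) := by
  have v : HasTyI [A] (Tm.var 0) A := .var (by rfl)
  have k := (ExtEqI.comp (hf.closed [A]) (hg.closed [A]) v).ieq (T := T) (Θ := []) (Φ := [])
  have k' := (ExtEqI.comp (hf'.closed [A]) (hg'.closed [A]) v).ieq (T := T) (Θ := []) (Φ := [])
  constructor
  · intro h
    have h₁ := (IEq.wk1 ⟨hf.comp hg, hf'.comp hg', h⟩ A).appL v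
    rw [(hf.comp hg).wk_one, (hf'.comp hg').wk_one] at h₁
    exact k.symm.trans (h₁.trans k')
  · intro h
    refine (IEq.ext hext (hf.comp hg) (hf'.comp hg') ?_).prf
    rw [(hf.comp hg).wk_one, (hf'.comp hg').wk_one]
    exact k.trans (h.trans k'.symm)

/-- Equations between composites become equations at a variable by extensionality and β, and the
polymorphic functor terms are replaced by the direct action. -/
theorem isDialgHom_iff (hext : Extensionality T) (hα : σ.OnlyNeg 1)
    (hβ : σ.OnlyPos 0) {D E : DialgData S n} (hD : IsDialgebra σ D) (hE : IsDialgebra σ E) :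
    IsDialgHom T σ D E k k' ↔
      HasTyI [] k (Ty.lolli D.pos E.pos) ∧ HasTyI [] k' (Ty.lolli E.neg D.neg) ∧
      IEq T [ap₂ σ D.neg D.pos] [] [] E.pos (Tm.app k (Tm.app D.inn (Tm.var 0)))
        (Tm.app E.inn (Tm.app (fmap σ D.neg D.pos E.neg E.pos k' k) (Tm.var 0))) ∧
      IEq T [E.neg] [] [] (ap₂ σ D.pos D.neg)
        (Tm.app (fmap σ E.pos E.neg D.pos D.neg k k') (Tm.app E.out (Tm.var 0)))
        (Tm.app D.out (Tm.app k' (Tm.var 0))) := by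
  refine and_congr_right fun hk => and_congr_right fun hk' => and_congr ?_ ?_
  · have v : HasTyI [ap₂ σ D.neg D.pos] (Tm.var 0) (ap₂ σ D.neg D.pos) := .var (by rfl)
    have e := (ExtEqI.app (ExtEqI.map₂ hα hβ (hk'.closed [ap₂ σ D.neg D.pos])
      (hk.closed [ap₂ σ D.neg D.pos])) (ExtEq.refl v))
    have e₁ := IEq.appR (T := T) (Θ := []) (Φ := []) (hE.1.closed _) (ExtEqI.ieq e)
    rw [IEq.comp_iff hext hk hD.1 hE.1 (ExtEqI.map₂ hα hβ hk' hk).hasTy.1]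
    exact ⟨fun h => h.trans e₁, fun h => h.trans e₁.symm⟩
  · have v : HasTyI [E.neg] (Tm.var 0) E.neg := .var (by rfl)
    have e := (ExtEqI.app (ExtEqI.map₂ hα hβ (hk.closed [E.neg]) (hk'.closed [E.neg]))
      (ExtEq.refl ((hE.2.closed [E.neg]).app v))).ieq (T := T) (Θ := []) (Φ := [])
    rw [IEq.comp_iff hext (ExtEqI.map₂ hα hβ hk hk').hasTy.1 hE.2 hD.2 hk']
    exact ⟨fun h => e.symm.trans h, fun h => e.trans h⟩

/-- The composite `fold X !g ∘ ω(f)` is a map of algebras over `f`. -/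
theorem omegaFold_map_in (hext : Extensionality T) (hid : IdentityExtension T) (hα : σ.OnlyNeg 1)
    (hβ : σ.OnlyPos 0) (hf : HasTyI [] f (Ty.lolli A B)) (hg : HasTyI [] g (Ty.lolli (ap₂ σ A X) X))
    {Γ : List (S.Ty n)} (hz : HasTyI Γ z (ap₂ σ B (omegaAt σ B))) :
    IEq T Γ [] [] X
      (Tm.app (Tm.comp (omegaAt σ B) (omegaFold σ A X g) (omegaMap σ A B f))
        (Tm.app (omegaIn σ B) z))
      (Tm.app g (Tm.app (fmap σ B (omegaAt σ B) A X f
        (Tm.comp (omegaAt σ B) (omegaFold σ A X g) (omegaMap σ A B f))) z)) := by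
  have ha := omegaFold_hasTy hg
  have hm := omegaMap_hasTy (σ := σ) hα hf
  have hF := fmap_hasTy hα hβ hf hm
  have hiz := (omegaIn_hasTy (B := B) hβ Γ).app hz
  refine (ExtEqI.comp (ha.closed Γ) (hm.closed Γ) hiz).ieq.trans ?_
  refine (IEq.appR (ha.closed Γ) (omegaMap_in hext hid hα hβ (hf.closed Γ) hz)).trans ?_
  refine (omegaFold_in hα hβ (hg.closed Γ) ((hF.closed Γ).app hz)).trans (.appR (hg.closed Γ) ?_)
  -- Naturality of `in` and the computation rule of fold have produced σ(A, fold) ∘ σ(f, ω(f)),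
  -- which functoriality fuses.
  refine fmap_fmap hext hid hα hβ (hf.closed Γ) (hm.closed Γ) (.idm A) (ha.closed Γ)
    (hf.closed Γ) ((ha.comp hm).closed Γ) ?_ ?_ hz
  · rw [Tm.wk_idm, hf.wk_one]
    exact IEq.appR (hf.closed _) (ExtEqI.idm (.var (by rfl))).ieq
  · rw [ha.wk_one, hm.wk_one, (ha.comp hm).wk_one]
    exact (ExtEqI.comp (ha.closed _) (hm.closed _) (.var (by rfl))).ieq.symm

/-- The coalgebra `σ(fold X !g, A) ∘ g'` on `A`, for the functor `α ↦ σ(ω(α), α)`. -/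
def negCoalg (σ : S.Ty 2) (A X : S.Ty n) (g g' : Tm S n) : Tm S n :=
  Tm.comp A (fmap σ X A (omegaAt σ A) A (omegaFold σ A X g) (Tm.idm A)) g'

theorem negCoalg_hasTy (hα : σ.OnlyNeg 1) (hβ : σ.OnlyPos 0)
    (hg : HasTyI [] g (Ty.lolli (ap₂ σ A X) X)) (hg' : HasTyI [] g' (Ty.lolli A (ap₂ σ X A))) :
    HasTyI [] (negCoalg σ A X g g') (Ty.lolli A (ap₂ σ (omegaAt σ A) A)) :=
  (fmap_hasTy hα hβ (omegaFold_hasTy hg) (.idm A)).comp hg'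

/-- Functoriality: σ(ω(f), f) ∘ σ(fold X !g, A) = σ(fold X !g ∘ ω(f), f). With the second map
written as k this is σ(k, f), so the second equation of a dialgebra morphism is the same as a
coalgebra map equation. -/
theorem negCoalg_map (hext : Extensionality T) (hid : IdentityExtension T) (hα : σ.OnlyNeg 1)
    (hβ : σ.OnlyPos 0) (hf : HasTyI [] f (Ty.lolli A B)) (hg : HasTyI [] g (Ty.lolli (ap₂ σ A X) X))
    (hg' : HasTyI [] g' (Ty.lolli A (ap₂ σ X A))) {Γ : List (S.Ty n)} (hz : HasTyI Γ z A) :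
    IEq T Γ [] [] (ap₂ σ (omegaAt σ B) B)
      (Tm.app (fmap σ (omegaAt σ A) A (omegaAt σ B) B (omegaMap σ A B f) f)
        (Tm.app (negCoalg σ A X g g') z))
      (Tm.app (fmap σ X A (omegaAt σ B) B
        (Tm.comp (omegaAt σ B) (omegaFold σ A X g) (omegaMap σ A B f)) f) (Tm.app g' z)) := by
  have ha := omegaFold_hasTy hg
  have hm := omegaMap_hasTy (σ := σ) hα hf
  have hF := fmap_hasTy hα hβ hm hf
  have hG := fmap_hasTy hα hβ ha (.idm A)
  refine (IEq.appR (hF.closed Γ) (ExtEqI.comp (hG.closed Γ) (hg'.closed Γ) hz).ieq).trans ?_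
  refine fmap_fmap hext hid hα hβ (ha.closed Γ) (.idm A) (hm.closed Γ) (hf.closed Γ)
    ((ha.comp hm).closed Γ) (hf.closed Γ) ?_ ?_ ((hg'.closed Γ).app hz)
  · rw [ha.wk_one, hm.wk_one, (ha.comp hm).wk_one]
    exact (ExtEqI.comp (ha.closed _) (hm.closed _) (.var (by rfl))).ieq.symm
  · rw [Tm.wk_idm, hf.wk_one]
    exact IEq.appR (hf.closed _) (ExtEqI.idm (.var (by rfl))).ieq

/-- Two maps of algebras over `f` agree. -/
theorem omega_hom_unique (hext : Extensionality T) (hid : IdentityExtension T) (hα : σ.OnlyNeg 1)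
    (hβ : σ.OnlyPos 0) (hf : HasTyI [] f (Ty.lolli A B)) (hg : HasTyI [] g (Ty.lolli (ap₂ σ A X) X))
    (hk : HasTyI [] k (Ty.lolli (omegaAt σ B) X)) (hm : HasTyI [] m (Ty.lolli (omegaAt σ B) X))
    (hkc : IEq T [ap₂ σ B (omegaAt σ B)] [] [] X
      (Tm.app k (Tm.app (omegaIn σ B) (Tm.var 0)))
      (Tm.app g (Tm.app (fmap σ B (omegaAt σ B) A X f k) (Tm.var 0))))
    (hmc : IEq T [ap₂ σ B (omegaAt σ B)] [] [] X
      (Tm.app m (Tm.app (omegaIn σ B) (Tm.var 0)))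
      (Tm.app g (Tm.app (fmap σ B (omegaAt σ B) A X f m) (Tm.var 0)))) :
    IEq T [] [] [] (Ty.lolli (omegaAt σ B) X) k m := by
  refine IEq.ext hext hk hm ?_
  have v : HasTyI [omegaAt σ B] (Tm.var 0) (omegaAt σ B) := .var (by rfl)
  -- Any map of algebras over f equals one and the same fold, so two of them equal each other.
  have key : ∀ {k : Tm S n}, HasTyI [] k (Ty.lolli (omegaAt σ B) X) →
      IEq T [ap₂ σ B (omegaAt σ B)] [] [] X
        (Tm.app k (Tm.app (omegaIn σ B) (Tm.var 0)))
        (Tm.app g (Tm.app (fmap σ B (omegaAt σ B) A X f k) (Tm.var 0))) →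
      IEq T [omegaAt σ B] [] [] X (Tm.app (k.wk 1) (Tm.var 0)) (Tm.app (Tm.tapp (Tm.var 0) X)
        (Tm.bang (Tm.comp (ap₂ σ B X) g (fmap σ B X A X f (Tm.idm X))))) := by
    intro k hk hkc
    have h₁ := hkc.append [omegaAt σ B]
    rw [hk.wk_one]
    refine omega_unique hext hid hα hβ (hf.closed _) (hg.closed _) (hk.closed _) ?_ v
    rw [hk.wk_one, hg.wk_one, hf.wk_one]
    exact h₁
  exact (key hk hkc).trans (key hm hmc).symm

theorem recDialgebra_initial (hext : Extensionality T) (hid : IdentityExtension T)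
    (hα : σ.OnlyNeg 1) (hβ : σ.OnlyPos 0) (n : ℕ) :
    IsInitialDialgebra T σ ((recDialgebra σ).weaken n) := by
  refine ⟨recDialgebra_isDialgebra hα hβ n, fun E hE => ?_⟩
  have hD := recDialgebra_isDialgebra hα hβ n
  simp only [isDialgHom_iff hext hα hβ hD hE]
  rw [recDialgebra_weaken] at hD ⊢
  obtain ⟨X, A, g, g'⟩ := E
  obtain ⟨hg, hg'⟩ := hE
  simp only at hg hg' ⊢
  have hF := omegaDiag_onlyPos hα hβ
  have hc := negCoalg_hasTy hα hβ hg hg'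
  have hc' : HasTyI [] (negCoalg σ A X g g')
      (Ty.lolli A ((omegaDiag σ).subst (Ty.cons A Fin.elim0))) := by
    rw [omegaDiag_subst]; exact hc
  -- The negative component is the unfolding of the auxiliary coalgebra on A. The positive component
  -- is then forced to be fold X !g ∘ ω(h').
  have hh' := pun_hasTy hc'
  have hm := omegaMap_hasTy (σ := σ) hα hh'
  have hh := (omegaFold_hasTy hg).comp hm
  refine ⟨_, _, ⟨hh, hh', omegaFold_map_in hext hid hα hβ hh' hg (.var (by rfl)), ?_⟩,
    fun k k' ⟨hk, hk', hkc, hkc'⟩ => ?_⟩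
  -- The unfolding is a coalgebra map for α ↦ σ(ω(α),α). Fusing its action with the fold inside the
  -- auxiliary coalgebra turns this into the second morphism equation.
  · have v : HasTyI [A] (Tm.var 0) A := .var (by rfl)
    have h := unfold_comm (T := T) (Θ := []) (Φ := []) hF (hc'.closed [A]) v
    rw [pmap_omegaDiag hα hβ, omegaDiag_subst] at h
    exact (h.trans (negCoalg_map hext hid hα hβ hh' hg hg' v)).symm
  -- The first equation, read as a map of algebras over k', forces k = fold X !g ∘ ω(k').
  · have e : IEq T [] [] [] (Ty.lolli (omegaAt σ (recNegAt σ n)) X) k _ :=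
      omega_hom_unique hext hid hα hβ hk' hg hk
        ((omegaFold_hasTy hg).comp (omegaMap_hasTy hα hk')) hkc
        (omegaFold_map_in hext hid hα hβ hk' hg (.var (by rfl)))
    -- With this value of k the second equation makes k' a coalgebra map from the auxiliary
    -- coalgebra to τ', so finality determines it.
    have e' : IEq T [] [] [] (Ty.lolli A (recNegAt σ n)) k'
        (pun (omegaDiag σ) Fin.elim0 A (negCoalg σ A X g g')) := by
      refine IEq.ext hext hk' hh' ?_
      have v : HasTyI [A] (Tm.var 0) A := .var (by rfl)
      rw [hk'.wk_one, hh'.wk_one]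
      refine unfold_unique hext hid hF (hc'.closed _) (hk'.closed _) ?_ v
      have v₂ : HasTyI [A, A] (Tm.var 0) A := .var (by rfl)
      rw [hk'.wk_one, hc'.wk_one, pmap_omegaDiag hα hβ, omegaDiag_subst]
      have h₁ := hkc'.append [A]
      have h₂ := fmap_congr (T := T) (Γ := [A, A]) (Θ := []) (Φ := []) hext hid hα hβ
        (e.append [A, A]) (.rfl (hk'.closed _)) (.rfl ((hg'.closed [A, A]).app v₂))
      exact h₁.symm.trans (h₂.trans (negCoalg_map hext hid hα hβ hk' hg hg' v₂).symm)
    refine ⟨?_, e'.prf⟩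
    -- Replacing k' by h' in the first equation makes k a map of algebras over h', just as h is;
    -- such maps are unique.
    refine (omega_hom_unique hext hid hα hβ hh' hg hk hh (hkc.trans ?_)
      (omegaFold_map_in hext hid hα hβ hh' hg (.var (by rfl)))).prf
    exact IEq.appR (hg.closed _) (fmap_congr hext hid hα hβ (e'.append _)
      (.rfl (hk.closed _)) (.rfl (.var (by rfl))))

end Dialgebra

end LAPL

theorem mainTheorem6 (S : LAPL.Signature.{u}) (T : LAPL.Theory S)
    (hext : LAPL.Extensionality T) (hid : LAPL.IdentityExtension T)
    (σ : S.Ty 2) (hα : σ.OnlyNeg 1) (hβ : σ.OnlyPos 0) (n : ℕ) :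
    LAPL.IsInitialDialgebra T σ ((LAPL.recDialgebra σ).weaken n) :=
  LAPL.recDialgebra_initial hext hid hα hβ n
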